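/- Notation. $\mathrm{sn}_\kappa,\mathrm{cs}_\kappa$ are the solutions of $u''+\kappa u=0$ with $\mathrm{sn}_\kappa(0)=0$, $\mathrm{sn}_\kappa'(0)=1$, $\mathrm{cs}_\kappa(0)=1$, $\mathrm{cs}_\kappa'(0)=0$; $\overline g$ is the round metric of $\mathbb S^2$. Singular germs. Fix $\kappa\in\mathbb R$ and a finite graph $\Sigma$ whose edges are either closed curves without vertices or join two (possibly equal) vertices, all vertices being at least trivalent. A singular germ $\mathcal S$ of curvature $\kappa$ along $\Sigma$ is given by a length $\lambda_e>0$, a dihedral (cone) angle $\alpha_e\in(0,2\pi)$ and a twist parameter for each edge $e$, and for each vertex $p$ a spherical cone metric $h_p=e^{2\phi_p}\overline g$ (curvature $1$) on $\mathbb S^2$, with one cone point $q_\eta$ of cone angle $\alpha_e$ for each end $\eta$ at $p$ of an edge $e$. Near $q_\eta$ there are polar coordinates $(s,\theta)$, $\theta\in\mathbb R/\alpha_e\mathbb Z$, with $h_p=ds^2+\sin^2 s\,d\theta^2$, and $\phi_p-(\frac{\alpha_e}{2\pi}-1)\log d_{\overline g}(\cdot,q_\eta)$ is bounded. The associated cone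 metric $g$ is $dr^2+\mathrm{sn}_\kappa^2 r\,h_p$ on the cone over $(\mathbb S^2,h_p)$ near $p$ and $d\rho^2+\mathrm{sn}_\kappa^2\rho\,d\theta^2+\mathrm{cs}_\kappa^2\rho\,dy^2$ on a tube around each edge; these pieces are glued isometrically (using the polar coordinates at the $q_\eta$ and, for a closed edge, the twist parameter). Let $\mathcal U$ be the neighbourhood of $\Sigma$ which is the union of the cones of radius $a$ and the tubes of radius $b$, where $a$ is small and $b$ is small with respect to $a$. Standard form. A smooth family of singular germs $\mathcal S_\epsilon$, $|\epsilon|<\epsilon_0$, $\mathcal S_0=\mathcal S$, with fixed $\Sigma$ and $\kappa$, is in standard form if it is represented by the metrics $$g_\epsilon=d\rho^2+\mathrm{sn}_\kappa^2\rho\,(1+c_e(\epsilon))^2\,\bigl(d(\theta+t_e(\epsilon)f_e(y))\bigr)^2+\mathrm{cs}_\kappa^2\rho\,\bigl(1+l_e(\epsilon)f_e'(y)\bigr)^2dy^2$$ around each edge $e$, with $c_e,t_e,l_e$ smooth and vanishing at $0$, and $f_e$ smooth, nondecreasing, $f_e=0$ for $y\le\lambda_e/4$ and $f_e=1$ for $y\ge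 3\lambda_e/4$ (for closed edges, $f'_e|_{[0,\lambda_e]}$ is extended periodically); and $$g_\epsilon=dr^2+\mathrm{sn}_\kappa^2r\;e^{2\phi_{p,\epsilon}}F_{p,\epsilon}^*\overline g$$ around each vertex $p$. Here $F_{p,\epsilon}$ is a smooth family of diffeomorphisms of $\mathbb S^2$, $F_{p,0}=\mathrm{id}$, which are isometries of $\overline g$ on a fixed neighbourhood of each $q_\eta$; $e^{2\phi_{p,\epsilon}}F_{p,\epsilon}^*\overline g$ is a spherical cone metric with cone points $q_\eta$ (fixed) of angles $\alpha_e(\epsilon)=\alpha_e(1+c_e(\epsilon))\in(0,2\pi)$; $\phi_{p,\epsilon}$ is smooth in $\epsilon$ and off the $q_\eta$, and $\phi_{p,\epsilon}-(\frac{\alpha_e(\epsilon)}{2\pi}-1)\log d_{\overline g}(\cdot,q_\eta)$ and its $\epsilon$-derivative are bounded near $q_\eta$. For each $\epsilon$ the pieces are glued by isometries between tubes and cones depending smoothly on $\epsilon$. A smooth symmetric $2$-tensor $\dot g$ on $\mathcal U\setminus\Sigma$ represents the infinitesimal deformation if it equals $\partial_\epsilon g_\epsilon|_{\epsilon=0}$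 (computed with the above formulas) on the tubes (at distance along the edge greater than $a/2$ from the vertices) and on the cones of radius $a/4$ around the vertices, and if on the cones of radius $a$ it equals $\partial_\epsilon g_\epsilon|_{\epsilon=0}+\mathcal L_Zg$, where $Z$ is a smooth vector field off $\Sigma$ which vanishes for $r<a/4$, tends to $0$ at $\Sigma$, and on the overlap with the tubes is the derivative at $\epsilon=0$ of the gluing isometries. Polyhomogeneous means: the components are smooth off $\Sigma$ and have asymptotic expansions, which may be differentiated term by term with respect to $r\partial_r$, $s\partial_s$, $\rho\partial_\rho$ and the other coordinates, of the form $\sum\rho^{\gamma_j}(\log\rho)^\ell a_{j,\ell}$ at the edges and $\sum r^{\gamma_j}(\log r)^\ell a_{j,\ell}$ at the vertices away from the edges, and double expansions $\sum r^{\gamma_j}s^{\eta_i}(\log r)^\ell(\log s)^k a_{i,j,k,\ell}$ at $r=s=0$, with smooth coefficients, $\mathrm{Re}\,\gamma_j,\mathrm{Re}\,\eta_i\to\infty$ and finitely many powers of logarithms for each exponent. **Proposition.** For every family of singular germs in standard form as above and every such $\mathcal U$, the infinitesimal deformation is represented by a symmetric $2$-tensor $\dot g$ on $\mathcal U\setminus\Sigma$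 which is polyhomogeneous at $\Sigma$ and lies in $L^2(\mathcal U;g)$, and whose covariant derivative $\nabla\dot g$ (Levi-Civita connection of $g$) lies in $L^2(\mathcal U;g)$ if and only if the infinitesimal deformation preserves all dihedral angles, i.e. $\frac{d}{d\epsilon}\big|_{\epsilon=0}\alpha_e(\epsilon)=0$ for every edge $e$. Moreover, if some dihedral angle is not infinitesimally preserved, then no tensor representing the infinitesimal deformation has its covariant derivative in $L^2(\mathcal U;g)$. -/

import Mathlib

open Real Set Filter Topology MeasureTheory
open scoped ContDiff

noncomputable section

/-! ## Constant curvature trigonometry -/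

/-- `sn_κ`: the solution of `f'' + κ f = 0`, `f 0 = 0`, `f' 0 = 1`. -/
def sn (κ t : ℝ) : ℝ :=
  if κ = 0 then t
  else if 0 < κ then Real.sin (√κ * t) / √κ
  else Real.sinh (√(-κ) * t) / √(-κ)

/-- `cs_κ`: the solution of `f'' + κ f = 0`, `f 0 = 1`, `f' 0 = 0`. -/
def cs (κ t : ℝ) : ℝ :=
  if κ = 0 then 1
  else if 0 < κ then Real.cos (√κ * t)
  else Real.cosh (√(-κ) * t)

/-- The inverse function of `sn_κ` (with values in `[-π/(2√κ), π/(2√κ)]` if `κ > 0`). -/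
def arcsn (κ t : ℝ) : ℝ :=
  if κ = 0 then t
  else if 0 < κ then Real.arcsin (√κ * t) / √κ
  else Real.arsinh (√(-κ) * t) / √(-κ)

/-! ## Tensor calculus in coordinates on open subsets of `ℝ³` -/

abbrev E3 := EuclideanSpace ℝ (Fin 3)

/-- Covariant 2-tensor fields on (subsets of) `ℝ³`, as matrices of coefficients. -/
abbrev TensorField := E3 → Matrix (Fin 3) (Fin 3) ℝ

/-- The coordinate vector `e_i`. -/
def coordVec (i : Fin 3) : E3 := EuclideanSpace.single i 1

/-- Partial derivative `∂_i u`. -/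
def pd (i : Fin 3) (u : E3 → ℝ) (x : E3) : ℝ := fderiv ℝ u x (coordVec i)

/-- The pullback `Φ^* k`. -/
def pullback (Φ : E3 → E3) (k : TensorField) : TensorField := fun x =>
  Matrix.of fun i j => ∑ a, ∑ b,
    (fderiv ℝ Φ x (coordVec i)) a * (fderiv ℝ Φ x (coordVec j)) b * k (Φ x) a b

/-- The Lie derivative `L_Z k`. -/
def lieDerivative (Z : E3 → E3) (k : TensorField) : TensorField := fun x =>
  Matrix.of fun i j => ∑ a,
    (Z x a * pd a (fun y => k y i j) x
      + pd i (fun y => Z y a) x * k x a j + pd j (fun y => Z y a) x * k x i a)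

/-- Christoffel symbols `Γ^m_{li}` of the Levi-Civita connection of `g`. -/
def christoffel (g : TensorField) (x : E3) (m l i : Fin 3) : ℝ :=
  (1 / 2) * ∑ n, (g x)⁻¹ m n *
    (pd l (fun y => g y n i) x + pd i (fun y => g y n l) x - pd n (fun y => g y l i) x)

/-- The covariant derivative `(∇_l k)_{ij}` for the Levi-Civita connection of `g`. -/
def covDeriv (g k : TensorField) (x : E3) (l i j : Fin 3) : ℝ :=
  pd l (fun y => k y i j) x
    - ∑ m, christoffel g x m l i * k x m j - ∑ m, christoffel g x m l j * k x i m

/-- `|k|_g²`. -/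
def normSqTensor (g k : TensorField) (x : E3) : ℝ :=
  ∑ i, ∑ j, ∑ i', ∑ j', (g x)⁻¹ i i' * (g x)⁻¹ j j' * k x i j * k x i' j'

/-- `|∇k|_g²`. -/
def normSqCovDeriv (g k : TensorField) (x : E3) : ℝ :=
  ∑ l, ∑ i, ∑ j, ∑ l', ∑ i', ∑ j',
    (g x)⁻¹ l l' * (g x)⁻¹ i i' * (g x)⁻¹ j j' * covDeriv g k x l i j * covDeriv g k x l' i' j'

/-- Riemannian volume density of `g`. -/
def volDensity (g : TensorField) (x : E3) : ℝ := √((g x).det)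

/-- `k` is square integrable on `D`, for the metric `g`. -/
def L2On (g k : TensorField) (D : Set E3) : Prop :=
  IntegrableOn (fun x => normSqTensor g k x * volDensity g x) D volume

/-- `∇k` is square integrable on `D`, for the metric `g`. -/
def CovDerivL2On (g k : TensorField) (D : Set E3) : Prop :=
  IntegrableOn (fun x => normSqCovDeriv g k x * volDensity g x) D volume

/-! ## Polyhomogeneous functions

With `r = exp t`, the vector field `r ∂_r` becomes `∂_t`; hence conormal estimates (stable under
`r ∂_r` and derivatives in the parameters) are estimates on all ordinary derivatives in the
variables `(t, z)`, and `r^γ (log r)^ℓ = exp (γ t) t^ℓ`. -/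

/-- A set of pairs (exponent, power of the logarithm) with `Re γ → ∞`, finitely many powers of the
logarithm for each exponent. -/
def IsIndexSet (I : Set (ℂ × ℕ)) : Prop := ∀ N : ℝ, {p ∈ I | p.1.re ≤ N}.Finite

/-- The monomial `r^γ (log r)^ℓ` at `r = exp t`. -/
def phgMonomial (p : ℂ × ℕ) (t : ℝ) : ℂ := Complex.exp (p.1 * (t : ℂ)) * (t : ℂ) ^ p.2

/-- `u (r, z)`, `0 < r < R`, `z ∈ O`, is smooth and polyhomogeneous at `r = 0`:
`u ∼ ∑ r^γ (log r)^ℓ a_{γ,ℓ}(z)` with smooth coefficients, where the difference of `u` and the sum of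
the terms with `Re γ ≤ N` is `O(r^N)` together with all its derivatives by `r ∂_r` and `∂_z`, locally
uniformly in `z`. -/
def IsPhg {X : Type*} [NormedAddCommGroup X] [NormedSpace ℝ X] (R : ℝ) (O : Set X)
    (u : ℝ → X → ℝ) : Prop :=
  ContDiffOn ℝ ∞ (fun w : ℝ × X => u w.1 w.2) (Ioo 0 R ×ˢ O) ∧
  ∃ (I : Set (ℂ × ℕ)) (hI : IsIndexSet I) (a : ℂ × ℕ → X → ℂ),
    (∀ p ∈ I, ContDiffOn ℝ ∞ (a p) O) ∧
    ∀ (N : ℝ) (n : ℕ) (K : Set X), IsCompact K → K ⊆ O →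
      ∃ C T : ℝ, ∀ t ≤ T, ∀ z ∈ K,
        ‖iteratedFDeriv ℝ n (fun w : ℝ × X =>
            (u (Real.exp w.1) w.2 : ℂ)
              - ∑ p ∈ (hI N).toFinset, phgMonomial p w.1 * a p w.2) (t, z)‖
          ≤ C * Real.exp (N * t)

/-- `u (r, s, z)`, `0 < r < R`, `0 < s < R'`, `z ∈ O`, is smooth and has a double expansion
`u ∼ ∑ r^γ s^η (log r)^ℓ (log s)^k a_{γ,ℓ,η,k}(z)` at the corner `r = s = 0`: the difference of `u` and
the sum of the terms with `Re γ ≤ N`, `Re η ≤ N` is `O(r^N s^{-m} + r^{-m} s^N)` for a fixed `m`, with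
all its derivatives by `r ∂_r`, `s ∂_s`, `∂_z`. -/
def IsPhgCorner {X : Type*} [NormedAddCommGroup X] [NormedSpace ℝ X] (R R' : ℝ) (O : Set X)
    (u : ℝ → ℝ → X → ℝ) : Prop :=
  ContDiffOn ℝ ∞ (fun w : ℝ × ℝ × X => u w.1 w.2.1 w.2.2) (Ioo 0 R ×ˢ Ioo 0 R' ×ˢ O) ∧
  ∃ (I J : Set (ℂ × ℕ)) (hI : IsIndexSet I) (hJ : IsIndexSet J)
    (a : ℂ × ℕ → ℂ × ℕ → X → ℂ) (m : ℝ),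
    (∀ p ∈ I, ∀ q ∈ J, ContDiffOn ℝ ∞ (a p q) O) ∧
    ∀ (N : ℝ) (n : ℕ) (K : Set X), IsCompact K → K ⊆ O →
      ∃ C T : ℝ, ∀ t ≤ T, ∀ t' ≤ T, ∀ z ∈ K,
        ‖iteratedFDeriv ℝ n (fun w : ℝ × ℝ × X =>
            (u (Real.exp w.1) (Real.exp w.2.1) w.2.2 : ℂ)
              - ∑ p ∈ (hI N).toFinset, ∑ q ∈ (hJ N).toFinset,
                  phgMonomial p w.1 * phgMonomial q w.2.1 * a p q w.2.2) (t, t', z)‖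
          ≤ C * (Real.exp (N * t - m * t') + Real.exp (N * t' - m * t))

/-! ## Spherical cone-surfaces

Functions and maps on the unit sphere `S² ⊆ ℝ³` are functions on `ℝ³` of which only the values at unit
vectors are used. -/

/-- Radial projection to the unit sphere. -/
def dir (x : E3) : E3 := ‖x‖⁻¹ • x

/-- The open cone in `ℝ³` over the unit sphere without the points `q j`, `j ∈ J`. -/
def puncturedCone {ι : Type*} (J : Set ι) (q : ι → E3) : Set E3 :=
  {x | x ≠ 0 ∧ ∀ j ∈ J, dir x ≠ q j}

/-- The Gauss curvature at `ξ` of the metric `e^{2u} ḡ` on (a part of) the unit sphere with its round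
metric `ḡ`, that is `e^{-2u} (1 - Δ_ḡ u)`. The Laplacian of the sphere is the Laplacian of `ℝ³` applied
to the extension which is constant along rays. -/
def conformalGaussCurvature (u : E3 → ℝ) (ξ : E3) : ℝ :=
  Real.exp (-2 * u ξ) * (1 - Laplacian.laplacian (fun x => u (dir x)) ξ)

/-- The metric `h = e^{2φ} F^* ḡ` on the sphere, evaluated at `v w ∈ T_ξ S²`. -/
def linkMetric (φ : E3 → ℝ) (F : E3 → E3) (ξ v w : E3) : ℝ :=
  Real.exp (2 * φ ξ) *
    inner ℝ (fderiv ℝ (fun x => F (dir x)) ξ v) (fderiv ℝ (fun x => F (dir x)) ξ w)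

/-- `P (s, θ)`, `0 < s < s₀`, `θ ∈ ℝ/αℤ`, are polar coordinates on a punctured neighbourhood of the cone
point `q j₀` of cone angle `α`, in which `h = e^{2φ} F^* ḡ` is `ds² + sin² s dθ²`. -/
structure IsConePolar {ι : Type*} (J : Set ι) (q : ι → E3) (φ : E3 → ℝ) (F : E3 → E3)
    (j₀ : ι) (α s₀ : ℝ) (P : ℝ → ℝ → E3) : Prop where
  smooth : ContDiffOn ℝ ∞ (fun z : ℝ × ℝ => P z.1 z.2) (Ioo 0 s₀ ×ˢ univ)
  norm_eq : ∀ s ∈ Ioo 0 s₀, ∀ θ, ‖P s θ‖ = 1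
  regular : ∀ s ∈ Ioo 0 s₀, ∀ θ, ∀ j ∈ J, P s θ ≠ q j
  periodic : ∀ s ∈ Ioo 0 s₀, ∀ θ, P s (θ + α) = P s θ
  injective : ∀ s ∈ Ioo 0 s₀, ∀ s' ∈ Ioo 0 s₀, ∀ θ θ', P s θ = P s' θ' →
    s = s' ∧ ∃ n : ℤ, θ' = θ + n * α
  tendsto : ∀ δ > 0, ∃ σ > 0, ∀ s ∈ Ioo 0 s₀, s < σ → ∀ θ, ‖P s θ - q j₀‖ < δ
  nhds : ∃ δ > 0, ∀ ξ : E3, ‖ξ‖ = 1 → ξ ≠ q j₀ → ‖ξ - q j₀‖ < δ →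
    ∃ s ∈ Ioo 0 s₀, ∃ θ, P s θ = ξ
  metric_ss : ∀ s ∈ Ioo 0 s₀, ∀ θ,
    linkMetric φ F (P s θ) (deriv (fun s' => P s' θ) s) (deriv (fun s' => P s' θ) s) = 1
  metric_sθ : ∀ s ∈ Ioo 0 s₀, ∀ θ,
    linkMetric φ F (P s θ) (deriv (fun s' => P s' θ) s) (deriv (fun θ' => P s θ') θ) = 0
  metric_θθ : ∀ s ∈ Ioo 0 s₀, ∀ θ,
    linkMetric φ F (P s θ) (deriv (fun θ' => P s θ') θ) (deriv (fun θ' => P s θ') θ)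
      = Real.sin s ^ 2

/-- `h = e^{2φ} F^* ḡ` is a spherical cone metric on the sphere with cone points `q j`, `j ∈ J`, and
cone angles `α j`. Here `F` is a diffeomorphism of the sphere with inverse `G`, `φ` has a logarithmic
singularity with coefficient `α j / (2π) - 1` at `q j`, and `P j` are polar coordinates at `q j`. -/
structure IsSphericalConeMetric {ι : Type*} (J : Set ι) (q : ι → E3) (α : ι → ℝ) (s₀ : ℝ)
    (φ : E3 → ℝ) (F G : E3 → E3) (P : ι → ℝ → ℝ → E3) : Prop where
  smooth_φ : ContDiffOn ℝ ∞ (fun x => φ (dir x)) (puncturedCone J q)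
  smooth_F : ContDiffOn ℝ ∞ (fun x => F (dir x)) {x | x ≠ 0}
  smooth_G : ContDiffOn ℝ ∞ (fun x => G (dir x)) {x | x ≠ 0}
  norm_F : ∀ ξ, ‖ξ‖ = 1 → ‖F ξ‖ = 1
  norm_G : ∀ ξ, ‖ξ‖ = 1 → ‖G ξ‖ = 1
  left_inv : ∀ ξ, ‖ξ‖ = 1 → G (F ξ) = ξ
  right_inv : ∀ ξ, ‖ξ‖ = 1 → F (G ξ) = ξ
  /-- `h` is isometric, by `F`, to `e^{2 φ ∘ F⁻¹} ḡ`, which has curvature one. -/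
  curvature : ∀ ξ, ‖ξ‖ = 1 → (∀ j ∈ J, ξ ≠ F (q j)) →
    conformalGaussCurvature (fun x => φ (G x)) ξ = 1
  log_singularity : ∀ j ∈ J, ∃ C, ∃ δ > 0, ∀ ξ : E3, ‖ξ‖ = 1 →
    0 < InnerProductGeometry.angle ξ (q j) → InnerProductGeometry.angle ξ (q j) < δ →
    |φ ξ - (α j / (2 * π) - 1) * Real.log (InnerProductGeometry.angle ξ (q j))| ≤ C
  polar : ∀ j ∈ J, IsConePolar J q φ F j (α j) s₀ (P j)

/-! ## Model metrics near vertices and edges -/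

/-- `dr² + sn_κ² r · e^{2φ} F^* ḡ` in the coordinates `x = r ξ` of `ℝ³`. -/
def coneMetric (κ : ℝ) (φ : E3 → ℝ) (F : E3 → E3) : TensorField := fun x =>
  Matrix.of fun i j => x i * x j / ‖x‖ ^ 2
    + sn κ ‖x‖ ^ 2 * (Real.exp (2 * φ (dir x)) *
      inner ℝ (fderiv ℝ (fun y => F (dir y)) x (coordVec i))
        (fderiv ℝ (fun y => F (dir y)) x (coordVec j)))

/-- `dρ² + sn_κ² ρ (1 + c)² (dθ + t w(y) dy)² + cs_κ² ρ (1 + l w(y))² dy²` in the coordinates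
`(ρ, θ, y) = (x 0, x 1, x 2)`. -/
def tubeMetric (κ c t l : ℝ) (w : ℝ → ℝ) : TensorField := fun x =>
  let A := (sn κ (x 0) * (1 + c)) ^ 2
  let B := t * w (x 2)
  let C := (cs κ (x 0) * (1 + l * w (x 2))) ^ 2
  !![1, 0, 0;
     0, A, A * B;
     0, A * B, A * B ^ 2 + C]

/-! ## Singular germs -/

/-- The ends at the vertex `p` of the edges of a graph: `ends e = none` if `e` is a closed curve without
vertices, and otherwise `ends e` are the vertices at its ends `(e, false)` and `(e, true)`. -/
def graphEnds {V E : Type*} (ends : E → Option (V × V)) (p : V) : Set (E × Bool) :=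
  {η | ∃ pq, ends η.1 = some pq ∧ (if η.2 then pq.2 else pq.1) = p}

/-- A singular germ (for any curvature `κ`, which enters the metric below) with cone angles in `(0, 2π)`: a finite graph with vertex set `V`
and edge set `E`; an edge `e` is either closed, without vertices (`ends e = none`), or joins two
(possibly equal) vertices. The ends of the edges are indexed by `(e, false)` and `(e, true)`.
Each end `η` at the vertex `p` is a cone point `q η` of the link `N_p`, which is the sphere with a
spherical cone metric `e^{2φ_p} ḡ`. The polar coordinates `P (e, false)` and `P (e, true)`, of periods
`angle e`, at the two ends of `e` share the angular coordinate `θ` which is parallel along `e`: this is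
how the twist parameter of an edge with vertices is recorded. For a closed edge, `holonomy e` is the
twist parameter: `(ρ, θ, y)` is identified with `(ρ, θ + holonomy e, y + length e)`. -/
structure SingularGerm (V E : Type*) where
  ends : E → Option (V × V)
  length : E → ℝ
  angle : E → ℝ
  holonomy : E → ℝ
  q : E × Bool → E3
  φ : V → E3 → ℝ
  P : E × Bool → ℝ → ℝ → E3
  s₀ : ℝ
  length_pos : ∀ e, 0 < length e
  angle_pos : ∀ e, 0 < angle e
  angle_lt : ∀ e, angle e < 2 * π
  s₀_pos : 0 < s₀
  s₀_le : s₀ ≤ π / 2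
  /-- Each vertex is at least trivalent. -/
  valence : ∀ p, 3 ≤ (graphEnds ends p).ncard
  norm_q : ∀ η, ‖q η‖ = 1
  q_injOn : ∀ p, InjOn q (graphEnds ends p)
  link : ∀ p, IsSphericalConeMetric (graphEnds ends p) q (fun η => angle η.1) s₀ (φ p) id id P
  /-- The polar discs around the cone points of one link are disjoint. -/
  disjoint : ∀ p, ∀ η ∈ graphEnds ends p, ∀ η' ∈ graphEnds ends p, η ≠ η' →
    ∀ s ∈ Ioo 0 s₀, ∀ s' ∈ Ioo 0 s₀, ∀ θ θ', P η s θ ≠ P η' s' θ'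

namespace SingularGerm

variable {V E : Type*} (S : SingularGerm V E)

/-- The ends of edges at the vertex `p`. -/
def endsAt (p : V) : Set (E × Bool) := graphEnds S.ends p

/-- `a` and `b` are admissible radii for the neighbourhood of the singular locus which is the union of
the cones of radius `a` over the links and of the tubes of radius `b` around the edges. The last
condition says that, at distance at least `a / 2` from the vertices, the tubes meet the cones in the
interior of the polar discs only. -/
structure IsTubular (κ a b : ℝ) : Prop where
  a_pos : 0 < a
  b_pos : 0 < b
  a_le : ∀ e, S.ends e ≠ none → a ≤ S.length e / 4
  a_lt : 0 < κ → a < π / (2 * √κ)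
  b_lt : 0 < κ → b < π / (2 * √κ)
  b_small : sn κ b < Real.sin S.s₀ * sn κ (a / 2)

/-- The regular part of the cone neighbourhood of `p`, in the coordinates `x = r ξ ∈ ℝ³`. -/
def cone (a : ℝ) (p : V) : Set E3 := {x ∈ puncturedCone (S.endsAt p) S.q | ‖x‖ < a}

/-- The range of the coordinate `y` on the tube around `e`. For a closed edge, `y` is only defined
modulo `length e`, up to a rotation, and one passes to the universal covering. -/
def tubeRange (a : ℝ) (e : E) : Set ℝ :=
  {y | S.ends e = none ∨ y ∈ Ioo (a / 2) (S.length e - a / 2)}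

/-- The regular part of the tube around `e`, in the coordinates `(ρ, θ, y)`, with `θ` in the universal
covering of the circle. -/
def tube (a b : ℝ) (e : E) : Set E3 := {x | x 0 ∈ Ioo 0 b ∧ x 2 ∈ S.tubeRange a e}

/-- A fundamental domain of the tube (up to null sets). -/
def tubeDomain (a b : ℝ) (e : E) : Set E3 :=
  {x ∈ S.tube a b e | x 1 ∈ Ioo 0 (S.angle e) ∧ x 2 ∈ Ioo 0 (S.length e)}

/-- The cone metric near `p`. -/
def metricAtVertex (κ : ℝ) (p : V) : TensorField := coneMetric κ (S.φ p) id

/-- The cone metric `dρ² + sn_κ² ρ dθ² + cs_κ² ρ dy²` near the edges. -/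
def metricAtEdge (κ : ℝ) : TensorField := tubeMetric κ 0 0 0 0

/-- The distance along the edge of the foot point of `x` from the given end. -/
def endDist (η : E × Bool) (x : E3) : ℝ := if η.2 then S.length η.1 - x 2 else x 2

/-- The distance of the point `x` of the tube from the vertex at the end `η`. -/
def vertexDist (κ : ℝ) (η : E × Bool) (x : E3) : ℝ :=
  arcsn κ √(sn κ (x 0) ^ 2 + cs κ (x 0) ^ 2 * sn κ (S.endDist η x) ^ 2)

/-- The angle, at the vertex at the end `η`, between the edge and the geodesic to the point `x` of the
tube. -/
def vertexAngle (κ : ℝ) (η : E × Bool) (x : E3) : ℝ :=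
  Real.arctan (sn κ (x 0) / (cs κ (x 0) * sn κ (S.endDist η x)))

/-- The coordinate change from the tube to the cone at the end `η`. -/
def tubeToCone (κ : ℝ) (η : E × Bool) (x : E3) : E3 :=
  S.vertexDist κ η x • S.P η (S.vertexAngle κ η x) (x 1)

/-- The part of the tube which is contained in the cone at the end `η`. -/
def overlap (κ a b : ℝ) (η : E × Bool) : Set E3 :=
  {x ∈ S.tube a b η.1 | S.endDist η x < a ∧ S.vertexDist κ η x < a}

/-- The polar coordinates `(r, s, θ) ↦ r P (s, θ)` of the cone along the edge at the end `η`. -/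
def conePolar (η : E × Bool) (x : E3) : E3 := x 0 • S.P η (x 1) (x 2)

end SingularGerm

/-- A pair of families of coefficients, on the cones and on the tubes. -/
structure NbhdTensor (V E : Type*) where
  onCone : V → TensorField
  onTube : E → TensorField

namespace SingularGerm

variable {V E : Type*} (S : SingularGerm V E)

/-- `k` is a smooth symmetric 2-tensor on the regular part of the neighbourhood (of radii `a`, `b`) of
the singular locus: its expressions on cones and tubes agree under the coordinate changes. -/
structure IsSymmTensor (κ a b : ℝ) (k : NbhdTensor V E) : Prop where
  smooth_cone : ∀ p i j, ContDiffOn ℝ ∞ (fun x => k.onCone p x i j) (S.cone a p)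
  smooth_tube : ∀ e i j, ContDiffOn ℝ ∞ (fun x => k.onTube e x i j) (S.tube a b e)
  symm_cone : ∀ p, ∀ x ∈ S.cone a p, ∀ i j, k.onCone p x i j = k.onCone p x j i
  symm_tube : ∀ e, ∀ x ∈ S.tube a b e, ∀ i j, k.onTube e x i j = k.onTube e x j i
  periodic : ∀ e, ∀ x ∈ S.tube a b e,
    k.onTube e !₂[x 0, x 1 + S.angle e, x 2] = k.onTube e x
  closed : ∀ e, S.ends e = none → ∀ x ∈ S.tube a b e,
    k.onTube e !₂[x 0, x 1 + S.holonomy e, x 2 + S.length e] = k.onTube e x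
  compatible : ∀ p, ∀ η ∈ S.endsAt p, ∀ x ∈ S.overlap κ a b η,
    pullback (S.tubeToCone κ η) (k.onCone p) x = k.onTube η.1 x

/-- `k` is polyhomogeneous at the singular locus. -/
structure IsPolyhomogeneous (a b : ℝ) (k : NbhdTensor V E) : Prop where
  /-- At the edges, `ρ → 0`. -/
  edge : ∀ e i j, IsPhg b {z : ℝ × ℝ | z.2 ∈ S.tubeRange a e}
    (fun ρ z => k.onTube e !₂[ρ, z.1, z.2] i j)
  /-- At the vertices, `r → 0`, away from the edges. -/
  vertex : ∀ p i j, IsPhg a (puncturedCone (S.endsAt p) S.q)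
    (fun r w => k.onCone p (r • dir w) i j)
  /-- At the edges in the cones, `s → 0`, away from the vertices. -/
  coneEdge : ∀ p, ∀ η ∈ S.endsAt p, ∀ i j, IsPhg S.s₀ {z : ℝ × ℝ | z.1 ∈ Ioo 0 a}
    (fun s z => pullback (S.conePolar η) (k.onCone p) !₂[z.1, s, z.2] i j)
  /-- At the corners `r = s = 0`. -/
  corner : ∀ p, ∀ η ∈ S.endsAt p, ∀ i j, IsPhgCorner a S.s₀ (univ : Set ℝ)
    (fun r s θ => pullback (S.conePolar η) (k.onCone p) !₂[r, s, θ] i j)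

/-- `k ∈ L²`. -/
def IsL2 (κ a b : ℝ) (k : NbhdTensor V E) : Prop :=
  (∀ p, L2On (S.metricAtVertex κ p) (k.onCone p) (S.cone a p)) ∧
  ∀ e, L2On (metricAtEdge κ) (k.onTube e) (S.tubeDomain a b e)

/-- `∇k ∈ L²`. -/
def IsCovDerivL2 (κ a b : ℝ) (k : NbhdTensor V E) : Prop :=
  (∀ p, CovDerivL2On (S.metricAtVertex κ p) (k.onCone p) (S.cone a p)) ∧
  ∀ e, CovDerivL2On (metricAtEdge κ) (k.onTube e) (S.tubeDomain a b e)

end SingularGerm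

/-! ## Deformations in standard form -/

/-- A smooth family, `|ε| < ε₀`, of singular germs in standard form which starts at `S`. At parameter `ε`
the edge `e` has length `length e + l e ε`, its twist is changed by `t e ε`, and its cone angle is
`angle e * (1 + c e ε)`; the link of `p` has the spherical cone metric
`e^{2 φ p ε} (F p ε)^* ḡ` with the cone points fixed at the `q η`. The germ is glued as the
initial one, by means of polar coordinates `P η ε` which vary smoothly, the tube coordinate `θ`
corresponding to the angular coordinate `(1 + c e ε) θ` of the link. -/
structure StandardDeformation {V E : Type*} (S : SingularGerm V E) where
  ε₀ : ℝ
  c : E → ℝ → ℝ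
  t : E → ℝ → ℝ
  l : E → ℝ → ℝ
  f : E → ℝ → ℝ
  φ : V → ℝ → E3 → ℝ
  F : V → ℝ → E3 → E3
  G : V → ℝ → E3 → E3
  P : E × Bool → ℝ → ℝ → ℝ → E3
  ε₀_pos : 0 < ε₀
  smooth_c : ∀ e, ContDiffOn ℝ ∞ (c e) (Ioo (-ε₀) ε₀)
  smooth_t : ∀ e, ContDiffOn ℝ ∞ (t e) (Ioo (-ε₀) ε₀)
  smooth_l : ∀ e, ContDiffOn ℝ ∞ (l e) (Ioo (-ε₀) ε₀)
  c_zero : ∀ e, c e 0 = 0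
  t_zero : ∀ e, t e 0 = 0
  l_zero : ∀ e, l e 0 = 0
  smooth_f : ∀ e, ContDiff ℝ ∞ (f e)
  monotone_f : ∀ e, Monotone (f e)
  f_eq_zero : ∀ e, ∀ y ≤ S.length e / 4, f e y = 0
  f_eq_one : ∀ e, ∀ y, 3 * S.length e / 4 ≤ y → f e y = 1
  nondegenerate : ∀ e, ∀ ε ∈ Ioo (-ε₀) ε₀, ∀ y, 0 < 1 + l e ε * deriv (f e) y
  angle_pos : ∀ e, ∀ ε ∈ Ioo (-ε₀) ε₀, 0 < S.angle e * (1 + c e ε)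
  angle_lt : ∀ e, ∀ ε ∈ Ioo (-ε₀) ε₀, S.angle e * (1 + c e ε) < 2 * π
  smooth_φ : ∀ p, ContDiffOn ℝ ∞ (fun z : ℝ × E3 => φ p z.1 (dir z.2))
    (Ioo (-ε₀) ε₀ ×ˢ puncturedCone (S.endsAt p) S.q)
  smooth_F : ∀ p, ContDiffOn ℝ ∞ (fun z : ℝ × E3 => F p z.1 (dir z.2))
    (Ioo (-ε₀) ε₀ ×ˢ {x | x ≠ 0})
  smooth_G : ∀ p, ContDiffOn ℝ ∞ (fun z : ℝ × E3 => G p z.1 (dir z.2))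
    (Ioo (-ε₀) ε₀ ×ˢ {x | x ≠ 0})
  smooth_P : ∀ p, ∀ η ∈ S.endsAt p, ContDiffOn ℝ ∞ (fun z : ℝ × ℝ × ℝ => P η z.1 z.2.1 z.2.2)
    (Ioo (-ε₀) ε₀ ×ˢ Ioo 0 S.s₀ ×ˢ univ)
  φ_zero : ∀ p ξ, ‖ξ‖ = 1 → φ p 0 ξ = S.φ p ξ
  F_zero : ∀ p ξ, ‖ξ‖ = 1 → F p 0 ξ = ξ
  P_zero : ∀ p, ∀ η ∈ S.endsAt p, ∀ s ∈ Ioo 0 S.s₀, ∀ θ, P η 0 s θ = S.P η s θ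
  link : ∀ p, ∀ ε ∈ Ioo (-ε₀) ε₀, IsSphericalConeMetric (S.endsAt p) S.q
    (fun η => S.angle η.1 * (1 + c η.1 ε)) S.s₀ (φ p ε) (F p ε) (G p ε) (fun η => P η ε)
  /-- Near the cone points, `F` is an isometry of the round metric. -/
  isometric : ∀ p, ∀ η ∈ S.endsAt p, ∃ δ > 0, ∀ ε ∈ Ioo (-ε₀) ε₀, ∀ ξ ξ' : E3,
    ‖ξ‖ = 1 → ‖ξ'‖ = 1 → ‖ξ - S.q η‖ < δ → ‖ξ' - S.q η‖ < δ →
    ‖F p ε ξ - F p ε ξ'‖ = ‖ξ - ξ'‖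
  /-- The `ε`-derivative of `φ` has logarithmic singularities too: the regular part
  `φ - β log s`, where `2π (1 + β)` is the cone angle, has a bounded derivative. -/
  log_derivative : ∀ p, ∀ η ∈ S.endsAt p, ∀ ε ∈ Ioo (-ε₀) ε₀, ∃ C, ∃ δ > 0, ∀ ξ : E3, ‖ξ‖ = 1 →
    0 < InnerProductGeometry.angle ξ (S.q η) → InnerProductGeometry.angle ξ (S.q η) < δ →
    |deriv (fun ε' => φ p ε' ξ - (S.angle η.1 * (1 + c η.1 ε') / (2 * π) - 1)
      * Real.log (InnerProductGeometry.angle ξ (S.q η))) ε| ≤ C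

namespace StandardDeformation

variable {V E : Type*} {S : SingularGerm V E} (D : StandardDeformation S)

/-- The dihedral angle of `e` at parameter `ε`. -/
def dihedralAngle (e : E) (ε : ℝ) : ℝ := S.angle e * (1 + D.c e ε)

/-- The infinitesimal deformation preserves all dihedral angles. -/
def PreservesAngles : Prop := ∀ e, deriv (D.dihedralAngle e) 0 = 0

/-- The derivative of `f`, on `[0, length e]`, continued with period `length e` (which matters for closed
edges only). -/
def slope (e : E) (y : ℝ) : ℝ := deriv (D.f e) (S.length e * Int.fract (y / S.length e))

/-- The metric at parameter `ε` near the vertex `p`. -/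
def metricAtVertex (κ ε : ℝ) (p : V) : TensorField := coneMetric κ (D.φ p ε) (D.F p ε)

/-- The metric at parameter `ε` near the edge `e`. -/
def metricAtEdge (κ ε : ℝ) (e : E) : TensorField :=
  tubeMetric κ (D.c e ε) (D.t e ε) (D.l e ε) (D.slope e)

/-- The infinitesimal deformation near the vertex `p`. -/
def derivAtVertex (κ : ℝ) (p : V) : TensorField := fun x =>
  Matrix.of fun i j => deriv (fun ε => D.metricAtVertex κ ε p x i j) 0

/-- The infinitesimal deformation near the edge `e`. -/
def derivAtEdge (κ : ℝ) (e : E) : TensorField := fun x =>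
  Matrix.of fun i j => deriv (fun ε => D.metricAtEdge κ ε e x i j) 0

/-- The coordinate change from the tube to the cone at the end `η`, at parameter `ε`: an isometry of the
metrics at parameter `ε`. -/
def tubeToCone (κ ε : ℝ) (η : E × Bool) (x : E3) : E3 :=
  S.vertexDist κ η x • D.P η ε (S.vertexAngle κ η x) ((1 + D.c η.1 ε) * x 1)

/-- The tensor `k` on the neighbourhood of radii `a`, `b` represents the infinitesimal deformation given
by `D`. It is in standard form on the tubes and on the cones of radius `a / 4`. Since the coordinate
changes between tubes and cones may depend on `ε`, the expressions in standard form on the cone and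
on the tube may differ by the Lie derivative of the metric along the vector field which generates
these coordinate changes; so, further out in the cones, `k` differs from the standard form by the Lie
derivative along a vector field `Z` which interpolates and which vanishes at the singular locus. -/
structure Represents (κ a b : ℝ) (k : NbhdTensor V E) : Prop where
  isSymmTensor : S.IsSymmTensor κ a b k
  tube_eq : ∀ e, ∀ x ∈ S.tube a b e, k.onTube e x = D.derivAtEdge κ e x
  cone_eq : ∀ p, ∃ Z : E3 → E3, ContDiffOn ℝ ∞ Z (S.cone a p) ∧
    (∀ x ∈ S.cone a p, k.onCone p x
      = D.derivAtVertex κ p x + lieDerivative Z (S.metricAtVertex κ p) x) ∧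
    (∀ x ∈ S.cone a p, ‖x‖ < a / 4 → Z x = 0) ∧
    (∀ η ∈ S.endsAt p, ∀ x ∈ S.overlap κ a b η,
      Z (S.tubeToCone κ η x) = deriv (fun ε => D.tubeToCone κ ε η x) 0) ∧
    ∀ x₀ : E3, ‖x₀‖ < a → x₀ ∉ S.cone a p →
      Tendsto (fun x => ∑ i, ∑ j, S.metricAtVertex κ p x i j * Z x i * Z x j)
        (𝓝[S.cone a p] x₀) (𝓝 0)

end StandardDeformation

end

/-!
Let `c_e' = cdot e` be the derivative of the logarithm of the cone angle of the edge `e`. The angles are preserved if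
and only if all `c_e'` vanish.

**The angles must be fixed.** On the tube around `e`, every representing tensor is the derivative of the given metrics,
`2 c_e' sn² dθ² + ⋯`. The coefficient of `dθ²` is rescaled, that of `dρ²` is not, and the orthonormal frame
`e_ρ, e_θ, e_y` rotates along the circles around the edge: `(∇_{e_θ} ġ)(e_ρ, e_θ) = -2 c_e' cs / sn`. With the volume
density `sn cs`, this contributes at least `4 c_e'² cs³ / sn` to the integrand of `∫ |∇ġ|²`, which diverges like
`∫ dρ / ρ` unless `c_e' = 0` (`cdot_eq_zero_of_covDerivL2On`). Only the form of `ġ` on the tubes enters.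

**The representing tensor.** In the cone over the link of a vertex, the polar coordinates `P_ε(s, θ)` at a cone point,
with the angle normalised to a fixed period, move with the parameter. Let `X ∂_s + Y ∂_θ` be their velocity at `ε = 0`.
Compensating this motion turns the derivative of the metric into the pure variation `2 c_e' sn² r sin² s dθ²` of the cone
angle (`pullback_derivAtVertex_add`), as on the tube. So `representative` is the derivative of the metrics, plus the
Lie derivative of the metric along the velocity, cut off near the vertex and away from the cone points (`gaugeField`).

**The velocity.** The metrics of the link vary within their conformal class near the cone points, hence `X ∂_s + Y ∂_θ`
is a conformal Killing field up to the rescaling of the angle (`exists_velocity_equations`). This says that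
`X / sin s + c_e' log tan(s/2) + i Y` is holomorphic in `log tan(s/2) + iθ`. It has the period of the cone, so it is a
holomorphic function of the conformal coordinate `ζ = exp((log tan(s/2) + iθ)/β)`, where `2πβ` is the cone angle, with at
most an isolated singularity at `ζ = 0`. The conformal factors are logarithmic at the cone points, with a logarithmic
derivative in `ε`, and the polar radius is bounded by a power of the distance in the round metric
(`exists_le_angle_rpow`). Therefore `∂_s X = O(log s)`, the holomorphic function is `O(|ζ|^{-β})`, and since `β < 1` the
singularity is removable (`exists_holomorphic`). In `s` and `θ`, the velocity is thus a smooth function of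
`(s^{1/β}, s, θ)`, up to terms with one factor `log s` (`IsPolarSmooth`), which gives the asymptotic expansions.

**Square integrability.** On the tubes the tensor is explicit, and if `c_e' = 0`, then `|∇ġ|²` extends continuously to the
edge. In a cone there are two regimes. Near an edge with `c_e' = 0`, no logarithms remain, and the components of `sn r ∇ġ` in the orthonormal frame are
polynomials in bounded functions of `r` and `s` and in the real and imaginary parts of `H`, `ζ H' / sin s` and
`ζ (ζ H')' / sin s` (`covDeriv_polar`), where `H` is the holomorphic function of the velocity. They are bounded because
`1/β > 1`. The tensor `ġ` itself has at most a logarithmic singularity, also if `c_e' ≠ 0`. Away from the edges, the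
metric and `ġ` are conical, and scaling gives `|ġ| = O(1)` and `|∇ġ| = O(1/r)` (`IsConical.exists_bound`), which is square
integrable in dimension three. The link is compact, so these regimes cover the cone (`integrableOn_cone`).
-/

open Finset (sum_congr sum_comm mul_sum sum_mul)
open Matrix (of_apply diagonal cons_val_zero cons_val_one cons_val)

/-! ### Tensor calculus in coordinates: pullbacks, Lie derivatives and covariant derivatives -/

/-- The Jacobian matrix of `Φ`: the entry `a i` is `∂_i Φ^a`. -/
noncomputable def jac (Φ : E3 → E3) (x : E3) : Matrix (Fin 3) (Fin 3) ℝ :=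
  Matrix.of fun a i => (fderiv ℝ Φ x (coordVec i)) a

lemma sum_smul_coordVec (v : E3) : ∑ a, v a • coordVec a = v := by
  ext i
  simp [coordVec, Finset.sum_apply, Pi.single_apply]

lemma fderiv_eq_sum_pd (u : E3 → ℝ) (x v : E3) : fderiv ℝ u x v = ∑ a, v a * pd a u x := by
  conv_lhs => rw [← sum_smul_coordVec v]
  simp [pd]

lemma fderiv_coord {G : Type*} [NormedAddCommGroup G] [NormedSpace ℝ G] {Φ : G → E3} {x : G}
    (h : DifferentiableAt ℝ Φ x) (v : G) (a : Fin 3) :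
    (fderiv ℝ Φ x v) a = fderiv ℝ (fun y => Φ y a) x v := by
  have := ((EuclideanSpace.proj a : E3 →L[ℝ] ℝ).hasFDerivAt (x := Φ x)).comp x h.hasFDerivAt
  have h2 : fderiv ℝ (fun y => Φ y a) x = _ := this.fderiv
  rw [h2]; rfl

lemma jac_eq_pd {Φ : E3 → E3} {x : E3} (h : DifferentiableAt ℝ Φ x) (a i : Fin 3) :
    jac Φ x a i = pd i (fun y => Φ y a) x := fderiv_coord h _ _

lemma pd_congr {u w : E3 → ℝ} {x : E3} (h : u =ᶠ[𝓝 x] w) (i : Fin 3) : pd i u x = pd i w x := by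
  simp only [pd, h.fderiv_eq]

lemma pd_mul {u w : E3 → ℝ} {x : E3} (hu : DifferentiableAt ℝ u x) (hw : DifferentiableAt ℝ w x)
    (i : Fin 3) : pd i (fun y => u y * w y) x = pd i u x * w x + u x * pd i w x := by
  simp only [pd, fderiv_fun_mul hu hw]; simp; ring

lemma pd_sum {u : Fin 3 → E3 → ℝ} {x : E3} (hu : ∀ a, DifferentiableAt ℝ (u a) x)
    (i : Fin 3) : pd i (fun y => ∑ a, u a y) x = ∑ a, pd i (u a) x := by
  simp only [pd, fderiv_fun_sum (fun a _ => hu a)]; simp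

lemma pd_comp {Φ : E3 → E3} {u : E3 → ℝ} {x : E3} (hΦ : DifferentiableAt ℝ Φ x)
    (hu : DifferentiableAt ℝ u (Φ x)) (i : Fin 3) :
    pd i (fun y => u (Φ y)) x = ∑ d, jac Φ x d i * pd d u (Φ x) := by
  have : fderiv ℝ (fun y => u (Φ y)) x = _ := fderiv_comp x hu hΦ
  simp only [pd, this, ContinuousLinearMap.comp_apply]
  exact fderiv_eq_sum_pd _ _ _

lemma pd_const (c : ℝ) (x : E3) (i : Fin 3) : pd i (fun _ => c) x = 0 := by simp [pd]

lemma pullback_apply (Φ : E3 → E3) (k : TensorField) (x : E3) (i j : Fin 3) :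
    pullback Φ k x i j = ∑ a, ∑ b, jac Φ x a i * jac Φ x b j * k (Φ x) a b := rfl

lemma pullback_eq_mul (Φ : E3 → E3) (k : TensorField) (x : E3) :
    pullback Φ k x = (jac Φ x).transpose * k (Φ x) * jac Φ x := by
  ext i j
  simp only [pullback_apply, Matrix.mul_apply, Matrix.transpose_apply, sum_mul]
  rw [sum_comm]
  exact sum_congr rfl fun _ _ => sum_congr rfl fun _ _ => by ring

lemma jac_comp {Φ Ψ : E3 → E3} {x : E3} (hΦ : DifferentiableAt ℝ Φ (Ψ x))
    (hΨ : DifferentiableAt ℝ Ψ x) : jac (Φ ∘ Ψ) x = jac Φ (Ψ x) * jac Ψ x := by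
  ext a i
  simp only [jac, fderiv_comp x hΦ hΨ, of_apply, ContinuousLinearMap.comp_apply, Matrix.mul_apply]
  rw [fderiv_coord hΦ, fderiv_eq_sum_pd]
  exact sum_congr rfl fun d _ => by rw [pd, fderiv_coord hΦ]; ring

lemma pullback_comp {Φ Ψ : E3 → E3} {x : E3} (hΦ : DifferentiableAt ℝ Φ (Ψ x))
    (hΨ : DifferentiableAt ℝ Ψ x) (k : TensorField) :
    pullback (Φ ∘ Ψ) k x = pullback Ψ (pullback Φ k) x := by
  simp only [pullback_eq_mul, jac_comp hΦ hΨ, Matrix.transpose_mul, Matrix.mul_assoc, Function.comp]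

lemma pullback_congr {Φ Ψ : E3 → E3} {x : E3} (h : Φ =ᶠ[𝓝 x] Ψ) (k : TensorField) :
    pullback Φ k x = pullback Ψ k x := by
  simp only [pullback, h.fderiv_eq, h.eq_of_nhds]

lemma contDiffAt_jac {Φ : E3 → E3} {x : E3} {n : WithTop ℕ∞} (h : ContDiffAt ℝ (n + 1) Φ x)
    (a i : Fin 3) : ContDiffAt ℝ n (fun y => jac Φ y a i) x := by
  have h1 : ContDiffAt ℝ n (fun y => fderiv ℝ Φ y (coordVec i)) x :=
    (h.fderiv_right le_rfl).clm_apply contDiffAt_const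
  exact contDiffAt_euclidean.1 h1 a

lemma contDiffAt_pd {u : E3 → ℝ} {x : E3} {n : WithTop ℕ∞} (h : ContDiffAt ℝ (n + 1) u x)
    (i : Fin 3) : ContDiffAt ℝ n (fun y => pd i u y) x :=
  (h.fderiv_right le_rfl).clm_apply contDiffAt_const

lemma contDiffAt_pullback {Φ : E3 → E3} {k : TensorField} {x : E3} {n : WithTop ℕ∞}
    (h : ContDiffAt ℝ (n + 1) Φ x) (hk : ∀ a b, ContDiffAt ℝ n (fun y => k y a b) (Φ x))
    (i j : Fin 3) : ContDiffAt ℝ n (fun y => pullback Φ k y i j) x := by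
  simp only [pullback_apply]
  refine ContDiffAt.sum fun a _ => ContDiffAt.sum fun b _ => ?_
  exact ((contDiffAt_jac h a i).mul (contDiffAt_jac h b j)).mul ((hk a b).comp x (h.of_le le_self_add))

/-- Symmetry of second derivatives: `∂_i ∂_c Φ^a = ∂_c ∂_i Φ^a`. -/
lemma pd_jac_comm {Φ : E3 → E3} {x : E3} (h : ContDiffAt ℝ 2 Φ x) (a i c : Fin 3) :
    pd i (fun y => jac Φ y a c) x = pd c (fun y => jac Φ y a i) x := by
  have hs : IsSymmSndFDerivAt ℝ Φ x := h.isSymmSndFDerivAt (by simp)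
  have hd : DifferentiableAt ℝ (fderiv ℝ Φ) x :=
    (h.fderiv_right (m := 1) (by norm_num)).differentiableAt (by norm_num)
  have key : ∀ i c, pd i (fun y => jac Φ y a c) x = (fderiv ℝ (fderiv ℝ Φ) x (coordVec i) (coordVec c)) a := by
    intro i c
    have h1 : DifferentiableAt ℝ (fun y => fderiv ℝ Φ y (coordVec c)) x :=
      hd.clm_apply (differentiableAt_const _)
    simp only [pd, jac, of_apply]
    rw [← fderiv_coord h1]
    rw [fderiv_clm_apply hd (differentiableAt_const _)]
    simp
  rw [key, key, hs.eq]

/-- Differentiation in a parameter commutes with differentiation in space. -/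
lemma hasDerivAt_fderiv_param {F : Type*} [NormedAddCommGroup F] [NormedSpace ℝ F]
    {Ψ : ℝ → E3 → F} {x : E3} (h : ContDiffAt ℝ 2 (fun z : ℝ × E3 => Ψ z.1 z.2) (0, x)) (v : E3) :
    HasDerivAt (fun ε => fderiv ℝ (Ψ ε) x v) (fderiv ℝ (fun y => deriv (fun ε => Ψ ε y) 0) x v) 0 := by
  set U : ℝ × E3 → F := fun z => Ψ z.1 z.2
  have hs : IsSymmSndFDerivAt ℝ U (0, x) := h.isSymmSndFDerivAt (by simp)
  have hd : DifferentiableAt ℝ (fderiv ℝ U) (0, x) :=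
    (h.fderiv_right (m := 1) (by norm_num)).differentiableAt (by norm_num)
  have hev : ∀ᶠ z in 𝓝 ((0 : ℝ), x), DifferentiableAt ℝ U z :=
    (h.eventually (by simp)).mono fun z hz => hz.differentiableAt (by norm_num)
  have h1 : ∀ᶠ ε in 𝓝 (0 : ℝ), fderiv ℝ (Ψ ε) x v = fderiv ℝ U (ε, x) (0, v) := by
    have : Tendsto (fun ε : ℝ => (ε, x)) (𝓝 0) (𝓝 (0, x)) :=
      (Continuous.prodMk_left x).tendsto 0
    filter_upwards [this.eventually hev] with ε hε
    have : HasFDerivAt (Ψ ε) _ x := hε.hasFDerivAt.comp x (hasFDerivAt_prodMk_right ε x)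
    rw [this.fderiv]; simp
  have h2 : ∀ᶠ y in 𝓝 x, deriv (fun ε => Ψ ε y) 0 = fderiv ℝ U (0, y) (1, 0) := by
    have : Tendsto (fun y : E3 => ((0 : ℝ), y)) (𝓝 x) (𝓝 (0, x)) :=
      (Continuous.prodMk_right (0 : ℝ)).tendsto x
    filter_upwards [this.eventually hev] with y hy
    have : HasFDerivAt (fun ε => Ψ ε y) _ (0 : ℝ) :=
      HasFDerivAt.comp (0 : ℝ) (f := fun ε : ℝ => (ε, y)) hy.hasFDerivAt (hasFDerivAt_prodMk_left (0 : ℝ) y)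
    rw [this.hasDerivAt.deriv]; simp
  have h3 : HasDerivAt (fun ε : ℝ => fderiv ℝ U (ε, x) (0, v)) (fderiv ℝ (fderiv ℝ U) (0, x) (1, 0) (0, v)) 0 := by
    have h0 : HasFDerivAt (fun ε : ℝ => fderiv ℝ U (ε, x)) _ (0 : ℝ) :=
      HasFDerivAt.comp (0 : ℝ) (g := fderiv ℝ U) (f := fun ε : ℝ => (ε, x)) hd.hasFDerivAt
        (hasFDerivAt_prodMk_left (0 : ℝ) x)
    simpa using (h0.clm_apply (hasFDerivAt_const ((0 : ℝ), v) (0 : ℝ))).hasDerivAt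
  have h4 : HasFDerivAt (fun y : E3 => fderiv ℝ U (0, y) (1, 0)) _ x :=
    ((hd.hasFDerivAt.comp x (hasFDerivAt_prodMk_right (0 : ℝ) x)).clm_apply (hasFDerivAt_const ((1 : ℝ), (0 : E3)) x) :)
  rw [EventuallyEq.fderiv_eq h2, h4.fderiv]
  refine (h3.congr_of_eventuallyEq h1).congr_deriv ?_
  rw [hs.eq]; simp

lemma pd_pullback {Φ : E3 → E3} {k : TensorField} {x : E3} (hΦ : ContDiffAt ℝ 2 Φ x)
    (hk : ∀ a b, DifferentiableAt ℝ (fun y => k y a b) (Φ x)) (c i j : Fin 3) :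
    pd c (fun y => pullback Φ k y i j) x = ∑ a, ∑ b, (pd c (fun y => jac Φ y a i) x * jac Φ x b j * k (Φ x) a b
        + jac Φ x a i * pd c (fun y => jac Φ y b j) x * k (Φ x) a b
        + jac Φ x a i * jac Φ x b j * ∑ d, jac Φ x d c * pd d (fun y => k y a b) (Φ x)) := by
  have hJ : ∀ a i, DifferentiableAt ℝ (fun y => jac Φ y a i) x := fun a i =>
    (contDiffAt_jac (n := 1) (by simpa [one_add_one_eq_two] using hΦ) a i).differentiableAt (by norm_num)
  have hd : DifferentiableAt ℝ Φ x := hΦ.differentiableAt (by norm_num)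
  have hkc : ∀ a b, DifferentiableAt ℝ (fun y => k (Φ y) a b) x := fun a b => (hk a b).comp x hd
  simp only [pullback_apply]
  rw [pd_sum fun a => DifferentiableAt.fun_sum fun b _ => ((hJ a i).fun_mul (hJ b j)).fun_mul (hkc a b)]
  refine sum_congr rfl fun a _ => ?_
  rw [pd_sum fun b => ((hJ a i).fun_mul (hJ b j)).fun_mul (hkc a b)]
  refine sum_congr rfl fun b _ => ?_
  rw [pd_mul ((hJ a i).fun_mul (hJ b j)) (hkc a b), pd_mul (hJ a i) (hJ b j),
    pd_comp (u := fun y => k y a b) hd (hk a b)]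
  ring

/-- If the vector field `X` is `Φ`-related to the vector field `V` along `Φ`, the coordinates of `V`
have the derivatives given by the product rule. -/
lemma pd_related {Φ X V : E3 → E3} {x : E3} (hΦ : ContDiffAt ℝ 2 Φ x) (hX : DifferentiableAt ℝ X x)
    (hV : ∀ᶠ y in 𝓝 x, fderiv ℝ Φ y (X y) = V y) (a i : Fin 3) :
    pd i (fun y => V y a) x = ∑ c, (pd c (fun y => jac Φ y a i) x * X x c + jac Φ x a c * pd i (fun y => X y c) x) := by
  have hJ : ∀ a i, DifferentiableAt ℝ (fun y => jac Φ y a i) x := fun a i =>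
    (contDiffAt_jac (n := 1) (by simpa [one_add_one_eq_two] using hΦ) a i).differentiableAt (by norm_num)
  have hXc : ∀ c, DifferentiableAt ℝ (fun y => X y c) x := differentiableAt_euclidean.1 hX
  have hev : (fun y => V y a) =ᶠ[𝓝 x] fun y => ∑ c, jac Φ y a c * X y c := by
    filter_upwards [hV, hΦ.eventually (by simp)] with y hy hd
    have hd' : DifferentiableAt ℝ Φ y := hd.differentiableAt (by norm_num)
    rw [← hy, fderiv_coord hd', fderiv_eq_sum_pd]
    exact sum_congr rfl fun c _ => by rw [jac_eq_pd hd', mul_comm]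
  rw [pd_congr hev, pd_sum fun c => (hJ a c).fun_mul (hXc c)]
  exact sum_congr rfl fun c _ => by rw [pd_mul (hJ a c) (hXc c), pd_jac_comm hΦ]

set_option maxRecDepth 4000 in
/-- Naturality of the Lie derivative. -/
lemma lieDerivative_pullback {Φ X Z : E3 → E3} {k : TensorField} {x : E3}
    (hΦ : ContDiffAt ℝ 2 Φ x) (hk : ∀ a b, DifferentiableAt ℝ (fun y => k y a b) (Φ x))
    (hX : DifferentiableAt ℝ X x) (hZ : DifferentiableAt ℝ Z (Φ x))
    (h : ∀ᶠ y in 𝓝 x, fderiv ℝ Φ y (X y) = Z (Φ y)) :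
    lieDerivative X (pullback Φ k) x = pullback Φ (lieDerivative Z k) x := by
  have hd : DifferentiableAt ℝ Φ x := hΦ.differentiableAt (by norm_num)
  have hZc : ∀ c, DifferentiableAt ℝ (fun y => Z y c) (Φ x) := differentiableAt_euclidean.1 hZ
  have e1 : ∀ a i, ∑ d, jac Φ x d i * pd d (fun y => Z y a) (Φ x)
      = ∑ c, (pd c (fun y => jac Φ y a i) x * X x c + jac Φ x a c * pd i (fun y => X y c) x) := by
    intro a i
    rw [← pd_related hΦ hX h, pd_comp (u := fun y => Z y a) hd (hZc a)]
  have e2 : ∀ a, Z (Φ x) a = ∑ c, jac Φ x a c * X x c := by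
    intro a
    rw [← h.self_of_nhds, fderiv_coord hd, fderiv_eq_sum_pd]
    exact sum_congr rfl fun c _ => by rw [jac_eq_pd hd, mul_comm]
  ext i j
  have lhs : lieDerivative X (pullback Φ k) x i j = ∑ a, ∑ b,
      ((∑ c, (pd c (fun y => jac Φ y a i) x * X x c + jac Φ x a c * pd i (fun y => X y c) x))
          * jac Φ x b j * k (Φ x) a b
        + (∑ c, (pd c (fun y => jac Φ y b j) x * X x c + jac Φ x b c * pd j (fun y => X y c) x))
          * jac Φ x a i * k (Φ x) a b
        + jac Φ x a i * jac Φ x b j * ∑ d, (∑ c, jac Φ x d c * X x c) * pd d (fun y => k y a b) (Φ x)) := by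
    simp only [lieDerivative, of_apply, pd_pullback hΦ hk]
    simp only [pullback_apply]
    simp only [Fin.sum_univ_three]; ring
  have rhs : pullback Φ (lieDerivative Z k) x i j = ∑ a, ∑ b,
      ((∑ d, jac Φ x d i * pd d (fun y => Z y a) (Φ x)) * jac Φ x b j * k (Φ x) a b
        + (∑ d, jac Φ x d j * pd d (fun y => Z y b) (Φ x)) * jac Φ x a i * k (Φ x) a b
        + jac Φ x a i * jac Φ x b j * ∑ d, Z (Φ x) d * pd d (fun y => k y a b) (Φ x)) := by
    simp only [lieDerivative, of_apply, pullback_apply]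
    simp only [Fin.sum_univ_three]; ring
  rw [lhs, rhs]
  simp only [e1, e2]

set_option maxRecDepth 4000 in
/-- The derivative of a family of pullbacks `Φ_ε^* k_ε`, in terms of the vector field `X` with
`dΦ_0 X = ∂_ε Φ_ε`. -/
lemma hasDerivAt_pullback {Φ : ℝ → E3 → E3} {X : E3 → E3} {k : ℝ → TensorField} {x : E3}
    (hΦ : ContDiffAt ℝ 2 (fun z : ℝ × E3 => Φ z.1 z.2) (0, x))
    (hk : ∀ a b, DifferentiableAt ℝ (fun z : ℝ × E3 => k z.1 z.2 a b) (0, Φ 0 x))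
    (hX : DifferentiableAt ℝ X x)
    (h : ∀ᶠ y in 𝓝 x, fderiv ℝ (Φ 0) y (X y) = deriv (fun ε => Φ ε y) 0) (i j : Fin 3) :
    HasDerivAt (fun ε => pullback (Φ ε) (k ε) x i j)
      (pullback (Φ 0) (fun y => Matrix.of fun a b => deriv (fun ε => k ε y a b) 0) x i j
        + lieDerivative X (pullback (Φ 0) (k 0)) x i j) 0 := by
  have hΦ0 : ContDiffAt ℝ 2 (Φ 0) x :=
    hΦ.comp (g := fun z : ℝ × E3 => Φ z.1 z.2) x (f := fun y : E3 => ((0 : ℝ), y))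
      (contDiffAt_const.prodMk contDiffAt_id)
  have hd : DifferentiableAt ℝ (Φ 0) x := hΦ0.differentiableAt (by norm_num)
  have hk0 : ∀ a b, DifferentiableAt ℝ (fun y => k 0 y a b) (Φ 0 x) := fun a b =>
    (hk a b).comp (f := fun y : E3 => ((0 : ℝ), y)) (Φ 0 x) (by fun_prop)
  have hεx : HasDerivAt (fun ε => Φ ε x) (deriv (fun ε => Φ ε x) 0) 0 := by
    have : DifferentiableAt ℝ (fun ε => Φ ε x) 0 :=
      (hΦ.differentiableAt (by norm_num)).comp (f := fun ε : ℝ => (ε, x)) 0 (by fun_prop)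
    exact this.hasDerivAt
  have dJ : ∀ a i, HasDerivAt (fun ε => jac (Φ ε) x a i) (∑ c, (pd c (fun y => jac (Φ 0) y a i) x * X x c
        + jac (Φ 0) x a c * pd i (fun y => X y c) x)) 0 := by
    intro a i
    have h1 := hasDerivAt_fderiv_param hΦ (coordVec i)
    have h2 := hasDerivAt_pi.1
      (((EuclideanSpace.equiv (Fin 3) ℝ : E3 →L[ℝ] (Fin 3 → ℝ)).hasFDerivAt).comp_hasDerivAt 0 h1) a
    have h3 : (fderiv ℝ (fun y => deriv (fun ε => Φ ε y) 0) x (coordVec i)) a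
        = ∑ c, (pd c (fun y => jac (Φ 0) y a i) x * X x c
        + jac (Φ 0) x a c * pd i (fun y => X y c) x) := by
      rw [← pd_related hΦ0 hX h, ← jac_eq_pd]
      · rfl
      · have : DifferentiableAt ℝ (fun y => fderiv ℝ (Φ 0) y (X y)) x :=
          ((hΦ0.fderiv_right (m := 1) (by norm_num)).differentiableAt (by norm_num)).clm_apply hX
        exact this.congr_of_eventuallyEq (h.mono fun y hy => hy.symm)
    rw [← h3]
    exact h2
  have dk : ∀ a b, HasDerivAt (fun ε => k ε (Φ ε x) a b) (deriv (fun ε => k ε (Φ 0 x) a b) 0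
        + ∑ d, (∑ c, jac (Φ 0) x d c * X x c) * pd d (fun y => k 0 y a b) (Φ 0 x)) 0 := by
    intro a b
    have h1 : HasDerivAt (fun ε : ℝ => (ε, Φ ε x)) (1, deriv (fun ε => Φ ε x) 0) 0 :=
      (hasDerivAt_id 0).prodMk hεx
    have h2 := (hk a b).hasFDerivAt.comp_hasDerivAt (0 : ℝ) h1
    refine h2.congr_deriv ?_
    have h3 : ((1 : ℝ), deriv (fun ε => Φ ε x) 0) = (1, 0) + (0, deriv (fun ε => Φ ε x) 0) := by simp
    rw [h3, map_add]
    have h4 : HasFDerivAt (fun ε => k ε (Φ 0 x) a b) _ (0 : ℝ) :=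
      HasFDerivAt.comp (0 : ℝ) (f := fun ε : ℝ => (ε, Φ 0 x)) (hk a b).hasFDerivAt (hasFDerivAt_prodMk_left (0 : ℝ) (Φ 0 x))
    have h5 : HasFDerivAt (fun y => k 0 y a b) _ (Φ 0 x) :=
      (hk a b).hasFDerivAt.comp (Φ 0 x) (hasFDerivAt_prodMk_right (0 : ℝ) (Φ 0 x))
    congr 1
    · rw [h4.hasDerivAt.deriv]; simp
    · have h6 : ∀ d, deriv (fun ε => Φ ε x) 0 d = ∑ c, jac (Φ 0) x d c * X x c := by
        intro d
        rw [← h.self_of_nhds, fderiv_coord hd, fderiv_eq_sum_pd]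
        exact sum_congr rfl fun c _ => by rw [jac_eq_pd hd, mul_comm]
      simp only [← h6]
      rw [← fderiv_eq_sum_pd, h5.fderiv]; simp
  simp only [pullback_apply]
  refine (HasDerivAt.fun_sum fun a _ => HasDerivAt.fun_sum fun b _ =>
    ((dJ a i).fun_mul (dJ b j)).fun_mul (dk a b)).congr_deriv ?_
  simp only [lieDerivative, of_apply, pd_pullback hΦ0 hk0]
  simp only [pullback_apply]
  simp only [Fin.sum_univ_three]; ring

/-! ### Behaviour of the tensor norms under changes of coordinates -/

/-- The Christoffel symbols of the first kind. -/
noncomputable def christoffelLower (g : TensorField) (x : E3) (n l i : Fin 3) : ℝ :=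
  (1 / 2) * (pd l (fun y => g y n i) x + pd i (fun y => g y n l) x - pd n (fun y => g y l i) x)

lemma christoffel_eq (g : TensorField) (x : E3) (m l i : Fin 3) :
    christoffel g x m l i = ∑ n, (g x)⁻¹ m n * christoffelLower g x n l i := by
  simp only [christoffel, christoffelLower, mul_sum]
  exact sum_congr rfl fun _ _ => by ring

set_option maxRecDepth 4000 in
lemma christoffelLower_pullback {Φ : E3 → E3} {g : TensorField} {x : E3}
    (hΦ : ContDiffAt ℝ 2 Φ x) (hg : ∀ a b, DifferentiableAt ℝ (fun y => g y a b) (Φ x))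
    (hsymm : ∀ a b, g (Φ x) a b = g (Φ x) b a) (n l i : Fin 3) :
    christoffelLower (pullback Φ g) x n l i
      = ∑ d, jac Φ x d n * (∑ b, ∑ c, jac Φ x b l * jac Φ x c i * christoffelLower g (Φ x) d b c
        + ∑ a, g (Φ x) d a * pd l (fun y => jac Φ y a i) x) := by
  simp only [christoffelLower, pd_pullback hΦ hg]
  simp only [pd_jac_comm hΦ _ n, pd_jac_comm hΦ _ i l]
  have h01 := hsymm 0 1
  have h02 := hsymm 0 2
  have h12 := hsymm 1 2
  simp only [Fin.sum_univ_three, h01, h02, h12]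
  ring

/-- `J (Jᵀ A J)⁻¹ Jᵀ = A⁻¹`. -/
lemma mul_inv_mul_transpose {J A : Matrix (Fin 3) (Fin 3) ℝ} (hJ : J.det ≠ 0) :
    J * (J.transpose * A * J)⁻¹ * J.transpose = A⁻¹ := by
  have h1 : IsUnit J.det := isUnit_iff_ne_zero.2 hJ
  have h2 : IsUnit J.transpose.det := by rwa [Matrix.det_transpose]
  rw [Matrix.mul_inv_rev, Matrix.mul_inv_rev, ← Matrix.mul_assoc, Matrix.mul_nonsing_inv _ h1,
    Matrix.one_mul, Matrix.mul_assoc, Matrix.nonsing_inv_mul _ h2, Matrix.mul_one]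

/-- The transformation law of the Christoffel symbols. -/
lemma christoffel_pullback {Φ : E3 → E3} {g : TensorField} {x : E3}
    (hΦ : ContDiffAt ℝ 2 Φ x) (hg : ∀ a b, DifferentiableAt ℝ (fun y => g y a b) (Φ x))
    (hsymm : ∀ a b, g (Φ x) a b = g (Φ x) b a) (hJ : (jac Φ x).det ≠ 0)
    (hdet : (g (Φ x)).det ≠ 0) (a l i : Fin 3) :
    ∑ m, jac Φ x a m * christoffel (pullback Φ g) x m l i
      = ∑ b, ∑ c, jac Φ x b l * jac Φ x c i * christoffel g (Φ x) a b c + pd l (fun y => jac Φ y a i) x := by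
  set v : Fin 3 → ℝ := fun d => ∑ b, ∑ c, jac Φ x b l * jac Φ x c i * christoffelLower g (Φ x) d b c
        + ∑ a, g (Φ x) d a * pd l (fun y => jac Φ y a i) x with hv
  have h1 : ∑ m, jac Φ x a m * christoffel (pullback Φ g) x m l i
      = ((jac Φ x * (pullback Φ g x)⁻¹ * (jac Φ x).transpose).mulVec v) a := by
    simp only [christoffel_eq, christoffelLower_pullback hΦ hg hsymm]
    simp only [← Matrix.mulVec_mulVec]
    rfl
  rw [h1, pullback_eq_mul, mul_inv_mul_transpose hJ]
  have h2 : v = (fun d => ∑ b, ∑ c, jac Φ x b l * jac Φ x c i * christoffelLower g (Φ x) d b c)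
      + (g (Φ x)).mulVec (fun a => pd l (fun y => jac Φ y a i) x) := rfl
  rw [h2, Matrix.mulVec_add, Matrix.mulVec_mulVec,
    Matrix.nonsing_inv_mul _ (isUnit_iff_ne_zero.2 hdet), Matrix.one_mulVec]
  simp only [Pi.add_apply, Matrix.mulVec, dotProduct, christoffel_eq]
  congr 1
  simp only [Fin.sum_univ_three]; ring

set_option maxRecDepth 8000 in
set_option maxHeartbeats 1000000 in
/-- The covariant derivative is a tensor. -/
lemma covDeriv_pullback {Φ : E3 → E3} {g k : TensorField} {x : E3}
    (hΦ : ContDiffAt ℝ 2 Φ x) (hg : ∀ a b, DifferentiableAt ℝ (fun y => g y a b) (Φ x))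
    (hk : ∀ a b, DifferentiableAt ℝ (fun y => k y a b) (Φ x))
    (hsymm : ∀ a b, g (Φ x) a b = g (Φ x) b a) (hJ : (jac Φ x).det ≠ 0)
    (hdet : (g (Φ x)).det ≠ 0) (l i j : Fin 3) :
    covDeriv (pullback Φ g) (pullback Φ k) x l i j
      = ∑ c, ∑ a, ∑ b, jac Φ x c l * jac Φ x a i * jac Φ x b j * covDeriv g k (Φ x) c a b := by
  have h1 : ∀ i j, ∑ m, christoffel (pullback Φ g) x m l i * pullback Φ k x m j
      = ∑ a, ∑ b, (∑ b, ∑ c, jac Φ x b l * jac Φ x c i * christoffel g (Φ x) a b c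
        + pd l (fun y => jac Φ y a i) x) * (jac Φ x b j * k (Φ x) a b) := by
    intro i j
    simp only [← christoffel_pullback hΦ hg hsymm hJ hdet, pullback_apply]
    simp only [Fin.sum_univ_three]; ring
  have h2 : ∀ i j, ∑ m, christoffel (pullback Φ g) x m l j * pullback Φ k x i m
      = ∑ a, ∑ b, (∑ c, ∑ d, jac Φ x c l * jac Φ x d j * christoffel g (Φ x) b c d
        + pd l (fun y => jac Φ y b j) x) * (jac Φ x a i * k (Φ x) a b) := by
    intro i j
    simp only [← christoffel_pullback hΦ hg hsymm hJ hdet, pullback_apply]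
    simp only [Fin.sum_univ_three]; ring
  rw [covDeriv, h1, h2, pd_pullback hΦ hk]
  simp only [covDeriv]
  generalize christoffel g (Φ x) = Γ
  generalize k (Φ x) = K
  simp only [← Finset.sum_sub_distrib]
  have : ∀ a b : Fin 3, (pd l (fun y => jac Φ y a i) x * jac Φ x b j * K a b +
        jac Φ x a i * pd l (fun y => jac Φ y b j) x * K a b +
        jac Φ x a i * jac Φ x b j * ∑ d, jac Φ x d l * pd d (fun y => k y a b) (Φ x)) -
      (∑ b, ∑ c, jac Φ x b l * jac Φ x c i * Γ a b c + pd l (fun y => jac Φ y a i) x) * (jac Φ x b j * K a b) -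
      (∑ c, ∑ d, jac Φ x c l * jac Φ x d j * Γ b c d + pd l (fun y => jac Φ y b j) x) * (jac Φ x a i * K a b) =
      ∑ c, jac Φ x c l * (jac Φ x a i * jac Φ x b j * pd c (fun y => k y a b) (Φ x)
        - ∑ d, jac Φ x d i * Γ a c d * jac Φ x b j * K a b
        - ∑ d, jac Φ x d j * Γ b c d * jac Φ x a i * K a b) := by
    intro a b
    simp only [Fin.sum_univ_three]; ring
  simp only [this]
  rw [sum_congr rfl fun a _ => sum_comm, sum_comm]
  refine sum_congr rfl fun c _ => ?_
  simp only [Fin.sum_univ_three]; ring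

/-- Contraction of one index with the inverse metric is independent of the coordinates. -/
lemma contract_pullback {J A : Matrix (Fin 3) (Fin 3) ℝ} (hJ : J.det ≠ 0) (u v : Fin 3 → ℝ) :
    ∑ l, ∑ l', (J.transpose * A * J)⁻¹ l l' * (∑ a, J a l * u a) * (∑ b, J b l' * v b)
      = ∑ a, ∑ b, A⁻¹ a b * u a * v b := by
  rw [← mul_inv_mul_transpose (A := A) hJ]
  generalize (J.transpose * A * J)⁻¹ = B
  simp only [Matrix.mul_apply, Matrix.transpose_apply]
  simp only [Fin.sum_univ_three]; ring

lemma contract_comm (C D : Matrix (Fin 3) (Fin 3) ℝ) (F : Fin 3 → Fin 3 → Fin 3 → Fin 3 → ℝ) :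
    ∑ i, ∑ i', C i i' * ∑ b, ∑ b', D b b' * F i i' b b' = ∑ b, ∑ b', D b b' * ∑ i, ∑ i', C i i' * F i i' b b' := by
  simp only [mul_sum]
  rw [sum_congr rfl fun i _ => sum_comm, sum_comm]
  refine sum_congr rfl fun b _ => ?_
  rw [sum_congr rfl fun i _ => sum_comm, sum_comm]
  exact sum_congr rfl fun b _ => sum_congr rfl fun _ _ =>
    sum_congr rfl fun _ _ => by ring

lemma normSqTensor_pullback {Φ : E3 → E3} {g k : TensorField} {x : E3} (hJ : (jac Φ x).det ≠ 0) :
    normSqTensor (pullback Φ g) (pullback Φ k) x = normSqTensor g k (Φ x) := by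
  simp only [normSqTensor, pullback_apply Φ k, pullback_eq_mul Φ g]
  set J := jac Φ x
  set A := g (Φ x)
  set B := (J.transpose * A * J)⁻¹
  set K := k (Φ x)
  have h1 : ∀ i i', ∑ j, ∑ j', B j j' * (∑ b, J b j * ∑ a, J a i * K a b) * (∑ b, J b j' * ∑ a, J a i' * K a b)
      = ∑ b, ∑ b', A⁻¹ b b' * (∑ a, J a i * K a b) * (∑ a, J a i' * K a b') :=
    fun i i' => contract_pullback hJ _ _
  have h2 : ∀ b b', ∑ i, ∑ i', B i i' * (∑ a, J a i * K a b) * (∑ a, J a i' * K a b')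
      = ∑ a, ∑ a', A⁻¹ a a' * K a b * K a' b' :=
    fun b b' => contract_pullback hJ _ _
  have e : ∀ i j, ∑ a, ∑ b, J a i * J b j * K a b = ∑ b, J b j * ∑ a, J a i * K a b := by
    intro i j
    simp only [Fin.sum_univ_three]; ring
  calc _ = ∑ i, ∑ i', B i i' * ∑ j, ∑ j', B j j' * (∑ b, J b j * ∑ a, J a i * K a b)
        * (∑ b, J b j' * ∑ a, J a i' * K a b) := by
        simp only [e]
        simp only [mul_assoc, ← mul_sum]
        exact sum_congr rfl fun i _ => by rw [sum_comm]; simp only [← mul_sum]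
    _ = ∑ b, ∑ b', A⁻¹ b b' * ∑ i, ∑ i', B i i' * (∑ a, J a i * K a b) * (∑ a, J a i' * K a b') := by
        simp only [h1]
        simp only [mul_assoc]
        rw [contract_comm B A⁻¹]
    _ = _ := by
        simp only [h2]
        simp only [Fin.sum_univ_three]; ring

/-- `|T|²` for a covariant 3-tensor `T`, with the inverse metric `B`. -/
noncomputable def normSqThree (B : Matrix (Fin 3) (Fin 3) ℝ) (T : Fin 3 → Fin 3 → Fin 3 → ℝ) : ℝ :=
  ∑ l, ∑ l', B l l' * ∑ i, ∑ i', B i i' * ∑ j, ∑ j', B j j' * T l i j * T l' i' j'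

lemma normSqCovDeriv_eq (g k : TensorField) (x : E3) : normSqCovDeriv g k x = normSqThree (g x)⁻¹ (covDeriv g k x) := by
  simp only [normSqCovDeriv, normSqThree, mul_sum]
  refine sum_congr rfl fun l _ => ?_
  have : ∀ F : Fin 3 → Fin 3 → Fin 3 → Fin 3 → Fin 3 → ℝ,
      ∑ i, ∑ j, ∑ l', ∑ i', ∑ j', F i j l' i' j' = ∑ l', ∑ i, ∑ i', ∑ j, ∑ j', F i j l' i' j' := by
    intro F
    rw [sum_congr rfl fun i _ => sum_comm, sum_comm]
    refine sum_congr rfl fun l' _ => sum_congr rfl fun i _ => ?_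
    rw [sum_comm]
  rw [this]
  refine sum_congr rfl fun _ _ => sum_congr rfl fun _ _ =>
    sum_congr rfl fun _ _ => sum_congr rfl fun _ _ =>
    sum_congr rfl fun _ _ => by ring

/-- The norm of a covariant 3-tensor is independent of the coordinates. -/
lemma normSqThree_pullback {J A : Matrix (Fin 3) (Fin 3) ℝ} (hJ : J.det ≠ 0) (T : Fin 3 → Fin 3 → Fin 3 → ℝ) :
    normSqThree (J.transpose * A * J)⁻¹
      (fun l i j => ∑ c, ∑ a, ∑ b, J c l * J a i * J b j * T c a b) = normSqThree A⁻¹ T := by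
  set B := (J.transpose * A * J)⁻¹
  have e : ∀ l i j, ∑ c, ∑ a, ∑ b, J c l * J a i * J b j * T c a b
      = ∑ b, J b j * ∑ a, J a i * ∑ c, J c l * T c a b := by
    intro l i j
    simp only [Fin.sum_univ_three]; ring
  have h1 : ∀ l l' i i', ∑ j, ∑ j', B j j' * (∑ b, J b j * ∑ a, J a i * ∑ c, J c l * T c a b)
      * (∑ b, J b j' * ∑ a, J a i' * ∑ c, J c l' * T c a b)
      = ∑ b, ∑ b', A⁻¹ b b' * (∑ a, J a i * ∑ c, J c l * T c a b) * (∑ a, J a i' * ∑ c, J c l' * T c a b') :=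
    fun l l' i i' => contract_pullback hJ _ _
  have h2 : ∀ l l' b b', ∑ i, ∑ i', B i i' * (∑ a, J a i * ∑ c, J c l * T c a b)
      * (∑ a, J a i' * ∑ c, J c l' * T c a b')
      = ∑ a, ∑ a', A⁻¹ a a' * (∑ c, J c l * T c a b) * (∑ c, J c l' * T c a' b') :=
    fun l l' b b' => contract_pullback hJ _ _
  have h3 : ∀ a a' b b', ∑ l, ∑ l', B l l' * (∑ c, J c l * T c a b) * (∑ c, J c l' * T c a' b')
      = ∑ c, ∑ c', A⁻¹ c c' * T c a b * T c' a' b' :=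
    fun a a' b b' => contract_pullback hJ _ _
  simp only [normSqThree, e, h1]
  simp only [mul_assoc] at h2 h3 ⊢
  simp only [contract_comm B A⁻¹]
  simp only [h2]
  simp only [contract_comm B A⁻¹, h3]
  rw [sum_congr rfl fun b _ => sum_congr rfl fun b' _ =>
    congrArg _ (contract_comm A⁻¹ A⁻¹ fun a a' c c' => T c a b * T c' a' b'), contract_comm]
  refine sum_congr rfl fun _ _ => sum_congr rfl fun _ _ => congrArg _ ?_
  rw [contract_comm]

lemma normSqCovDeriv_pullback {Φ : E3 → E3} {g k : TensorField} {x : E3}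
    (hΦ : ContDiffAt ℝ 2 Φ x) (hg : ∀ a b, DifferentiableAt ℝ (fun y => g y a b) (Φ x))
    (hk : ∀ a b, DifferentiableAt ℝ (fun y => k y a b) (Φ x))
    (hsymm : ∀ a b, g (Φ x) a b = g (Φ x) b a) (hJ : (jac Φ x).det ≠ 0)
    (hdet : (g (Φ x)).det ≠ 0) :
    normSqCovDeriv (pullback Φ g) (pullback Φ k) x = normSqCovDeriv g k (Φ x) := by
  have : covDeriv (pullback Φ g) (pullback Φ k) x = fun l i j => ∑ c, ∑ a, ∑ b,
      jac Φ x c l * jac Φ x a i * jac Φ x b j * covDeriv g k (Φ x) c a b := by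
    ext l i j
    exact covDeriv_pullback hΦ hg hk hsymm hJ hdet l i j
  rw [normSqCovDeriv_eq, normSqCovDeriv_eq, this, pullback_eq_mul, normSqThree_pullback hJ]

lemma volDensity_pullback (Φ : E3 → E3) (g : TensorField) (x : E3) :
    volDensity (pullback Φ g) x = |(jac Φ x).det| * volDensity g (Φ x) := by
  rw [volDensity, volDensity, pullback_eq_mul, Matrix.det_mul, Matrix.det_mul,
    Matrix.det_transpose, show ∀ a b : ℝ, a * b * a = a ^ 2 * b by intros; ring,
    sqrt_mul (sq_nonneg _), sqrt_sq_eq_abs]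

lemma det_fderiv_eq (Φ : E3 → E3) (x : E3) : (fderiv ℝ Φ x).det = (jac Φ x).det := by
  have : jac Φ x = LinearMap.toMatrix (EuclideanSpace.basisFun (Fin 3) ℝ).toBasis
      (EuclideanSpace.basisFun (Fin 3) ℝ).toBasis (fderiv ℝ Φ x : E3 →ₗ[ℝ] E3) := by
    ext a i
    simp [jac, LinearMap.toMatrix_apply, coordVec]
  rw [this, LinearMap.det_toMatrix]

/-! ### Diagonal metrics -/

lemma inv_diagonal (d : Fin 3 → ℝ) (hd : ∀ i, d i ≠ 0) : (diagonal d)⁻¹ = diagonal fun i => (d i)⁻¹ := by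
  refine Matrix.inv_eq_right_inv ?_
  rw [Matrix.diagonal_mul_diagonal, ← Matrix.diagonal_one]
  congr 1
  ext i
  exact mul_inv_cancel₀ (hd i)

lemma normSqTensor_diagonal {g k : TensorField} {x : E3} {d : Fin 3 → ℝ} (hg : g x = diagonal d) (hd : ∀ i, d i ≠ 0) :
    normSqTensor g k x = ∑ i, ∑ j, k x i j ^ 2 / (d i * d j) := by
  simp only [normSqTensor, hg, inv_diagonal d hd, Matrix.diagonal_apply]
  simp
  exact sum_congr rfl fun i _ => sum_congr rfl fun j _ => by
    have := hd i; have := hd j; field_simp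

lemma normSqCovDeriv_diagonal {g k : TensorField} {x : E3} {d : Fin 3 → ℝ} (hg : g x = diagonal d) (hd : ∀ i, d i ≠ 0) :
    normSqCovDeriv g k x = ∑ l, ∑ i, ∑ j, covDeriv g k x l i j ^ 2 / (d l * d i * d j) := by
  simp only [normSqCovDeriv, hg, inv_diagonal d hd, Matrix.diagonal_apply]
  simp
  exact sum_congr rfl fun l _ => sum_congr rfl fun i _ =>
    sum_congr rfl fun j _ => by
    have := hd i; have := hd j; have := hd l; field_simp

lemma christoffel_diagonal {g : TensorField} {x : E3} {d : Fin 3 → ℝ}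
    (hg : g x = diagonal d) (hd : ∀ i, d i ≠ 0) (m l i : Fin 3) :
    christoffel g x m l i = (d m)⁻¹ * christoffelLower g x m l i := by
  rw [christoffel_eq, hg, inv_diagonal d hd]
  simp [Matrix.diagonal_apply]

/-! ### The functions `sn_κ` and `cs_κ` -/

lemma hasDerivAt_sn (κ t : ℝ) : HasDerivAt (sn κ) (cs κ t) t := by
  unfold sn cs
  split_ifs with h0 h1
  · exact hasDerivAt_id t
  · have hs : √κ ≠ 0 := (sqrt_pos_of_pos h1).ne'
    have := ((hasDerivAt_sin (√κ * t)).comp t ((hasDerivAt_id t).const_mul √κ)).div_const √κ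
    refine this.congr_deriv ?_
    simp; field_simp
  · have h2 : 0 < -κ := by have := lt_of_le_of_ne (not_lt.1 h1) h0; linarith
    have hs : √(-κ) ≠ 0 := (sqrt_pos_of_pos h2).ne'
    have := ((hasDerivAt_sinh (√(-κ) * t)).comp t ((hasDerivAt_id t).const_mul √(-κ))).div_const √(-κ)
    refine this.congr_deriv ?_
    simp; field_simp

lemma hasDerivAt_cs (κ t : ℝ) : HasDerivAt (cs κ) (-κ * sn κ t) t := by
  unfold sn cs
  split_ifs with h0 h1
  · simpa [h0] using hasDerivAt_const t (1 : ℝ)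
  · have hs : √κ ≠ 0 := (sqrt_pos_of_pos h1).ne'
    have := ((hasDerivAt_cos (√κ * t)).comp t ((hasDerivAt_id t).const_mul √κ))
    refine this.congr_deriv ?_
    have h2 : √κ ^ 2 = κ := sq_sqrt h1.le
    simp; field_simp; rw [h2]; ring
  · have h2 : 0 < -κ := by have := lt_of_le_of_ne (not_lt.1 h1) h0; linarith
    have hs : √(-κ) ≠ 0 := (sqrt_pos_of_pos h2).ne'
    have := ((hasDerivAt_cosh (√(-κ) * t)).comp t ((hasDerivAt_id t).const_mul √(-κ)))
    refine this.congr_deriv ?_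
    have h2 : √(-κ) ^ 2 = -κ := sq_sqrt h2.le
    simp; field_simp; rw [h2]; ring

lemma deriv_sn (κ : ℝ) : deriv (sn κ) = cs κ := funext fun t => (hasDerivAt_sn κ t).deriv

lemma contDiff_sn (κ : ℝ) {n : WithTop ℕ∞} : ContDiff ℝ n (sn κ) := by
  unfold sn
  split_ifs
  · exact contDiff_id
  · exact (contDiff_sin.comp (contDiff_const.mul contDiff_id)).div_const _
  · exact (contDiff_sinh.comp (contDiff_const.mul contDiff_id)).div_const _

lemma contDiff_cs (κ : ℝ) {n : WithTop ℕ∞} : ContDiff ℝ n (cs κ) := by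
  unfold cs
  split_ifs
  · exact contDiff_const
  · exact contDiff_cos.comp (contDiff_const.mul contDiff_id)
  · exact contDiff_cosh.comp (contDiff_const.mul contDiff_id)

lemma sn_zero (κ : ℝ) : sn κ 0 = 0 := by unfold sn; split_ifs <;> simp

lemma cs_zero (κ : ℝ) : cs κ 0 = 1 := by unfold cs; split_ifs <;> simp

lemma cs_sq (κ t : ℝ) : cs κ t ^ 2 = 1 - κ * sn κ t ^ 2 := by
  unfold sn cs
  split_ifs with h0 h1
  · simp [h0]
  · have hs : √κ ≠ 0 := (sqrt_pos_of_pos h1).ne'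
    have h2 : √κ ^ 2 = κ := sq_sqrt h1.le
    rw [div_pow, h2, cos_sq']; field_simp
  · have h2 : 0 < -κ := by have := lt_of_le_of_ne (not_lt.1 h1) h0; linarith
    have h3 : √(-κ) ^ 2 = -κ := sq_sqrt h2.le
    rw [div_pow, h3, cosh_sq]; field_simp; ring

/-- `t` lies in the interval `[0, π / (2 √κ))`, on which `sn_κ` is increasing. -/
def InRange (κ t : ℝ) : Prop := 0 ≤ t ∧ (0 < κ → t < π / (2 * √κ))

lemma InRange.sqrt_mul_lt {κ t : ℝ} (h : InRange κ t) (hκ : 0 < κ) : √κ * t < π / 2 := by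
  have hs := sqrt_pos_of_pos hκ
  have := h.2 hκ
  rw [lt_div_iff₀ (by positivity)] at this
  linarith

lemma cs_pos {κ t : ℝ} (h : InRange κ t) : 0 < cs κ t := by
  unfold cs
  split_ifs with h0 h1
  · norm_num
  · have := mul_nonneg (sqrt_pos_of_pos h1).le h.1
    exact cos_pos_of_mem_Ioo ⟨by linarith [pi_pos], h.sqrt_mul_lt h1⟩
  · exact cosh_pos _

lemma InRange.mono {κ s t : ℝ} (h : InRange κ t) (h0 : 0 ≤ s) (hs : s ≤ t) : InRange κ s :=
  ⟨h0, fun hκ => hs.trans_lt (h.2 hκ)⟩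

lemma sn_lt_sn {κ s t : ℝ} (h0 : 0 ≤ s) (hst : s < t) (h : InRange κ t) : sn κ s < sn κ t := by
  have : StrictMonoOn (sn κ) (Icc 0 t) := by
    refine strictMonoOn_of_deriv_pos (convex_Icc 0 t) (contDiff_sn κ (n := 0)).continuous.continuousOn ?_
    intro x hx
    rw [interior_Icc] at hx
    rw [deriv_sn]
    exact cs_pos (h.mono hx.1.le hx.2.le)
  exact this ⟨h0, hst.le⟩ ⟨h0.trans hst.le, le_rfl⟩ hst

lemma sn_pos {κ t : ℝ} (h0 : 0 < t) (h : InRange κ t) : 0 < sn κ t := by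
  simpa [sn_zero] using sn_lt_sn le_rfl h0 h

lemma sn_le_sn {κ s t : ℝ} (h0 : 0 ≤ s) (hst : s ≤ t) (h : InRange κ t) : sn κ s ≤ sn κ t := by
  rcases hst.eq_or_lt with rfl | h1
  · exact le_rfl
  · exact (sn_lt_sn h0 h1 h).le

lemma sn_arcsn {κ z : ℝ} (hz : κ * z ^ 2 ≤ 1) : sn κ (arcsn κ z) = z := by
  unfold sn arcsn
  split_ifs with h0 h1
  · rfl
  · have hs := sqrt_pos_of_pos h1
    have h2 : |√κ * z| ≤ 1 := by
      rw [← sq_le_one_iff_abs_le_one, mul_pow, sq_sqrt h1.le]; exact hz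
    have := abs_le.1 h2
    rw [mul_div_cancel₀ _ hs.ne', sin_arcsin this.1 this.2]
    field_simp
  · have h2 : 0 < -κ := by have := lt_of_le_of_ne (not_lt.1 h1) h0; linarith
    have hs := sqrt_pos_of_pos h2
    rw [mul_div_cancel₀ _ hs.ne', sinh_arsinh]
    field_simp

lemma arcsn_nonneg {κ z : ℝ} (hz : 0 ≤ z) : 0 ≤ arcsn κ z := by
  unfold arcsn
  split_ifs with h0 h1
  · exact hz
  · exact div_nonneg (arcsin_nonneg.2 (by positivity)) (by positivity)
  · exact div_nonneg (arsinh_nonneg_iff.2 (by positivity)) (by positivity)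

lemma differentiableAt_arcsn {κ z : ℝ} (hz : κ * z ^ 2 < 1) : DifferentiableAt ℝ (arcsn κ) z := by
  unfold arcsn
  split_ifs with h0 h1
  · exact differentiableAt_id
  · have hs := sqrt_pos_of_pos h1
    have h2 : |√κ * z| < 1 := by
      rw [← sq_lt_one_iff_abs_lt_one, mul_pow, sq_sqrt h1.le]; exact hz
    have := abs_lt.1 h2
    refine DifferentiableAt.div_const ?_ _
    exact (differentiableAt_arcsin.2 ⟨this.1.ne', this.2.ne⟩).comp z (differentiableAt_id.const_mul _)
  · refine DifferentiableAt.div_const ?_ _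
    exact (differentiable_arsinh _).comp z (differentiableAt_id.const_mul _)

/-! ### Smooth families of functions of one variable -/

/-- Hadamard's lemma with parameters: `Φ(x, y) = Φ(0, y) + x R(x, y)` with `R` smooth, namely
`R(x, y) = ∫_0^1 ∂_xΦ(σ x, y) dσ`. -/
lemma exists_hadamard {Y : Type*} [NormedAddCommGroup Y] [NormedSpace ℝ Y] {δ : ℝ} {W : Set Y}
    (hW : IsOpen W) {Φ : ℝ × Y → ℝ} (hΦ : ContDiffOn ℝ ∞ Φ (Ioo (-δ) δ ×ˢ W)) :
    ∃ R : ℝ × Y → ℝ, ContDiffOn ℝ ∞ R (Ioo (-δ) δ ×ˢ W) ∧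
      ∀ x ∈ Ioo (-δ) δ, ∀ y ∈ W, Φ (x, y) = Φ (0, y) + x * R (x, y) := by
  have hopen : IsOpen (Ioo (-δ) δ ×ˢ W) := isOpen_Ioo.prod hW
  set Ψ : ℝ × Y → ℝ := fun z => fderiv ℝ Φ z (1, 0) with hΨ
  have hΨs : ContDiffOn ℝ ∞ Ψ (Ioo (-δ) δ ×ˢ W) :=
    (hΦ.fderiv_of_isOpen hopen (by simp)).clm_apply contDiffOn_const
  refine ⟨fun z => ∫ σ in (0 : ℝ)..1, Ψ (σ * z.1, z.2), ?_, ?_⟩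
  · rintro ⟨x₀, y₀⟩ ⟨hx₀, hy₀⟩
    simp only at hx₀ hy₀
    -- a margin `η` such that `σ x` stays in the interval for `σ ∈ (-η, 1 + η)`
    obtain ⟨η, hη, hη'⟩ : ∃ η > 0, |x₀| * (1 + η) < δ := by
      have h1 : |x₀| < δ := abs_lt.2 hx₀
      have h2 : Tendsto (fun η : ℝ => |x₀| * (1 + η)) (𝓝[>] 0) (𝓝 (|x₀| * (1 + 0))) :=
        ((continuous_const.mul (continuous_const.add continuous_id)).tendsto 0).mono_left nhdsWithin_le_nhds
      have h3 := (h2.eventually (gt_mem_nhds (by simpa using h1))).and self_mem_nhdsWithin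
      obtain ⟨η, h4, h5⟩ := h3.exists
      exact ⟨η, h5, h4⟩
    set s : Set (ℝ × Y) := {z | |z.1| * (1 + η) < δ ∧ z.2 ∈ W} with hs
    have hso : IsOpen s := by
      refine IsOpen.inter (isOpen_lt (f := fun z : ℝ × Y => |z.1| * (1 + η)) (by fun_prop) continuous_const) (hW.preimage continuous_snd)
    set ψ : ContDiffBump (-1 / 2 : ℝ) := ⟨1 / 2, 1 / 2 + η / 2, by norm_num, by linarith⟩ with hψ
    set g : ℝ × Y → ℝ → ℝ := fun p t => ψ t * Ψ (-t * p.1, p.2) with hg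
    have hmem : ∀ p ∈ s, ∀ t : ℝ, t ∈ Ioo (-1 - η) η → (-t * p.1, p.2) ∈ Ioo (-δ) δ ×ˢ W := by
      rintro ⟨x, y⟩ ⟨h1, h2⟩ t ht
      refine ⟨abs_lt.1 (?_ : |-t * x| < δ), h2⟩
      rw [abs_mul, abs_neg]
      have : |t| ≤ 1 + η := abs_le.2 ⟨by linarith [ht.1], by linarith [ht.2]⟩
      calc |t| * |x| ≤ (1 + η) * |x| := by gcongr
        _ < δ := by rw [mul_comm]; exact h1
    have hgs : ContDiffOn ℝ ∞ (Function.uncurry g) (s ×ˢ univ) := by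
      rintro ⟨p, t⟩ ⟨hp, -⟩
      by_cases ht : t ∈ Ioo (-1 - η) η
      · refine ContDiffAt.contDiffWithinAt ?_
        have h1 : ContDiffAt ℝ ∞ (fun w : (ℝ × Y) × ℝ => Ψ (-w.2 * w.1.1, w.1.2)) (p, t) := by
          refine ContDiffAt.comp (p, t) (g := Ψ) (f := fun w : (ℝ × Y) × ℝ => (-w.2 * w.1.1, w.1.2)) ?_ (by fun_prop)
          exact hΨs.contDiffAt (hopen.mem_nhds (hmem p hp t ht))
        exact (ψ.contDiff.contDiffAt.comp (p, t) contDiffAt_snd).mul h1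
      · -- outside of the support of the bump function
        have h0 : ∀ᶠ w : (ℝ × Y) × ℝ in 𝓝 (p, t), Function.uncurry g w = 0 := by
          have : {t : ℝ | dist t (-1 / 2) > 1 / 2 + η / 2} ∈ 𝓝 t := by
            refine (isOpen_lt continuous_const (by fun_prop)).mem_nhds ?_
            simp only [mem_ofPred_eq, dist_eq]
            by_contra hcon
            have h4 := abs_le.1 (not_lt.1 hcon)
            exact ht ⟨by linarith, by linarith⟩
          filter_upwards [continuous_snd.tendsto (p, t) this] with w hw
          have : ψ w.2 = 0 := ψ.zero_of_le_dist (le_of_lt hw)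
          simp [Function.uncurry, hg, this]
        exact (contDiffAt_const (c := (0 : ℝ)).congr_of_eventuallyEq h0).contDiffWithinAt
    have hloc : LocallyIntegrable (indicator (Icc (0 : ℝ) 1) fun _ => (1 : ℝ)) volume :=
      (integrable_indicator_iff measurableSet_Icc |>.2 (integrableOn_const (by simp))).locallyIntegrable
    have hconv := contDiffOn_convolution_right_with_param (n := ⊤) (μ := volume)
      (ContinuousLinearMap.mul ℝ ℝ) (g := g) (s := s) (k := Metric.closedBall (-1 / 2 : ℝ) (1 / 2 + η / 2)) hso
      (isCompact_closedBall _ _) (fun p x hp hx => ?_) hloc hgs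
    · have h1 : ContDiffAt ℝ ∞ (fun p : ℝ × Y => MeasureTheory.convolution
          (indicator (Icc (0 : ℝ) 1) fun _ => (1 : ℝ)) (g p) (ContinuousLinearMap.mul ℝ ℝ) volume 0)
          (x₀, y₀) := by
        have h2 := hconv.contDiffAt (x := ((x₀, y₀), 0)) ((hso.prod isOpen_univ).mem_nhds ⟨⟨hη', hy₀⟩, mem_univ _⟩)
        exact h2.comp (x₀, y₀) (f := fun p : ℝ × Y => (p, (0 : ℝ))) (by fun_prop)
      refine (h1.congr_of_eventuallyEq (Eventually.of_forall fun p => ?_)).contDiffWithinAt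
      simp only [MeasureTheory.convolution, ContinuousLinearMap.mul_apply', zero_sub]
      show _ = _
      rw [intervalIntegral.integral_of_le zero_le_one, ← integral_Icc_eq_integral_Ioc,
        ← integral_indicator measurableSet_Icc]
      refine integral_congr_ae (Eventually.of_forall fun t => ?_)
      by_cases ht : t ∈ Icc (0 : ℝ) 1
      · have : ψ (-t) = 1 := by
          refine ψ.one_of_mem_closedBall ?_
          simp only [hψ, Metric.mem_closedBall, dist_eq]
          exact abs_le.2 ⟨by linarith [ht.2], by linarith [ht.1]⟩
        simp [ht, hg, this]
      · simp [ht]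
    · have : ψ x = 0 := ψ.zero_of_le_dist (by
        simp only [Metric.mem_closedBall, not_le] at hx; exact hx.le)
      simp [hg, this]
  · intro x hx y hy
    have hδ : 0 < δ := by linarith [hx.1, hx.2]
    have hmem : ∀ σ ∈ Icc (0 : ℝ) 1, (σ * x, y) ∈ Ioo (-δ) δ ×ˢ W := by
      intro σ hσ
      refine ⟨abs_lt.1 (?_ : |σ * x| < δ), hy⟩
      rw [abs_mul, abs_of_nonneg hσ.1]
      calc σ * |x| ≤ 1 * |x| := by gcongr; exact hσ.2
        _ < δ := by rw [one_mul]; exact abs_lt.2 hx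
    have hder : ∀ σ ∈ uIcc (0 : ℝ) 1, HasDerivAt (fun σ : ℝ => Φ (σ * x, y)) (x * Ψ (σ * x, y)) σ := by
      intro σ hσ
      rw [uIcc_of_le zero_le_one] at hσ
      have h1 : HasFDerivAt Φ (fderiv ℝ Φ (σ * x, y)) (σ * x, y) :=
        ((hΦ.contDiffAt (hopen.mem_nhds (hmem σ hσ))).differentiableAt (by simp)).hasFDerivAt
      have h2 : HasDerivAt (fun σ : ℝ => (σ * x, y)) (x, 0) σ := by
        simpa using ((hasDerivAt_id σ).mul_const x).prodMk (hasDerivAt_const σ y)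
      refine (h1.comp_hasDerivAt σ h2).congr_deriv ?_
      have : (x, (0 : Y)) = x • ((1 : ℝ), (0 : Y)) := by simp
      rw [this, map_smul]; rfl
    have hcont : ContinuousOn (fun σ : ℝ => x * Ψ (σ * x, y)) (uIcc 0 1) := by
      rw [uIcc_of_le zero_le_one]
      refine continuousOn_const.mul (hΨs.continuousOn.comp (by fun_prop) fun σ hσ => hmem σ hσ)
    have := intervalIntegral.integral_eq_sub_of_hasDerivAt hder hcont.intervalIntegrable
    simp only [one_mul, zero_mul] at this
    rw [intervalIntegral.integral_const_mul] at this
    simp only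
    linarith

/-! ### Asymptotic expansions -/

lemma natCast_le_infty (n : ℕ) : (n : WithTop ℕ∞) ≤ ∞ := by exact_mod_cast le_top

section Phg

variable {X : Type*} [NormedAddCommGroup X] [NormedSpace ℝ X]
  {F : Type*} [NormedAddCommGroup F] [NormedSpace ℝ F] {Y : Type*} [NormedAddCommGroup Y] [NormedSpace ℝ Y] {O : Set X}

/-- `u (t, z)` is smooth for `t` near `-∞`, and `O(exp (N t))` with all its derivatives, locally
uniformly in `z ∈ O`. -/
def IsExpBounded (O : Set X) (N : ℝ) (u : ℝ × X → F) : Prop :=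
  (∃ T, ContDiffOn ℝ ∞ u (Iio T ×ˢ O)) ∧
  ∀ (n : ℕ) (K : Set X), IsCompact K → K ⊆ O → ∃ C T : ℝ, ∀ t ≤ T, ∀ z ∈ K,
    ‖iteratedFDeriv ℝ n u (t, z)‖ ≤ C * exp (N * t)

lemma exists_le_nat_iteratedFDeriv {N : ℝ} {u : ℝ × X → F} (h : IsExpBounded O N u)
    (n : ℕ) {K : Set X} (hK : IsCompact K) (hKO : K ⊆ O) :
    ∃ C T : ℝ, 0 ≤ C ∧ ∀ i ≤ n, ∀ t ≤ T, ∀ z ∈ K, ‖iteratedFDeriv ℝ i u (t, z)‖ ≤ C * exp (N * t) := by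
  choose C T hCT using fun i => h.2 i K hK hKO
  refine ⟨∑ i ∈ Finset.range (n + 1), |C i|, (Finset.range (n + 1)).inf' (by simp) T,
    Finset.sum_nonneg fun _ _ => abs_nonneg _, fun i hi t ht z hz => ?_⟩
  have hi' : i ∈ Finset.range (n + 1) := by simp; omega
  refine (hCT i t (ht.trans (Finset.inf'_le _ hi')) z hz).trans ?_
  gcongr
  exact (le_abs_self _).trans (Finset.single_le_sum (f := fun i => |C i|) (fun _ _ => abs_nonneg _) hi')

lemma IsExpBounded.congr (hO : IsOpen O) {N : ℝ} {u w : ℝ × X → F}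
    (h : IsExpBounded O N u) {T₀ : ℝ} (he : ∀ t < T₀, ∀ z ∈ O, w (t, z) = u (t, z)) :
    IsExpBounded O N w := by
  obtain ⟨⟨T, hT⟩, h2⟩ := h
  refine ⟨⟨min T T₀, ?_⟩, fun n K hK hKO => ?_⟩
  · refine (hT.mono (prod_mono (Iio_subset_Iio (min_le_left _ _)) le_rfl)).congr ?_
    rintro ⟨t, z⟩ ⟨ht, hz⟩
    exact he t (lt_of_lt_of_le ht (min_le_right _ _)) z hz
  · obtain ⟨C, T', h3⟩ := h2 n K hK hKO
    refine ⟨C, min T' (T₀ - 1), fun t ht z hz => ?_⟩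
    have hev : w =ᶠ[𝓝 (t, z)] u := by
      have : (Iio T₀ ×ˢ O) ∈ 𝓝 (t, z) := (isOpen_Iio.prod hO).mem_nhds
        ⟨by have := ht.trans (min_le_right _ _); simp; linarith, hKO hz⟩
      filter_upwards [this] with y hy
      exact he y.1 hy.1 y.2 hy.2
    rw [(EventuallyEq.iteratedFDeriv ℝ hev n).eq_of_nhds]
    exact h3 t (ht.trans (min_le_left _ _)) z hz

lemma IsExpBounded.mono {N N' : ℝ} {u : ℝ × X → F} (h : IsExpBounded O N u) (hN : N' ≤ N) : IsExpBounded O N' u := by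
  refine ⟨h.1, fun n K hK hKO => ?_⟩
  obtain ⟨C, T, h0, h3⟩ := exists_le_nat_iteratedFDeriv h n hK hKO
  refine ⟨C, min T 0, fun t ht z hz => (h3 n le_rfl t (ht.trans (min_le_left _ _)) z hz).trans ?_⟩
  have : N * t ≤ N' * t := mul_le_mul_of_nonpos_right hN (ht.trans (min_le_right _ _))
  gcongr

lemma IsExpBounded.add (hO : IsOpen O) {N : ℝ} {u w : ℝ × X → F}
    (hu : IsExpBounded O N u) (hw : IsExpBounded O N w) : IsExpBounded O N fun y => u y + w y := by
  obtain ⟨⟨T₁, h1⟩, h2⟩ := hu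
  obtain ⟨⟨T₂, h3⟩, h4⟩ := hw
  refine ⟨⟨min T₁ T₂, (h1.mono (prod_mono (Iio_subset_Iio (min_le_left _ _)) le_rfl)).add
    (h3.mono (prod_mono (Iio_subset_Iio (min_le_right _ _)) le_rfl))⟩, fun n K hK hKO => ?_⟩
  obtain ⟨C, T, h5⟩ := h2 n K hK hKO
  obtain ⟨C', T', h6⟩ := h4 n K hK hKO
  refine ⟨C + C', min (min T T') (min T₁ T₂ - 1), fun t ht z hz => ?_⟩
  have e1 : t ≤ T := ht.trans ((min_le_left _ _).trans (min_le_left _ _))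
  have e2 : t ≤ T' := ht.trans ((min_le_left _ _).trans (min_le_right _ _))
  have e3 : t < min T₁ T₂ := by have := ht.trans (min_le_right _ _); linarith
  have m1 : (t, z) ∈ Iio T₁ ×ˢ O := ⟨lt_of_lt_of_le e3 (min_le_left _ _), hKO hz⟩
  have m2 : (t, z) ∈ Iio T₂ ×ˢ O := ⟨lt_of_lt_of_le e3 (min_le_right _ _), hKO hz⟩
  have d1 : ContDiffAt ℝ n u (t, z) :=
    (h1.contDiffAt ((isOpen_Iio.prod hO).mem_nhds m1)).of_le (natCast_le_infty n)
  have d2 : ContDiffAt ℝ n w (t, z) :=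
    (h3.contDiffAt ((isOpen_Iio.prod hO).mem_nhds m2)).of_le (natCast_le_infty n)
  have : iteratedFDeriv ℝ n (fun y => u y + w y) (t, z)
      = iteratedFDeriv ℝ n u (t, z) + iteratedFDeriv ℝ n w (t, z) := iteratedFDeriv_add_apply d1 d2
  rw [this, add_mul]
  exact (norm_add_le _ _).trans (add_le_add (h5 t e1 z hz) (h6 t e2 z hz))

lemma IsExpBounded.sum (hO : IsOpen O) {N : ℝ} {ι : Type*} {u : ι → ℝ × X → F}
    (s : Finset ι) (hu : ∀ i ∈ s, IsExpBounded O N (u i)) :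
    IsExpBounded O N fun y => ∑ i ∈ s, u i y := by
  classical
  induction s using Finset.induction_on with
  | empty =>
    simp only [Finset.sum_empty]
    refine ⟨⟨0, contDiffOn_const⟩, fun n K _ _ => ⟨0, 0, fun t _ z _ => ?_⟩⟩
    have : iteratedFDeriv ℝ n (fun _ : ℝ × X => (0 : F)) = 0 := iteratedFDeriv_fun_zero
    simp [this]
  | insert i s hi ih =>
    simp only [Finset.sum_insert hi]
    exact (hu i (by simp)).add hO (ih fun j hj => hu j (by simp [hj]))

lemma IsExpBounded.mul (hO : IsOpen O) {N N' : ℝ} {u w : ℝ × X → ℝ}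
    (hu : IsExpBounded O N u) (hw : IsExpBounded O N' w) :
    IsExpBounded O (N + N') fun y => u y * w y := by
  obtain ⟨T₁, h1⟩ := hu.1
  obtain ⟨T₂, h3⟩ := hw.1
  have h1' := h1.mono (prod_mono (Iio_subset_Iio (min_le_left T₁ T₂)) (le_refl O))
  have h3' := h3.mono (prod_mono (Iio_subset_Iio (min_le_right T₁ T₂)) (le_refl O))
  refine ⟨⟨min T₁ T₂, h1'.mul h3'⟩, fun n K hK hKO => ?_⟩
  obtain ⟨C, T, h0, h5⟩ := exists_le_nat_iteratedFDeriv hu n hK hKO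
  obtain ⟨C', T', h0', h6⟩ := exists_le_nat_iteratedFDeriv hw n hK hKO
  refine ⟨∑ i ∈ Finset.range (n + 1), (n.choose i : ℝ) * C * C', min (min T T') (min T₁ T₂ - 1), fun t ht z hz => ?_⟩
  have e1 : t ≤ T := ht.trans ((min_le_left _ _).trans (min_le_left _ _))
  have e2 : t ≤ T' := ht.trans ((min_le_left _ _).trans (min_le_right _ _))
  have e3 : t < min T₁ T₂ := by have := ht.trans (min_le_right _ _); linarith
  have hmem : (t, z) ∈ Iio (min T₁ T₂) ×ˢ O := ⟨e3, hKO hz⟩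
  have hop : IsOpen (Iio (min T₁ T₂) ×ˢ O) := isOpen_Iio.prod hO
  have key := norm_iteratedFDerivWithin_mul_le h1' h3' hop.uniqueDiffOn hmem (natCast_le_infty n)
  simp only [iteratedFDerivWithin_of_isOpen _ hop hmem] at key
  refine key.trans ?_
  rw [sum_mul]
  refine Finset.sum_le_sum fun i hi => ?_
  have hi' : i ≤ n := by simp at hi; omega
  have a1 := h5 i hi' t e1 z hz
  have a2 := h6 (n - i) (by omega) t e2 z hz
  calc _ ≤ (n.choose i : ℝ) * (C * exp (N * t)) * (C' * exp (N' * t)) := by gcongr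
    _ = _ := by rw [add_mul, exp_add]; ring

lemma continuousOn_iteratedFDeriv {s : Set Y} (hs : IsOpen s) {u : Y → F} (hu : ContDiffOn ℝ ∞ u s) (n : ℕ) :
    ContinuousOn (iteratedFDeriv ℝ n u) s := by
  exact (hu.continuousOn_iteratedFDerivWithin (natCast_le_infty n) hs.uniqueDiffOn).congr fun x hx =>
    (iteratedFDerivWithin_of_isOpen n hs hx).symm

lemma exists_bound_iteratedFDeriv {s : Set Y} (hs : IsOpen s) {u : Y → F} (hu : ContDiffOn ℝ ∞ u s) (n : ℕ) {K : Set Y}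
    (hK : IsCompact K) (hKs : K ⊆ s) : ∃ C, ∀ y ∈ K, ‖iteratedFDeriv ℝ n u y‖ ≤ C :=
  hK.exists_bound_of_continuousOn ((continuousOn_iteratedFDeriv hs hu n).mono hKs)

/-- A function which is homogeneous of degree `N` under translations of `t`. -/
lemma isExpBounded_of_translate (hO : IsOpen O) {N : ℝ} {u : ℝ × X → F} (hu : ContDiffOn ℝ ∞ u (univ ×ˢ O))
    (h : ∀ t z, u (t, z) = exp (N * t) • u (0, z)) : IsExpBounded O N u := by
  refine ⟨⟨0, hu.mono (prod_mono (subset_univ _) le_rfl)⟩, fun n K hK hKO => ?_⟩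
  have hop : IsOpen ((univ : Set ℝ) ×ˢ O) := isOpen_univ.prod hO
  obtain ⟨C, hC⟩ := exists_bound_iteratedFDeriv hop hu n (K := {(0 : ℝ)} ×ˢ K)
    (isCompact_singleton.prod hK) (prod_mono (subset_univ _) hKO)
  refine ⟨C, 0, fun t _ z hz => ?_⟩
  have h1 : (fun y : ℝ × X => u (y + (t, 0))) = exp (N * t) • u := by
    ext1 ⟨τ, ζ⟩
    simp only [Prod.mk_add_mk, add_zero, Pi.smul_apply]
    rw [h (τ + t), h τ, smul_smul, ← exp_add]
    congr 2; ring
  have h2 := iteratedFDeriv_comp_add_right (𝕜 := ℝ) (f := u) n (t, (0 : X)) (0, z)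
  rw [h1] at h2
  rw [iteratedFDeriv_const_smul_apply ((hu.contDiffAt
    (hop.mem_nhds ⟨mem_univ _, hKO hz⟩)).of_le (natCast_le_infty n))] at h2
  simp only [Prod.mk_add_mk, zero_add, add_zero] at h2
  rw [← h2, norm_smul, norm_of_nonneg (exp_pos _).le, mul_comm]
  gcongr
  exact hC _ ⟨rfl, hz⟩

lemma isExpBounded_exp (hO : IsOpen O) (N : ℝ) : IsExpBounded O N fun y : ℝ × X => exp (N * y.1) :=
  isExpBounded_of_translate hO (by fun_prop) fun t z => by simp

lemma isExpBounded_const_param (hO : IsOpen O) {a : X → F} (ha : ContDiffOn ℝ ∞ a O) :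
    IsExpBounded O 0 fun y : ℝ × X => a y.2 :=
  isExpBounded_of_translate hO (ha.comp contDiffOn_snd fun y hy => hy.2) fun t z => by simp

/-- `t = log r` grows more slowly than every negative power of `r = exp t`. -/
lemma isExpBounded_fst (hO : IsOpen O) {N : ℝ} (hN : N < 0) : IsExpBounded O N fun y : ℝ × X => y.1 := by
  refine ⟨⟨0, contDiffOn_fst⟩, fun n K hK hKO => ?_⟩
  have hbig : ∀ t ≤ 0, 1 ≤ exp (N * t) := fun t ht =>
    one_le_exp (mul_nonneg_of_nonpos_of_nonpos hN.le ht)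
  rcases Nat.eq_zero_or_pos n with rfl | hn
  · refine ⟨(-N)⁻¹, 0, fun t ht z hz => ?_⟩
    rw [norm_iteratedFDeriv_zero]
    have h1 := add_one_le_exp (N * t)
    have h2 : |t| = -t := abs_of_nonpos ht
    rw [norm_eq_abs, h2, ← div_eq_inv_mul, le_div_iff₀ (by linarith)]
    linarith
  · obtain ⟨C, hC⟩ := exists_bound_iteratedFDeriv (isOpen_univ.prod hO)
      (contDiffOn_fst (𝕜 := ℝ) (n := ∞)) n (K := {(0 : ℝ)} ×ˢ K)
      (isCompact_singleton.prod hK) (prod_mono (subset_univ _) hKO)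
    refine ⟨C, 0, fun t ht z hz => ?_⟩
    have h1 : (fun y : ℝ × X => (y + (t, 0)).1) = (fun y : ℝ × X => y.1) + fun _ => t := by
      ext1 ⟨τ, ζ⟩; simp
    have h2 := iteratedFDeriv_comp_add_right (𝕜 := ℝ) (f := fun y : ℝ × X => y.1) n (t, (0 : X)) (0, z)
    rw [h1, iteratedFDeriv_add_apply contDiff_fst.contDiffAt contDiff_const.contDiffAt,
      iteratedFDeriv_const_of_ne hn.ne'] at h2
    simp only [Pi.zero_apply, add_zero, Prod.mk_add_mk, zero_add] at h2
    rw [← h2]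
    have h3 := hC (0, z) ⟨rfl, hz⟩
    have h4 : 0 ≤ C := (norm_nonneg _).trans h3
    calc _ ≤ C * 1 := by rw [mul_one]; exact h3
      _ ≤ _ := by gcongr; exact hbig t ht

/-- Composition of a smooth function with a map of which all derivatives are bounded. -/
lemma IsExpBounded.comp (hO : IsOpen O) {D : Set Y} (hD : IsOpen D) {f : Y → F} (hf : ContDiffOn ℝ ∞ f D)
    {G : ℝ × X → Y} (hG : IsExpBounded O 0 G) {T₀ : ℝ} (hmaps : MapsTo G (Iio T₀ ×ˢ O) D)
    (hcomp : ∀ K, IsCompact K → K ⊆ O → ∃ K' T, IsCompact K' ∧ K' ⊆ D ∧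
      ∀ t ≤ T, ∀ z ∈ K, G (t, z) ∈ K') : IsExpBounded O 0 fun y => f (G y) := by
  obtain ⟨T₁, h1⟩ := hG.1
  have h1' := h1.mono (prod_mono (Iio_subset_Iio (min_le_left T₁ T₀)) (le_refl O))
  have hm' : MapsTo G (Iio (min T₁ T₀) ×ˢ O) D := fun y hy =>
    hmaps (prod_mono (Iio_subset_Iio (min_le_right T₁ T₀)) (le_refl O) hy)
  refine ⟨⟨min T₁ T₀, hf.comp h1' hm'⟩, fun n K hK hKO => ?_⟩
  obtain ⟨K', T, hK', hK'D, hmem⟩ := hcomp K hK hKO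
  obtain ⟨B, T₂, hB0, hB⟩ := exists_le_nat_iteratedFDeriv hG n hK hKO
  choose c hc using fun i => exists_bound_iteratedFDeriv hD hf i hK' hK'D
  set C := ∑ i ∈ Finset.range (n + 1), |c i| with hCdef
  refine ⟨n.factorial * C * (max 1 B) ^ n, min (min T T₂) (min T₁ T₀ - 1), fun t ht z hz => ?_⟩
  have e1 : t ≤ T := ht.trans ((min_le_left _ _).trans (min_le_left _ _))
  have e2 : t ≤ T₂ := ht.trans ((min_le_left _ _).trans (min_le_right _ _))
  have e3 : t < min T₁ T₀ := by have := ht.trans (min_le_right _ _); linarith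
  have hz' : (t, z) ∈ Iio (min T₁ T₀) ×ˢ O := ⟨e3, hKO hz⟩
  have hop : IsOpen (Iio (min T₁ T₀) ×ˢ O) := isOpen_Iio.prod hO
  have key := norm_iteratedFDerivWithin_comp_le hf h1' (natCast_le_infty n) hD.uniqueDiffOn hop.uniqueDiffOn hm' hz'
    (C := C) (D := max 1 B) ?_ ?_
  · rw [iteratedFDerivWithin_of_isOpen _ hop hz'] at key
    simpa [Function.comp_def] using key
  · intro i hi
    rw [iteratedFDerivWithin_of_isOpen _ hD (hm' hz')]
    refine (hc i _ (hmem t e1 z hz)).trans ((le_abs_self _).trans ?_)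
    exact Finset.single_le_sum (f := fun i => |c i|) (fun _ _ => abs_nonneg _) (by simp; omega)
  · intro i hi hin
    rw [iteratedFDerivWithin_of_isOpen _ hop hz']
    have := hB i hin t e2 z hz
    simp only [zero_mul, exp_zero, mul_one] at this
    calc _ ≤ max 1 B := this.trans (le_max_right _ _)
      _ ≤ (max 1 B) ^ i := le_self_pow₀ (le_max_left _ _) (by omega)

lemma IsExpBounded.clm (hO : IsOpen O) {N : ℝ} {u : ℝ × X → F} (hu : IsExpBounded O N u) (L : F →L[ℝ] Y) :
    IsExpBounded O N fun y => L (u y) := by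
  obtain ⟨T₁, h1⟩ := hu.1
  refine ⟨⟨T₁, L.contDiff.comp_contDiffOn h1⟩, fun n K hK hKO => ?_⟩
  obtain ⟨C, T, h2⟩ := hu.2 n K hK hKO
  refine ⟨‖L‖ * C, min T (T₁ - 1), fun t ht z hz => ?_⟩
  have e3 : t < T₁ := by have := ht.trans (min_le_right _ _); linarith
  have m1 : (t, z) ∈ Iio T₁ ×ˢ O := ⟨e3, hKO hz⟩
  have d1 : ContDiffAt ℝ n u (t, z) :=
    (h1.contDiffAt ((isOpen_Iio.prod hO).mem_nhds m1)).of_le (natCast_le_infty n)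
  have : iteratedFDeriv ℝ n (fun y => L (u y)) (t, z) = _ :=
    L.iteratedFDeriv_comp_left d1 le_rfl
  rw [this, mul_assoc]
  refine (L.norm_compContinuousMultilinearMap_le _).trans ?_
  gcongr
  exact h2 t (ht.trans (min_le_left _ _)) z hz

/-- A smooth function of `(exp (μ t), exp t, z)`, `μ > 0`, has bounded derivatives. -/
lemma isExpBounded_comp_exp (hO : IsOpen O) {δ μ : ℝ} (hδ : 0 < δ) (hμ : 0 < μ)
    {f : ℝ × ℝ × X → F} (hf : ContDiffOn ℝ ∞ f (Ioo (-δ) δ ×ˢ Ioo (-δ) δ ×ˢ O)) :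
    IsExpBounded O 0 fun y : ℝ × X => f (exp (μ * y.1), exp y.1, y.2) := by
  have hG : IsExpBounded O 0 fun y : ℝ × X => (exp (μ * y.1), exp y.1, y.2) := by
    have g1 := ((isExpBounded_exp hO μ).mono hμ.le).clm hO (ContinuousLinearMap.inl ℝ ℝ (ℝ × X))
    have g2 := ((isExpBounded_exp hO 1).mono zero_le_one).clm hO
      ((ContinuousLinearMap.inr ℝ ℝ (ℝ × X)).comp (ContinuousLinearMap.inl ℝ ℝ X))
    have g3 := (isExpBounded_const_param hO contDiffOn_id).clm hO
      ((ContinuousLinearMap.inr ℝ ℝ (ℝ × X)).comp (ContinuousLinearMap.inr ℝ ℝ X))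
    refine ((g1.add hO g2).add hO g3).congr hO (T₀ := 0) fun t _ z _ => ?_
    simp
  -- the bound on `t` which makes both exponentials smaller than `δ / 2`
  set T := min (log (δ / 2)) (log (δ / 2) / μ) with hT
  have hexp : ∀ t ≤ T, exp (μ * t) ≤ δ / 2 ∧ exp t ≤ δ / 2 := by
    intro t ht
    constructor
    · rw [← le_log_iff_exp_le (by positivity), mul_comm]
      exact (le_div_iff₀ hμ).1 (ht.trans (min_le_right _ _))
    · rw [← le_log_iff_exp_le (by positivity)]
      exact ht.trans (min_le_left _ _)
  refine IsExpBounded.comp hO (isOpen_Ioo.prod (isOpen_Ioo.prod hO)) hf hG (T₀ := T) ?_ ?_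
  · rintro ⟨t, z⟩ ⟨ht, hz⟩
    have := hexp t (le_of_lt ht)
    have p1 := exp_pos (μ * t)
    have p2 := exp_pos t
    exact ⟨⟨by simp only; linarith, by simp only; linarith⟩, ⟨by simp only; linarith, by simp only; linarith⟩, hz⟩
  · intro K hK hKO
    refine ⟨Icc 0 (δ / 2) ×ˢ Icc 0 (δ / 2) ×ˢ K, T, isCompact_Icc.prod (isCompact_Icc.prod hK), ?_, ?_⟩
    · have : Icc 0 (δ / 2) ⊆ Ioo (-δ) δ := fun x hx => ⟨by linarith [hx.1], by linarith [hx.2]⟩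
      exact prod_mono this (prod_mono this hKO)
    · intro t ht z hz
      have := hexp t ht
      exact ⟨⟨(exp_pos _).le, this.1⟩, ⟨(exp_pos _).le, this.2⟩, hz⟩

/-- The Taylor expansion in the first variable, with smooth coefficients and remainders. -/
lemma exists_taylor {δ : ℝ} (hδ : 0 < δ)
    {W : Set Y} (hW : IsOpen W) {Φ : ℝ × Y → ℝ} (hΦ : ContDiffOn ℝ ∞ Φ (Ioo (-δ) δ ×ˢ W)) :
    ∃ (a : ℕ → Y → ℝ) (R : ℕ → ℝ × Y → ℝ), (∀ i, ContDiffOn ℝ ∞ (a i) W) ∧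
      (∀ M, ContDiffOn ℝ ∞ (R M) (Ioo (-δ) δ ×ˢ W)) ∧
      ∀ M, ∀ x ∈ Ioo (-δ) δ, ∀ y ∈ W, Φ (x, y) = ∑ i ∈ Finset.range M, x ^ i * a i y + x ^ M * R M (x, y) := by
  choose next hnext using fun R : {R : ℝ × Y → ℝ // ContDiffOn ℝ ∞ R (Ioo (-δ) δ ×ˢ W)} =>
    exists_hadamard hW R.2
  set R : ℕ → {R : ℝ × Y → ℝ // ContDiffOn ℝ ∞ R (Ioo (-δ) δ ×ˢ W)} := fun M =>
    Nat.rec ⟨Φ, hΦ⟩ (fun _ r => ⟨next r, (hnext r).1⟩) M with hR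
  refine ⟨fun i y => (R i).1 (0, y), fun M => (R M).1, fun i => ?_, fun M => (R M).2, ?_⟩
  · exact (R i).2.comp (f := fun y : Y => ((0 : ℝ), y)) (by fun_prop) fun y hy => ⟨⟨by simpa using hδ, hδ⟩, hy⟩
  · intro M x hx y hy
    induction M with
    | zero => simp [hR]
    | succ M ih =>
      have h1 : (R (M + 1)).1 = next (R M) := rfl
      have h2 := (hnext (R M)).2 x hx y hy
      simp only [h1] at ih ⊢
      rw [ih, Finset.sum_range_succ, h2]
      ring

/-- The real monomial `r^γ (log r)^ℓ` at `r = exp t`. -/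
noncomputable def realMonomial (p : ℝ × ℕ) (t : ℝ) : ℝ := exp (p.1 * t) * t ^ p.2

/-- `u` has an asymptotic expansion in real monomials, with respect to an arbitrary family of
exponents, in which repetitions are allowed. -/
def HasExpansion (O : Set X) (u : ℝ × X → ℝ) : Prop :=
  ∃ (ι : Type) (γ : ι → ℝ × ℕ) (hγ : ∀ N : ℝ, {i | (γ i).1 ≤ N}.Finite) (a : ι → X → ℝ),
    (∀ i, ContDiffOn ℝ ∞ (a i) O) ∧ ∀ N : ℝ, IsExpBounded O N fun y =>
      u y - ∑ i ∈ (hγ N).toFinset, realMonomial (γ i) y.1 * a i y.2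

/-- Smooth functions of `(r^μ, r, z)`, and their products with `log r`, have asymptotic expansions. -/
lemma hasExpansion_of_smooth_log (hO : IsOpen O) {δ μ : ℝ} (hδ : 0 < δ) (hμ : 0 < μ)
    {f : Fin 2 → ℝ × ℝ × X → ℝ} (hf : ∀ ℓ, ContDiffOn ℝ ∞ (f ℓ) (Ioo (-δ) δ ×ˢ Ioo (-δ) δ ×ˢ O))
    {u : ℝ × X → ℝ} {T₀ : ℝ} (hu : ∀ t < T₀, ∀ z ∈ O,
      u (t, z) = f 0 (exp (μ * t), exp t, z) + t * f 1 (exp (μ * t), exp t, z)) :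
    HasExpansion O u := by
  choose A R hA hR hAR using fun ℓ => exists_taylor hδ (isOpen_Ioo.prod hO) (hf ℓ)
  choose a r ha hr har using fun ℓ i => exists_taylor hδ hO (hA ℓ i)
  have hfin : ∀ N : ℝ, ∃ M : ℕ, N < M ∧ N < μ * M := by
    intro N
    obtain ⟨M, hM⟩ := exists_nat_gt (max N (N / μ))
    refine ⟨M, (le_max_left _ _).trans_lt hM, ?_⟩
    have := (le_max_right _ _).trans_lt hM
    rw [div_lt_iff₀ hμ] at this
    linarith
  set γ : ℕ × ℕ × Fin 2 → ℝ × ℕ := fun i => (μ * i.1 + i.2.1, i.2.2) with hγdef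
  set box : ℕ → Finset (ℕ × ℕ × Fin 2) := fun M =>
    Finset.range M ×ˢ Finset.range M ×ˢ Finset.univ with hbox
  have hsub : ∀ (N : ℝ) (M : ℕ), N < M → N < μ * M → {i | (γ i).1 ≤ N} ⊆ box M := by
    rintro N M h1 h2 ⟨i, j, ℓ⟩ hi
    simp only [hγdef, mem_ofPred_eq] at hi
    simp only [hbox, Finset.coe_product, Finset.coe_range, Finset.coe_univ, mem_prod, mem_Iio, mem_univ, and_true]
    have hi0 : (0 : ℝ) ≤ i := by positivity
    have hj0 : (0 : ℝ) ≤ j := by positivity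
    constructor
    · have : μ * (i : ℝ) < μ * M := by linarith
      exact_mod_cast lt_of_mul_lt_mul_left this hμ.le
    · have : (j : ℝ) < M := by nlinarith
      exact_mod_cast this
  have hγ : ∀ N : ℝ, {i | (γ i).1 ≤ N}.Finite := fun N => by
    obtain ⟨M, h1, h2⟩ := hfin N
    exact (box M).finite_toSet.subset (hsub N M h1 h2)
  refine ⟨ℕ × ℕ × Fin 2, γ, hγ, fun i => a i.2.2 i.1 i.2.1, fun i => ha _ _ _, fun N => ?_⟩
  obtain ⟨M, h1, h2⟩ := hfin N
  -- monomials of exponent larger than `N` are absorbed, together with the logarithm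
  have hmono : ∀ (lam : ℝ) (ℓ : Fin 2) (w : ℝ × X → ℝ), N < lam → IsExpBounded O 0 w →
      IsExpBounded O N fun y => realMonomial (lam, ℓ) y.1 * w y := by
    intro lam ℓ w hl hw
    have e1 : IsExpBounded O (N - lam) fun y : ℝ × X => y.1 ^ (ℓ : ℕ) := by
      fin_cases ℓ
      · refine ((isExpBounded_const_param hO (a := fun _ => (1 : ℝ)) contDiffOn_const).mono
          (by linarith)).congr hO (T₀ := 0) fun t _ z _ => ?_
        simp
      · simpa using isExpBounded_fst hO (by linarith)
    have e2 := ((isExpBounded_exp hO lam).mul hO e1).mul hO hw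
    simpa [realMonomial] using e2
  have hδ' : ∀ᶠ t in atBot, exp (μ * t) < δ ∧ exp t < δ := by
    have t1 : Tendsto (fun t : ℝ => exp (μ * t)) atBot (𝓝 0) :=
      tendsto_exp_atBot.comp (tendsto_id.const_mul_atBot hμ)
    exact (t1.eventually (gt_mem_nhds hδ)).and (tendsto_exp_atBot.eventually (gt_mem_nhds hδ))
  obtain ⟨T₁, hT₁⟩ := eventually_atBot.1 hδ'
  have b1 : ∀ i ∈ box M \ (hγ N).toFinset,
      IsExpBounded O N fun y => realMonomial (γ i) y.1 * a i.2.2 i.1 i.2.1 y.2 := by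
    intro i hi
    have : N < (γ i).1 := by simpa using (Finset.mem_sdiff.1 hi).2
    exact hmono _ i.2.2 _ this (isExpBounded_const_param hO (ha _ _ _))
  have b2 : ∀ q ∈ Finset.range M ×ˢ (Finset.univ : Finset (Fin 2)), IsExpBounded O N fun y =>
      realMonomial (μ * q.1 + M, q.2) y.1 * r q.2 q.1 M (exp y.1, y.2) := by
    intro q _
    have hq : (0 : ℝ) ≤ μ * q.1 := by positivity
    refine hmono _ q.2 _ (by linarith) ?_
    exact isExpBounded_comp_exp hO hδ hμ (f := fun w => r q.2 q.1 M w.2)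
      ((hr q.2 q.1 M).comp contDiffOn_snd fun w hw => hw.2)
  have b3 : ∀ ℓ ∈ (Finset.univ : Finset (Fin 2)), IsExpBounded O N fun y =>
      realMonomial (μ * M, ℓ) y.1 * R ℓ M (exp (μ * y.1), exp y.1, y.2) := by
    intro ℓ _
    exact hmono _ ℓ _ h2 (isExpBounded_comp_exp hO hδ hμ (hR ℓ M))
  refine (((IsExpBounded.sum hO _ b1).add hO (IsExpBounded.sum hO _ b2)).add hO
    (IsExpBounded.sum hO _ b3)).congr hO (T₀ := min T₀ T₁) fun t ht z hz => ?_
  have ht1 := hT₁ t (le_of_lt (lt_of_lt_of_le ht (min_le_right _ _)))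
  have m1 : exp (μ * t) ∈ Ioo (-δ) δ := ⟨by linarith [exp_pos (μ * t)], ht1.1⟩
  have m2 : exp t ∈ Ioo (-δ) δ := ⟨by linarith [exp_pos t], ht1.2⟩
  have hss : (hγ N).toFinset ⊆ box M := fun i hi => by
    have := hsub N M h1 h2 (by simpa using hi)
    exact_mod_cast this
  rw [Finset.sum_sdiff_eq_sub hss]
  have expand : ∀ ℓ, f ℓ (exp (μ * t), exp t, z) = ∑ i ∈ Finset.range M, (exp (μ * t) ^ i *
          (∑ j ∈ Finset.range M, exp t ^ j * a ℓ i j z + exp t ^ M * r ℓ i M (exp t, z)))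
        + exp (μ * t) ^ M * R ℓ M (exp (μ * t), exp t, z) := by
    intro ℓ
    rw [hAR ℓ M _ m1 (exp t, z) ⟨m2, hz⟩]
    congr 1
    refine sum_congr rfl fun i _ => ?_
    rw [har ℓ i M _ m2 z hz]
  have pw : ∀ i : ℕ, exp (μ * t) ^ i = exp (μ * i * t) := fun i => by
    rw [← exp_nat_mul]; ring_nf
  have pw2 : ∀ i : ℕ, exp t ^ i = exp (i * t) := fun i => by
    rw [← exp_nat_mul]
  rw [hu t (lt_of_lt_of_le ht (min_le_left _ _)) z hz, expand, expand]
  simp only [hbox, Finset.sum_product, Fin.sum_univ_two, realMonomial, hγdef, pw, pw2]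
  simp only [add_mul, exp_add, Fin.val_zero, Fin.val_one, pow_zero, pow_one, mul_one,
    mul_add, Finset.sum_add_distrib, mul_sum]
  simp only [mul_comm, mul_left_comm, mul_assoc]
  ring

/-- An expansion in which every exponent occurs only once. -/
lemma HasExpansion.exists_set {u : ℝ × X → ℝ} (h : HasExpansion O u) :
    ∃ (I : Set (ℂ × ℕ)) (hI : IsIndexSet I) (a : ℂ × ℕ → X → ℂ),
      (∀ p ∈ I, ContDiffOn ℝ ∞ (a p) O) ∧ ∀ N : ℝ, ∃ U : ℝ × X → ℝ, IsExpBounded O N U ∧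
        ∀ y, (u y : ℂ) - ∑ p ∈ (hI N).toFinset, phgMonomial p y.1 * a p y.2 = (U y : ℂ) := by
  classical
  obtain ⟨ι, γ, hγ, a, ha, hN⟩ := h
  set I : Set (ℂ × ℕ) := range fun i => (((γ i).1 : ℂ), (γ i).2) with hIdef
  have hI : IsIndexSet I := by
    intro N
    refine ((hγ N).image fun i => (((γ i).1 : ℂ), (γ i).2)).subset ?_
    rintro p ⟨⟨i, rfl⟩, hi⟩
    exact ⟨i, by simpa using hi, rfl⟩
  set c : ℂ × ℕ → X → ℂ := fun p z =>
    ((∑ i ∈ (hγ p.1.re).toFinset with (((γ i).1 : ℂ), (γ i).2) = p, a i z : ℝ) : ℂ) with hc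
  refine ⟨I, hI, c, fun p _ => ?_, fun N => ⟨_, hN N, fun y => ?_⟩⟩
  · exact Complex.ofRealCLM.contDiff.comp_contDiffOn (ContDiffOn.sum fun i _ => ha i)
  · rw [Complex.ofReal_sub]
    congr 1
    have hmaps : ∀ i ∈ (hγ N).toFinset, (((γ i).1 : ℂ), (γ i).2) ∈ (hI N).toFinset := by
      intro i hi
      simp only [Finite.mem_toFinset, mem_ofPred_eq] at hi ⊢
      exact ⟨⟨i, rfl⟩, by simpa using hi⟩
    rw [← Finset.sum_fiberwise_of_maps_to hmaps, Complex.ofReal_sum]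
    refine sum_congr rfl fun p hp => ?_
    simp only [Finite.mem_toFinset, mem_ofPred_eq] at hp
    have hset : ((hγ p.1.re).toFinset.filter fun i => (((γ i).1 : ℂ), (γ i).2) = p)
        = (hγ N).toFinset.filter fun i => (((γ i).1 : ℂ), (γ i).2) = p := by
      ext i
      simp only [Finset.mem_filter, Finite.mem_toFinset, mem_ofPred_eq]
      constructor
      · rintro ⟨h1, h2⟩; exact ⟨h1.trans hp.2, h2⟩
      · rintro ⟨h1, h2⟩; refine ⟨?_, h2⟩; rw [← h2]; simp
    rw [hc]
    simp only
    rw [hset, Complex.ofReal_sum, Complex.ofReal_sum, mul_sum]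
    refine sum_congr rfl fun i hi => ?_
    have hi2 : (((γ i).1 : ℂ), (γ i).2) = p := (Finset.mem_filter.1 hi).2
    rw [← hi2]
    simp [realMonomial, phgMonomial]

lemma norm_iteratedFDeriv_ofReal (U : Y → ℝ) (n : ℕ) (y : Y) (hU : ContDiffAt ℝ n U y) :
    ‖iteratedFDeriv ℝ n (fun w => (U w : ℂ)) y‖ = ‖iteratedFDeriv ℝ n U y‖ :=
  Complex.ofRealLI.norm_iteratedFDeriv_comp_left hU le_rfl

/-- In the coordinate `t = log r`, the remainders of an expansion are estimated as polyhomogeneity requires. -/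
lemma HasExpansion.isPhg (hO : IsOpen O) {R : ℝ} {u : ℝ → X → ℝ}
    (hu : ContDiffOn ℝ ∞ (fun w : ℝ × X => u w.1 w.2) (Ioo 0 R ×ˢ O))
    (h : HasExpansion O fun y => u (exp y.1) y.2) : IsPhg R O u := by
  obtain ⟨I, hI, a, ha, hN⟩ := h.exists_set
  refine ⟨hu, I, hI, a, ha, fun N n K hK hKO => ?_⟩
  obtain ⟨U, hU, hUe⟩ := hN N
  obtain ⟨C, T, hCT⟩ := hU.2 n K hK hKO
  obtain ⟨T₁, hT₁⟩ := hU.1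
  refine ⟨C, min T (T₁ - 1), fun t ht z hz => ?_⟩
  have m1 : (t, z) ∈ Iio T₁ ×ˢ O :=
    ⟨by have := ht.trans (min_le_right _ _); simp only [mem_Iio]; linarith, hKO hz⟩
  simp only [hUe]
  rw [norm_iteratedFDeriv_ofReal _ _ _ ((hT₁.contDiffAt ((isOpen_Iio.prod hO).mem_nhds m1)).of_le (natCast_le_infty n))]
  exact hCT t (ht.trans (min_le_left _ _)) z hz

lemma norm_iteratedFDeriv_comp_clm_le {Z : Type*}
    [NormedAddCommGroup Z] [NormedSpace ℝ Z] {s : Set Y} (hs : IsOpen s) {f : Y → F}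
    (hf : ContDiffOn ℝ ∞ f s) (L : Z →L[ℝ] Y) (hL : ‖L‖ ≤ 1) {x : Z} (hx : L x ∈ s) (n : ℕ) :
    ‖iteratedFDeriv ℝ n (fun y => f (L y)) x‖ ≤ ‖iteratedFDeriv ℝ n f (L x)‖ := by
  have hop : IsOpen (L ⁻¹' s) := hs.preimage L.continuous
  have h1 := L.iteratedFDerivWithin_comp_right hf hs.uniqueDiffOn hop.uniqueDiffOn hx (natCast_le_infty n)
  rw [iteratedFDerivWithin_of_isOpen _ hop hx, iteratedFDerivWithin_of_isOpen _ hs hx] at h1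
  have h2 : iteratedFDeriv ℝ n (fun y => f (L y)) x = _ := h1
  rw [h2]
  refine (ContinuousMultilinearMap.norm_compContinuousLinearMap_le _ _).trans ?_
  have : ∏ _i : Fin n, ‖L‖ ≤ 1 := by
    rw [Finset.prod_const]; exact pow_le_one₀ (norm_nonneg _) hL
  exact mul_le_of_le_one_right (norm_nonneg _) this

/-- Bounds for products `U(t, z) W(t', z)`. -/
lemma exists_bound_corner (hO : IsOpen O) {N N' : ℝ} {U W : ℝ × X → ℝ}
    (hU : IsExpBounded O N U) (hW : IsExpBounded O N' W) (n : ℕ) {K : Set X} (hK : IsCompact K)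
    (hKO : K ⊆ O) : ∃ C T : ℝ, 0 ≤ C ∧ T ≤ 0 ∧ ∀ t ≤ T, ∀ t' ≤ T, ∀ z ∈ K,
      ContDiffAt ℝ n (fun w : ℝ × ℝ × X => U (w.1, w.2.2) * W (w.2.1, w.2.2)) (t, t', z) ∧
      ‖iteratedFDeriv ℝ n (fun w : ℝ × ℝ × X => U (w.1, w.2.2) * W (w.2.1, w.2.2)) (t, t', z)‖
        ≤ C * exp (N * t + N' * t') := by
  set P₁ : ℝ × ℝ × X →L[ℝ] ℝ × X := (ContinuousLinearMap.fst ℝ ℝ (ℝ × X)).prod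
    ((ContinuousLinearMap.snd ℝ ℝ X).comp (ContinuousLinearMap.snd ℝ ℝ (ℝ × X))) with hP₁
  set P₂ : ℝ × ℝ × X →L[ℝ] ℝ × X := ContinuousLinearMap.snd ℝ ℝ (ℝ × X) with hP₂
  have n1 : ‖P₁‖ ≤ 1 := by
    refine ContinuousLinearMap.opNorm_le_bound _ zero_le_one fun w => ?_
    rw [one_mul]
    refine max_le (norm_fst_le w) ((norm_snd_le w.2).trans (norm_snd_le w))
  have n2 : ‖P₂‖ ≤ 1 := ContinuousLinearMap.norm_snd_le ℝ ℝ (ℝ × X)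
  obtain ⟨T₁, h1⟩ := hU.1
  obtain ⟨T₂, h2⟩ := hW.1
  obtain ⟨C, T, h0, h5⟩ := exists_le_nat_iteratedFDeriv hU n hK hKO
  obtain ⟨C', T', h0', h6⟩ := exists_le_nat_iteratedFDeriv hW n hK hKO
  refine ⟨∑ i ∈ Finset.range (n + 1), (n.choose i : ℝ) * C * C',
    min (min (min T T') (min T₁ T₂ - 1)) 0, by positivity, min_le_right _ _,
    fun t ht t' ht' z hz => ?_⟩
  have ht := ht.trans (min_le_left _ _)
  have ht' := ht'.trans (min_le_left _ _)
  have e1 : t ≤ T := ht.trans ((min_le_left _ _).trans (min_le_left _ _))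
  have e2 : t' ≤ T' := ht'.trans ((min_le_left _ _).trans (min_le_right _ _))
  have e3 : t < T₁ := by have := ht.trans (min_le_right _ _); linarith [min_le_left T₁ T₂]
  have e4 : t' < T₂ := by have := ht'.trans (min_le_right _ _); linarith [min_le_right T₁ T₂]
  set S : Set (ℝ × ℝ × X) := Iio T₁ ×ˢ Iio T₂ ×ˢ O with hS
  have hop : IsOpen S := isOpen_Iio.prod (isOpen_Iio.prod hO)
  have hmem : (t, t', z) ∈ S := ⟨e3, e4, hKO hz⟩
  have c1 : ContDiffOn ℝ ∞ (fun w => U (P₁ w)) S :=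
    h1.comp P₁.contDiff.contDiffOn fun w hw => ⟨hw.1, hw.2.2⟩
  have c2 : ContDiffOn ℝ ∞ (fun w => W (P₂ w)) S :=
    h2.comp P₂.contDiff.contDiffOn fun w hw => hw.2
  refine ⟨((c1.mul c2).contDiffAt (hop.mem_nhds hmem)).of_le (natCast_le_infty n), ?_⟩
  have key := norm_iteratedFDerivWithin_mul_le c1 c2 hop.uniqueDiffOn hmem (natCast_le_infty n)
  simp only [iteratedFDerivWithin_of_isOpen _ hop hmem] at key
  refine key.trans ?_
  rw [sum_mul]
  refine Finset.sum_le_sum fun i hi => ?_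
  have hi' : i ≤ n := by simp at hi; omega
  have a1 := (norm_iteratedFDeriv_comp_clm_le (isOpen_Iio.prod hO) h1 P₁ n1 (x := (t, t', z))
    ⟨e3, hKO hz⟩ i).trans (h5 i hi' t e1 z hz)
  have a2 := (norm_iteratedFDeriv_comp_clm_le (isOpen_Iio.prod hO) h2 P₂ n2 (x := (t, t', z))
    ⟨e4, hKO hz⟩ (n - i)).trans (h6 (n - i) (by omega) t' e2 z hz)
  calc _ ≤ (n.choose i : ℝ) * (C * exp (N * t)) * (C' * exp (N' * t')) := by gcongr
    _ = _ := by rw [exp_add]; ring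

/-- Products `A(r, z) B(s, z)` of functions with expansions are polyhomogeneous at the corner. -/
lemma HasExpansion.isPhgCorner (hO : IsOpen O) {R R' : ℝ} {u : ℝ → ℝ → X → ℝ}
    (hu : ContDiffOn ℝ ∞ (fun w : ℝ × ℝ × X => u w.1 w.2.1 w.2.2) (Ioo 0 R ×ˢ Ioo 0 R' ×ˢ O))
    {A B : ℝ × X → ℝ} (hA : HasExpansion O A) (hB : HasExpansion O B)
    {m : ℝ} (hAm : IsExpBounded O (-m) A) (hBm : IsExpBounded O (-m) B) {T₀ : ℝ}
    (h : ∀ t < T₀, ∀ t' < T₀, ∀ z ∈ O, u (exp t) (exp t') z = A (t, z) * B (t', z)) :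
    IsPhgCorner R R' O u := by
  obtain ⟨I, hI, a, ha, hNA⟩ := hA.exists_set
  obtain ⟨J, hJ, b, hb, hNB⟩ := hB.exists_set
  -- all exponents are larger than `-m'`
  obtain ⟨m', hm', hIm⟩ : ∃ m', m ≤ m' ∧ ∀ N < -m', (hI N).toFinset = ∅ := by
    obtain ⟨c, hc⟩ := ((hI 0).image fun p => p.1.re).bddBelow
    refine ⟨max m (max 0 (-c)), le_max_left _ _, fun N hN => ?_⟩
    rw [Finite.toFinset_eq_empty, eq_empty_iff_forall_notMem]
    rintro p ⟨hp, hpN⟩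
    have h1 : N < 0 := by linarith [le_max_right m (max 0 (-c)), le_max_left 0 (-c)]
    have h2 : c ≤ p.1.re := hc ⟨p, ⟨hp, hpN.trans h1.le⟩, rfl⟩
    linarith [le_max_right m (max 0 (-c)), le_max_right 0 (-c)]
  refine ⟨hu, I, J, hI, hJ, fun p q z => a p z * b q z, m',
    fun p hp q hq => (ha p hp).mul (hb q hq), fun N n K hK hKO => ?_⟩
  obtain ⟨U, hU, hUe⟩ := hNA N
  obtain ⟨W, hW, hWe⟩ := hNB N
  have hAm' : IsExpBounded O (-m') A := hAm.mono (by linarith)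
  have hBm' : IsExpBounded O (-m') B := hBm.mono (by linarith)
  set V : (ℝ × X → ℝ) → (ℝ × X → ℝ) → ℝ × ℝ × X → ℝ :=
    fun U W w => U (w.1, w.2.2) * W (w.2.1, w.2.2) with hV
  have hopen : IsOpen (Iio T₀ ×ˢ Iio T₀ ×ˢ O) := isOpen_Iio.prod (isOpen_Iio.prod hO)
  have hprod : ∀ w : ℝ × ℝ × X, ∑ p ∈ (hI N).toFinset, ∑ q ∈ (hJ N).toFinset,
      phgMonomial p w.1 * phgMonomial q w.2.1 * (a p w.2.2 * b q w.2.2)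
      = ((A (w.1, w.2.2) : ℂ) - U (w.1, w.2.2)) * ((B (w.2.1, w.2.2) : ℂ) - W (w.2.1, w.2.2)) := by
    intro w
    rw [← hUe (w.1, w.2.2), ← hWe (w.2.1, w.2.2), sub_sub_cancel, sub_sub_cancel, Finset.sum_mul_sum]
    exact sum_congr rfl fun p _ => sum_congr rfl fun q _ => by ring
  simp only [hprod]
  -- for `N < -m'`, there is no term in the expansion, and `U = A`
  have hU' : IsExpBounded O (-m') U := by
    rcases lt_or_ge N (-m') with hN | hN
    · have : U = A := funext fun y => by
        have := hUe y
        rw [hIm N hN] at this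
        simpa using this.symm
      rwa [this]
    · exact hU.mono hN
  obtain ⟨C₁, T₁, hC₁, hT₁, h1⟩ := exists_bound_corner hO hU hBm' n hK hKO
  obtain ⟨C₂, T₂, hC₂, hT₂, h2⟩ := exists_bound_corner hO hAm' hW n hK hKO
  obtain ⟨C₃, T₃, hC₃, hT₃, h3⟩ := exists_bound_corner hO hU' hW n hK hKO
  refine ⟨C₁ + C₂ + C₃, min (min T₁ T₂) (min T₃ (T₀ - 1)), fun t ht t' ht' z hz => ?_⟩
  have hm : (t, t', z) ∈ Iio T₀ ×ˢ Iio T₀ ×ˢ O :=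
    ⟨by have := ht.trans ((min_le_right _ _).trans (min_le_right _ _))
        simp only [mem_Iio]; linarith,
      by have := ht'.trans ((min_le_right _ _).trans (min_le_right _ _))
         simp only [mem_Iio]; linarith, hKO hz⟩
  have hev : (fun w : ℝ × ℝ × X => (u (exp w.1) (exp w.2.1) w.2.2 : ℂ)
      - ((A (w.1, w.2.2) : ℂ) - U (w.1, w.2.2)) * ((B (w.2.1, w.2.2) : ℂ) - W (w.2.1, w.2.2)))
      =ᶠ[𝓝 (t, t', z)] fun w => ((V U B w + V A W w - V U W w : ℝ) : ℂ) := by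
    filter_upwards [hopen.mem_nhds hm] with w hw
    rw [h _ hw.1 _ hw.2.1 _ hw.2.2]
    simp only [hV]
    push_cast
    ring
  obtain ⟨k1, l1⟩ := h1 t (ht.trans ((min_le_left _ _).trans (min_le_left _ _)))
    t' (ht'.trans ((min_le_left _ _).trans (min_le_left _ _))) z hz
  obtain ⟨k2, l2⟩ := h2 t (ht.trans ((min_le_left _ _).trans (min_le_right _ _)))
    t' (ht'.trans ((min_le_left _ _).trans (min_le_right _ _))) z hz
  have ht3 := ht.trans ((min_le_right _ _).trans (min_le_left _ _))
  have ht3' := ht'.trans ((min_le_right _ _).trans (min_le_left _ _))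
  obtain ⟨k3, l3⟩ := h3 t ht3 t' ht3' z hz
  rw [(EventuallyEq.iteratedFDeriv ℝ hev n).eq_of_nhds, norm_iteratedFDeriv_ofReal _ _ _ ((k1.add k2).sub k3)]
  have e : iteratedFDeriv ℝ n (fun w => V U B w + V A W w - V U W w) (t, t', z)
      = iteratedFDeriv ℝ n (V U B) (t, t', z) + iteratedFDeriv ℝ n (V A W) (t, t', z)
        - iteratedFDeriv ℝ n (V U W) (t, t', z) := by
    have := iteratedFDeriv_sub_apply (f := fun w => V U B w + V A W w) (k1.add k2) k3
    have h' := iteratedFDeriv_add_apply k1 k2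
    exact this.trans (congrArg (· - _) h')
  rw [e]
  refine (norm_sub_le _ _).trans ((add_le_add_left (norm_add_le _ _) _).trans ?_)
  have x1 : N * t + -m' * t' = N * t - m' * t' := by ring
  have x2 : -m' * t + N * t' = N * t' - m' * t := by ring
  rw [x1] at l1
  rw [x2] at l2 l3
  have p1 := exp_pos (N * t - m' * t')
  have p2 := exp_pos (N * t' - m' * t)
  calc _ ≤ C₁ * exp (N * t - m' * t') + C₂ * exp (N * t' - m' * t)
        + C₃ * exp (N * t' - m' * t) := add_le_add (add_le_add l1 l2) l3
    _ ≤ _ := by nlinarith [mul_nonneg hC₁ p2.le, mul_nonneg hC₂ p1.le, mul_nonneg hC₃ p1.le]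

end Phg

open RCLike (conj_to_real)

/-! ### Cone metrics in polar coordinates -/

lemma contDiffAt_dir {x : E3} (hx : x ≠ 0) {n : WithTop ℕ∞} : ContDiffAt ℝ n dir x :=
  ((contDiffAt_norm ℝ hx).inv (norm_ne_zero_iff.2 hx)).smul contDiffAt_id

lemma norm_dir {x : E3} (hx : x ≠ 0) : ‖dir x‖ = 1 := by
  rw [dir, norm_smul, norm_inv, norm_norm, inv_mul_cancel₀ (norm_ne_zero_iff.2 hx)]

lemma dir_smul {c : ℝ} (hc : 0 < c) (x : E3) : dir (c • x) = dir x := by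
  rw [dir, dir, norm_smul, norm_of_nonneg hc.le, smul_smul, mul_inv, mul_comm c⁻¹, mul_assoc,
    inv_mul_cancel₀ hc.ne', mul_one]

lemma dir_of_norm_eq_one {x : E3} (hx : ‖x‖ = 1) : dir x = x := by simp [dir, hx]

lemma norm_smul_dir (x : E3) : ‖x‖ • dir x = x := by
  rcases eq_or_ne x 0 with rfl | h
  · simp
  · rw [dir, smul_smul, mul_inv_cancel₀ (norm_ne_zero_iff.2 h), one_smul]

lemma fderiv_smul_of_homogeneous {F : Type*} [NormedAddCommGroup F] [NormedSpace ℝ F] {A : E3 → F}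
    (hA : ∀ (c : ℝ) (y : E3), 0 < c → A (c • y) = A y) {c : ℝ} (hc : 0 < c) (x v : E3) :
    fderiv ℝ A (c • x) v = c⁻¹ • fderiv ℝ A x v := by
  have h1 : (fun y => A (c • y)) = A := funext fun y => hA c y hc
  have h2 := fderiv_comp_smul (𝕜 := ℝ) (f := A) (x := x) c
  rw [h1] at h2
  rw [h2, smul_apply, smul_smul, inv_mul_cancel₀ hc.ne', one_smul]

lemma fderiv_self_of_homogeneous {F : Type*} [NormedAddCommGroup F] [NormedSpace ℝ F] {A : E3 → F}
    (hA : ∀ (c : ℝ) (y : E3), 0 < c → A (c • y) = A y) {x : E3} (hd : DifferentiableAt ℝ A x) :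
    fderiv ℝ A x x = 0 := by
  have h1 : HasDerivAt (fun t : ℝ => t • x) x 1 := by
    simpa using (hasDerivAt_id (1 : ℝ)).smul_const x
  have h2 : HasDerivAt (fun t : ℝ => A (t • x)) (fderiv ℝ A x x) 1 := by
    have : HasFDerivAt A (fderiv ℝ A x) ((fun t : ℝ => t • x) 1) := by simpa using hd.hasFDerivAt
    exact this.comp_hasDerivAt 1 h1
  have h3 : HasDerivAt (fun t : ℝ => A (t • x)) 0 1 := by
    refine (hasDerivAt_const (1 : ℝ) (A x)).congr_of_eventuallyEq ?_
    filter_upwards [lt_mem_nhds (zero_lt_one)] with t ht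
    exact hA t x ht
  exact h2.unique h3

lemma homogeneous_comp_dir {F : Type*} (f : E3 → F) (c : ℝ) (y : E3) (hc : 0 < c) :
    f (dir (c • y)) = f (dir y) := by rw [dir_smul hc]

lemma sum_mul_coord (x u : E3) : ∑ a, u a * x a = inner ℝ x u := by
  simp [PiLp.inner_apply]

/-- The cone metric as a bilinear form. -/
lemma sum_coneMetric (κ : ℝ) (φ : E3 → ℝ) (F : E3 → E3) (x u v : E3) :
    ∑ a, ∑ b, u a * v b * coneMetric κ φ F x a b = inner ℝ x u * inner ℝ x v / ‖x‖ ^ 2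
      + sn κ ‖x‖ ^ 2 * (exp (2 * φ (dir x)) *
        inner ℝ (fderiv ℝ (fun y => F (dir y)) x u) (fderiv ℝ (fun y => F (dir y)) x v)) := by
  have e : ∀ u, fderiv ℝ (fun y => F (dir y)) x u = ∑ a, u a • fderiv ℝ (fun y => F (dir y)) x (coordVec a) := by
    intro u
    conv_lhs => rw [← sum_smul_coordVec u]
    simp
  rw [e u, e v, ← sum_mul_coord, ← sum_mul_coord]
  simp only [sum_inner, inner_sum, inner_smul_left, inner_smul_right, coneMetric, of_apply]
  simp only [Fin.sum_univ_three, conj_to_real]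
  ring

lemma pullback_coneMetric (κ : ℝ) (φ : E3 → ℝ) (F : E3 → E3) (Φ : E3 → E3) (x : E3) (i j : Fin 3) :
    pullback Φ (coneMetric κ φ F) x i j
      = inner ℝ (Φ x) (fderiv ℝ Φ x (coordVec i)) * inner ℝ (Φ x) (fderiv ℝ Φ x (coordVec j)) / ‖Φ x‖ ^ 2
      + sn κ ‖Φ x‖ ^ 2 * (exp (2 * φ (dir (Φ x))) *
        inner ℝ (fderiv ℝ (fun y => F (dir y)) (Φ x) (fderiv ℝ Φ x (coordVec i)))
          (fderiv ℝ (fun y => F (dir y)) (Φ x) (fderiv ℝ Φ x (coordVec j)))) :=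
  sum_coneMetric κ φ F (Φ x) _ _

/-- The map `(r, s, θ) ↦ r p(s, θ)`. -/
def radialMap (p : ℝ → ℝ → E3) (x : E3) : E3 := x 0 • p (x 1) (x 2)

lemma hasFDerivAt_coord (x : E3) (i : Fin 3) : HasFDerivAt (fun y : E3 => y i) (EuclideanSpace.proj i : E3 →L[ℝ] ℝ) x :=
  (EuclideanSpace.proj i : E3 →L[ℝ] ℝ).hasFDerivAt

lemma contDiff_coord (i : Fin 3) {n : WithTop ℕ∞} : ContDiff ℝ n (fun y : E3 => y i) :=
  (EuclideanSpace.proj i : E3 →L[ℝ] ℝ).contDiff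

lemma continuous_coord (i : Fin 3) : Continuous fun y : E3 => y i := (contDiff_coord i (n := 0)).continuous

lemma contDiffAt_radialMap {p : ℝ → ℝ → E3} {x : E3} {n : WithTop ℕ∞}
    (hp : ContDiffAt ℝ n (fun z : ℝ × ℝ => p z.1 z.2) (x 1, x 2)) :
    ContDiffAt ℝ n (radialMap p) x := by
  refine (contDiff_coord 0).contDiffAt.smul ?_
  exact hp.comp (f := fun y : E3 => (y 1, y 2)) x ((contDiff_coord 1).contDiffAt.prodMk (contDiff_coord 2).contDiffAt)

lemma fderiv_radialMap {p : ℝ → ℝ → E3} {x : E3}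
    (hp : DifferentiableAt ℝ (fun z : ℝ × ℝ => p z.1 z.2) (x 1, x 2)) (v : E3) :
    fderiv ℝ (radialMap p) x v = v 0 • p (x 1) (x 2) + (x 0 * v 1) • deriv (fun s => p s (x 2)) (x 1)
      + (x 0 * v 2) • deriv (fun θ => p (x 1) θ) (x 2) := by
  have hL : HasFDerivAt (fun y : E3 => (y 1, y 2)) ((EuclideanSpace.proj 1 : E3 →L[ℝ] ℝ).prod
      (EuclideanSpace.proj 2 : E3 →L[ℝ] ℝ)) x := (hasFDerivAt_coord x 1).prodMk (hasFDerivAt_coord x 2)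
  have h1 : HasFDerivAt (fun y : E3 => p (y 1) (y 2)) _ x :=
    HasFDerivAt.comp (f := fun y : E3 => (y 1, y 2)) x hp.hasFDerivAt hL
  have h2 : HasFDerivAt (radialMap p) _ x := (hasFDerivAt_coord x 0).smul h1
  have d1 : deriv (fun s => p s (x 2)) (x 1) = fderiv ℝ (fun z : ℝ × ℝ => p z.1 z.2) (x 1, x 2) (1, 0) := by
    have : HasFDerivAt (fun s => p s (x 2)) _ (x 1) :=
      HasFDerivAt.comp (f := fun s : ℝ => (s, x 2)) (x 1) hp.hasFDerivAt (hasFDerivAt_prodMk_left (x 1) (x 2))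
    rw [this.hasDerivAt.deriv]; simp
  have d2 : deriv (fun θ => p (x 1) θ) (x 2) = fderiv ℝ (fun z : ℝ × ℝ => p z.1 z.2) (x 1, x 2) (0, 1) := by
    have : HasFDerivAt (fun θ => p (x 1) θ) _ (x 2) :=
      HasFDerivAt.comp (f := fun θ : ℝ => (x 1, θ)) (x 2) hp.hasFDerivAt (hasFDerivAt_prodMk_right (x 1) (x 2))
    rw [this.hasDerivAt.deriv]; simp
  rw [h2.fderiv, d1, d2]
  have e : (v 1, v 2) = v 1 • ((1 : ℝ), (0 : ℝ)) + v 2 • ((0 : ℝ), (1 : ℝ)) := by simp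
  simp only [add_apply, smul_apply, ContinuousLinearMap.comp_apply, ContinuousLinearMap.prod_apply,
    ContinuousLinearMap.smulRight_apply, PiLp.proj_apply]
  rw [e, map_add, map_smul, map_smul]
  module

/-- The inner product of a curve on the unit sphere with its velocity vanishes. -/
lemma inner_deriv_eq_zero {γ : ℝ → E3} {t : ℝ} (hd : DifferentiableAt ℝ γ t)
    (hn : ∀ᶠ τ in 𝓝 t, ‖γ τ‖ = 1) : inner ℝ (γ t) (deriv γ t) = 0 := by
  have h1 : HasDerivAt (fun τ => inner ℝ (γ τ) (γ τ)) _ t := hd.hasDerivAt.inner ℝ hd.hasDerivAt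
  have h2 : HasDerivAt (fun τ => inner ℝ (γ τ) (γ τ)) (0 : ℝ) t := by
    refine (hasDerivAt_const t (1 : ℝ)).congr_of_eventuallyEq ?_
    filter_upwards [hn] with τ hτ
    rw [real_inner_self_eq_norm_sq, hτ, one_pow]
  have h3 := h1.unique h2
  rw [real_inner_comm (γ t) (deriv γ t)] at h3
  linarith

/-- The metric `dr² + sn_κ² r (E ds² + 2 F ds dθ + G dθ²)`. -/
noncomputable def radialMetric (κ r E F G : ℝ) : Matrix (Fin 3) (Fin 3) ℝ :=
  !![1, 0, 0; 0, sn κ r ^ 2 * E, sn κ r ^ 2 * F; 0, sn κ r ^ 2 * F, sn κ r ^ 2 * G]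

lemma coordVec_apply (i j : Fin 3) : coordVec i j = if j = i then 1 else 0 := by
  simp [coordVec]

lemma pullback_radialMap_coneMetric {κ : ℝ} {φ : E3 → ℝ} {F : E3 → E3} {p : ℝ → ℝ → E3} {x : E3}
    (hx : 0 < x 0) (hp : DifferentiableAt ℝ (fun z : ℝ × ℝ => p z.1 z.2) (x 1, x 2))
    (hn : ∀ᶠ z in 𝓝 (x 1, x 2), ‖p z.1 z.2‖ = 1)
    (hF : DifferentiableAt ℝ (fun y => F (dir y)) (p (x 1) (x 2))) :
    pullback (radialMap p) (coneMetric κ φ F) x = radialMetric κ (x 0)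
      (linkMetric φ F (p (x 1) (x 2)) (deriv (fun s => p s (x 2)) (x 1)) (deriv (fun s => p s (x 2)) (x 1)))
      (linkMetric φ F (p (x 1) (x 2)) (deriv (fun s => p s (x 2)) (x 1)) (deriv (fun θ => p (x 1) θ) (x 2)))
      (linkMetric φ F (p (x 1) (x 2)) (deriv (fun θ => p (x 1) θ) (x 2)) (deriv (fun θ => p (x 1) θ) (x 2)))
      := by
  set P := p (x 1) (x 2) with hP
  have hn0 : ‖P‖ = 1 := hn.self_of_nhds
  have t1 : Tendsto (fun s : ℝ => (s, x 2)) (𝓝 (x 1)) (𝓝 (x 1, x 2)) :=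
    (Continuous.prodMk_left (x 2)).tendsto _
  have t2 : Tendsto (fun θ : ℝ => (x 1, θ)) (𝓝 (x 2)) (𝓝 (x 1, x 2)) :=
    (Continuous.prodMk_right (x 1)).tendsto _
  have o1 : inner ℝ P (deriv (fun s => p s (x 2)) (x 1)) = 0 :=
    inner_deriv_eq_zero (γ := fun s => p s (x 2))
      (hp.comp (f := fun s : ℝ => (s, x 2)) (x 1) (by fun_prop)) (t1.eventually hn)
  have o2 : inner ℝ P (deriv (fun θ => p (x 1) θ) (x 2)) = 0 :=
    inner_deriv_eq_zero (γ := fun θ => p (x 1) θ)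
      (hp.comp (f := fun θ : ℝ => (x 1, θ)) (x 2) (by fun_prop)) (t2.eventually hn)
  have hQ : radialMap p x = x 0 • P := rfl
  have hnQ : ‖x 0 • P‖ = x 0 := by rw [norm_smul, hn0, mul_one, norm_of_nonneg hx.le]
  have hdir : dir (x 0 • P) = P := by rw [dir_smul hx, dir_of_norm_eq_one hn0]
  have hD : ∀ v, fderiv ℝ (fun y => F (dir y)) (x 0 • P) v = (x 0)⁻¹ • fderiv ℝ (fun y => F (dir y)) P v :=
    fun v => fderiv_smul_of_homogeneous (homogeneous_comp_dir F) hx P v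
  have hDP : fderiv ℝ (fun y => F (dir y)) P P = 0 :=
    fderiv_self_of_homogeneous (homogeneous_comp_dir F) hF
  have hPP : inner ℝ P P = (1 : ℝ) := by rw [real_inner_self_eq_norm_sq, hn0, one_pow]
  have hx' := hx.ne'
  ext i j
  rw [pullback_coneMetric, hQ, hnQ, hdir, hD, hD]
  simp only [fderiv_radialMap hp, coordVec_apply, ← hP, radialMetric, linkMetric]
  fin_cases i <;> fin_cases j <;>
    simp [inner_smul_left, inner_smul_right, o1, o2, hDP, hn0, inv_smul_smul₀ hx']
  · field_simp
  · exact Or.inl (real_inner_comm _ _)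

lemma det_radialMetric_ne_zero {κ r E G : ℝ} (hr : sn κ r ≠ 0) (hE : E ≠ 0) (hG : G ≠ 0) :
    (radialMetric κ r E 0 G).det ≠ 0 := by
  simp [radialMetric, Matrix.det_fin_three, hr, hE, hG]

lemma fderiv_id_dir (x v : E3) (hx : x ≠ 0) :
    fderiv ℝ (fun y => id (dir y)) x v = ‖x‖⁻¹ • (v - inner ℝ (dir x) v • dir x) := by
  have hn : HasFDerivAt (fun y : E3 => ‖y‖) (fderiv ℝ (fun y : E3 => ‖y‖) x) x :=
    ((contDiffAt_norm ℝ hx (n := 1)).differentiableAt (by norm_num)).hasFDerivAt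
  have hnv : fderiv ℝ (fun y : E3 => ‖y‖) x v = inner ℝ (dir x) v := by
    have h1 := (hn.mul hn)
    have h2 : HasFDerivAt (fun y : E3 => ‖y‖ * ‖y‖) (2 • (innerSL ℝ x)) x := by
      have := (hasStrictFDerivAt_norm_sq x).hasFDerivAt
      refine this.congr_of_eventuallyEq (Eventually.of_forall fun y => ?_)
      simp [sq]
    have h3 := congrArg (fun L : E3 →L[ℝ] ℝ => L v) (h1.unique h2)
    have hx0 : ‖x‖ ≠ 0 := norm_ne_zero_iff.2 hx
    simp at h3
    rw [dir, inner_smul_left, conj_to_real]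
    field_simp
    linarith
  have h := ((hasDerivAt_inv (norm_ne_zero_iff.2 hx)).comp_hasFDerivAt x hn).smul (hasFDerivAt_id x)
  have h' : fderiv ℝ (fun y => id (dir y)) x = _ := h.fderiv
  rw [h']
  have hx0 : ‖x‖ ≠ 0 := norm_ne_zero_iff.2 hx
  simp only [add_apply, smul_apply, ContinuousLinearMap.smulRight_apply, ContinuousLinearMap.coe_id', id, hnv]
  rw [smul_sub, dir, smul_smul, smul_smul]
  simp only [sub_eq_add_neg, ← neg_smul]
  congr 2
  simp
  field_simp

/-- The cone metric of the conformal class of the round metric. -/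
lemma coneMetric_id (κ : ℝ) (φ : E3 → ℝ) {x : E3} (hx : x ≠ 0) (i j : Fin 3) :
    coneMetric κ φ id x i j = dir x i * dir x j + sn κ ‖x‖ ^ 2 * exp (2 * φ (dir x)) / ‖x‖ ^ 2 *
      ((if i = j then 1 else 0) - dir x i * dir x j) := by
  have hx0 : ‖x‖ ≠ 0 := norm_ne_zero_iff.2 hx
  have hd : inner ℝ (dir x) (dir x) = (1 : ℝ) := by
    rw [real_inner_self_eq_norm_sq, norm_dir hx, one_pow]
  have hc : ∀ i, inner ℝ (dir x) (coordVec i) = dir x i := by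
    intro i; simp [coordVec, EuclideanSpace.inner_single_right]
  have hcc : inner ℝ (coordVec i) (coordVec j) = (if i = j then 1 else 0 : ℝ) := by
    simp [coordVec, EuclideanSpace.inner_single_left]
  have e1 : ∀ i, x i = ‖x‖ * dir x i := fun i => by
    conv_lhs => rw [← norm_smul_dir x]
    simp
  have hc' : ∀ i, inner ℝ (coordVec i) (dir x) = dir x i := fun i => by rw [real_inner_comm, hc]
  rw [coneMetric, of_apply, fderiv_id_dir _ _ hx, fderiv_id_dir _ _ hx]
  simp only [inner_smul_left, inner_smul_right, inner_sub_left, inner_sub_right, hc, hc', hcc, hd, conj_to_real]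
  rw [e1 i, e1 j]
  field_simp
  ring

lemma coneMetric_symm (κ : ℝ) (φ : E3 → ℝ) (F : E3 → E3) (x : E3) (i j : Fin 3) :
    coneMetric κ φ F x i j = coneMetric κ φ F x j i := by
  simp only [coneMetric, of_apply]
  rw [mul_comm (x i), real_inner_comm]

lemma norm_fderiv_eq_of_isometric {A B : E3 → E3} {x : E3} (hA : DifferentiableAt ℝ A x)
    (hB : DifferentiableAt ℝ B x) (h : ∀ᶠ y in 𝓝 x, ‖A y - A x‖ = ‖B y - B x‖) (v : E3) :
    ‖fderiv ℝ A x v‖ = ‖fderiv ℝ B x v‖ := by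
  have hline : HasDerivAt (fun t : ℝ => x + t • v) v 0 := by
    simpa using ((hasDerivAt_id (0 : ℝ)).smul_const v).const_add x
  have key : ∀ {C : E3 → E3}, DifferentiableAt ℝ C x →
      Tendsto (fun t : ℝ => ‖t⁻¹ • (C (x + t • v) - C x)‖) (𝓝[≠] 0) (𝓝 ‖fderiv ℝ C x v‖) := by
    intro C hC
    have h1 : HasFDerivAt C (fderiv ℝ C x) ((fun t : ℝ => x + t • v) 0) := by
      simpa using hC.hasFDerivAt
    have h2 := hasDerivAt_iff_tendsto_slope.1 (h1.comp_hasDerivAt 0 hline)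
    refine (h2.norm).congr fun t => ?_
    simp [slope, vsub_eq_sub]
  have t0 : Tendsto (fun t : ℝ => x + t • v) (𝓝[≠] 0) (𝓝 x) := by
    have := hline.continuousAt.tendsto
    simp only [zero_smul, add_zero] at this
    exact this.mono_left nhdsWithin_le_nhds
  refine tendsto_nhds_unique (key hA) ((key hB).congr' ?_)
  filter_upwards [t0.eventually h] with t ht
  rw [norm_smul, norm_smul, ht]

lemma inner_fderiv_eq_of_isometric {A B : E3 → E3} {x : E3} (hA : DifferentiableAt ℝ A x)
    (hB : DifferentiableAt ℝ B x) (h : ∀ᶠ y in 𝓝 x, ‖A y - A x‖ = ‖B y - B x‖) (v w : E3) :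
    inner ℝ (fderiv ℝ A x v) (fderiv ℝ A x w) = inner ℝ (fderiv ℝ B x v) (fderiv ℝ B x w) := by
  rw [real_inner_eq_norm_add_mul_self_sub_norm_mul_self_sub_norm_mul_self_div_two,
    real_inner_eq_norm_add_mul_self_sub_norm_mul_self_sub_norm_mul_self_div_two, ← map_add,
    ← map_add]
  simp only [norm_fderiv_eq_of_isometric hA hB h]

open InnerProductGeometry (angle angle_self)
open Function (Periodic)

/-! ### Polar discs around cone points -/

lemma exists_hasStrictFDerivAt_equiv {Φ : E3 → E3} {x : E3} (hΦ : ContDiffAt ℝ ∞ Φ x) (hJ : (jac Φ x).det ≠ 0) :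
    ∃ L : E3 ≃L[ℝ] E3, HasStrictFDerivAt Φ (L : E3 →L[ℝ] E3) x := by
  refine ⟨(fderiv ℝ Φ x).toContinuousLinearEquivOfDetNeZero (by rwa [det_fderiv_eq]), ?_⟩
  rw [ContinuousLinearMap.coe_toContinuousLinearEquivOfDetNeZero]
  exact hΦ.hasStrictFDerivAt (by simp)

/-- The inverse function theorem, in terms of the Jacobian matrix. -/
lemma exists_local_inverse {Φ : E3 → E3} {x : E3} (hΦ : ContDiffAt ℝ ∞ Φ x) (hJ : (jac Φ x).det ≠ 0) :
    ∃ Ψ : E3 → E3, ContDiffAt ℝ ∞ Ψ (Φ x) ∧ Ψ (Φ x) = x ∧ (∀ᶠ y in 𝓝 (Φ x), Φ (Ψ y) = y) ∧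
      ∀ᶠ z in 𝓝 x, Ψ (Φ z) = z := by
  obtain ⟨L, hL⟩ := exists_hasStrictFDerivAt_equiv hΦ hJ
  exact ⟨_, hΦ.to_localInverse hL.hasFDerivAt (by simp), hΦ.localInverse_apply_image hL.hasFDerivAt (by simp),
    hL.eventually_right_inverse, hL.eventually_left_inverse⟩

lemma map_nhds_eq {Φ : E3 → E3} {x : E3} (hΦ : ContDiffAt ℝ ∞ Φ x) (hJ : (jac Φ x).det ≠ 0) :
    map Φ (𝓝 x) = 𝓝 (Φ x) := by
  obtain ⟨L, hL⟩ := exists_hasStrictFDerivAt_equiv hΦ hJ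
  exact hL.map_nhds_eq_of_equiv

lemma sum_pullback (Φ : E3 → E3) (k : TensorField) (x v w : E3) :
    ∑ a, ∑ b, (fderiv ℝ Φ x v) a * (fderiv ℝ Φ x w) b * k (Φ x) a b = ∑ i, ∑ j, v i * w j * pullback Φ k x i j := by
  have e : ∀ (v : E3) a, (fderiv ℝ Φ x v) a = ∑ i, v i * (fderiv ℝ Φ x (coordVec i)) a := by
    intro v a
    conv_lhs => rw [← sum_smul_coordVec v]
    simp
  simp only [e v, e w, pullback_apply, jac, of_apply, Fin.sum_univ_three]
  ring

namespace IsConePolar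

variable {ι : Type*} {J : Set ι} {q : ι → E3} {φ : E3 → ℝ} {j₀ : ι} {α s₀ : ℝ} {P : ℝ → ℝ → E3} {F : E3 → E3}

lemma contDiffAt (h : IsConePolar J q φ F j₀ α s₀ P) {s : ℝ} (hs : s ∈ Ioo 0 s₀)
    (θ : ℝ) : ContDiffAt ℝ ∞ (fun z : ℝ × ℝ => P z.1 z.2) (s, θ) :=
  h.smooth.contDiffAt ((isOpen_Ioo.prod isOpen_univ).mem_nhds ⟨hs, mem_univ _⟩)

lemma contDiffAt_radialMap (h : IsConePolar J q φ F j₀ α s₀ P) {x : E3}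
    (hs : x 1 ∈ Ioo 0 s₀) : ContDiffAt ℝ ∞ (radialMap P) x :=
  _root_.contDiffAt_radialMap (h.contDiffAt hs _)

lemma eventually_norm_eq (h : IsConePolar J q φ F j₀ α s₀ P) {s : ℝ}
    (hs : s ∈ Ioo 0 s₀) (θ : ℝ) : ∀ᶠ z : ℝ × ℝ in 𝓝 (s, θ), ‖P z.1 z.2‖ = 1 := by
  filter_upwards [(isOpen_Ioo.prod isOpen_univ).mem_nhds (⟨hs, mem_univ θ⟩ : (s, θ) ∈ Ioo 0 s₀ ×ˢ univ)]
    with z hz using h.norm_eq _ hz.1 _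

lemma ne_zero (h : IsConePolar J q φ F j₀ α s₀ P) {s : ℝ} (hs : s ∈ Ioo 0 s₀)
    (θ : ℝ) : P s θ ≠ 0 := norm_ne_zero_iff.1 (by rw [h.norm_eq s hs]; norm_num)

lemma dir_eq (h : IsConePolar J q φ F j₀ α s₀ P) {s : ℝ} (hs : s ∈ Ioo 0 s₀)
    (θ : ℝ) : dir (P s θ) = P s θ := dir_of_norm_eq_one (h.norm_eq s hs θ)

lemma pullback_coneMetric (h : IsConePolar J q φ F j₀ α s₀ P) (κ : ℝ)
    (hF : ContDiffOn ℝ ∞ (fun x => F (dir x)) {x | x ≠ 0}) {x : E3} (hr : 0 < x 0)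
    (hs : x 1 ∈ Ioo 0 s₀) :
    pullback (radialMap P) (coneMetric κ φ F) x = radialMetric κ (x 0) 1 0 (sin (x 1) ^ 2) := by
  rw [pullback_radialMap_coneMetric hr ((h.contDiffAt hs _).differentiableAt (by simp))
    (h.eventually_norm_eq hs _), h.metric_ss _ hs, h.metric_sθ _ hs, h.metric_θθ _ hs]
  exact (hF.contDiffAt (isOpen_ne.mem_nhds (h.ne_zero hs _))).differentiableAt (by simp)

lemma contDiffOn_id_dir : ContDiffOn ℝ ∞ (fun x => (id (dir x) : E3)) {x | x ≠ 0} :=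
  fun _ hx => (contDiffAt_dir hx).contDiffWithinAt

lemma sin_pos (_ : IsConePolar J q φ F j₀ α s₀ P) (hπ : s₀ ≤ π / 2) {s : ℝ} (hs : s ∈ Ioo 0 s₀) : 0 < sin s :=
  sin_pos_of_pos_of_lt_pi hs.1 (by linarith [hs.2, pi_pos])

/-- `(r, s, θ) ↦ r P(s, θ)` is a local diffeomorphism. -/
lemma det_jac_ne_zero (h : IsConePolar J q φ id j₀ α s₀ P) (hπ : s₀ ≤ π / 2) {x : E3}
    (hr : 0 < x 0) (hs : x 1 ∈ Ioo 0 s₀) : (jac (radialMap P) x).det ≠ 0 := by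
  have h1 := congrArg Matrix.det (h.pullback_coneMetric 0 contDiffOn_id_dir hr hs)
  rw [pullback_eq_mul, Matrix.det_mul, Matrix.det_mul, Matrix.det_transpose] at h1
  have h2 : (radialMetric 0 (x 0) 1 0 (sin (x 1) ^ 2)).det ≠ 0 :=
    det_radialMetric_ne_zero (by simpa [sn] using hr.ne') one_ne_zero (pow_ne_zero 2 (h.sin_pos hπ hs).ne')
  intro h3
  rw [← h1, h3] at h2
  simp at h2

/-- The cone over the polar region `s ∈ U`. -/
def sector (P : ℝ → ℝ → E3) (U : Set ℝ) : Set E3 := {x | x ≠ 0 ∧ ∃ s ∈ U, ∃ θ, dir x = P s θ}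

lemma isOpen_sector (h : IsConePolar J q φ id j₀ α s₀ P) (hπ : s₀ ≤ π / 2) {U : Set ℝ}
    (hU : IsOpen U) (hUs : U ⊆ Ioo 0 s₀) : IsOpen (sector P U) := by
  rw [isOpen_iff_mem_nhds]
  rintro x ⟨hx, s, hs, θ, hsθ⟩
  have hr : 0 < ‖x‖ := norm_pos_iff.2 hx
  have hxe : radialMap P !₂[‖x‖, s, θ] = x := by simp [radialMap, ← hsθ, norm_smul_dir]
  have hm := map_nhds_eq (x := !₂[‖x‖, s, θ]) (h.contDiffAt_radialMap (by simpa using hUs hs))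
    (h.det_jac_ne_zero hπ (by simpa using hr) (by simpa using hUs hs))
  rw [hxe] at hm
  rw [← hm, mem_map]
  have c0 : ∀ᶠ z : E3 in 𝓝 !₂[‖x‖, s, θ], 0 < z 0 :=
    (continuous_coord 0).tendsto _ |>.eventually (lt_mem_nhds (by simpa using hr))
  have c1 : ∀ᶠ z : E3 in 𝓝 !₂[‖x‖, s, θ], z 1 ∈ U :=
    (contDiff_coord 1 (n := 0)).continuous.tendsto _ |>.eventually (hU.mem_nhds (by simpa using hs))
  filter_upwards [c0, c1] with z hz0 hz1
  have hs' := hUs hz1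
  refine ⟨smul_ne_zero hz0.ne' (h.ne_zero hs' _), z 1, hz1, z 2, ?_⟩
  rw [radialMap, dir_smul hz0, h.dir_eq hs']

lemma exists_mem_Ico (h : IsConePolar J q φ id j₀ α s₀ P) (hα : 0 < α) {s : ℝ} (hs : s ∈ Ioo 0 s₀)
    (θ : ℝ) : ∃ θ' ∈ Ico 0 α, P s θ' = P s θ := by
  have hp : Periodic (P s) α := fun θ => h.periodic s hs θ
  obtain ⟨y, hy, he⟩ := hp.exists_mem_Ico₀ hα θ
  exact ⟨y, hy, he.symm⟩

lemma isCompact_image (h : IsConePolar J q φ id j₀ α s₀ P) (hα : 0 < α) {σ σ' : ℝ} (h1 : 0 < σ)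
    (h2 : σ' < s₀) : IsCompact {ξ | ∃ s ∈ Icc σ σ', ∃ θ, P s θ = ξ} := by
  have : {ξ | ∃ s ∈ Icc σ σ', ∃ θ, P s θ = ξ} = (fun z : ℝ × ℝ => P z.1 z.2) '' (Icc σ σ' ×ˢ Icc 0 α) := by
    ext ξ
    constructor
    · rintro ⟨s, hs, θ, rfl⟩
      obtain ⟨θ', hθ', he⟩ := h.exists_mem_Ico hα ⟨h1.trans_le hs.1, hs.2.trans_lt h2⟩ θ
      exact ⟨(s, θ'), ⟨hs, Ico_subset_Icc_self hθ'⟩, he⟩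
    · rintro ⟨z, hz, rfl⟩
      exact ⟨z.1, hz.1, z.2, rfl⟩
  rw [this]
  refine (isCompact_Icc.prod isCompact_Icc).image_of_continuousOn (h.smooth.continuousOn.mono ?_)
  exact fun z hz => ⟨⟨h1.trans_le hz.1.1, hz.1.2.trans_lt h2⟩, mem_univ _⟩

/-- A direction which is not in the closed polar disc of radius `σ'` has a neighbourhood outside this
disc. -/
lemma eventually_notMem_sector (h : IsConePolar J q φ id j₀ α s₀ P) (hα : 0 < α) {σ' : ℝ}
    (h2 : σ' < s₀) {x : E3} (hx : x ≠ 0) (hq : dir x ≠ q j₀) (hxs : x ∉ sector P (Ioc 0 σ')) :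
    ∀ᶠ y in 𝓝 x, y ∉ sector P (Ioc 0 σ') := by
  have hd : 0 < ‖dir x - q j₀‖ := norm_pos_iff.2 (sub_ne_zero.2 hq)
  obtain ⟨σ, hσ, hσ2⟩ := h.tendsto (‖dir x - q j₀‖ / 2) (by positivity)
  have hcont : ContinuousAt dir x := (contDiffAt_dir hx (n := 0)).continuousAt
  have e1 : ∀ᶠ y in 𝓝 x, ‖dir x - q j₀‖ / 2 < ‖dir y - q j₀‖ :=
    ((hcont.sub_const (q j₀)).norm).eventually (lt_mem_nhds (by linarith))
  have e2 : ∀ᶠ y in 𝓝 x, dir y ∉ {ξ | ∃ s ∈ Icc σ σ', ∃ θ, P s θ = ξ} := by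
    refine hcont.eventually ((h.isCompact_image hα hσ h2).isClosed.isOpen_compl.mem_nhds ?_)
    rintro ⟨s, hs, θ, he⟩
    exact hxs ⟨hx, s, ⟨hσ.trans_le hs.1, hs.2⟩, θ, he.symm⟩
  filter_upwards [e1, e2] with y h3 h4
  rintro ⟨-, s, hs, θ, he⟩
  rcases lt_or_ge s σ with h5 | h5
  · have := hσ2 s ⟨hs.1, hs.2.trans_lt h2⟩ h5 θ
    rw [← he] at this
    linarith
  · exact h4 ⟨s, ⟨h5, hs.2⟩, θ, he.symm⟩

/-- A punctured spherical cap. -/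
lemma exists_isPreconnected_cap {ξ₀ : E3} (hξ₀ : ‖ξ₀‖ = 1) {δ : ℝ} (hδ : 0 < δ) :
    ∃ C : Set E3, IsPreconnected C ∧ (∀ ξ ∈ C, ‖ξ‖ = 1 ∧ ξ ≠ ξ₀ ∧ ‖ξ - ξ₀‖ < δ) ∧
      ∃ δ' > 0, ∀ ξ : E3, ‖ξ‖ = 1 → ξ ≠ ξ₀ → ‖ξ - ξ₀‖ < δ' → ξ ∈ C := by
  have h00 : ξ₀ ≠ 0 := norm_ne_zero_iff.1 (by rw [hξ₀]; norm_num)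
  have hin : inner ℝ ξ₀ ξ₀ = (1 : ℝ) := by rw [real_inner_self_eq_norm_sq, hξ₀, one_pow]
  have hdir0 : dir ξ₀ = ξ₀ := dir_of_norm_eq_one hξ₀
  obtain ⟨c, hc, hc2⟩ : ∃ c > 0, ∀ v : E3, ‖v‖ < c → ‖dir (ξ₀ + v) - ξ₀‖ < δ := by
    have : ContinuousAt dir ξ₀ := (contDiffAt_dir h00 (n := 0)).continuousAt
    obtain ⟨c, hc, h⟩ := Metric.continuousAt_iff.1 this δ hδ
    refine ⟨c, hc, fun v hv => ?_⟩
    have := h (x := ξ₀ + v) (by simpa [dist_eq_norm] using hv)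
    rwa [hdir0, dist_eq_norm] at this
  let W := (Submodule.span ℝ {ξ₀})ᗮ
  have hW : ∀ w : W, inner ℝ ξ₀ (w : E3) = 0 := fun w =>
    Submodule.mem_orthogonal_singleton_iff_inner_right.1 w.2
  let m : W → E3 := fun w => (c / (1 + ‖w‖)) • (w : E3)
  have hm : ∀ w, inner ℝ ξ₀ (m w) = 0 := fun w => by simp [m, inner_smul_right, hW]
  have hne : ∀ v : E3, inner ℝ ξ₀ v = (0 : ℝ) → ξ₀ + v ≠ 0 := by
    intro v hv h0
    have := congrArg (fun u => (inner ℝ ξ₀ u : ℝ)) h0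
    simp [inner_add_right, hv, hξ₀] at this
  have hinj : ∀ v : E3, inner ℝ ξ₀ v = (0 : ℝ) → dir (ξ₀ + v) = ξ₀ → v = 0 := by
    intro v hv h0
    have e := norm_smul_dir (ξ₀ + v)
    rw [h0] at e
    have h1 := congrArg (fun u => (inner ℝ ξ₀ u : ℝ)) e
    simp only [inner_smul_right, hin, inner_add_right, hv] at h1
    have h2 : ‖ξ₀ + v‖ = 1 := by linarith
    rw [h2, one_smul] at e
    simpa using e.symm
  refine ⟨(fun w => dir (ξ₀ + m w)) '' ({0}ᶜ : Set W), ?_, ?_, ?_⟩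
  · refine IsPreconnected.image ?_ _ ?_
    · have : Fact (Module.finrank ℝ E3 = 2 + 1) := ⟨by simp⟩
      refine (isConnected_compl_singleton_of_one_lt_rank ?_ _).isPreconnected
      have h2 : Module.finrank ℝ W = 2 := Submodule.finrank_orthogonal_span_singleton h00
      rw [← Module.finrank_eq_rank, h2]
      norm_num
    · intro w _
      have h1 : ContinuousAt dir (ξ₀ + m w) :=
        (contDiffAt_dir (hne _ (hm w)) (n := 0)).continuousAt
      have h2 : Continuous fun w : W => ξ₀ + m w := by
        refine continuous_const.add (Continuous.smul (f := fun w : W => c / (1 + ‖w‖)) ?_ continuous_subtype_val)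
        exact continuous_const.div (by fun_prop) fun w => by positivity
      exact (ContinuousAt.comp (f := fun w : W => ξ₀ + m w) h1 h2.continuousAt).continuousWithinAt
  · rintro ξ ⟨w, hw, rfl⟩
    refine ⟨norm_dir (hne _ (hm w)), fun h0 => hw ?_, hc2 _ ?_⟩
    · have := hinj _ (hm w) h0
      have h3 : c / (1 + ‖w‖) ≠ 0 := by positivity
      exact Subtype.ext ((smul_eq_zero.1 this).resolve_left h3)
    · have h3 : 0 < c / (1 + ‖w‖) := by positivity
      rw [norm_smul, norm_of_nonneg h3.le, Submodule.coe_norm, div_mul_eq_mul_div, div_lt_iff₀ (by positivity)]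
      nlinarith [norm_nonneg (w : E3)]
  · have hcont : ContinuousAt (fun ξ : E3 => ((inner ℝ ξ₀ ξ : ℝ), ‖(inner ℝ ξ₀ ξ : ℝ)⁻¹ • ξ - ξ₀‖)) ξ₀ := by
      have h1 : ContinuousAt (fun ξ : E3 => (inner ℝ ξ₀ ξ : ℝ)) ξ₀ := by fun_prop
      exact h1.prodMk (((h1.inv₀ (by simp [hξ₀])).smul continuousAt_id).sub_const _).norm
    have h1 := hcont.eventually ((isOpen_Ioi.prod isOpen_Iio).mem_nhds
      (show ((inner ℝ ξ₀ ξ₀ : ℝ), ‖(inner ℝ ξ₀ ξ₀ : ℝ)⁻¹ • ξ₀ - ξ₀‖) ∈ Ioi (0 : ℝ) ×ˢ Iio c by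
        rw [hin]; simpa using hc))
    obtain ⟨δ', hδ', h2⟩ := Metric.eventually_nhds_iff.1 h1
    refine ⟨δ', hδ', fun ξ hξ hne' hd => ?_⟩
    obtain ⟨h3, h4⟩ := h2 (by rwa [dist_eq_norm] : dist ξ ξ₀ < δ')
    simp only [mem_Ioi, mem_Iio] at h3 h4
    set d : ℝ := inner ℝ ξ₀ ξ with hdd
    set v : E3 := d⁻¹ • ξ - ξ₀ with hv
    have hvW : inner ℝ ξ₀ v = (0 : ℝ) := by
      rw [hv, inner_sub_right, inner_smul_right, hin, ← hdd, inv_mul_cancel₀ h3.ne', sub_self]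
    have hdv : dir (ξ₀ + v) = ξ := by
      rw [hv, add_sub_cancel, dir_smul (inv_pos.2 h3), dir_of_norm_eq_one hξ]
    have hcv : 0 < c - ‖v‖ := by linarith
    have hmem : (c - ‖v‖)⁻¹ • v ∈ W :=
      Submodule.mem_orthogonal_singleton_iff_inner_right.2 (by rw [inner_smul_right, hvW, mul_zero])
    refine ⟨⟨(c - ‖v‖)⁻¹ • v, hmem⟩, ?_, ?_⟩
    · intro h5
      have h6 : (c - ‖v‖)⁻¹ • v = 0 := congrArg Subtype.val h5
      rw [smul_eq_zero] at h6
      rcases h6 with h6 | h6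
      · exact hcv.ne' (inv_eq_zero.1 h6)
      · rw [h6, add_zero, hdir0] at hdv
        exact hne' hdv.symm
    · have h7 : m ⟨(c - ‖v‖)⁻¹ • v, hmem⟩ = v := by
        simp only [m, Submodule.coe_norm]
        rw [norm_smul, norm_inv, norm_of_nonneg hcv.le, smul_smul]
        have : c / (1 + (c - ‖v‖)⁻¹ * ‖v‖) * (c - ‖v‖)⁻¹ = 1 := by
          have : 1 + (c - ‖v‖)⁻¹ * ‖v‖ = c / (c - ‖v‖) := by field_simp; ring
          rw [this]; field_simp
        rw [this, one_smul]
      simp only [h7, hdv]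

/-- Unit vectors close to the cone point have a small polar radius. -/
lemma exists_small (h : IsConePolar J q φ id j₀ α s₀ P) (hπ : s₀ ≤ π / 2) (hα : 0 < α)
    (hj : j₀ ∈ J) (hq : ‖q j₀‖ = 1) {σ : ℝ} (hσ : σ ∈ Ioo 0 s₀) :
    ∃ δ > 0, ∀ ξ : E3, ‖ξ‖ = 1 → ξ ≠ q j₀ → ‖ξ - q j₀‖ < δ → ∃ s ∈ Ioo 0 σ, ∃ θ, P s θ = ξ := by
  obtain ⟨δ₀, hδ₀, h0⟩ := h.nhds
  obtain ⟨δ₁, hδ₁, h1⟩ : ∃ δ₁ > 0, ∀ θ, δ₁ ≤ ‖P σ θ - q j₀‖ := by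
    have hcl := (h.isCompact_image hα hσ.1 hσ.2 (σ := σ) (σ' := σ)).isClosed
    have hm : q j₀ ∈ {ξ | ∃ s ∈ Icc σ σ, ∃ θ, P s θ = ξ}ᶜ := by
      rintro ⟨s, hs, θ, he⟩
      have : s = σ := le_antisymm hs.2 hs.1
      exact h.regular σ hσ θ j₀ hj (this ▸ he)
    obtain ⟨δ₁, hδ₁, hb⟩ := Metric.isOpen_iff.1 hcl.isOpen_compl _ hm
    refine ⟨δ₁, hδ₁, fun θ => ?_⟩
    by_contra! hlt
    exact hb (by rwa [Metric.mem_ball, dist_eq_norm]) ⟨σ, ⟨le_rfl, le_rfl⟩, θ, rfl⟩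
  obtain ⟨C, hC, hC1, δ', hδ', hC2⟩ := exists_isPreconnected_cap hq (lt_min hδ₀ hδ₁)
  have hsub : C ⊆ sector P (Ioo 0 σ) := by
    refine hC.subset_left_of_subset_union (h.isOpen_sector hπ isOpen_Ioo (Ioo_subset_Ioo_right hσ.2.le))
      (h.isOpen_sector hπ isOpen_Ioo (Ioo_subset_Ioo_left hσ.1.le)) ?_ ?_ ?_ (v := sector P (Ioo σ s₀))
    · rw [Set.disjoint_left]
      rintro x ⟨-, s, hs, θ, e⟩ ⟨-, s', hs', θ', e'⟩
      have := (h.injective s ⟨hs.1, hs.2.trans hσ.2⟩ s' ⟨hσ.1.trans hs'.1, hs'.2⟩ θ θ' (e ▸ e')).1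
      linarith [hs.2, hs'.1]
    · intro ξ hξ
      obtain ⟨hn, hne, hlt⟩ := hC1 ξ hξ
      obtain ⟨s, hs, θ, he⟩ := h0 ξ hn hne (hlt.trans_le (min_le_left _ _))
      have hξ0 : ξ ≠ 0 := norm_ne_zero_iff.1 (by rw [hn]; norm_num)
      rcases lt_trichotomy s σ with h5 | h5 | h5
      · exact Or.inl ⟨hξ0, s, ⟨hs.1, h5⟩, θ, by rw [dir_of_norm_eq_one hn, he]⟩
      · have := h1 θ
        rw [← h5, he] at this
        exact absurd (hlt.trans_le (min_le_right _ _)) (not_lt.2 this)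
      · exact Or.inr ⟨hξ0, s, ⟨h5, hs.2⟩, θ, by rw [dir_of_norm_eq_one hn, he]⟩
    · obtain ⟨σ₂, hσ₂, h2⟩ := h.tendsto δ' hδ'
      have hm : min σ₂ σ / 2 ∈ Ioo 0 σ := ⟨by have := lt_min hσ₂ hσ.1; linarith, by
        have := min_le_right σ₂ σ; have := hσ.1; linarith⟩
      have hm' : min σ₂ σ / 2 ∈ Ioo 0 s₀ := ⟨hm.1, hm.2.trans hσ.2⟩
      refine ⟨P (min σ₂ σ / 2) 0, hC2 _ (h.norm_eq _ hm' _) (h.regular _ hm' _ _ hj)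
        (h2 _ hm' (by have := min_le_left σ₂ σ; have := hm.1; linarith) _), h.ne_zero hm' _, _, hm, 0,
        h.dir_eq hm' _⟩
  refine ⟨δ', hδ', fun ξ hn hne hlt => ?_⟩
  obtain ⟨-, s, hs, θ, he⟩ := hsub (hC2 ξ hn hne hlt)
  exact ⟨s, hs, θ, by rw [← he, dir_of_norm_eq_one hn]⟩

lemma exists_angle_lt (h : IsConePolar J q φ F j₀ α s₀ P) (hq : ‖q j₀‖ = 1) {ψ : ℝ}
    (hψ : 0 < ψ) : ∃ σ > 0, ∀ s ∈ Ioo 0 s₀, s < σ → ∀ θ, angle (P s θ) (q j₀) < ψ := by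
  have hq0 : q j₀ ≠ 0 := norm_ne_zero_iff.1 (by rw [hq]; norm_num)
  have hca : ContinuousAt (fun ξ => angle ξ (q j₀)) (q j₀) :=
    ContinuousAt.comp (f := fun ξ : E3 => (ξ, q j₀)) (InnerProductGeometry.continuousAt_angle hq0 hq0)
      (continuousAt_id.prodMk continuousAt_const)
  have e := hca.eventually (gt_mem_nhds (by simpa [angle_self hq0] using hψ : angle (q j₀) (q j₀) < ψ))
  obtain ⟨δ₂, hδ₂, h3⟩ := Metric.eventually_nhds_iff.1 e
  obtain ⟨σ, hσ, h4⟩ := h.tendsto δ₂ hδ₂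
  exact ⟨σ, hσ, fun s hs hlt θ => h3 (by rw [dist_eq_norm]; exact h4 s hs hlt θ)⟩

/-- The polar radius is bounded by a power of the angle to the cone point: the great circle arc from
the cone point of length `ψ` has `h`-length at most `∫₀^ψ C u^(α/2π - 1) du`. -/
lemma exists_le_angle_rpow (h : IsConePolar J q φ id j₀ α s₀ P) (hπ : s₀ ≤ π / 2) (hα : 0 < α)
    (hj : j₀ ∈ J) (hq : ‖q j₀‖ = 1) (hs₀ : 0 < s₀)
    (hlog : ∃ C, ∃ δ > 0, ∀ ξ : E3, ‖ξ‖ = 1 → 0 < angle ξ (q j₀) → angle ξ (q j₀) < δ →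
      |φ ξ - (α / (2 * π) - 1) * log (angle ξ (q j₀))| ≤ C) :
    ∃ C > 0, ∃ σ ∈ Ioo 0 s₀, ∀ s ∈ Ioo 0 σ, ∀ θ, 0 < angle (P s θ) (q j₀) ∧
      s ≤ C * angle (P s θ) (q j₀) ^ (α / (2 * π)) := by
  obtain ⟨C, δ, hδ, hC⟩ := hlog
  have hπ0 := pi_pos
  set β := α / (2 * π) with hβ
  have hβ0 : 0 < β := by positivity
  have hqq : inner ℝ (q j₀) (q j₀) = (1 : ℝ) := by rw [real_inner_self_eq_norm_sq, hq, one_pow]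
  obtain ⟨δ₁, hδ₁, h1⟩ := h.exists_small hπ hα hj hq (σ := s₀ / 2) ⟨by linarith, by linarith⟩
  -- great circle arcs of length `ψ₀` stay in the polar disc
  set ψ₀ := min (min δ 1) (δ₁ / 2) with hψ₀
  have hψ₀0 : 0 < ψ₀ := by positivity
  have hψδ : ψ₀ ≤ δ := (min_le_left _ _).trans (min_le_left _ _)
  have hψ1 : ψ₀ ≤ 1 := (min_le_left _ _).trans (min_le_right _ _)
  have hψδ₁ : ψ₀ < δ₁ := (min_le_right _ _).trans_lt (by linarith)
  obtain ⟨σ, hσ, h2⟩ := h.exists_angle_lt hq hψ₀0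
  refine ⟨exp C / β, by positivity, min σ (s₀ / 2), ⟨lt_min hσ (by linarith),
    (min_le_right _ _).trans_lt (by linarith)⟩, fun s hs θ => ?_⟩
  have hss : s ∈ Ioo 0 s₀ := ⟨hs.1, hs.2.trans_le ((min_le_right _ _).trans (by linarith))⟩
  set ψ := angle (P s θ) (q j₀) with hψ
  have hψlt : ψ < ψ₀ := h2 s hss (hs.2.trans_le (min_le_left _ _)) θ
  have hn1 := h.norm_eq s hss θ
  have hcosψ : inner ℝ (q j₀) (P s θ) = cos ψ := by
    have := InnerProductGeometry.cos_angle (P s θ) (q j₀)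
    rw [hψ, this, hn1, hq, real_inner_comm]; simp
  have hψ0 : 0 < ψ := by
    refine lt_of_le_of_ne (InnerProductGeometry.angle_nonneg _ _) fun h0 => ?_
    have h3 := InnerProductGeometry.angle_eq_zero_iff.1 h0.symm
    obtain ⟨-, r, hr, he⟩ := h3
    have hnr := congrArg norm he
    rw [norm_smul, hq, hn1, norm_of_nonneg hr.le, mul_one] at hnr
    rw [← hnr, one_smul] at he
    exact h.regular s hss θ j₀ hj he.symm
  have hsinψ : 0 < sin ψ := sin_pos_of_pos_of_lt_pi hψ0 (by linarith [pi_gt_three])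
  refine ⟨hψ0, ?_⟩
  -- the great circle arc through `P s θ`
  set v : E3 := (sin ψ)⁻¹ • (P s θ - cos ψ • q j₀) with hv
  have hqv : inner ℝ (q j₀) v = (0 : ℝ) := by
    rw [hv, inner_smul_right, inner_sub_right, inner_smul_right, hqq, hcosψ]; ring
  have hvv : inner ℝ v v = (1 : ℝ) := by
    have e1 : inner ℝ (P s θ) (P s θ) = (1 : ℝ) := by rw [real_inner_self_eq_norm_sq, hn1, one_pow]
    rw [hv]
    simp only [inner_smul_right, inner_smul_left, inner_sub_right, inner_sub_left, hqq, hcosψ,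
      real_inner_comm (q j₀) (P s θ), e1, conj_to_real]
    have := sin_sq_add_cos_sq ψ
    field_simp
    linarith
  have hvq : inner ℝ v (q j₀) = (0 : ℝ) := by rw [real_inner_comm, hqv]
  set γ : ℝ → E3 := fun u => cos u • q j₀ + sin u • v with hγ
  have hγn : ∀ u, ‖γ u‖ = 1 := by
    intro u
    have : ‖γ u‖ ^ 2 = 1 := by
      rw [← real_inner_self_eq_norm_sq, hγ]
      simp only [inner_add_left, inner_add_right, inner_smul_left, inner_smul_right, hqq, hvv, hqv, hvq, conj_to_real]
      linarith [sin_sq_add_cos_sq u]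
    exact (pow_eq_one_iff_of_nonneg (norm_nonneg _) two_ne_zero).1 this
  have hγψ : γ ψ = P s θ := by
    simp only [hγ, hv, smul_smul, mul_inv_cancel₀ hsinψ.ne', one_smul]
    abel
  have hγin : ∀ u, inner ℝ (γ u) (q j₀) = cos u := by
    intro u
    simp [hγ, inner_add_left, inner_smul_left, hvq, hq]
  have hγang : ∀ u ∈ Ioo 0 ψ₀, angle (γ u) (q j₀) = u := by
    intro u hu
    rw [angle, hγin, hγn, hq]
    simp only [mul_one, div_one]
    exact arccos_cos hu.1.le (by linarith [hu.2, pi_gt_three])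
  have hγd : ∀ u, HasDerivAt γ (-sin u • q j₀ + cos u • v) u := fun u =>
    ((hasDerivAt_cos u).smul_const _).add ((hasDerivAt_sin u).smul_const _)
  have hγdn : ∀ u, ‖-sin u • q j₀ + cos u • v‖ = 1 := by
    intro u
    have : ‖-sin u • q j₀ + cos u • v‖ ^ 2 = 1 := by
      rw [← real_inner_self_eq_norm_sq]
      simp only [inner_add_left, inner_add_right, inner_smul_left, inner_smul_right, hqq, hvv, hqv, hvq, conj_to_real]
      linarith [sin_sq_add_cos_sq u]
    exact (pow_eq_one_iff_of_nonneg (norm_nonneg _) two_ne_zero).1 this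
  have hγq : ∀ u ∈ Ioo 0 ψ₀, γ u ≠ q j₀ := by
    intro u hu he
    have h3 := hγang u hu
    rw [he, angle_self (norm_ne_zero_iff.1 (by rw [hq]; norm_num))] at h3
    exact hu.1.ne h3
  have hγ0 : γ 0 = q j₀ := by simp [hγ]
  have hγclose : ∀ u ∈ Ioo 0 ψ₀, ‖γ u - q j₀‖ ≤ u := by
    intro u hu
    have h3 := (convex_univ (𝕜 := ℝ) (E := ℝ)).norm_image_sub_le_of_norm_hasDerivWithin_le
      (f := γ) (C := 1) (fun u _ => (hγd u).hasDerivWithinAt) (fun u _ => (hγdn u).le)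
      (mem_univ 0) (mem_univ u)
    rw [hγ0] at h3
    simpa [norm_of_nonneg hu.1.le] using h3
  have hex : ∀ u ∈ Ioo 0 ψ₀, ∃ s ∈ Ioo 0 (s₀ / 2), ∃ θ, P s θ = γ u := fun u hu =>
    h1 _ (hγn u) (hγq u hu) ((hγclose u hu).trans_lt (hu.2.trans hψδ₁))
  choose! S hS using hex
  have hSS : ∀ u ∈ Ioo 0 ψ₀, S u ∈ Ioo 0 s₀ := fun u hu =>
    ⟨(hS u hu).1.1, by linarith [(hS u hu).1.2]⟩
  -- the polar radius along the arc has derivative at most `exp φ`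
  have hder : ∀ u ∈ Ioo 0 ψ₀, ∃ S', HasDerivAt S S' u ∧ S' ≤ exp C * u ^ (β - 1) := by
    intro u hu
    obtain ⟨θ', hθ'⟩ := (hS u hu).2
    set x : E3 := !₂[1, S u, θ'] with hx
    have hx1 : x 1 ∈ Ioo 0 s₀ := by simpa [hx] using hSS u hu
    have hx0 : 0 < x 0 := by simp [hx]
    have hxe : radialMap P x = γ u := by simp [radialMap, hx, hθ']
    obtain ⟨Ψ, hΨ, hΨx, hΨr, -⟩ := exists_local_inverse (h.contDiffAt_radialMap hx1) (h.det_jac_ne_zero hπ hx0 hx1)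
    rw [hxe] at hΨ hΨx hΨr
    have hΨd : HasDerivAt (fun u => Ψ (γ u)) _ u :=
      ((hΨ.differentiableAt (by simp)).hasFDerivAt).comp_hasDerivAt u (hγd u)
    set w := fderiv ℝ Ψ (γ u) (-sin u • q j₀ + cos u • v) with hw
    have hSe : S =ᶠ[𝓝 u] fun u => (Ψ (γ u)) 1 := by
      have hΨc : ContinuousAt (fun u => Ψ (γ u)) u := hΨd.continuousAt
      have c0 : ∀ᶠ u' in 𝓝 u, 0 < (Ψ (γ u')) 0 :=
        ((continuous_coord 0).continuousAt.comp hΨc).eventually (lt_mem_nhds (by simpa [hΨx] using hx0))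
      have c1 : ∀ᶠ u' in 𝓝 u, (Ψ (γ u')) 1 ∈ Ioo 0 s₀ :=
        ((contDiff_coord 1 (n := 0)).continuous.continuousAt.comp hΨc).eventually
          (isOpen_Ioo.mem_nhds (by simpa only [Function.comp, hΨx] using hx1))
      filter_upwards [c0, c1, (hγd u).continuousAt.eventually hΨr, isOpen_Ioo.mem_nhds hu] with u' h0' h1' h2' h3'
      obtain ⟨θ₂, hθ₂⟩ := (hS u' h3').2
      have e : dir (γ u') = P ((Ψ (γ u')) 1) ((Ψ (γ u')) 2) := by
        conv_lhs => rw [← h2']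
        rw [radialMap, dir_smul h0', h.dir_eq h1']
      rw [dir_of_norm_eq_one (hγn u')] at e
      exact (h.injective _ (hSS u' h3') _ h1' _ _ (hθ₂.trans e)).1
    refine ⟨w 1, (((hasFDerivAt_coord (Ψ (γ u)) 1).comp_hasDerivAt u hΨd).congr_of_eventuallyEq hSe), ?_⟩
    have hlink : w 1 ^ 2 ≤ exp (2 * φ (γ u)) := by
      have hRd := (h.contDiffAt_radialMap hx1).differentiableAt (by simp)
      have hcomp : fderiv ℝ (radialMap P) x w = -sin u • q j₀ + cos u • v := by
        have h5 : HasFDerivAt (fun y => radialMap P (Ψ y)) _ (γ u) :=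
          HasFDerivAt.comp (g := radialMap P) (γ u) (by rw [hΨx]; exact hRd.hasFDerivAt)
            (hΨ.differentiableAt (by simp)).hasFDerivAt
        have h6 : HasFDerivAt (fun y => radialMap P (Ψ y)) (ContinuousLinearMap.id ℝ E3) (γ u) :=
          (hasFDerivAt_id (γ u)).congr_of_eventuallyEq hΨr
        have h7 := congrArg (fun L : E3 →L[ℝ] E3 => L (-sin u • q j₀ + cos u • v)) (h5.unique h6)
        rw [ContinuousLinearMap.comp_apply, ← hw] at h7
        exact h7
      have hg := sum_coneMetric 0 φ id (radialMap P x) (fderiv ℝ (radialMap P) x w) (fderiv ℝ (radialMap P) x w)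
      rw [sum_pullback, h.pullback_coneMetric 0 contDiffOn_id_dir hx0 hx1, hcomp, hxe] at hg
      have hgu : γ u ≠ 0 := norm_ne_zero_iff.1 (by rw [hγn]; norm_num)
      rw [fderiv_id_dir _ _ hgu, hγn, dir_of_norm_eq_one (hγn u)] at hg
      have hgi : inner ℝ (γ u) (-sin u • q j₀ + cos u • v) = (0 : ℝ) := by
        simp only [hγ, inner_add_left, inner_add_right, inner_smul_left, inner_smul_right, hqq, hvv,
          hqv, hvq, conj_to_real]
        ring
      rw [hgi] at hg
      simp only [zero_smul, sub_zero, inv_one, one_smul, real_inner_self_eq_norm_sq, hγdn] at hg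
      simp [Fin.sum_univ_three, radialMetric, sn] at hg
      have hx00 : x 0 = 1 := by simp [hx]
      rw [hx00] at hg
      have := mul_nonneg (mul_self_nonneg (w 2)) (sq_nonneg (sin (x 1)))
      nlinarith [sq_nonneg (w 0)]
    have hexp : exp (φ (γ u)) ≤ exp C * u ^ (β - 1) := by
      have h5 := hC (γ u) (hγn u) (by rw [hγang u hu]; exact hu.1) (by rw [hγang u hu]; exact hu.2.trans_le hψδ)
      rw [hγang u hu] at h5
      have h6 := (abs_le.1 h5).2
      rw [rpow_def_of_pos hu.1, ← exp_add]
      exact exp_le_exp.2 (by linarith)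
    refine le_trans ?_ hexp
    refine le_of_sq_le_sq ?_ (exp_pos _).le
    rw [← exp_nat_mul]
    exact_mod_cast hlink
  -- comparison with the primitive of `u^(β - 1)`
  have hmono : MonotoneOn (fun u => exp C / β * u ^ β - S u) (Ioo 0 ψ₀) := by
    refine monotoneOn_of_deriv_nonneg (convex_Ioo _ _) ?_ ?_ ?_
    · intro u hu
      obtain ⟨S', hS', -⟩ := hder u hu
      exact ((((hasDerivAt_rpow_const (Or.inl hu.1.ne')).const_mul _).sub hS').continuousAt).continuousWithinAt
    · rw [interior_Ioo]
      intro u hu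
      obtain ⟨S', hS', -⟩ := hder u hu
      exact ((((hasDerivAt_rpow_const (Or.inl hu.1.ne')).const_mul _).sub hS').differentiableAt).differentiableWithinAt
    · rw [interior_Ioo]
      intro u hu
      obtain ⟨S', hS', hle⟩ := hder u hu
      have h5 := (((hasDerivAt_rpow_const (p := β) (Or.inl hu.1.ne')).const_mul (exp C / β)).sub hS').deriv
      have h5' : deriv (fun u => exp C / β * u ^ β - S u) u = _ := h5
      rw [h5']
      have : exp C / β * (β * u ^ (β - 1)) = exp C * u ^ (β - 1) := by field_simp
      rw [this]; linarith
  have hSψ : S ψ = s := by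
    obtain ⟨θ', hθ'⟩ := (hS ψ ⟨hψ0, hψlt⟩).2
    exact (h.injective _ (hSS ψ ⟨hψ0, hψlt⟩) _ hss _ _ (hθ'.trans hγψ)).1
  have hlim : Tendsto (fun u => exp C / β * u ^ β - S u) (𝓝[>] 0) (𝓝 0) := by
    have l1 : Tendsto (fun u : ℝ => exp C / β * u ^ β) (𝓝[>] 0) (𝓝 0) := by
      have := ((continuousAt_rpow_const (0 : ℝ) β (Or.inr hβ0.le)).tendsto.const_mul
        (exp C / β)).mono_left (nhdsWithin_le_nhds (s := Ioi 0))
      rwa [zero_rpow hβ0.ne', mul_zero] at this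
    have l2 : Tendsto S (𝓝[>] 0) (𝓝 0) := by
      rw [Metric.tendsto_nhds]
      intro e he
      have hm : min e (s₀ / 2) ∈ Ioo 0 s₀ := ⟨by positivity, (min_le_right _ _).trans_lt (by linarith)⟩
      obtain ⟨δ₃, hδ₃, h6⟩ := h.exists_small hπ hα hj hq hm
      filter_upwards [Ioo_mem_nhdsGT (lt_min hδ₃ hψ₀0)] with u hu
      have hu' : u ∈ Ioo 0 ψ₀ := ⟨hu.1, hu.2.trans_le (min_le_right _ _)⟩
      obtain ⟨s', hs', θ₁, e1⟩ := h6 _ (hγn u) (hγq u hu') ((hγclose u hu').trans_lt (hu.2.trans_le (min_le_left _ _)))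
      obtain ⟨θ₂, e2⟩ := (hS u hu').2
      have e3 := (h.injective _ (hSS u hu') _ ⟨hs'.1, hs'.2.trans hm.2⟩ _ _ (e2.trans e1.symm)).1
      rw [e3, dist_eq, sub_zero, abs_of_pos hs'.1]
      exact hs'.2.trans_le (min_le_left _ _)
    simpa using l1.sub l2
  have hfin : 0 ≤ exp C / β * ψ ^ β - S ψ := by
    refine le_of_tendsto hlim ?_
    filter_upwards [Ioo_mem_nhdsGT hψ0] with u hu
    exact hmono ⟨hu.1, hu.2.trans hψlt⟩ ⟨hψ0, hψlt⟩ hu.2.le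
  rw [hSψ] at hfin
  linarith

end IsConePolar

open Complex (I)

/-! ### Conformal Killing fields near cone points -/

lemma hasFDerivAt_partials {g : ℝ → ℝ → ℝ} {s θ : ℝ} (hg : DifferentiableAt ℝ (fun z : ℝ × ℝ => g z.1 z.2) (s, θ)) :
    HasFDerivAt (fun z : ℝ × ℝ => g z.1 z.2) (deriv (fun s' => g s' θ) s • ContinuousLinearMap.fst ℝ ℝ ℝ
        + deriv (g s) θ • ContinuousLinearMap.snd ℝ ℝ ℝ) (s, θ) := by
  have d1 : HasFDerivAt (fun s => g s θ) _ s :=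
    HasFDerivAt.comp (f := fun s : ℝ => (s, θ)) s hg.hasFDerivAt (hasFDerivAt_prodMk_left s θ)
  have d2 : HasFDerivAt (fun θ => g s θ) _ θ :=
    HasFDerivAt.comp (f := fun θ : ℝ => (s, θ)) θ hg.hasFDerivAt (hasFDerivAt_prodMk_right s θ)
  refine hg.hasFDerivAt.congr_fderiv ?_
  have d2' : deriv (g s) θ = _ := d2.hasDerivAt.deriv
  ext
  · rw [d1.hasDerivAt.deriv, d2']; simp
  · rw [d1.hasDerivAt.deriv, d2']; simp

/-- The conformal coordinate of the spherical cone of angle `2πβ`, in terms of the polar coordinates. -/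
noncomputable def coneCoord (β s θ : ℝ) : ℂ :=
  Complex.exp (((log (tan (s / 2)) : ℝ) + θ * I) / β)

lemma tan_half_pos {s : ℝ} (h0 : 0 < s) (h1 : s < π) : 0 < tan (s / 2) :=
  tan_pos_of_pos_of_lt_pi_div_two (by linarith) (by linarith)

lemma sin_two_arctan_exp (t : ℝ) : sin (2 * arctan (exp t)) = 2 * exp t * (1 / (1 + exp t ^ 2)) := by
  have h3 := tan_mul_cos (cos_arctan_pos (exp t)).ne'
  rw [tan_arctan] at h3
  rw [sin_two_mul, ← h3, ← cos_sq_arctan]; ring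

lemma hasDerivAt_two_arctan_exp (t : ℝ) : HasDerivAt (fun t => 2 * arctan (exp t)) (sin (2 * arctan (exp t))) t := by
  refine ((hasDerivAt_exp t).arctan.const_mul 2).congr_deriv ?_
  rw [sin_two_arctan_exp]; ring

lemma two_arctan_tan_half {s : ℝ} (h0 : 0 < s) (h1 : s < π) : 2 * arctan (exp (log (tan (s / 2)))) = s := by
  rw [exp_log (tan_half_pos h0 h1), arctan_tan (by linarith) (by linarith)]
  ring

lemma two_arctan_exp_mem {s₂ t : ℝ} (h0 : 0 < s₂) (h1 : s₂ < π)
    (ht : t < log (tan (s₂ / 2))) : 2 * arctan (exp t) ∈ Ioo 0 s₂ := by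
  refine ⟨by have := arctan_pos.2 (exp_pos t); linarith, ?_⟩
  have := arctan_strictMono (exp_lt_exp.2 ht)
  linarith [two_arctan_tan_half h0 h1]

lemma exp_le_two_arctan_exp {t : ℝ} (ht : t ≤ 0) : exp t ≤ 2 * arctan (exp t) := by
  have h0 : 0 < 2 * arctan (exp t) := by
    have := arctan_pos.2 (exp_pos t); linarith
  refine le_trans ?_ (sin_le h0.le)
  rw [sin_two_arctan_exp]
  have e0 := exp_pos t
  have e1 := exp_le_one_iff.2 ht
  rw [mul_one_div, le_div_iff₀ (by positivity)]
  nlinarith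

section Holomorphic

variable {c s₂ C α : ℝ} {X Y : ℝ → ℝ → ℝ}

/-- The function `X/sin s + c log tan(s/2) + i Y` in the coordinate `log tan(s/2) + iθ`. -/
noncomputable def conformalFn (c : ℝ) (X Y : ℝ → ℝ → ℝ) (w : ℂ) : ℂ :=
  ((X (2 * arctan (exp w.re)) w.im / sin (2 * arctan (exp w.re)) + c * w.re : ℝ) : ℂ)
    + ((Y (2 * arctan (exp w.re)) w.im : ℝ) : ℂ) * I

lemma differentiableAt_conformalFn (h0 : 0 < s₂) (hπ : s₂ ≤ π / 2)
    (hX : ∀ s ∈ Ioo 0 s₂, ∀ θ, DifferentiableAt ℝ (fun z : ℝ × ℝ => X z.1 z.2) (s, θ))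
    (hY : ∀ s ∈ Ioo 0 s₂, ∀ θ, DifferentiableAt ℝ (fun z : ℝ × ℝ => Y z.1 z.2) (s, θ))
    (h2 : ∀ s ∈ Ioo 0 s₂, ∀ θ, deriv (X s) θ + sin s ^ 2 * deriv (fun s' => Y s' θ) s = 0)
    (h3 : ∀ s ∈ Ioo 0 s₂, ∀ θ, cos s * X s θ / sin s + deriv (Y s) θ
      = c + deriv (fun s' => X s' θ) s) {w : ℂ} (hw : w.re < log (tan (s₂ / 2))) :
    DifferentiableAt ℂ (conformalFn c X Y) w := by
  have hπ0 := pi_pos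
  set s := 2 * arctan (exp w.re) with hs
  have hsm : s ∈ Ioo 0 s₂ := two_arctan_exp_mem h0 (by linarith) hw
  have hsin : 0 < sin s := sin_pos_of_pos_of_lt_pi hsm.1 (by linarith [hsm.2])
  have hL : HasFDerivAt (fun w : ℂ => (2 * arctan (exp w.re), w.im))
      ((sin s • Complex.reCLM).prod Complex.imCLM) w := by
    refine HasFDerivAt.prodMk ?_ Complex.imCLM.hasFDerivAt
    exact (hasDerivAt_two_arctan_exp w.re).comp_hasFDerivAt w Complex.reCLM.hasFDerivAt
  have hXw : HasFDerivAt (fun w : ℂ => X (2 * arctan (exp w.re)) w.im) _ w :=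
    HasFDerivAt.comp (g := fun z : ℝ × ℝ => X z.1 z.2) (f := fun w : ℂ => (2 * arctan (exp w.re), w.im)) w
      (hasFDerivAt_partials (hX s hsm w.im)) hL
  have hYw : HasFDerivAt (fun w : ℂ => Y (2 * arctan (exp w.re)) w.im) _ w :=
    HasFDerivAt.comp (g := fun z : ℝ × ℝ => Y z.1 z.2) (f := fun w : ℂ => (2 * arctan (exp w.re), w.im)) w
      (hasFDerivAt_partials (hY s hsm w.im)) hL
  have hS : HasFDerivAt (fun w : ℂ => (sin (2 * arctan (exp w.re)))⁻¹) ((-cos s / sin s) • Complex.reCLM) w := by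
    have h5 : HasDerivAt (fun t => (sin (2 * arctan (exp t)))⁻¹) (-cos s / sin s) w.re := by
      refine (((hasDerivAt_two_arctan_exp w.re).sin).inv hsin.ne').congr_deriv ?_
      rw [← hs]; field_simp
    exact h5.comp_hasFDerivAt w Complex.reCLM.hasFDerivAt
  have hsin' := hsin.ne'
  have hU : HasFDerivAt (fun w : ℂ => X (2 * arctan (exp w.re)) w.im / sin (2 * arctan (exp w.re)) + c * w.re)
      ((deriv (fun s' => X s' w.im) s - cos s * X s w.im / sin s + c) • Complex.reCLM
        + (deriv (X s) w.im / sin s) • Complex.imCLM) w := by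
    simp only [div_eq_mul_inv (X _ _)]
    refine ((hXw.mul hS).add ((Complex.reCLM.hasFDerivAt (x := w)).const_mul c)).congr_fderiv ?_
    ext v
    simp only [← hs, add_apply, smul_apply,
      ContinuousLinearMap.comp_apply, ContinuousLinearMap.prod_apply, ContinuousLinearMap.coe_fst',
      ContinuousLinearMap.coe_snd', Complex.reCLM_apply, Complex.imCLM_apply, smul_eq_mul]
    field_simp
    ring
  have hW : HasFDerivAt (fun w : ℂ => Y (2 * arctan (exp w.re)) w.im)
      ((sin s * deriv (fun s' => Y s' w.im) s) • Complex.reCLM + deriv (Y s) w.im • Complex.imCLM) w := by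
    refine hYw.congr_fderiv ?_
    ext v
    simp only [← hs, add_apply, smul_apply,
      ContinuousLinearMap.comp_apply, ContinuousLinearMap.prod_apply, ContinuousLinearMap.coe_fst',
      ContinuousLinearMap.coe_snd', Complex.reCLM_apply, Complex.imCLM_apply, smul_eq_mul]
    ring
  have e2 := h2 s hsm w.im
  have e3 := h3 s hsm w.im
  set a := deriv (fun s' => X s' w.im) s - cos s * X s w.im / sin s + c with ha
  set b := deriv (X s) w.im / sin s with hb
  set a' := sin s * deriv (fun s' => Y s' w.im) s with ha'
  set b' := deriv (Y s) w.im with hb'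
  have c1 : b = -a' := by
    rw [hb, ha', div_eq_iff hsin']; linarith
  have c2 : b' = a := by rw [ha]; linarith
  have hf : HasFDerivAt (conformalFn c X Y) _ w :=
    ((Complex.ofRealCLM.hasFDerivAt).comp w hU).add (((Complex.ofRealCLM.hasFDerivAt).comp w hW).mul_const I)
  rw [differentiableAt_complex_iff_differentiableAt_real]
  refine ⟨hf.differentiableAt, ?_⟩
  rw [hf.fderiv]
  apply Complex.ext
  · simp [c1, c2]
  · simp [c1, c2]

/-- A conformal Killing field `X ∂_s + Y ∂_θ` of a spherical cone of angle `α < 2π`, of which the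
divergence has at most a logarithmic singularity, is given by a function which is holomorphic in the
conformal coordinate, up to a multiple of `sin s log tan(s/2) ∂_s`. -/
lemma exists_holomorphic (h0 : 0 < s₂) (hπ : s₂ ≤ π / 2) (hα : 0 < α) (hα2 : α < 2 * π)
    (hX : ∀ s ∈ Ioo 0 s₂, ∀ θ, DifferentiableAt ℝ (fun z : ℝ × ℝ => X z.1 z.2) (s, θ))
    (hY : ∀ s ∈ Ioo 0 s₂, ∀ θ, DifferentiableAt ℝ (fun z : ℝ × ℝ => Y z.1 z.2) (s, θ))
    (hXp : ∀ s ∈ Ioo 0 s₂, ∀ θ, X s (θ + α) = X s θ) (hYp : ∀ s ∈ Ioo 0 s₂, ∀ θ, Y s (θ + α) = Y s θ)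
    (h1 : ∀ s ∈ Ioo 0 s₂, ∀ θ, |deriv (fun s' => X s' θ) s| ≤ C * (1 + |log s|))
    (h2 : ∀ s ∈ Ioo 0 s₂, ∀ θ, deriv (X s) θ + sin s ^ 2 * deriv (fun s' => Y s' θ) s = 0)
    (h3 : ∀ s ∈ Ioo 0 s₂, ∀ θ, cos s * X s θ / sin s + deriv (Y s) θ = c + deriv (fun s' => X s' θ) s) :
    ∃ s₃ ∈ Ioo 0 s₂, ∃ ρ > 0, ∃ H : ℂ → ℂ, DifferentiableOn ℂ H (Metric.ball 0 ρ) ∧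
      ∀ s ∈ Ioo 0 s₃, ∀ θ, coneCoord (α / (2 * π)) s θ ∈ Metric.ball 0 ρ ∧
        X s θ = sin s * ((H (coneCoord (α / (2 * π)) s θ)).re - c * log (tan (s / 2))) ∧
        Y s θ = (H (coneCoord (α / (2 * π)) s θ)).im := by
  have hπ0 := pi_pos
  set s₃ := min (s₂ / 2) (1 / 2) with hs₃
  have hs₃0 : 0 < s₃ := by positivity
  have hs₃2 : s₃ < s₂ := (min_le_left _ _).trans_lt (by linarith)
  have hs₃h : s₃ ≤ 1 / 2 := min_le_right _ _
  have hs₃m : s₃ ∈ Ioo 0 s₂ := ⟨hs₃0, hs₃2⟩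
  have hC : 0 ≤ C := by
    have := (abs_nonneg _).trans (h1 s₃ hs₃m 0)
    by_contra! hneg
    nlinarith [abs_nonneg (log s₃)]
  have hXc : ∀ s ∈ Ioo 0 s₂, Continuous (X s) := fun s hs => continuous_iff_continuousAt.2 fun θ =>
    ContinuousAt.comp (f := fun θ : ℝ => (s, θ)) (hX s hs θ).continuousAt (by fun_prop)
  have hYd : ∀ s ∈ Ioo 0 s₂, Differentiable ℝ (Y s) := fun s hs θ =>
    (hY s hs θ).comp (f := fun θ : ℝ => (s, θ)) θ (by fun_prop)
  have hXd : ∀ s ∈ Ioo 0 s₂, ∀ θ, DifferentiableAt ℝ (fun s' => X s' θ) s := fun s hs θ =>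
    (hX s hs θ).comp (f := fun s : ℝ => (s, θ)) s (by fun_prop)
  -- `X` is bounded
  obtain ⟨M₀, hM₀⟩ : ∃ M₀, ∀ θ, |X s₃ θ| ≤ M₀ := by
    obtain ⟨M₀, h⟩ := (isCompact_Icc (a := (0 : ℝ)) (b := α)).exists_bound_of_continuousOn (hXc s₃ hs₃m).continuousOn
    refine ⟨M₀, fun θ => ?_⟩
    obtain ⟨y, hy, he⟩ := Periodic.exists_mem_Ico₀ (f := X s₃) (hXp s₃ hs₃m) hα θ
    rw [he]
    exact h y (Ico_subset_Icc_self hy)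
  have hMX : ∀ s ∈ Ioc 0 s₃, ∀ θ, |X s θ| ≤ M₀ + 4 * C := by
    intro s hs θ
    have hG : ∀ u ∈ Ioo 0 s₂, HasDerivAt (fun u => C * (2 * u - u * log u)) (C * (1 - log u)) u := by
      intro u hu
      have h5 : HasDerivAt (fun u => u * log u) _ u := (hasDerivAt_id u).mul (hasDerivAt_log hu.1.ne')
      refine ((((hasDerivAt_id u).const_mul 2).sub h5).const_mul C).congr_deriv ?_
      have := hu.1.ne'
      simp only [id]
      field_simp
      ring
    have hsub : Ioc 0 s₃ ⊆ Ioo 0 s₂ := fun u hu => ⟨hu.1, hu.2.trans_lt hs₃2⟩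
    have hint : interior (Ioc 0 s₃) ⊆ Ioc 0 s₃ := interior_subset
    have hlog : ∀ u ∈ Ioc 0 s₃, |log u| = -log u := fun u hu =>
      abs_of_nonpos (log_nonpos hu.1.le (by linarith [hu.2]))
    have mono : ∀ ε : ℝ, |ε| = 1 → MonotoneOn (fun u => C * (2 * u - u * log u) + ε * X u θ) (Ioc 0 s₃) := by
      intro ε hε
      have hd : ∀ u ∈ Ioc 0 s₃, HasDerivAt (fun u => C * (2 * u - u * log u) + ε * X u θ)
          (C * (1 - log u) + ε * deriv (fun s' => X s' θ) u) u := fun u hu =>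
        (hG u (hsub hu)).add ((hXd u (hsub hu) θ).hasDerivAt.const_mul ε)
      refine monotoneOn_of_deriv_nonneg (convex_Ioc _ _) (fun u hu => (hd u hu).continuousAt.continuousWithinAt)
        (fun u hu => (hd u (hint hu)).differentiableAt.differentiableWithinAt) fun u hu => ?_
      rw [(hd u (hint hu)).deriv]
      have h5 := h1 u (hsub (hint hu)) θ
      rw [hlog u (hint hu)] at h5
      have h6 : |ε * deriv (fun s' => X s' θ) u| ≤ C * (1 - log u) := by
        rw [abs_mul, hε, one_mul]; linarith
      linarith [neg_le_of_abs_le h6]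
    have hs₃mem : s₃ ∈ Ioc 0 s₃ := ⟨hs₃0, le_rfl⟩
    have m1 := mono 1 (by simp) hs hs₃mem hs.2
    have m2 := mono (-1) (by simp) hs hs₃mem hs.2
    simp only at m1 m2
    have g1 : C * (2 * s₃ - s₃ * log s₃) ≤ 4 * C := by
      have := abs_log_mul_self_lt s₃ hs₃0 (by linarith)
      have := (abs_lt.1 this).1
      nlinarith
    have g0 : 0 ≤ C * (2 * s - s * log s) := by
      have : log s ≤ 0 := log_nonpos hs.1.le (by linarith [hs.2])
      have h7 : 0 ≤ 2 * s - s * log s := by nlinarith [hs.1]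
      positivity
    have := abs_le.1 (hM₀ θ)
    rw [abs_le]
    constructor <;> linarith
  -- `∂_θ Y` is `O(1/s)`
  obtain ⟨K, hK0, hK⟩ : ∃ K, 0 ≤ K ∧ ∀ s ∈ Ioc 0 s₃, ∀ θ, |deriv (Y s) θ| ≤ K / s := by
    have hM : 0 ≤ M₀ + 4 * C := (abs_nonneg _).trans (hMX s₃ ⟨hs₃0, le_rfl⟩ 0)
    refine ⟨|c| + 2 * C + (M₀ + 4 * C) * (π / 2), by positivity, fun s hs θ => ?_⟩
    have hsm : s ∈ Ioo 0 s₂ := ⟨hs.1, hs.2.trans_lt hs₃2⟩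
    have hs1 : s ≤ 1 := by linarith [hs.2]
    have e := h3 s hsm θ
    have e' : deriv (Y s) θ = c + deriv (fun s' => X s' θ) s - cos s * X s θ / sin s := by
      linarith
    have hsin : 2 / π * s ≤ sin s := mul_le_sin hs.1.le (by linarith [hsm.2])
    have hsin0 : 0 < 2 / π * s := by have := hs.1; positivity
    have b1 : |c| ≤ |c| / s := by
      rw [le_div_iff₀ hs.1]; nlinarith [abs_nonneg c, hs.1]
    have b2 : |deriv (fun s' => X s' θ) s| ≤ 2 * C / s := by
      refine (h1 s hsm θ).trans ?_
      rw [le_div_iff₀ hs.1]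
      have := abs_log_mul_self_lt s hs.1 hs1
      rw [abs_mul, abs_of_pos hs.1] at this
      nlinarith [hs.1]
    have b3 : |cos s * X s θ / sin s| ≤ (M₀ + 4 * C) * (π / 2) / s := by
      rw [abs_div, abs_mul, abs_of_pos (hsin0.trans_le hsin), div_le_div_iff₀ (hsin0.trans_le hsin) hs.1]
      have a1 := hMX s hs θ
      have a2 := abs_cos_le_one s
      have a3 : |cos s| * |X s θ| ≤ M₀ + 4 * C := by nlinarith [abs_nonneg (X s θ), abs_nonneg (cos s)]
      calc _ ≤ (M₀ + 4 * C) * s := mul_le_mul_of_nonneg_right a3 hs.1.le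
        _ = (M₀ + 4 * C) * (π / 2) * (2 / π * s) := by field_simp
        _ ≤ _ := by gcongr
    rw [e']
    calc _ ≤ |c| + |deriv (fun s' => X s' θ) s| + |cos s * X s θ / sin s| :=
          (abs_sub _ _).trans (add_le_add_left (abs_add_le _ _) _)
      _ ≤ |c| / s + 2 * C / s + (M₀ + 4 * C) * (π / 2) / s := by gcongr
      _ = _ := by ring
  set τ₃ := log (tan (s₃ / 2)) with hτ₃
  have hs₃π : s₃ < π := by linarith
  have hτ₃2 : τ₃ < log (tan (s₂ / 2)) := by
    refine log_lt_log (tan_half_pos hs₃0 hs₃π) ?_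
    exact tan_lt_tan_of_nonneg_of_lt_pi_div_two (by linarith) (by linarith) (by linarith)
  have hτ₃0 : τ₃ ≤ 0 := by
    refine log_nonpos (tan_half_pos hs₃0 hs₃π).le ?_
    rw [← tan_pi_div_four]
    exact (tan_lt_tan_of_nonneg_of_lt_pi_div_two (by linarith) (by linarith) (by linarith [pi_gt_three])).le
  have hmem : ∀ t ≤ τ₃, 2 * arctan (exp t) ∈ Ioc 0 s₃ := by
    intro t ht
    refine ⟨by have := arctan_pos.2 (exp_pos t); linarith, ?_⟩
    have := arctan_strictMono.monotone (exp_le_exp.2 ht)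
    linarith [two_arctan_tan_half hs₃0 hs₃π]
  have hmem2 : ∀ t ≤ τ₃, 2 * arctan (exp t) ∈ Ioo 0 s₂ := fun t ht =>
    ⟨(hmem t ht).1, (hmem t ht).2.trans_lt hs₃2⟩
  set f := conformalFn c X Y with hf
  have hfd : ∀ w : ℂ, w.re ≤ τ₃ → DifferentiableAt ℂ f w := fun w hw =>
    differentiableAt_conformalFn h0 hπ hX hY h2 h3 (hw.trans_lt hτ₃2)
  have hfp : ∀ w : ℂ, w.re ≤ τ₃ → f (w + α * I) = f w := by
    intro w hw
    have e1 : (w + α * I).re = w.re := by simp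
    have e2 : (w + α * I).im = w.im + α := by simp
    simp only [hf, conformalFn, e1, e2, hXp _ (hmem2 _ hw), hYp _ (hmem2 _ hw)]
  -- the mean of `Y` over the circles is constant, by Cauchy's theorem
  have hmean : ∀ t ≤ τ₃, ∫ y in (0 : ℝ)..α, f (t + y * I) = ∫ y in (0 : ℝ)..α, f (τ₃ + y * I) := by
    intro t ht
    have h5 := Complex.integral_boundary_rect_eq_zero_of_differentiableOn f (t : ℂ) (τ₃ + α * I) (fun w hw => (hfd w (by
        have := hw.1; simp [uIcc_of_le ht] at this; exact this.2)).differentiableWithinAt)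
    simp only [Complex.ofReal_re, Complex.ofReal_im, Complex.add_re, Complex.add_im, Complex.mul_re,
      Complex.mul_im, Complex.I_re, Complex.I_im, mul_zero, mul_one, sub_zero, add_zero, zero_add,
      Complex.ofReal_zero, zero_mul] at h5
    have h6 : ∫ x : ℝ in t..τ₃, f (x + α * I) = ∫ x : ℝ in t..τ₃, f x := by
      refine intervalIntegral.integral_congr fun x hx => ?_
      rw [uIcc_of_le ht] at hx
      exact hfp x (by simpa using hx.2)
    rw [h6, sub_self, zero_add, ← smul_sub, smul_eq_zero] at h5
    exact (sub_eq_zero.1 (h5.resolve_left Complex.I_ne_zero)).symm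
  set I₀ := (∫ y in (0 : ℝ)..α, f (τ₃ + y * I)).im with hI₀
  have hmeanY : ∀ t ≤ τ₃, ∫ y in (0 : ℝ)..α, Y (2 * arctan (exp t)) y = I₀ := by
    intro t ht
    rw [hI₀, ← hmean t ht]
    have hfc : Continuous fun y : ℝ => f (t + y * I) := continuous_iff_continuousAt.2 fun y =>
      ContinuousAt.comp (f := fun y : ℝ => (t : ℂ) + y * I)
        (hfd (t + y * I) (by simpa using ht)).continuousAt (by fun_prop)
    have h5 := Complex.imCLM.intervalIntegral_comp_comm (hfc.intervalIntegrable (μ := volume) 0 α)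
    simp only [Complex.imCLM_apply] at h5
    rw [← h5]
    refine intervalIntegral.integral_congr fun y _ => ?_
    have e1 : ((t : ℂ) + y * I).re = t := by simp
    have e2 : ((t : ℂ) + y * I).im = y := by simp
    simp only [hf, conformalFn, e1, e2, Complex.add_im, Complex.ofReal_im, Complex.mul_I_im,
      Complex.ofReal_re, zero_add]
  have hYb : ∀ s ∈ Ioc 0 s₃, ∀ θ, |Y s θ| ≤ (|I₀| / α + α * K) / s := by
    intro s hs θ
    have hsm : s ∈ Ioo 0 s₂ := ⟨hs.1, hs.2.trans_lt hs₃2⟩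
    obtain ⟨x, hx, he⟩ := Periodic.exists_mem_Ico₀ (f := Y s) (hYp s hsm) hα θ
    rw [he]
    have h5 : ∫ y in (0 : ℝ)..α, Y s y = I₀ := by
      have := hmeanY (log (tan (s / 2))) (log_le_log (tan_half_pos hs.1 (by linarith [hs.2]))
        (strictMonoOn_tan.monotoneOn ⟨by linarith [hs.1], by linarith [hs.2]⟩
          ⟨by linarith, by linarith⟩ (by linarith [hs.2])))
      rwa [two_arctan_tan_half hs.1 (by linarith [hs.2])] at this
    have h6 : ‖∫ y in (0 : ℝ)..α, (Y s x - Y s y)‖ ≤ (α * (K / s)) * |α - 0| := by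
      refine intervalIntegral.norm_integral_le_of_norm_le_const fun y hy => ?_
      rw [uIoc_of_le hα.le] at hy
      have h7 := (convex_univ (𝕜 := ℝ) (E := ℝ)).norm_image_sub_le_of_norm_deriv_le (f := Y s) (C := K / s)
        (fun u _ => hYd s hsm u) (fun u _ => hK s hs u) (mem_univ y) (mem_univ x)
      refine h7.trans ?_
      rw [mul_comm α]
      refine mul_le_mul_of_nonneg_left ?_ (div_nonneg hK0 hs.1.le)
      rw [norm_eq_abs, abs_le]
      constructor <;> linarith [hx.1, hx.2, hy.1, hy.2]
    rw [intervalIntegral.integral_sub (by simp) ((hYd s hsm).continuous.intervalIntegrable _ _), h5,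
      intervalIntegral.integral_const, sub_zero, smul_eq_mul, abs_of_pos hα, norm_eq_abs] at h6
    have h8 : |α * Y s x| ≤ |I₀| + α * (K / s) * α := by
      have : α * Y s x = I₀ + (α * Y s x - I₀) := by ring
      rw [this]
      exact (abs_add_le _ _).trans (by linarith)
    rw [abs_mul, abs_of_pos hα] at h8
    have h9 : |Y s x| ≤ |I₀| / α + α * (K / s) := by
      rw [← mul_le_mul_iff_right₀ hα]
      refine h8.trans (le_of_eq ?_)
      field_simp
    refine h9.trans ?_
    have : |I₀| / α ≤ |I₀| / α / s := by
      rw [le_div_iff₀ hs.1]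
      have : 0 ≤ |I₀| / α := by positivity
      nlinarith [hs.2, hs.1]
    calc _ ≤ |I₀| / α / s + α * (K / s) := by linarith
      _ = _ := by ring
  obtain ⟨B, hB⟩ : ∃ B, ∀ w : ℂ, w.re ≤ τ₃ → ‖f w‖ ≤ B * exp (-w.re) := by
    have hM : 0 ≤ M₀ + 4 * C := (abs_nonneg _).trans (hMX s₃ ⟨hs₃0, le_rfl⟩ 0)
    refine ⟨(M₀ + 4 * C) * (π / 2) + |c| + (|I₀| / α + α * K), fun w hw => ?_⟩
    have hm := hmem _ hw
    set s := 2 * arctan (exp w.re) with hs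
    have hes : exp w.re ≤ s := exp_le_two_arctan_exp (hw.trans hτ₃0)
    have hsin : 2 / π * s ≤ sin s := mul_le_sin hm.1.le (by linarith [hm.2])
    have hsin0 : 0 < 2 / π * s := by have := hm.1; positivity
    have hinv : 1 / s ≤ exp (-w.re) := by
      rw [exp_neg, one_div]
      exact inv_anti₀ (exp_pos _) hes
    have b1 : |X s w.im / sin s| ≤ (M₀ + 4 * C) * (π / 2) * exp (-w.re) := by
      rw [abs_div, abs_of_pos (hsin0.trans_le hsin)]
      calc _ ≤ (M₀ + 4 * C) / (2 / π * s) := div_le_div₀ hM (hMX s hm _) hsin0 hsin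
        _ = (M₀ + 4 * C) * (π / 2) * (1 / s) := by field_simp
        _ ≤ _ := by gcongr
    have b2 : |c * w.re| ≤ |c| * exp (-w.re) := by
      rw [abs_mul]
      refine mul_le_mul_of_nonneg_left ?_ (abs_nonneg c)
      rw [abs_of_nonpos (hw.trans hτ₃0)]
      linarith [add_one_le_exp (-w.re)]
    have b3 : |Y s w.im| ≤ (|I₀| / α + α * K) * exp (-w.re) := by
      refine (hYb s hm _).trans ?_
      rw [div_eq_mul_one_div]
      have : 0 ≤ |I₀| / α + α * K := by positivity
      gcongr
    simp only [hf, conformalFn, ← hs]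
    refine (norm_add_le _ _).trans ?_
    rw [norm_mul, Complex.norm_I, mul_one, Complex.norm_real, Complex.norm_real, norm_eq_abs, norm_eq_abs]
    have := abs_add_le (X s w.im / sin s) (c * w.re)
    calc _ ≤ ((M₀ + 4 * C) * (π / 2) * exp (-w.re) + |c| * exp (-w.re))
          + (|I₀| / α + α * K) * exp (-w.re) := by linarith
      _ = _ := by ring
  -- the function `ζ f(ζ)` extends across `ζ = 0` by Riemann's theorem
  set g : ℂ → ℂ := fun z => if -z.im < τ₃ then f (I * z) * Periodic.qParam α z else 0 with hg
  have hre : ∀ z : ℂ, (I * z).re = -z.im := fun z => by simp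
  have hαC : (α : ℂ) ≠ 0 := by exact_mod_cast hα.ne'
  have hgp : Periodic g α := by
    intro z
    have e1 : (z + (α : ℂ)).im = z.im := by simp
    simp only [hg, e1]
    split_ifs with h5
    · have e2 : I * (z + α) = I * z + α * I := by ring
      have e3 : Periodic.qParam α (z + α) = Periodic.qParam α z := by
        rw [Periodic.qParam, Periodic.qParam, Complex.exp_eq_exp_iff_exists_int]
        exact ⟨1, by field_simp; push_cast; ring⟩
      rw [e2, e3, hfp _ (by rw [hre]; exact h5.le)]
    · rfl
  have hgd : ∀ z : ℂ, -z.im < τ₃ → DifferentiableAt ℂ g z := by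
    intro z hz
    have e : (fun z => f (I * z) * Periodic.qParam α z) =ᶠ[𝓝 z] g := by
      filter_upwards [(Complex.continuous_im.neg.continuousAt.eventually (gt_mem_nhds hz))] with y hy
      have hy' : -y.im < τ₃ := hy
      simp only [hg, if_pos hy']
    refine DifferentiableAt.congr_of_eventuallyEq ?_ e.symm
    refine DifferentiableAt.mul ?_ (Periodic.differentiable_qParam z)
    exact (hfd (I * z) (by rw [hre]; exact hz.le)).comp (f := fun z => I * z) z (by fun_prop)
  have hqn : ∀ z : ℂ, ‖Periodic.qParam α z‖ = exp (2 * π / α * -z.im) := by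
    intro z
    rw [Periodic.norm_qParam]
    congr 1; ring
  have him : ∀ᶠ z : ℂ in comap Complex.im atTop, -z.im < τ₃ := by
    filter_upwards [preimage_mem_comap (Ioi_mem_atTop (-τ₃))] with z hz
    have : -τ₃ < z.im := hz
    linarith
  have hzero : Tendsto g (comap Complex.im atTop) (𝓝 0) := by
    have hlim : Tendsto (fun z : ℂ => B * exp ((2 * π / α - 1) * -z.im)) (comap Complex.im atTop) (𝓝 0) := by
      have h5 : 0 < 2 * π / α - 1 := by rw [sub_pos, lt_div_iff₀ hα]; linarith
      have h6 : Tendsto (fun y : ℝ => B * exp ((2 * π / α - 1) * -y)) atTop (𝓝 (B * 0)) :=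
        (tendsto_exp_atBot.comp (tendsto_neg_atTop_atBot.const_mul_atBot h5)).const_mul B
      rw [mul_zero] at h6
      exact h6.comp tendsto_comap
    refine squeeze_zero_norm' ?_ hlim
    filter_upwards [him] with z hz
    simp only [hg, if_pos hz]
    rw [norm_mul, hqn]
    have h5 := hB (I * z) (by rw [hre]; exact hz.le)
    rw [hre] at h5
    calc _ ≤ B * exp (- -z.im) * exp (2 * π / α * -z.im) :=
          mul_le_mul_of_nonneg_right h5 (exp_pos _).le
      _ = _ := by rw [mul_assoc, ← exp_add]; ring_nf
  set G := Periodic.cuspFunction α g with hG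
  set ρ := exp (2 * π / α * τ₃) with hρ
  have hGz : G 0 = 0 := Periodic.cuspFunction_zero_of_zero_at_inf hα hzero
  have hG0 : DifferentiableAt ℂ G 0 := Periodic.differentiableAt_cuspFunction_zero hα hgp
    (him.mono fun z hz => hgd z hz) (hzero.isBigO_one ℝ)
  have hGd : DifferentiableOn ℂ G (Metric.ball 0 ρ) := by
    intro ζ hζ
    rw [mem_ball_zero_iff] at hζ
    rcases eq_or_ne ζ 0 with rfl | hne
    · exact hG0.differentiableWithinAt
    · have h5 := Periodic.qParam_right_inv hα.ne' hne
      rw [← h5, hqn, hρ, exp_lt_exp, mul_lt_mul_iff_right₀ (by positivity)] at hζ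
      have := Periodic.differentiableAt_cuspFunction hα.ne' hgp (hgd _ hζ)
      rw [h5] at this
      exact this.differentiableWithinAt
  refine ⟨s₃, hs₃m, ρ, exp_pos _, dslope G 0,
    (Complex.differentiableOn_dslope (Metric.ball_mem_nhds 0 (exp_pos _))).2 hGd,
    fun s hs θ => ?_⟩
  set t := log (tan (s / 2)) with ht
  have hsπ : s < π := by linarith [hs.2]
  have ht3 : t < τ₃ := by
    refine log_lt_log (tan_half_pos hs.1 hsπ) ?_
    exact tan_lt_tan_of_nonneg_of_lt_pi_div_two (by linarith [hs.1]) (by linarith) (by linarith [hs.2])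
  set z : ℂ := -I * (t + θ * I) with hz
  have hIz : I * z = t + θ * I := by
    rw [hz, ← mul_assoc, mul_neg, Complex.I_mul_I]; ring
  have hzim : -z.im = t := by rw [← hre, hIz]; simp
  have hζ : coneCoord (α / (2 * π)) s θ = Periodic.qParam α z := by
    rw [coneCoord, Periodic.qParam, ← ht, hz]
    congr 1
    have : (π : ℂ) ≠ 0 := by exact_mod_cast hπ0.ne'
    push_cast
    field_simp
    rw [Complex.I_sq]; ring
  have hζ0 := Periodic.qParam_ne_zero (h := α) z
  have hH : dslope G 0 (coneCoord (α / (2 * π)) s θ) = f (t + θ * I) := by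
    rw [hζ, dslope_of_ne _ hζ0, slope_def_field, hGz, hG, Periodic.eq_cuspFunction hα.ne' hgp]
    simp only [hg, hzim, if_pos ht3, hIz]
    field_simp
    simp
  have hre2 : ((t : ℂ) + θ * I).re = t := by simp
  have him2 : ((t : ℂ) + θ * I).im = θ := by simp
  have hsa := two_arctan_tan_half hs.1 hsπ
  have hsin : 0 < sin s := sin_pos_of_pos_of_lt_pi hs.1 hsπ
  refine ⟨?_, ?_, ?_⟩
  · rw [hζ, mem_ball_zero_iff, hqn, hzim, hρ, exp_lt_exp]
    exact mul_lt_mul_of_pos_left ht3 (by positivity)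
  · rw [hH, hf, conformalFn, hre2, him2, ht, hsa]
    simp only [Complex.add_re, Complex.ofReal_re, Complex.mul_I_re, Complex.ofReal_im, neg_zero, add_zero]
    field_simp
    ring
  · rw [hH, hf, conformalFn, hre2, him2, ht, hsa]
    simp only [Complex.add_im, Complex.ofReal_im, Complex.mul_I_im, Complex.ofReal_re, zero_add]

end Holomorphic

/-! ### Tensors in polar coordinates -/

lemma linkMetric_id (φ : E3 → ℝ) {ξ v w : E3} (hξ : ‖ξ‖ = 1) (hv : inner ℝ ξ v = (0 : ℝ))
    (hw : inner ℝ ξ w = (0 : ℝ)) : linkMetric φ id ξ v w = exp (2 * φ ξ) * inner ℝ v w := by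
  have h0 : ξ ≠ 0 := norm_ne_zero_iff.1 (by rw [hξ]; norm_num)
  rw [linkMetric, fderiv_id_dir _ _ h0, fderiv_id_dir _ _ h0, dir_of_norm_eq_one hξ, hv, hw, hξ]
  simp

lemma linkMetric_smul_smul (φ : E3 → ℝ) (F : E3 → E3) (ξ v w : E3) (a b : ℝ) :
    linkMetric φ F ξ (a • v) (b • w) = a * b * linkMetric φ F ξ v w := by
  simp only [linkMetric, map_smul, inner_smul_left, inner_smul_right, conj_to_real]; ring

/-- Smoothness of the derivative by a parameter. -/
lemma contDiffOn_deriv_param {Y F : Type*} [NormedAddCommGroup Y] [NormedSpace ℝ Y]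
    [NormedAddCommGroup F] [NormedSpace ℝ F] {δ : ℝ} (hδ : 0 < δ) {U : Set Y} (hU : IsOpen U)
    {f : ℝ × Y → F} (hf : ContDiffOn ℝ ∞ f (Ioo (-δ) δ ×ˢ U)) :
    ContDiffOn ℝ ∞ (fun y => deriv (fun ε => f (ε, y)) 0) U := by
  have h0 : (0 : ℝ) ∈ Ioo (-δ) δ := ⟨by linarith, hδ⟩
  have hat : ∀ y ∈ U, ContDiffAt ℝ ∞ f (0, y) := fun y hy =>
    hf.contDiffAt ((isOpen_Ioo.prod hU).mem_nhds ⟨h0, hy⟩)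
  have e : ∀ y ∈ U, deriv (fun ε => f (ε, y)) 0 = fderiv ℝ f (0, y) (1, 0) := by
    intro y hy
    have : HasFDerivAt (fun ε => f (ε, y)) _ (0 : ℝ) :=
      HasFDerivAt.comp (0 : ℝ) (f := fun ε : ℝ => (ε, y))
        ((hat y hy).differentiableAt (by simp)).hasFDerivAt (hasFDerivAt_prodMk_left (0 : ℝ) y)
    rw [this.hasDerivAt.deriv]; simp
  refine ContDiffOn.congr (fun y hy => ContDiffAt.contDiffWithinAt ?_) e
  have h1 : ContDiffAt ℝ ∞ (fderiv ℝ f) (0, y) := (hat y hy).fderiv_right (by simp)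
  exact (h1.comp y (f := fun y => ((0 : ℝ), y)) (contDiffAt_const.prodMk contDiffAt_id)).clm_apply contDiffAt_const

lemma lieDerivative_congr {Z Z' : E3 → E3} {k k' : TensorField} {x : E3} (hZ : Z =ᶠ[𝓝 x] Z')
    (hk : k =ᶠ[𝓝 x] k') : lieDerivative Z k x = lieDerivative Z' k' x := by
  ext i j
  simp only [lieDerivative, of_apply]
  refine sum_congr rfl fun a _ => ?_
  rw [pd_congr (hk.mono fun y hy => congrFun (congrFun hy i) j),
    pd_congr (hZ.mono fun y hy => congrArg (fun v : E3 => v a) hy),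
    pd_congr (hZ.mono fun y hy => congrArg (fun v : E3 => v a) hy), hZ.self_of_nhds, hk.self_of_nhds]

lemma pd_polar {w : ℝ → ℝ} {u : ℝ → ℝ → ℝ} {x : E3} (hw : DifferentiableAt ℝ w (x 0))
    (hu : DifferentiableAt ℝ (fun z : ℝ × ℝ => u z.1 z.2) (x 1, x 2)) (i : Fin 3) :
    pd i (fun y => w (y 0) * u (y 1) (y 2)) x
      = ![deriv w (x 0) * u (x 1) (x 2), w (x 0) * deriv (fun s => u s (x 2)) (x 1),
          w (x 0) * deriv (u (x 1)) (x 2)] i := by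
  have hL : HasFDerivAt (fun y : E3 => (y 1, y 2)) ((EuclideanSpace.proj 1 : E3 →L[ℝ] ℝ).prod
      (EuclideanSpace.proj 2 : E3 →L[ℝ] ℝ)) x := (hasFDerivAt_coord x 1).prodMk (hasFDerivAt_coord x 2)
  have h1 : HasFDerivAt (fun y : E3 => u (y 1) (y 2)) _ x :=
    HasFDerivAt.comp (g := fun z : ℝ × ℝ => u z.1 z.2) (f := fun y : E3 => (y 1, y 2)) x (hasFDerivAt_partials hu) hL
  have h2 : HasFDerivAt (fun y : E3 => w (y 0)) _ x :=
    hw.hasDerivAt.comp_hasFDerivAt x (hasFDerivAt_coord x 0)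
  have h3 : HasFDerivAt (fun y : E3 => w (y 0) * u (y 1) (y 2)) _ x := h2.mul h1
  rw [pd, h3.fderiv]
  fin_cases i <;> simp [coordVec, mul_comm]

/-- The vector field `w(r) (u(s, θ) ∂_s + v(s, θ) ∂_θ)`. -/
noncomputable def polarField (w : ℝ → ℝ) (u v : ℝ → ℝ → ℝ) : E3 → E3 := fun x =>
  !₂[0, w (x 0) * u (x 1) (x 2), w (x 0) * v (x 1) (x 2)]

lemma lieDerivative_polarField (κ : ℝ) {w : ℝ → ℝ} {u v : ℝ → ℝ → ℝ} {x : E3} (hw : DifferentiableAt ℝ w (x 0))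
    (hu : DifferentiableAt ℝ (fun z : ℝ × ℝ => u z.1 z.2) (x 1, x 2))
    (hv : DifferentiableAt ℝ (fun z : ℝ × ℝ => v z.1 z.2) (x 1, x 2)) :
    lieDerivative (polarField w u v) (fun y => radialMetric κ (y 0) 1 0 (sin (y 1) ^ 2)) x = sn κ (x 0) ^ 2 •
        !![0, deriv w (x 0) * u (x 1) (x 2), sin (x 1) ^ 2 * (deriv w (x 0) * v (x 1) (x 2));
          deriv w (x 0) * u (x 1) (x 2), w (x 0) * (2 * deriv (fun s => u s (x 2)) (x 1)),
            w (x 0) * (deriv (u (x 1)) (x 2) + sin (x 1) ^ 2 * deriv (fun s => v s (x 2)) (x 1));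
          sin (x 1) ^ 2 * (deriv w (x 0) * v (x 1) (x 2)), w (x 0) * (deriv (u (x 1)) (x 2)
              + sin (x 1) ^ 2 * deriv (fun s => v s (x 2)) (x 1)),
            w (x 0) * (2 * (sin (x 1) * cos (x 1) * u (x 1) (x 2) + sin (x 1) ^ 2 * deriv (v (x 1)) (x 2)))] := by
  have hsn : DifferentiableAt ℝ (fun r => sn κ r ^ 2) (x 0) := ((hasDerivAt_sn κ (x 0)).pow 2).differentiableAt
  have p0 : ∀ i, pd i (fun _ : E3 => (0 : ℝ)) x = 0 := fun i => pd_const 0 x i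
  have p1 : ∀ i, pd i (fun _ : E3 => (1 : ℝ)) x = 0 := fun i => pd_const 1 x i
  have p2 : ∀ i, pd i (fun y : E3 => sn κ (y 0) ^ 2) x = ![deriv (fun r => sn κ r ^ 2) (x 0), 0, 0] i := by
    intro i
    have := pd_polar (w := fun r => sn κ r ^ 2) (u := fun _ _ => 1) hsn (by fun_prop) i
    simpa using this
  have p3 : ∀ i, pd i (fun y : E3 => sn κ (y 0) ^ 2 * sin (y 1) ^ 2) x
      = ![deriv (fun r => sn κ r ^ 2) (x 0) * sin (x 1) ^ 2, sn κ (x 0) ^ 2 * (2 * sin (x 1) * cos (x 1)), 0] i := by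
    intro i
    have := pd_polar (w := fun r => sn κ r ^ 2) (u := fun s _ => sin s ^ 2) (x := x) hsn (by fun_prop) i
    rw [this]
    have : deriv (fun s => sin s ^ 2) (x 1) = 2 * sin (x 1) * cos (x 1) := by
      have := ((hasDerivAt_sin (x 1)).fun_pow 2).deriv
      rw [this]; norm_num
    rw [this]; simp
  have pu := pd_polar hw hu
  have pv := pd_polar hw hv
  ext i j
  simp only [lieDerivative, polarField, radialMetric, of_apply, Fin.sum_univ_three]
  fin_cases i <;> fin_cases j <;> simp [p0, p1, p2, p3, pu, pv] <;> ring

namespace IsConePolar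

variable {ι : Type*} {J : Set ι} {q : ι → E3} {φ : E3 → ℝ} {j₀ : ι} {α s₀ : ℝ} {P : ℝ → ℝ → E3}

lemma differentiableAt_fst {F : E3 → E3} (h : IsConePolar J q φ F j₀ α s₀ P) {s : ℝ}
    (hs : s ∈ Ioo 0 s₀) (θ : ℝ) : DifferentiableAt ℝ (fun s' => P s' θ) s :=
  ((h.contDiffAt hs θ).differentiableAt (by simp)).comp (f := fun s : ℝ => (s, θ)) s (by fun_prop)

lemma differentiableAt_snd {F : E3 → E3} (h : IsConePolar J q φ F j₀ α s₀ P) {s : ℝ}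
    (hs : s ∈ Ioo 0 s₀) (θ : ℝ) : DifferentiableAt ℝ (fun θ' => P s θ') θ :=
  ((h.contDiffAt hs θ).differentiableAt (by simp)).comp (f := fun θ : ℝ => (s, θ)) θ (by fun_prop)

lemma inner_deriv_fst {F : E3 → E3} (h : IsConePolar J q φ F j₀ α s₀ P) {s : ℝ}
    (hs : s ∈ Ioo 0 s₀) (θ : ℝ) : inner ℝ (P s θ) (deriv (fun s' => P s' θ) s) = (0 : ℝ) :=
  inner_deriv_eq_zero (γ := fun s => P s θ) (h.differentiableAt_fst hs θ) (by
    filter_upwards [isOpen_Ioo.mem_nhds hs] with s' hs' using h.norm_eq s' hs' θ)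

lemma inner_deriv_snd {F : E3 → E3} (h : IsConePolar J q φ F j₀ α s₀ P) {s : ℝ}
    (hs : s ∈ Ioo 0 s₀) (θ : ℝ) : inner ℝ (P s θ) (deriv (fun θ' => P s θ') θ) = (0 : ℝ) :=
  inner_deriv_eq_zero (γ := fun θ => P s θ) (h.differentiableAt_snd hs θ)
    (Eventually.of_forall fun θ' => h.norm_eq s hs θ')

/-- The components, in polar coordinates, of a vector tangent to the sphere. -/
lemma eq_sum_of_inner_eq_zero (h : IsConePolar J q φ id j₀ α s₀ P) (hπ : s₀ ≤ π / 2) {s : ℝ}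
    (hs : s ∈ Ioo 0 s₀) (θ : ℝ) {v : E3} (hv : inner ℝ (P s θ) v = (0 : ℝ)) :
    v = (exp (2 * φ (P s θ)) * inner ℝ v (deriv (fun s' => P s' θ) s)) • deriv (fun s' => P s' θ) s
      + (exp (2 * φ (P s θ)) * inner ℝ v (deriv (fun θ' => P s θ') θ) / sin s ^ 2) • deriv (fun θ' => P s θ') θ := by
  set x : E3 := !₂[1, s, θ] with hx
  have hx1 : x 1 ∈ Ioo 0 s₀ := by simpa [hx] using hs
  have hn := h.norm_eq s hs θ
  have hdet := h.det_jac_ne_zero hπ (x := x) (by simp [hx]) hx1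
  obtain ⟨w, hw⟩ : ∃ w, fderiv ℝ (radialMap P) x w = v := by
    have hd : (fderiv ℝ (radialMap P) x).det ≠ 0 := by rwa [det_fderiv_eq]
    refine ⟨((fderiv ℝ (radialMap P) x).toContinuousLinearEquivOfDetNeZero hd).symm v, ?_⟩
    rw [← ContinuousLinearMap.toContinuousLinearEquivOfDetNeZero_apply _ hd]
    simp
  rw [fderiv_radialMap ((h.contDiffAt hx1 _).differentiableAt (by simp))] at hw
  have e0 : x 0 = 1 := by simp [hx]
  have e1 : x 1 = s := by simp [hx]
  have e2 : x 2 = θ := by simp [hx]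
  rw [e0, e1, e2, one_mul, one_mul] at hw
  have o1 := h.inner_deriv_fst hs θ
  have o2 := h.inner_deriv_snd hs θ
  have g11 := h.metric_ss s hs θ
  have g12 := h.metric_sθ s hs θ
  have g22 := h.metric_θθ s hs θ
  rw [linkMetric_id φ hn o1 o1] at g11
  rw [linkMetric_id φ hn o1 o2] at g12
  rw [linkMetric_id φ hn o2 o2] at g22
  set A := deriv (fun s' => P s' θ) s with hA
  set B := deriv (fun θ' => P s θ') θ with hB
  have hexp := exp_pos (2 * φ (P s θ))
  have hsin := h.sin_pos hπ hs
  have g12' : inner ℝ A B = (0 : ℝ) := (mul_eq_zero.1 g12).resolve_left hexp.ne'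
  have g21' : inner ℝ B A = (0 : ℝ) := by rw [real_inner_comm, g12']
  have hPP : inner ℝ (P s θ) (P s θ) = (1 : ℝ) := by rw [real_inner_self_eq_norm_sq, hn, one_pow]
  have hw0 : w 0 = 0 := by
    rw [← hw, inner_add_right, inner_add_right, inner_smul_right, inner_smul_right, inner_smul_right, o1, o2, hPP] at hv
    linarith
  rw [hw0, zero_smul, zero_add] at hw
  have w1 : exp (2 * φ (P s θ)) * inner ℝ v A = w 1 := by
    rw [← hw, inner_add_left, inner_smul_left, inner_smul_left, g21', conj_to_real]
    linear_combination (w 1) * g11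
  have w2 : exp (2 * φ (P s θ)) * inner ℝ v B / sin s ^ 2 = w 2 := by
    rw [← hw, inner_add_left, inner_smul_left, inner_smul_left, g12', conj_to_real,
      conj_to_real, div_eq_iff (pow_ne_zero 2 hsin.ne')]
    linear_combination (w 2) * g22
  rw [w1, w2, hw]

end IsConePolar

/-! ### The velocity of the polar coordinates -/

lemma isOpen_puncturedCone {ι : Type*} [Finite ι] (J : Set ι) (q : ι → E3) : IsOpen (puncturedCone J q) := by
  rw [isOpen_iff_mem_nhds]
  rintro x ⟨hx, hJ⟩
  have hc : ContinuousAt dir x := (contDiffAt_dir hx (n := 0)).continuousAt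
  have h1 : ∀ᶠ y in 𝓝 x, ∀ j : J, dir y ≠ q j :=
    eventually_all.2 fun j => hc.eventually (isOpen_ne.mem_nhds (hJ j j.2))
  filter_upwards [h1, isOpen_ne.mem_nhds hx] with y hy hy0
  exact ⟨hy0, fun j hj => hy ⟨j, hj⟩⟩

namespace SingularGerm

variable {V E : Type*} {S : SingularGerm V E} {p : V} {η : E × Bool} (hη : η ∈ S.endsAt p)
include hη

lemma isConePolar : IsConePolar (S.endsAt p) S.q (S.φ p) id η (S.angle η.1) S.s₀ (S.P η) :=
  (S.link p).polar η hη

lemma mem_puncturedCone {s : ℝ} (hs : s ∈ Ioo 0 S.s₀) (θ : ℝ) : S.P η s θ ∈ puncturedCone (S.endsAt p) S.q := by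
  have h := (S.link p).polar η hη
  refine ⟨h.ne_zero hs θ, fun j hj => ?_⟩
  rw [h.dir_eq hs]
  exact h.regular s hs θ j hj

lemma contDiffOn_exp_φ : ContDiffOn ℝ ∞ (fun z : ℝ × ℝ => exp (2 * S.φ p (S.P η z.1 z.2))) (Ioo 0 S.s₀ ×ˢ univ) := by
  have h := (S.link p).polar η hη
  have h1 : ContDiffOn ℝ ∞ (fun z : ℝ × ℝ => S.φ p (dir (S.P η z.1 z.2))) (Ioo 0 S.s₀ ×ˢ univ) :=
    (S.link p).smooth_φ.comp h.smooth fun z hz => mem_puncturedCone hη hz.1 z.2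
  refine ((contDiffOn_const (c := (2 : ℝ))).mul h1).exp.congr fun z hz => ?_
  simp only [h.dir_eq hz.1]

end SingularGerm

namespace StandardDeformation

variable {V E : Type*} {S : SingularGerm V E} (D : StandardDeformation S)

/-- The derivative of the logarithm of the cone angle. -/
noncomputable def cdot (e : E) : ℝ := deriv (D.c e) 0

/-- The polar coordinates at parameter `ε`, with an angular coordinate of a period which does not
depend on `ε`. -/
noncomputable def polar (η : E × Bool) (ε s θ : ℝ) : E3 := D.P η ε s ((1 + D.c η.1 ε) * θ)

/-- The velocity at `ε = 0` of the polar coordinates. -/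
noncomputable def velocity (η : E × Bool) (s θ : ℝ) : E3 := deriv (fun ε => D.polar η ε s θ) 0

/-- The radial component of the velocity of the polar coordinates. -/
noncomputable def radialVelocity (p : V) (η : E × Bool) (s θ : ℝ) : ℝ :=
  exp (2 * S.φ p (S.P η s θ)) * inner ℝ (D.velocity η s θ) (deriv (fun s' => S.P η s' θ) s)

/-- The angular component of the velocity of the polar coordinates. -/
noncomputable def angularVelocity (p : V) (η : E × Bool) (s θ : ℝ) : ℝ :=
  exp (2 * S.φ p (S.P η s θ)) * inner ℝ (D.velocity η s θ) (deriv (fun θ' => S.P η s θ') θ) / sin s ^ 2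

lemma zero_mem : (0 : ℝ) ∈ Ioo (-D.ε₀) D.ε₀ := ⟨by linarith [D.ε₀_pos], D.ε₀_pos⟩

lemma eventually_mem : ∀ᶠ ε : ℝ in 𝓝 0, ε ∈ Ioo (-D.ε₀) D.ε₀ := isOpen_Ioo.mem_nhds D.zero_mem

lemma hasDerivAt_c (e : E) : HasDerivAt (D.c e) (D.cdot e) 0 :=
  (((D.smooth_c e).contDiffAt (isOpen_Ioo.mem_nhds D.zero_mem)).differentiableAt (by simp)).hasDerivAt

lemma deriv_dihedralAngle (e : E) : deriv (D.dihedralAngle e) 0 = S.angle e * D.cdot e :=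
  (((D.hasDerivAt_c e).const_add 1).const_mul (S.angle e)).deriv

lemma preservesAngles_iff : D.PreservesAngles ↔ ∀ e, D.cdot e = 0 := by
  refine forall_congr' fun e => ?_
  rw [D.deriv_dihedralAngle, mul_eq_zero]
  exact or_iff_right (S.angle_pos e).ne'

variable {p : V} {η : E × Bool} (hη : η ∈ S.endsAt p)
include hη

lemma contDiffOn_polar : ContDiffOn ℝ ∞ (fun z : ℝ × ℝ × ℝ => D.polar η z.1 z.2.1 z.2.2)
    (Ioo (-D.ε₀) D.ε₀ ×ˢ (Ioo 0 S.s₀ ×ˢ univ)) := by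
  refine (D.smooth_P p η hη).comp (f := fun z : ℝ × ℝ × ℝ => (z.1, z.2.1, (1 + D.c η.1 z.1) * z.2.2))
    ?_ fun z hz => ⟨hz.1, hz.2.1, mem_univ _⟩
  refine contDiffOn_fst.prodMk ((contDiff_fst.comp contDiff_snd).contDiffOn.prodMk
    (ContDiffOn.mul (contDiffOn_const.add ?_) (contDiff_snd.comp contDiff_snd).contDiffOn))
  exact (D.smooth_c η.1).comp contDiffOn_fst fun z hz => hz.1

omit hη in
lemma polar_zero_eq (hη : η ∈ S.endsAt p) {s : ℝ} (hs : s ∈ Ioo 0 S.s₀) (θ : ℝ) : D.polar η 0 s θ = S.P η s θ := by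
  rw [polar, D.c_zero, add_zero, one_mul, D.P_zero p η hη s hs]

lemma contDiffOn_velocity : ContDiffOn ℝ ∞ (fun z : ℝ × ℝ => D.velocity η z.1 z.2) (Ioo 0 S.s₀ ×ˢ univ) :=
  contDiffOn_deriv_param D.ε₀_pos (isOpen_Ioo.prod isOpen_univ)
    (f := fun z : ℝ × ℝ × ℝ => D.polar η z.1 z.2.1 z.2.2) (D.contDiffOn_polar hη)

lemma norm_polar {ε : ℝ} (hε : ε ∈ Ioo (-D.ε₀) D.ε₀) {s : ℝ} (hs : s ∈ Ioo 0 S.s₀) (θ : ℝ) :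
    ‖D.polar η ε s θ‖ = 1 := ((D.link p ε hε).polar η hη).norm_eq s hs _

lemma velocity_add_angle {s : ℝ} (hs : s ∈ Ioo 0 S.s₀) (θ : ℝ) :
    D.velocity η s (θ + S.angle η.1) = D.velocity η s θ := by
  refine EventuallyEq.deriv_eq ?_
  filter_upwards [D.eventually_mem] with ε hε
  have := ((D.link p ε hε).polar η hη).periodic s hs ((1 + D.c η.1 ε) * θ)
  rw [polar, polar, ← this]
  ring_nf

lemma inner_velocity {s : ℝ} (hs : s ∈ Ioo 0 S.s₀) (θ : ℝ) : inner ℝ (S.P η s θ) (D.velocity η s θ) = (0 : ℝ) := by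
  rw [← D.polar_zero_eq hη hs θ]
  refine inner_deriv_eq_zero (γ := fun ε => D.polar η ε s θ) ?_ ?_
  · have h1 : ContDiffAt ℝ ∞ (fun z : ℝ × ℝ × ℝ => D.polar η z.1 z.2.1 z.2.2) (0, s, θ) :=
      (D.contDiffOn_polar hη).contDiffAt ((isOpen_Ioo.prod (isOpen_Ioo.prod isOpen_univ)).mem_nhds
        ⟨D.zero_mem, hs, mem_univ _⟩)
    exact (h1.differentiableAt (by simp)).comp (f := fun ε : ℝ => (ε, s, θ)) 0 (by fun_prop)
  · filter_upwards [D.eventually_mem] with ε hε using D.norm_polar hη hε hs θ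

lemma velocity_eq {s : ℝ} (hs : s ∈ Ioo 0 S.s₀) (θ : ℝ) :
    D.velocity η s θ = D.radialVelocity p η s θ • deriv (fun s' => S.P η s' θ) s
      + D.angularVelocity p η s θ • deriv (fun θ' => S.P η s θ') θ :=
  (SingularGerm.isConePolar hη).eq_sum_of_inner_eq_zero S.s₀_le hs θ (D.inner_velocity hη hs θ)

omit hη in
lemma contDiffOn_deriv_fst {P : ℝ → ℝ → E3} {s₀ : ℝ}
    (h : ContDiffOn ℝ ∞ (fun z : ℝ × ℝ => P z.1 z.2) (Ioo 0 s₀ ×ˢ univ)) :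
    ContDiffOn ℝ ∞ (fun z : ℝ × ℝ => deriv (fun s' => P s' z.2) z.1) (Ioo 0 s₀ ×ˢ univ) := by
  have hop : IsOpen (Ioo 0 s₀ ×ˢ (univ : Set ℝ)) := isOpen_Ioo.prod isOpen_univ
  have e : ∀ z ∈ Ioo 0 s₀ ×ˢ (univ : Set ℝ), deriv (fun s' => P s' z.2) z.1
      = fderiv ℝ (fun z : ℝ × ℝ => P z.1 z.2) z (1, 0) := by
    intro z hz
    have : HasFDerivAt (fun s => P s z.2) _ z.1 :=
      HasFDerivAt.comp (g := fun z : ℝ × ℝ => P z.1 z.2) (f := fun s : ℝ => (s, z.2)) z.1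
        ((h.contDiffAt (hop.mem_nhds hz)).differentiableAt (by simp)).hasFDerivAt
        (hasFDerivAt_prodMk_left z.1 z.2)
    rw [this.hasDerivAt.deriv]; simp
  refine ContDiffOn.congr (fun z hz => ContDiffAt.contDiffWithinAt ?_) e
  exact ((h.contDiffAt (hop.mem_nhds hz)).fderiv_right (by simp)).clm_apply contDiffAt_const

omit hη in
lemma contDiffOn_deriv_snd {P : ℝ → ℝ → E3} {s₀ : ℝ}
    (h : ContDiffOn ℝ ∞ (fun z : ℝ × ℝ => P z.1 z.2) (Ioo 0 s₀ ×ˢ univ)) :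
    ContDiffOn ℝ ∞ (fun z : ℝ × ℝ => deriv (fun θ' => P z.1 θ') z.2) (Ioo 0 s₀ ×ˢ univ) := by
  have hop : IsOpen (Ioo 0 s₀ ×ˢ (univ : Set ℝ)) := isOpen_Ioo.prod isOpen_univ
  have e : ∀ z ∈ Ioo 0 s₀ ×ˢ (univ : Set ℝ), deriv (fun θ' => P z.1 θ') z.2
      = fderiv ℝ (fun z : ℝ × ℝ => P z.1 z.2) z (0, 1) := by
    intro z hz
    have : HasFDerivAt (fun θ => P z.1 θ) _ z.2 :=
      HasFDerivAt.comp (g := fun z : ℝ × ℝ => P z.1 z.2) (f := fun θ : ℝ => (z.1, θ)) z.2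
        ((h.contDiffAt (hop.mem_nhds hz)).differentiableAt (by simp)).hasFDerivAt
        (hasFDerivAt_prodMk_right z.1 z.2)
    rw [this.hasDerivAt.deriv]; simp
  refine ContDiffOn.congr (fun z hz => ContDiffAt.contDiffWithinAt ?_) e
  exact ((h.contDiffAt (hop.mem_nhds hz)).fderiv_right (by simp)).clm_apply contDiffAt_const

lemma contDiffOn_radialVelocity : ContDiffOn ℝ ∞ (fun z : ℝ × ℝ => D.radialVelocity p η z.1 z.2) (Ioo 0 S.s₀ ×ˢ univ) :=
  (SingularGerm.contDiffOn_exp_φ hη).mul ((D.contDiffOn_velocity hη).inner ℝ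
    (contDiffOn_deriv_fst (SingularGerm.isConePolar hη).smooth))

lemma contDiffOn_angularVelocity : ContDiffOn ℝ ∞ (fun z : ℝ × ℝ => D.angularVelocity p η z.1 z.2)
    (Ioo 0 S.s₀ ×ˢ univ) := by
  refine ((SingularGerm.contDiffOn_exp_φ hη).mul ((D.contDiffOn_velocity hη).inner ℝ
    (contDiffOn_deriv_snd (SingularGerm.isConePolar hη).smooth))).div
    ((contDiff_sin.comp contDiff_fst).pow 2).contDiffOn fun z hz => ?_
  exact pow_ne_zero 2 ((SingularGerm.isConePolar hη).sin_pos S.s₀_le hz.1).ne'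

lemma radialVelocity_add_angle {s : ℝ} (hs : s ∈ Ioo 0 S.s₀) (θ : ℝ) :
    D.radialVelocity p η s (θ + S.angle η.1) = D.radialVelocity p η s θ := by
  have h := (S.link p).polar η hη
  have e : deriv (fun s' => S.P η s' (θ + S.angle η.1)) s = deriv (fun s' => S.P η s' θ) s := by
    refine EventuallyEq.deriv_eq ?_
    filter_upwards [isOpen_Ioo.mem_nhds hs] with s' hs' using h.periodic s' hs' θ
  rw [radialVelocity, radialVelocity, D.velocity_add_angle hη hs, h.periodic s hs, e]

lemma angularVelocity_add_angle {s : ℝ} (hs : s ∈ Ioo 0 S.s₀) (θ : ℝ) :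
    D.angularVelocity p η s (θ + S.angle η.1) = D.angularVelocity p η s θ := by
  have h := (S.link p).polar η hη
  have e : deriv (fun θ' => S.P η s θ') (θ + S.angle η.1) = deriv (fun θ' => S.P η s θ') θ := by
    rw [← deriv_comp_add_const]
    exact congrArg (fun f => deriv f θ) (funext fun θ' => h.periodic s hs θ')
  rw [angularVelocity, angularVelocity, D.velocity_add_angle hη hs, h.periodic s hs, e]

end StandardDeformation

namespace StandardDeformation

variable {V E : Type*} {S : SingularGerm V E} (D : StandardDeformation S)

lemma contDiffOn_metricAtVertex [Finite E] (κ : ℝ) (p : V) (i j : Fin 3) :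
    ContDiffOn ℝ ∞ (fun z : ℝ × E3 => D.metricAtVertex κ z.1 p z.2 i j)
      (Ioo (-D.ε₀) D.ε₀ ×ˢ puncturedCone (S.endsAt p) S.q) := by
  have hsub : ∀ z ∈ Ioo (-D.ε₀) D.ε₀ ×ˢ puncturedCone (S.endsAt p) S.q, z.2 ≠ 0 := fun z hz => hz.2.1
  have hop : IsOpen (Ioo (-D.ε₀) D.ε₀ ×ˢ {x : E3 | x ≠ 0}) := isOpen_Ioo.prod isOpen_ne
  have hc : ∀ i, ContDiff ℝ ∞ (fun z : ℝ × E3 => z.2 i) := fun i => (contDiff_coord i).comp contDiff_snd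
  have hn : ContDiffOn ℝ ∞ (fun z : ℝ × E3 => ‖z.2‖) (Ioo (-D.ε₀) D.ε₀ ×ˢ puncturedCone (S.endsAt p) S.q) := fun z hz =>
    ((contDiffAt_norm ℝ (hsub z hz)).comp z contDiffAt_snd).contDiffWithinAt
  have hF : ∀ v : E3, ContDiffOn ℝ ∞ (fun z : ℝ × E3 => fderiv ℝ (fun y => D.F p z.1 (dir y)) z.2 v)
      (Ioo (-D.ε₀) D.ε₀ ×ˢ puncturedCone (S.endsAt p) S.q) := by
    intro v
    have e : ∀ z ∈ Ioo (-D.ε₀) D.ε₀ ×ˢ puncturedCone (S.endsAt p) S.q, fderiv ℝ (fun y => D.F p z.1 (dir y)) z.2 v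
          = fderiv ℝ (fun z : ℝ × E3 => D.F p z.1 (dir z.2)) z (0, v) := by
      intro z hz
      have h1 := ((D.smooth_F p).contDiffAt (hop.mem_nhds ⟨hz.1, hsub z hz⟩)).differentiableAt (by simp)
      have : HasFDerivAt (fun y => D.F p z.1 (dir y)) _ z.2 :=
        HasFDerivAt.comp (g := fun z : ℝ × E3 => D.F p z.1 (dir z.2)) (f := fun y : E3 => (z.1, y)) z.2
          h1.hasFDerivAt (hasFDerivAt_prodMk_right z.1 z.2)
      rw [this.fderiv]; simp
    refine ContDiffOn.congr (fun z hz => ContDiffAt.contDiffWithinAt ?_) e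
    exact (((D.smooth_F p).contDiffAt (hop.mem_nhds ⟨hz.1, hsub z hz⟩)).fderiv_right (by simp)).clm_apply
      contDiffAt_const
  refine ContDiffOn.add (((hc i).mul (hc j)).contDiffOn.div (hn.pow 2) fun z hz => ?_) ?_
  · exact pow_ne_zero 2 (norm_ne_zero_iff.2 (hsub z hz))
  · refine (((contDiff_sn κ).comp_contDiffOn hn).pow 2).mul ?_
    exact (contDiffOn_const.mul (D.smooth_φ p)).exp.mul ((hF _).inner ℝ (hF _))

lemma contDiffOn_derivAtVertex [Finite E] (κ : ℝ) (p : V) (i j : Fin 3) :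
    ContDiffOn ℝ ∞ (fun x => D.derivAtVertex κ p x i j) (puncturedCone (S.endsAt p) S.q) :=
  contDiffOn_deriv_param D.ε₀_pos (isOpen_puncturedCone _ _)
    (f := fun z : ℝ × E3 => D.metricAtVertex κ z.1 p z.2 i j) (D.contDiffOn_metricAtVertex κ p i j)

/-- The velocity, as a vector field on the cone, in polar coordinates. -/
noncomputable def polarVelocity (p : V) (η : E × Bool) (w : ℝ → ℝ) : E3 → E3 :=
  polarField w (D.radialVelocity p η) (D.angularVelocity p η)

lemma fderiv_radialMap_polarField {P : ℝ → ℝ → E3} {w : ℝ → ℝ} {u v : ℝ → ℝ → ℝ} {x : E3}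
    (hP : DifferentiableAt ℝ (fun z : ℝ × ℝ => P z.1 z.2) (x 1, x 2)) :
    fderiv ℝ (radialMap P) x (polarField w u v x) = (x 0 * w (x 0)) • (u (x 1) (x 2) • deriv (fun s => P s (x 2)) (x 1)
        + v (x 1) (x 2) • deriv (fun θ => P (x 1) θ) (x 2)) := by
  rw [fderiv_radialMap hP]
  simp only [polarField, PiLp.toLp_apply, cons_val_zero, cons_val_one, cons_val]
  module

lemma contDiffAt_polarField {w : ℝ → ℝ} {u v : ℝ → ℝ → ℝ} {x : E3} {n : WithTop ℕ∞} (hw : ContDiffAt ℝ n w (x 0))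
    (hu : ContDiffAt ℝ n (fun z : ℝ × ℝ => u z.1 z.2) (x 1, x 2))
    (hv : ContDiffAt ℝ n (fun z : ℝ × ℝ => v z.1 z.2) (x 1, x 2)) :
    ContDiffAt ℝ n (polarField w u v) x := by
  have h1 : ContDiffAt ℝ n (fun y : E3 => (y 1, y 2)) x :=
    (contDiff_coord 1).contDiffAt.prodMk (contDiff_coord 2).contDiffAt
  have hw' : ContDiffAt ℝ n (fun y : E3 => w (y 0)) x := hw.comp x (contDiff_coord 0).contDiffAt
  have hu' : ContDiffAt ℝ n (fun y : E3 => u (y 1) (y 2)) x :=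
    hu.comp (f := fun y : E3 => (y 1, y 2)) x h1
  have hv' : ContDiffAt ℝ n (fun y : E3 => v (y 1) (y 2)) x :=
    hv.comp (f := fun y : E3 => (y 1, y 2)) x h1
  rw [contDiffAt_euclidean]
  intro i
  fin_cases i
  · exact contDiffAt_const
  · exact hw'.mul hu'
  · exact hw'.mul hv'

/-- In polar coordinates, the infinitesimal deformation and the Lie derivative along the velocity add up
to the derivative of the cone angle. -/
lemma pullback_derivAtVertex_add [Finite E] (κ : ℝ) {p : V} {η : E × Bool} (hη : η ∈ S.endsAt p)
    {x : E3} (hr : 0 < x 0) (hs : x 1 ∈ Ioo 0 S.s₀) (i j : Fin 3) :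
    pullback (radialMap (S.P η)) (D.derivAtVertex κ p) x i j + lieDerivative (D.polarVelocity p η fun _ => 1)
          (fun y => radialMetric κ (y 0) 1 0 (sin (y 1) ^ 2)) x i j
      = radialMetric κ (x 0) 0 0 (sin (x 1) ^ 2 * (2 * D.cdot η.1)) i j - radialMetric κ (x 0) 0 0 0 i j := by
  have h := SingularGerm.isConePolar hη
  have hop : IsOpen (Ioo 0 S.s₀ ×ˢ (univ : Set ℝ)) := isOpen_Ioo.prod isOpen_univ
  have hmem : ((x 1, x 2) : ℝ × ℝ) ∈ Ioo 0 S.s₀ ×ˢ (univ : Set ℝ) := ⟨hs, mem_univ _⟩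
  have hev : ∀ᶠ y : E3 in 𝓝 x, 0 < y 0 ∧ y 1 ∈ Ioo 0 S.s₀ :=
    ((continuous_coord 0).continuousAt.eventually (lt_mem_nhds hr)).and
      ((contDiff_coord 1 (n := 0)).continuous.continuousAt.eventually (isOpen_Ioo.mem_nhds hs))
  have e0 : ∀ y : E3, y 1 ∈ Ioo 0 S.s₀ → radialMap (D.polar η 0) y = radialMap (S.P η) y := by
    intro y hy
    rw [radialMap, radialMap, D.polar_zero_eq hη hy]
  have e0' : radialMap (D.polar η 0) =ᶠ[𝓝 x] radialMap (S.P η) := hev.mono fun y hy => e0 y hy.2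
  have hΦ : ContDiffAt ℝ ∞ (fun z : ℝ × E3 => radialMap (D.polar η z.1) z.2) (0, x) := by
    have h1 : ContDiffAt ℝ ∞ (fun z : ℝ × ℝ × ℝ => D.polar η z.1 z.2.1 z.2.2) (0, x 1, x 2) :=
      (D.contDiffOn_polar hη).contDiffAt ((isOpen_Ioo.prod hop).mem_nhds ⟨D.zero_mem, hmem⟩)
    have h2 : ∀ i, ContDiffAt ℝ ∞ (fun z : ℝ × E3 => z.2 i) (0, x) := fun i =>
      ((contDiff_coord i).comp contDiff_snd).contDiffAt
    exact (h2 0).smul (h1.comp (f := fun z : ℝ × E3 => (z.1, z.2 1, z.2 2)) ((0 : ℝ), x)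
      (contDiffAt_fst.prodMk ((h2 1).prodMk (h2 2))))
  have hx0 : radialMap (D.polar η 0) x ∈ puncturedCone (S.endsAt p) S.q := by
    rw [e0 x hs]
    have h1 := SingularGerm.mem_puncturedCone hη hs (x 2)
    refine ⟨smul_ne_zero hr.ne' h1.1, fun j hj => ?_⟩
    rw [radialMap, dir_smul hr]
    exact h1.2 j hj
  have hk : ∀ a b, DifferentiableAt ℝ (fun z : ℝ × E3 => D.metricAtVertex κ z.1 p z.2 a b)
      (0, radialMap (D.polar η 0) x) := fun a b =>
    ((D.contDiffOn_metricAtVertex κ p a b).contDiffAt ((isOpen_Ioo.prod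
      (isOpen_puncturedCone _ _)).mem_nhds ⟨D.zero_mem, hx0⟩)).differentiableAt (by simp)
  have hX : DifferentiableAt ℝ (D.polarVelocity p η fun _ => 1) x :=
    (contDiffAt_polarField (n := 1) contDiffAt_const
      (((D.contDiffOn_radialVelocity hη).contDiffAt (hop.mem_nhds hmem)).of_le (by exact_mod_cast le_top))
      (((D.contDiffOn_angularVelocity hη).contDiffAt (hop.mem_nhds hmem)).of_le (by exact_mod_cast le_top))
      ).differentiableAt (by simp)
  have hrel : ∀ᶠ y in 𝓝 x, fderiv ℝ (radialMap (D.polar η 0)) y (D.polarVelocity p η (fun _ => 1) y)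
      = deriv (fun ε => radialMap (D.polar η ε) y) 0 := by
    filter_upwards [hev, e0'.eventuallyEq_nhds] with y hy hy2
    rw [EventuallyEq.fderiv_eq hy2, polarVelocity, fderiv_radialMap_polarField
      ((h.contDiffAt hy.2 _).differentiableAt (by simp)), ← D.velocity_eq hη hy.2, mul_one]
    have hd : DifferentiableAt ℝ (fun ε => D.polar η ε (y 1) (y 2)) 0 := by
      have h1 : ContDiffAt ℝ ∞ (fun z : ℝ × ℝ × ℝ => D.polar η z.1 z.2.1 z.2.2) (0, y 1, y 2) :=
        (D.contDiffOn_polar hη).contDiffAt ((isOpen_Ioo.prod hop).mem_nhds ⟨D.zero_mem, hy.2, mem_univ _⟩)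
      exact (h1.differentiableAt (by simp)).comp (f := fun ε : ℝ => (ε, y 1, y 2)) 0 (by fun_prop)
    exact ((hd.hasDerivAt).const_smul (y 0)).deriv.symm
  have key := hasDerivAt_pullback (Φ := fun ε => radialMap (D.polar η ε))
    (k := fun ε => D.metricAtVertex κ ε p) (hΦ.of_le (by norm_cast)) hk hX hrel i j
  have hval : ∀ ε ∈ Ioo (-D.ε₀) D.ε₀, ∀ y : E3, 0 < y 0 → y 1 ∈ Ioo 0 S.s₀ →
      pullback (radialMap (D.polar η ε)) (D.metricAtVertex κ ε p) y
        = radialMetric κ (y 0) 1 0 ((1 + D.c η.1 ε) ^ 2 * sin (y 1) ^ 2) := by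
    intro ε hε y hy0 hy1
    have hε' := (D.link p ε hε).polar η hη
    have hmemy : ((ε, y 1, y 2) : ℝ × ℝ × ℝ) ∈ Ioo (-D.ε₀) D.ε₀ ×ˢ (Ioo 0 S.s₀ ×ˢ (univ : Set ℝ)) :=
      ⟨hε, hy1, mem_univ _⟩
    have hsm : ContDiffAt ℝ ∞ (fun z : ℝ × ℝ => D.polar η ε z.1 z.2) (y 1, y 2) :=
      ((D.contDiffOn_polar hη).contDiffAt ((isOpen_Ioo.prod hop).mem_nhds hmemy)).comp
        (f := fun z : ℝ × ℝ => (ε, z.1, z.2)) (y 1, y 2) (contDiffAt_const.prodMk contDiffAt_id)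
    have hFd : DifferentiableAt ℝ (fun y => D.F p ε (dir y)) (D.polar η ε (y 1) (y 2)) :=
      ((D.link p ε hε).smooth_F.contDiffAt (isOpen_ne.mem_nhds (hε'.ne_zero hy1 _))).differentiableAt (by simp)
    have hnn : ∀ᶠ z : ℝ × ℝ in 𝓝 (y 1, y 2), ‖D.polar η ε z.1 z.2‖ = 1 := by
      filter_upwards [hop.mem_nhds (show ((y 1, y 2) : ℝ × ℝ) ∈ Ioo 0 S.s₀ ×ˢ univ from ⟨hy1, mem_univ _⟩)] with z hz
      exact D.norm_polar hη hε hz.1 z.2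
    have dθ : deriv (fun θ => D.polar η ε (y 1) θ) (y 2)
        = (1 + D.c η.1 ε) • deriv (fun θ' => D.P η ε (y 1) θ') ((1 + D.c η.1 ε) * y 2) :=
      deriv_comp_mul_left (1 + D.c η.1 ε) (fun θ' => D.P η ε (y 1) θ') (y 2)
    rw [StandardDeformation.metricAtVertex, pullback_radialMap_coneMetric hy0 (hsm.differentiableAt (by simp)) hnn hFd, dθ]
    have g1 := hε'.metric_ss _ hy1 ((1 + D.c η.1 ε) * y 2)
    have g2 := hε'.metric_sθ _ hy1 ((1 + D.c η.1 ε) * y 2)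
    have g3 := hε'.metric_θθ _ hy1 ((1 + D.c η.1 ε) * y 2)
    have m1 : ∀ v w : E3, linkMetric (D.φ p ε) (D.F p ε) (D.polar η ε (y 1) (y 2)) v ((1 + D.c η.1 ε) • w)
        = (1 + D.c η.1 ε) * linkMetric (D.φ p ε) (D.F p ε) (D.polar η ε (y 1) (y 2)) v w := by
      intro v w
      have := linkMetric_smul_smul (D.φ p ε) (D.F p ε) (D.polar η ε (y 1) (y 2)) v w 1 (1 + D.c η.1 ε)
      rwa [one_smul, one_mul] at this
    rw [m1, linkMetric_smul_smul]
    simp only [polar]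
    rw [g1, g2, g3, mul_zero, sq (1 + D.c η.1 ε)]
  have hder : HasDerivAt (fun ε => pullback (radialMap (D.polar η ε)) (D.metricAtVertex κ ε p) x i j)
      (radialMetric κ (x 0) 0 0 (sin (x 1) ^ 2 * (2 * D.cdot η.1)) i j - radialMetric κ (x 0) 0 0 0 i j) 0 := by
    have hc : HasDerivAt (fun ε => sn κ (x 0) ^ 2 * ((1 + D.c η.1 ε) ^ 2 * sin (x 1) ^ 2))
        (sn κ (x 0) ^ 2 * (sin (x 1) ^ 2 * (2 * D.cdot η.1))) 0 := by
      refine (((((D.hasDerivAt_c η.1).const_add 1).fun_pow 2).mul_const _).const_mul _).congr_deriv ?_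
      rw [D.c_zero]; push_cast; ring
    have e1 : (fun ε => pullback (radialMap (D.polar η ε)) (D.metricAtVertex κ ε p) x i j)
        =ᶠ[𝓝 0] fun ε => radialMetric κ (x 0) 1 0 ((1 + D.c η.1 ε) ^ 2 * sin (x 1) ^ 2) i j := by
      filter_upwards [D.eventually_mem] with ε hε
      rw [hval ε hε x hr hs]
    refine HasDerivAt.congr_of_eventuallyEq ?_ e1
    fin_cases i <;> fin_cases j <;> simp [radialMetric] <;>
      first | exact hasDerivAt_const _ _ | exact hc
  have hfin := key.unique hder
  rw [← hfin]
  have hg : pullback (radialMap (D.polar η 0)) (D.metricAtVertex κ 0 p)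
      =ᶠ[𝓝 x] fun y => radialMetric κ (y 0) 1 0 (sin (y 1) ^ 2) := by
    filter_upwards [hev] with y hy
    rw [hval 0 D.zero_mem y hy.1 hy.2, D.c_zero]; simp
  rw [lieDerivative_congr (EventuallyEq.refl _ _) hg, pullback_congr e0']
  rfl

end StandardDeformation

/-! ### The velocity as a conformal Killing field -/

lemma pullback_radialMap_dr {P : ℝ → ℝ → E3} {x : E3} (hr : 0 < x 0)
    (hP : DifferentiableAt ℝ (fun z : ℝ × ℝ => P z.1 z.2) (x 1, x 2)) (hn : ‖P (x 1) (x 2)‖ = 1)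
    (o1 : inner ℝ (P (x 1) (x 2)) (deriv (fun s => P s (x 2)) (x 1)) = (0 : ℝ))
    (o2 : inner ℝ (P (x 1) (x 2)) (deriv (fun θ => P (x 1) θ) (x 2)) = (0 : ℝ)) (κ : ℝ) (i j : Fin 3) :
    pullback (radialMap P) (fun y => Matrix.of fun a b => y a * y b / ‖y‖ ^ 2) x i j
      = radialMetric κ (x 0) 0 0 0 i j := by
  have h1 : ∀ v, ∑ a, (fderiv ℝ (radialMap P) x v) a * radialMap P x a = x 0 * v 0 := by
    intro v
    have hPP : inner ℝ (P (x 1) (x 2)) (P (x 1) (x 2)) = (1 : ℝ) := by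
      rw [real_inner_self_eq_norm_sq, hn, one_pow]
    rw [sum_mul_coord, fderiv_radialMap hP, radialMap]
    simp only [inner_add_right, inner_smul_right, inner_smul_left, o1, o2, hPP, conj_to_real]
    ring
  have h2 : ‖radialMap P x‖ = x 0 := by
    rw [radialMap, norm_smul, hn, mul_one, norm_of_nonneg hr.le]
  have h3 : pullback (radialMap P) (fun y => Matrix.of fun a b => y a * y b / ‖y‖ ^ 2) x i j
      = (∑ a, (fderiv ℝ (radialMap P) x (coordVec i)) a * radialMap P x a)
        * (∑ b, (fderiv ℝ (radialMap P) x (coordVec j)) b * radialMap P x b) / ‖radialMap P x‖ ^ 2 := by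
    rw [pullback_apply, Finset.sum_mul_sum, Finset.sum_div]
    refine sum_congr rfl fun a _ => ?_
    rw [Finset.sum_div]
    refine sum_congr rfl fun b _ => ?_
    simp only [jac, of_apply]; ring
  rw [h3, h1, h1, h2]
  have := hr.ne'
  fin_cases i <;> fin_cases j <;> simp [coordVec, radialMetric]
  field_simp

namespace StandardDeformation

variable {V E : Type*} {S : SingularGerm V E} (D : StandardDeformation S)

/-- The derivative of the conformal factor of the link. -/
noncomputable def φDot (p : V) (ξ : E3) : ℝ := deriv (fun ε => D.φ p ε ξ) 0

lemma differentiableAt_φ [Finite E] {p : V} {ξ : E3} (hξ : ‖ξ‖ = 1)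
    (hm : ξ ∈ puncturedCone (S.endsAt p) S.q) : DifferentiableAt ℝ (fun ε => D.φ p ε ξ) 0 := by
  have h1 := (((D.smooth_φ p).contDiffAt ((isOpen_Ioo.prod (isOpen_puncturedCone _ _)).mem_nhds
    (⟨D.zero_mem, hm⟩ : ((0 : ℝ), ξ) ∈ _ ×ˢ _))).differentiableAt (by simp)).comp
      (f := fun ε : ℝ => (ε, ξ)) 0 (by fun_prop)
  simpa [Function.comp_def, dir_of_norm_eq_one hξ] using h1

/-- Near the cone points the metrics of the links vary in their conformal class. -/
lemma exists_derivAtVertex_eq [Finite E] {p : V} {η : E × Bool} (hη : η ∈ S.endsAt p) :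
    ∃ δ > 0, ∀ (κ : ℝ) (x : E3), x ∈ puncturedCone (S.endsAt p) S.q → ‖dir x - S.q η‖ < δ → ∀ i j,
      D.derivAtVertex κ p x i j = 2 * D.φDot p (dir x) * (S.metricAtVertex κ p x i j - x i * x j / ‖x‖ ^ 2) := by
  obtain ⟨δ, hδ, hiso⟩ := D.isometric p η hη
  refine ⟨δ, hδ, fun κ x hx hlt i j => ?_⟩
  have hd := (contDiffAt_dir hx.1 (n := 1)).differentiableAt (by simp)
  have hev : ∀ᶠ ε in 𝓝 (0 : ℝ), D.metricAtVertex κ ε p x i j = x i * x j / ‖x‖ ^ 2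
      + sn κ ‖x‖ ^ 2 * (exp (2 * D.φ p ε (dir x)) *
      inner ℝ (fderiv ℝ (fun y => id (dir y)) x (coordVec i)) (fderiv ℝ (fun y => id (dir y)) x (coordVec j))) := by
    filter_upwards [D.eventually_mem] with ε hε
    have h1 : inner ℝ (fderiv ℝ (fun y => D.F p ε (dir y)) x (coordVec i))
        (fderiv ℝ (fun y => D.F p ε (dir y)) x (coordVec j)) = (inner ℝ
        (fderiv ℝ (fun y => id (dir y)) x (coordVec i)) (fderiv ℝ (fun y => id (dir y)) x (coordVec j)) : ℝ) := by
      refine inner_fderiv_eq_of_isometric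
        ((((D.link p ε hε).smooth_F).contDiffAt (isOpen_ne.mem_nhds hx.1)).differentiableAt (by simp)) hd ?_ _ _
      filter_upwards [isOpen_ne.mem_nhds hx.1, (hd.continuousAt.sub_const (S.q η)).norm.eventually
        (gt_mem_nhds hlt)] with y hy hy2
      exact hiso ε hε _ _ (norm_dir hy) (norm_dir hx.1) hy2 hlt
    simp only [StandardDeformation.metricAtVertex, coneMetric, of_apply, h1]
  have hφ := D.differentiableAt_φ (norm_dir hx.1) (p := p) (ξ := dir x) ⟨norm_ne_zero_iff.1 (by
    rw [norm_dir hx.1]; norm_num), fun j hj => by rw [dir_of_norm_eq_one (norm_dir hx.1)]; exact hx.2 j hj⟩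
  have hdd := ((((hφ.hasDerivAt.const_mul 2).exp).mul_const (inner ℝ
    (fderiv ℝ (fun y => id (dir y)) x (coordVec i)) (fderiv ℝ (fun y => id (dir y)) x (coordVec j)))).const_mul
    (sn κ ‖x‖ ^ 2)).const_add (x i * x j / ‖x‖ ^ 2)
  rw [derivAtVertex, of_apply, EventuallyEq.deriv_eq hev, hdd.deriv, D.φ_zero p _ (norm_dir hx.1)]
  simp only [SingularGerm.metricAtVertex, coneMetric, of_apply, φDot]
  ring

lemma exists_pullback_derivAtVertex_eq [Finite E] {p : V} {η : E × Bool} (hη : η ∈ S.endsAt p) :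
    ∃ σ ∈ Ioo 0 S.s₀, ∀ (κ : ℝ) (x : E3), 0 < x 0 → x 1 ∈ Ioo 0 σ → ∀ i j,
      pullback (radialMap (S.P η)) (D.derivAtVertex κ p) x i j
        = 2 * D.φDot p (S.P η (x 1) (x 2)) * (radialMetric κ (x 0) 1 0 (sin (x 1) ^ 2) i j
          - radialMetric κ (x 0) 0 0 0 i j) := by
  obtain ⟨δ, hδ, h1⟩ := D.exists_derivAtVertex_eq hη
  have h := SingularGerm.isConePolar hη
  have hs₀ := S.s₀_pos
  obtain ⟨σ, hσ, h2⟩ := h.tendsto δ hδ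
  refine ⟨min σ (S.s₀ / 2), ⟨by positivity, (min_le_right _ _).trans_lt (by linarith)⟩, fun κ x hr hs i j => ?_⟩
  have hs' : x 1 ∈ Ioo 0 S.s₀ := ⟨hs.1, hs.2.trans_le ((min_le_right _ _).trans (by linarith))⟩
  have hdir : dir (radialMap (S.P η) x) = S.P η (x 1) (x 2) := by
    rw [radialMap, dir_smul hr, h.dir_eq hs']
  have hm : radialMap (S.P η) x ∈ puncturedCone (S.endsAt p) S.q := by
    have h3 := SingularGerm.mem_puncturedCone hη hs' (x 2)
    refine ⟨smul_ne_zero hr.ne' h3.1, fun j hj => ?_⟩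
    rw [hdir, ← h.dir_eq hs']
    exact h3.2 j hj
  have h4 := h1 κ _ hm (by rw [hdir]; exact h2 _ hs' (hs.2.trans_le (min_le_left _ _)) _)
  rw [hdir] at h4
  have h5 : pullback (radialMap (S.P η)) (D.derivAtVertex κ p) x i j
      = 2 * D.φDot p (S.P η (x 1) (x 2)) * (pullback (radialMap (S.P η)) (S.metricAtVertex κ p) x i j
        - pullback (radialMap (S.P η)) (fun y => Matrix.of fun a b => y a * y b / ‖y‖ ^ 2) x i j) := by
    simp only [pullback_apply, h4, of_apply, Fin.sum_univ_three]
    ring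
  rw [h5, SingularGerm.metricAtVertex, h.pullback_coneMetric κ IsConePolar.contDiffOn_id_dir hr hs',
    pullback_radialMap_dr hr ((h.contDiffAt hs' _).differentiableAt (by simp)) (h.norm_eq _ hs' _)
      (h.inner_deriv_fst hs' _) (h.inner_deriv_snd hs' _) κ]

/-- The equations for the velocity as a conformal Killing field. -/
lemma exists_velocity_equations [Finite E] {p : V} {η : E × Bool} (hη : η ∈ S.endsAt p) :
    ∃ σ ∈ Ioo 0 S.s₀, ∀ s ∈ Ioo 0 σ, ∀ θ, deriv (fun s' => D.radialVelocity p η s' θ) s = - D.φDot p (S.P η s θ) ∧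
      deriv (D.radialVelocity p η s) θ + sin s ^ 2 * deriv (fun s' => D.angularVelocity p η s' θ) s = 0 ∧
      cos s * D.radialVelocity p η s θ / sin s + deriv (D.angularVelocity p η s) θ
        = D.cdot η.1 + deriv (fun s' => D.radialVelocity p η s' θ) s ∧
      ∀ (κ : ℝ) (x : E3), 0 < x 0 → x 1 = s → x 2 = θ → ∀ i j, pullback (radialMap (S.P η)) (D.derivAtVertex κ p) x i j
        = - 2 * deriv (fun s' => D.radialVelocity p η s' θ) s *
          (radialMetric κ (x 0) 1 0 (sin s ^ 2) i j - radialMetric κ (x 0) 0 0 0 i j) := by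
  obtain ⟨σ, hσ, h1⟩ := D.exists_pullback_derivAtVertex_eq hη
  refine ⟨σ, hσ, fun s hs θ => ?_⟩
  have hs' : s ∈ Ioo 0 S.s₀ := ⟨hs.1, hs.2.trans hσ.2⟩
  have hop : IsOpen (Ioo 0 S.s₀ ×ˢ (univ : Set ℝ)) := isOpen_Ioo.prod isOpen_univ
  have hmem : ((s, θ) : ℝ × ℝ) ∈ Ioo 0 S.s₀ ×ˢ (univ : Set ℝ) := ⟨hs', mem_univ _⟩
  set x : E3 := !₂[1, s, θ] with hx
  have x0 : x 0 = 1 := by simp [hx]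
  have x1 : x 1 = s := by simp [hx]
  have x2 : x 2 = θ := by simp [hx]
  have hsin := (SingularGerm.isConePolar hη).sin_pos S.s₀_le hs'
  have key := fun i j => D.pullback_derivAtVertex_add 0 hη (x := x) (by rw [x0]; norm_num) (by rwa [x1]) i j
  have key2 := h1 0 x (by rw [x0]; norm_num) (by rwa [x1])
  simp only [key2] at key
  rw [polarVelocity, lieDerivative_polarField 0 (by fun_prop)
    (by rw [x1, x2]; exact ((D.contDiffOn_radialVelocity hη).contDiffAt (hop.mem_nhds hmem)).differentiableAt (by simp))
    (by rw [x1, x2]; exact ((D.contDiffOn_angularVelocity hη).contDiffAt (hop.mem_nhds hmem)).differentiableAt (by simp))] at key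
  have k11 := key 1 1
  have k12 := key 1 2
  have k22 := key 2 2
  simp [radialMetric, x0, x1, x2, sn] at k11 k12 k22
  have e1 : deriv (fun s' => D.radialVelocity p η s' θ) s = - D.φDot p (S.P η s θ) := by linarith
  refine ⟨e1, k12, ?_, fun κ y hy0 hy1 hy2 i j => ?_⟩
  · have hsin' := hsin.ne'
    rw [e1, div_add' _ _ _ hsin', div_eq_iff hsin']
    have : sin s * (cos s * D.radialVelocity p η s θ + deriv (D.angularVelocity p η s) θ * sin s)
        = sin s * ((D.cdot η.1 + -D.φDot p (S.P η s θ)) * sin s) := by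
      linear_combination k22 / 2
    exact mul_left_cancel₀ hsin' this
  · rw [h1 κ y hy0 (by rw [hy1]; exact hs) i j, e1, hy1, hy2]
    ring

/-- `φDot` is logarithmic in the distance to the cone point in the round metric, which is bounded from below
by a power of `s`. -/
lemma exists_abs_φDot_le [Finite E] {p : V} {η : E × Bool} (hη : η ∈ S.endsAt p) :
    ∃ C, ∃ σ ∈ Ioo 0 S.s₀, ∀ s ∈ Ioo 0 σ, ∀ θ, |D.φDot p (S.P η s θ)| ≤ C * (1 + |log s|) := by
  have h := SingularGerm.isConePolar hη
  have hα := S.angle_pos η.1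
  have hπ := pi_pos
  obtain ⟨C₁, hC₁, σ₁, hσ₁, h1⟩ := h.exists_le_angle_rpow S.s₀_le hα hη (S.norm_q η) S.s₀_pos
    ((S.link p).log_singularity η hη)
  obtain ⟨C₂, δ, hδ, h2⟩ := D.log_derivative p η hη 0 D.zero_mem
  obtain ⟨σ₂, hσ₂, h3⟩ := h.exists_angle_lt (S.norm_q η) (lt_min hδ one_pos)
  set β := S.angle η.1 / (2 * π) with hβ
  have hβ0 : 0 < β := by positivity
  refine ⟨|C₂| + |β * D.cdot η.1| * ((|log C₁| + 1) / β), min σ₁ σ₂,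
    ⟨lt_min hσ₁.1 hσ₂, (min_le_left _ _).trans_lt hσ₁.2⟩, fun s hs θ => ?_⟩
  have hs₁ : s ∈ Ioo 0 σ₁ := ⟨hs.1, hs.2.trans_le (min_le_left _ _)⟩
  have hss : s ∈ Ioo 0 S.s₀ := ⟨hs.1, hs₁.2.trans hσ₁.2⟩
  obtain ⟨ha0, hsa⟩ := h1 s hs₁ θ
  have ha := h3 s hss (hs.2.trans_le (min_le_right _ _)) θ
  have hd := h2 (S.P η s θ) (h.norm_eq s hss θ) ha0 (ha.trans_le (min_le_left _ _))
  set ψ := angle (S.P η s θ) (S.q η) with hψ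
  have ha1 : ψ < 1 := ha.trans_le (min_le_right _ _)
  have hder : deriv (fun ε' => D.φ p ε' (S.P η s θ) - (S.angle η.1 * (1 + D.c η.1 ε') / (2 * π) - 1)
      * log ψ) 0 = D.φDot p (S.P η s θ) - β * D.cdot η.1 * log ψ := by
    have hφ := (D.differentiableAt_φ (h.norm_eq s hss θ) (SingularGerm.mem_puncturedCone hη hss θ)).hasDerivAt
    have hc := ((((((D.hasDerivAt_c η.1).const_add 1).const_mul (S.angle η.1)).div_const (2 * π)).sub_const 1).mul_const
      (log ψ))
    rw [(hφ.fun_sub hc).deriv, φDot, hβ]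
    ring
  rw [hder] at hd
  have hlogψ : log ψ ≤ 0 := log_nonpos ha0.le ha1.le
  have hlog : |log ψ| ≤ (|log C₁| + |log s|) / β := by
    rw [abs_of_nonpos hlogψ, le_div_iff₀ hβ0]
    have h5 := log_le_log hs.1 hsa
    rw [log_mul hC₁.ne' (by positivity), log_rpow ha0] at h5
    have := le_abs_self (log C₁)
    have := neg_abs_le (log s)
    linarith
  have h6 : |D.φDot p (S.P η s θ)| ≤ |C₂| + |β * D.cdot η.1| * |log ψ| := by
    have e : D.φDot p (S.P η s θ) = (D.φDot p (S.P η s θ) - β * D.cdot η.1 * log ψ) + β * D.cdot η.1 * log ψ := by ring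
    rw [e]
    refine (abs_add_le _ _).trans (add_le_add (hd.trans (le_abs_self _)) ?_)
    rw [abs_mul]
  refine h6.trans ?_
  have h7 : |β * D.cdot η.1| * |log ψ| ≤ |β * D.cdot η.1| * ((|log C₁| + |log s|) / β) :=
    mul_le_mul_of_nonneg_left hlog (abs_nonneg _)
  have h8 : (|log C₁| + |log s|) / β ≤ (|log C₁| + 1) / β * (1 + |log s|) := by
    rw [div_mul_eq_mul_div, div_le_div_iff_of_pos_right hβ0]
    nlinarith [abs_nonneg (log C₁), abs_nonneg (log s)]
  have h9 := mul_le_mul_of_nonneg_left h8 (abs_nonneg (β * D.cdot η.1))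
  have := mul_nonneg (abs_nonneg C₂) (abs_nonneg (log s))
  calc _ ≤ |C₂| + |β * D.cdot η.1| * ((|log C₁| + 1) / β * (1 + |log s|)) := by linarith
    _ ≤ _ := by nlinarith

/-- In the polar disc of radius `σ`, the velocity is given by the function `H`, holomorphic on the disc
of radius `ρ`, in the conformal coordinate. -/
structure IsHolomorphicVelocity (p : V) (η : E × Bool) (σ ρ : ℝ) (H : ℂ → ℂ) : Prop where
  mem : σ ∈ Ioo 0 S.s₀
  radius_pos : 0 < ρ
  holomorphic : DifferentiableOn ℂ H (Metric.ball 0 ρ)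
  coneCoord_mem : ∀ s ∈ Ioo 0 σ, ∀ θ, coneCoord (S.angle η.1 / (2 * π)) s θ ∈ Metric.ball 0 ρ
  radial : ∀ s ∈ Ioo 0 σ, ∀ θ, D.radialVelocity p η s θ = sin s * ((H (coneCoord (S.angle η.1 / (2 * π)) s θ)).re
        - D.cdot η.1 * log (tan (s / 2)))
  angular : ∀ s ∈ Ioo 0 σ, ∀ θ, D.angularVelocity p η s θ = (H (coneCoord (S.angle η.1 / (2 * π)) s θ)).im
  pullback_add : ∀ (κ : ℝ) (w : ℝ → ℝ) (x : E3), 0 < x 0 → x 1 ∈ Ioo 0 σ → DifferentiableAt ℝ w (x 0) →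
    pullback (radialMap (S.P η)) (D.derivAtVertex κ p) x
      + lieDerivative (D.polarVelocity p η w) (fun y => radialMetric κ (y 0) 1 0 (sin (y 1) ^ 2)) x
      = sn κ (x 0) ^ 2 • !![0, deriv w (x 0) * D.radialVelocity p η (x 1) (x 2),
            sin (x 1) ^ 2 * (deriv w (x 0) * D.angularVelocity p η (x 1) (x 2));
          deriv w (x 0) * D.radialVelocity p η (x 1) (x 2),
            -2 * (1 - w (x 0)) * deriv (fun s => D.radialVelocity p η s (x 2)) (x 1), 0;
          sin (x 1) ^ 2 * (deriv w (x 0) * D.angularVelocity p η (x 1) (x 2)), 0,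
            sin (x 1) ^ 2 * (-2 * (1 - w (x 0)) * deriv (fun s => D.radialVelocity p η s (x 2)) (x 1)
              + 2 * w (x 0) * D.cdot η.1)]

/-- The hypotheses of `exists_holomorphic` hold for the velocity of the polar coordinates. -/
lemma exists_isHolomorphicVelocity [Finite E] {p : V} {η : E × Bool} (hη : η ∈ S.endsAt p) :
    ∃ σ ρ H, D.IsHolomorphicVelocity p η σ ρ H := by
  obtain ⟨C, σ₁, hσ₁, h1⟩ := D.exists_abs_φDot_le hη
  obtain ⟨σ₂, hσ₂, h2⟩ := D.exists_velocity_equations hη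
  have hop : IsOpen (Ioo 0 S.s₀ ×ˢ (univ : Set ℝ)) := isOpen_Ioo.prod isOpen_univ
  set σ := min σ₁ σ₂ with hσ
  have hσ0 : 0 < σ := lt_min hσ₁.1 hσ₂.1
  have hσs : σ < S.s₀ := (min_le_left _ _).trans_lt hσ₁.2
  have m : ∀ s ∈ Ioo 0 σ, s ∈ Ioo 0 σ₁ ∧ s ∈ Ioo 0 σ₂ ∧ s ∈ Ioo 0 S.s₀ := fun s hs =>
    ⟨⟨hs.1, hs.2.trans_le (min_le_left _ _)⟩, ⟨hs.1, hs.2.trans_le (min_le_right _ _)⟩, ⟨hs.1, hs.2.trans hσs⟩⟩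
  have dX : ∀ s ∈ Ioo 0 S.s₀, ∀ θ, DifferentiableAt ℝ (fun z : ℝ × ℝ => D.radialVelocity p η z.1 z.2) (s, θ) :=
    fun s hs θ => ((D.contDiffOn_radialVelocity hη).contDiffAt (hop.mem_nhds ⟨hs, mem_univ _⟩)).differentiableAt (by simp)
  have dY : ∀ s ∈ Ioo 0 S.s₀, ∀ θ, DifferentiableAt ℝ (fun z : ℝ × ℝ => D.angularVelocity p η z.1 z.2) (s, θ) :=
    fun s hs θ => ((D.contDiffOn_angularVelocity hη).contDiffAt (hop.mem_nhds ⟨hs, mem_univ _⟩)).differentiableAt (by simp)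
  obtain ⟨s₃, hs₃, ρ, hρ, H, hH, h3⟩ := exists_holomorphic (s₂ := σ) (C := C) (c := D.cdot η.1)
    (X := D.radialVelocity p η) (Y := D.angularVelocity p η)
    hσ0 (hσs.le.trans S.s₀_le) (S.angle_pos η.1) (S.angle_lt η.1)
    (fun s hs => dX s (m s hs).2.2) (fun s hs => dY s (m s hs).2.2)
    (fun s hs θ => D.radialVelocity_add_angle hη (m s hs).2.2 θ)
    (fun s hs θ => D.angularVelocity_add_angle hη (m s hs).2.2 θ)
    (fun s hs θ => by rw [(h2 s (m s hs).2.1 θ).1, abs_neg]; exact h1 s (m s hs).1 θ)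
    (fun s hs θ => (h2 s (m s hs).2.1 θ).2.1) (fun s hs θ => (h2 s (m s hs).2.1 θ).2.2.1)
  refine ⟨s₃, ρ, H, ⟨hs₃.1, hs₃.2.trans hσs⟩, hρ, hH, fun s hs θ => (h3 s hs θ).1,
    fun s hs θ => (h3 s hs θ).2.1, fun s hs θ => (h3 s hs θ).2.2, fun κ w x hr hs hw => ?_⟩
  have hm := m (x 1) ⟨hs.1, hs.2.trans hs₃.2⟩
  obtain ⟨-, e2, e3, e4⟩ := h2 (x 1) hm.2.1 (x 2)
  have e4' : pullback (radialMap (S.P η)) (D.derivAtVertex κ p) x = Matrix.of fun i j =>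
      - 2 * deriv (fun s' => D.radialVelocity p η s' (x 2)) (x 1) *
          (radialMetric κ (x 0) 1 0 (sin (x 1) ^ 2) i j - radialMetric κ (x 0) 0 0 0 i j) := by
    ext i j
    rw [e4 κ x hr rfl rfl i j, of_apply]
  rw [e4', polarVelocity, lieDerivative_polarField κ hw (dX _ hm.2.2 _) (dY _ hm.2.2 _), e2]
  have hsin := ((SingularGerm.isConePolar hη).sin_pos S.s₀_le hm.2.2).ne'
  have e5 : sin (x 1) * cos (x 1) * D.radialVelocity p η (x 1) (x 2)
      + sin (x 1) ^ 2 * deriv (D.angularVelocity p η (x 1)) (x 2)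
      = sin (x 1) ^ 2 * (D.cdot η.1 + deriv (fun s' => D.radialVelocity p η s' (x 2)) (x 1)) := by
    rw [← e3]; field_simp
  rw [e5]
  ext i j
  fin_cases i <;> fin_cases j <;> simp [radialMetric] <;> ring

end StandardDeformation

/-! ### The interpolating vector field -/

/-- A cutoff function which vanishes for `r ≤ a / 4` and is `1` for `r ≥ a / 2`. -/
noncomputable def radialCutoff (a r : ℝ) : ℝ := smoothTransition ((r - a / 4) / (a / 4))

lemma contDiff_radialCutoff (a : ℝ) {n : ℕ∞} : ContDiff ℝ n (radialCutoff a) :=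
  smoothTransition.contDiff.comp ((contDiff_id.sub contDiff_const).div_const _)

lemma radialCutoff_eq_zero {a r : ℝ} (ha : 0 < a) (hr : r ≤ a / 4) : radialCutoff a r = 0 :=
  smoothTransition.zero_of_nonpos (div_nonpos_of_nonpos_of_nonneg (by linarith) (by linarith))

lemma radialCutoff_eq_one {a r : ℝ} (ha : 0 < a) (hr : a / 2 ≤ r) : radialCutoff a r = 1 :=
  smoothTransition.one_of_one_le ((one_le_div (by linarith)).2 (by linarith))

/-- A cutoff function which is `1` for `s ≤ s₁` and vanishes for `s ≥ (s₀ + s₁) / 2`. -/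
noncomputable def discCutoff (s₀ s₁ s : ℝ) : ℝ := 1 - smoothTransition ((s - s₁) / ((s₀ - s₁) / 2))

lemma contDiff_discCutoff (s₀ s₁ : ℝ) {n : ℕ∞} : ContDiff ℝ n (discCutoff s₀ s₁) :=
  contDiff_const.sub (smoothTransition.contDiff.comp ((contDiff_id.sub contDiff_const).div_const _))

lemma discCutoff_eq_one {s₀ s₁ s : ℝ} (h : s₁ < s₀) (hs : s ≤ s₁) : discCutoff s₀ s₁ s = 1 := by
  rw [discCutoff, smoothTransition.zero_of_nonpos
    (div_nonpos_of_nonpos_of_nonneg (by linarith) (by linarith)), sub_zero]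

lemma discCutoff_eq_zero {s₀ s₁ s : ℝ} (h : s₁ < s₀) (hs : (s₀ + s₁) / 2 ≤ s) : discCutoff s₀ s₁ s = 0 := by
  rw [discCutoff, smoothTransition.one_of_one_le ((one_le_div (by linarith)).2 (by linarith)), sub_self]

lemma lieDerivative_symm {Z : E3 → E3} {k : TensorField} {x : E3} (hk : ∀ y i j, k y i j = k y j i)
    (i j : Fin 3) : lieDerivative Z k x i j = lieDerivative Z k x j i := by
  simp only [lieDerivative, of_apply]
  refine sum_congr rfl fun a _ => ?_
  simp only [hk _ j i, hk x a i, hk x j a]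
  rw [hk x a j]
  ring

lemma contDiffOn_lieDerivative {Z : E3 → E3} {k : TensorField} {U : Set E3} (hU : IsOpen U)
    (hZ : ContDiffOn ℝ ∞ Z U) (hk : ∀ i j, ContDiffOn ℝ ∞ (fun x => k x i j) U) (i j : Fin 3) :
    ContDiffOn ℝ ∞ (fun x => lieDerivative Z k x i j) U := by
  have hZa : ∀ a, ContDiffOn ℝ ∞ (fun x => Z x a) U := fun a => (contDiff_coord a).comp_contDiffOn hZ
  have hpd : ∀ {u : E3 → ℝ}, ContDiffOn ℝ ∞ u U → ∀ i, ContDiffOn ℝ ∞ (pd i u) U := fun hu i x hx =>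
    (contDiffAt_pd (n := ∞) ((hu.contDiffAt (hU.mem_nhds hx)).of_le (by simp)) i).contDiffWithinAt
  simp only [lieDerivative, of_apply]
  refine ContDiffOn.sum fun a _ => ?_
  exact (((hZa a).mul (hpd (hk i j) a)).add ((hpd (hZa a) i).mul (hk a j))).add ((hpd (hZa a) j).mul (hk i a))

/-- Smoothness can be tested in local coordinates. -/
lemma contDiffAt_of_comp {F : Type*} [NormedAddCommGroup F] [NormedSpace ℝ F] {Φ : E3 → E3} {f : E3 → F}
    {x : E3} (hΦ : ContDiffAt ℝ ∞ Φ x) (hJ : (jac Φ x).det ≠ 0)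
    (h : ContDiffAt ℝ ∞ (fun z => f (Φ z)) x) : ContDiffAt ℝ ∞ f (Φ x) := by
  obtain ⟨Ψ, hΨ, hx, hr, -⟩ := exists_local_inverse hΦ hJ
  refine ContDiffAt.congr_of_eventuallyEq (f := fun y => f (Φ (Ψ y))) ?_ (hr.mono fun y hy => by simp only [hy])
  exact ContDiffAt.comp (g := fun z => f (Φ z)) (Φ x) (by rwa [hx]) hΨ

namespace SingularGerm

variable {V E : Type*} (S : SingularGerm V E)

/-- The maximal angle at the vertices between an edge and the tube around it. -/
noncomputable def overlapAngle (_ : SingularGerm V E) (κ a b : ℝ) : ℝ := arcsin (sn κ b / sn κ (a / 2))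

variable {S} {κ a b : ℝ}

lemma IsTubular.inRange_a (h : S.IsTubular κ a b) : InRange κ a := ⟨h.a_pos.le, h.a_lt⟩

lemma IsTubular.inRange_b (h : S.IsTubular κ a b) : InRange κ b := ⟨h.b_pos.le, h.b_lt⟩

lemma IsTubular.sn_half_pos (h : S.IsTubular κ a b) : 0 < sn κ (a / 2) :=
  sn_pos (by linarith [h.a_pos]) (h.inRange_a.mono (by linarith [h.a_pos]) (by linarith [h.a_pos]))

lemma IsTubular.sin_overlapAngle (h : S.IsTubular κ a b) : sin (S.overlapAngle κ a b) = sn κ b / sn κ (a / 2) := by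
  have h1 := h.sn_half_pos
  have h2 := sn_pos h.b_pos h.inRange_b
  refine sin_arcsin (by linarith [div_pos h2 h1]) ?_
  rw [div_le_one h1]
  have := h.b_small
  nlinarith [sin_le_one S.s₀]

lemma IsTubular.overlapAngle_mem (h : S.IsTubular κ a b) : S.overlapAngle κ a b ∈ Ioo 0 S.s₀ := by
  have h1 := h.sn_half_pos
  have h2 := sn_pos h.b_pos h.inRange_b
  refine ⟨arcsin_pos.2 (div_pos h2 h1), ?_⟩
  have h3 : sin (S.overlapAngle κ a b) < sin S.s₀ := by
    rw [h.sin_overlapAngle, div_lt_iff₀ h1]; exact h.b_small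
  exact (strictMonoOn_sin.lt_iff_lt ⟨neg_pi_div_two_le_arcsin _, arcsin_le_pi_div_two _⟩
    ⟨by linarith [S.s₀_pos, pi_pos], S.s₀_le⟩).1 h3

lemma isOpen_cone [Finite E] (a : ℝ) (p : V) : IsOpen (S.cone a p) :=
  (isOpen_puncturedCone _ _).inter (isOpen_lt continuous_norm continuous_const)

lemma radialMap_mem_puncturedCone {p : V} {η : E × Bool} (hη : η ∈ S.endsAt p) {x : E3} (hr : 0 < x 0)
    (hs : x 1 ∈ Ioo 0 S.s₀) : radialMap (S.P η) x ∈ puncturedCone (S.endsAt p) S.q := by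
  have h3 := SingularGerm.mem_puncturedCone hη hs (x 2)
  refine ⟨smul_ne_zero hr.ne' h3.1, fun j hj => ?_⟩
  rw [radialMap, dir_smul hr]
  exact h3.2 j hj

lemma norm_radialMap {p : V} {η : E × Bool} (hη : η ∈ S.endsAt p) {x : E3} (hr : 0 ≤ x 0)
    (hs : x 1 ∈ Ioo 0 S.s₀) : ‖radialMap (S.P η) x‖ = x 0 := by
  rw [radialMap, norm_smul, (isConePolar hη).norm_eq _ hs, mul_one, norm_of_nonneg hr]

lemma dir_radialMap {p : V} {η : E × Bool} (hη : η ∈ S.endsAt p) {x : E3} (hr : 0 < x 0)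
    (hs : x 1 ∈ Ioo 0 S.s₀) : dir (radialMap (S.P η) x) = S.P η (x 1) (x 2) := by
  rw [radialMap, dir_smul hr, (isConePolar hη).dir_eq hs]

lemma contDiffOn_metricAtVertex (κ : ℝ) (p : V) (i j : Fin 3) :
    ContDiffOn ℝ ∞ (fun x => S.metricAtVertex κ p x i j) (puncturedCone (S.endsAt p) S.q) := by
  have hn : ContDiffOn ℝ ∞ (fun x : E3 => ‖x‖) (puncturedCone (S.endsAt p) S.q) := fun x hx =>
    (contDiffAt_norm ℝ hx.1).contDiffWithinAt
  have hd : ∀ i, ContDiffOn ℝ ∞ (fun x : E3 => dir x i) (puncturedCone (S.endsAt p) S.q) := fun i x hx =>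
    ((contDiff_coord i).contDiffAt.comp x (contDiffAt_dir hx.1)).contDiffWithinAt
  refine ContDiffOn.congr (f := fun x => dir x i * dir x j + sn κ ‖x‖ ^ 2 * exp (2 * S.φ p (dir x)) / ‖x‖ ^ 2 *
      ((if i = j then 1 else 0) - dir x i * dir x j)) ?_ fun x hx => coneMetric_id κ (S.φ p) hx.1 i j
  refine ((hd i).mul (hd j)).add ((ContDiffOn.div ?_ (hn.pow 2) fun x hx => ?_).mul
    (contDiffOn_const.sub ((hd i).mul (hd j))))
  · exact (((contDiff_sn κ).comp_contDiffOn hn).pow 2).mul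
      (((contDiffOn_const (c := (2 : ℝ))).mul (S.link p).smooth_φ).exp)
  · exact pow_ne_zero 2 (norm_ne_zero_iff.2 hx.1)

end SingularGerm

namespace StandardDeformation

variable {V E : Type*} {S : SingularGerm V E} (D : StandardDeformation S)

open Classical in
/-- The vector field which interpolates between the derivative of the gluing isometries on the overlap
of cones and tubes, and zero near the vertex. At `r P(s, θ)` it is the velocity of the polar coordinates
times cutoff functions in `r` and `s`. -/
noncomputable def gaugeField (a s₁ : ℝ) (p : V) (x : E3) : E3 :=
  if h : ∃ z : (E × Bool) × ℝ × ℝ, z.1 ∈ S.endsAt p ∧ z.2.1 ∈ Ioo 0 S.s₀ ∧ dir x = S.P z.1 z.2.1 z.2.2 then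
    (radialCutoff a ‖x‖ * discCutoff S.s₀ s₁ h.choose.2.1 * ‖x‖) • D.velocity h.choose.1 h.choose.2.1 h.choose.2.2
  else 0

lemma gaugeField_eq (a s₁ : ℝ) {p : V} {η : E × Bool} (hη : η ∈ S.endsAt p) {x : E3} {s θ : ℝ}
    (hs : s ∈ Ioo 0 S.s₀) (hx : dir x = S.P η s θ) :
    D.gaugeField a s₁ p x = (radialCutoff a ‖x‖ * discCutoff S.s₀ s₁ s * ‖x‖) • D.velocity η s θ := by
  have h : ∃ z : (E × Bool) × ℝ × ℝ, z.1 ∈ S.endsAt p ∧ z.2.1 ∈ Ioo 0 S.s₀ ∧ dir x = S.P z.1 z.2.1 z.2.2 :=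
    ⟨(η, s, θ), hη, hs, hx⟩
  rw [gaugeField, dif_pos h]
  obtain ⟨h1, h2, h3⟩ := h.choose_spec
  set z := h.choose
  rcases eq_or_ne z.1 η with h4 | h4
  · rw [h4] at h3 ⊢
    obtain ⟨h5, n, h6⟩ := (SingularGerm.isConePolar hη).injective s hs _ h2 θ _ (hx.symm.trans h3)
    rw [← h5, h6]
    have hp : Periodic (D.velocity η s) (S.angle η.1) := fun θ => D.velocity_add_angle hη hs θ
    rw [hp.int_mul n θ]
  · exact absurd (h3.symm.trans hx) (S.disjoint p _ h1 η hη h4 _ h2 _ hs _ _)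

lemma gaugeField_of_notMem (a s₁ : ℝ) {p : V} {x : E3}
    (h : ¬ ∃ z : (E × Bool) × ℝ × ℝ, z.1 ∈ S.endsAt p ∧ z.2.1 ∈ Ioo 0 S.s₀ ∧ dir x = S.P z.1 z.2.1 z.2.2) :
    D.gaugeField a s₁ p x = 0 := by
  rw [gaugeField, dif_neg h]

lemma gaugeField_of_norm_le {a : ℝ} (ha : 0 < a) (s₁ : ℝ) {p : V} {x : E3} (hx : ‖x‖ ≤ a / 4) :
    D.gaugeField a s₁ p x = 0 := by
  unfold gaugeField
  split_ifs with h
  · rw [radialCutoff_eq_zero ha hx]; simp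
  · rfl

lemma gaugeField_radialMap (a s₁ : ℝ) {p : V} {η : E × Bool} (hη : η ∈ S.endsAt p) {x : E3} (hr : 0 < x 0)
    (hs : x 1 ∈ Ioo 0 S.s₀) : D.gaugeField a s₁ p (radialMap (S.P η) x)
      = (radialCutoff a (x 0) * discCutoff S.s₀ s₁ (x 1) * x 0) • D.velocity η (x 1) (x 2) := by
  rw [D.gaugeField_eq a s₁ hη hs (SingularGerm.dir_radialMap hη hr hs), SingularGerm.norm_radialMap hη hr.le hs]

lemma contDiffOn_gaugeField [Finite E] (a : ℝ) {s₁ : ℝ} (hs₁ : s₁ < S.s₀) (p : V) :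
    ContDiffOn ℝ ∞ (D.gaugeField a s₁ p) (puncturedCone (S.endsAt p) S.q) := by
  intro x hx
  refine ContDiffAt.contDiffWithinAt ?_
  by_cases h : ∃ z : (E × Bool) × ℝ × ℝ, z.1 ∈ S.endsAt p ∧ z.2.1 ∈ Ioo 0 S.s₀ ∧ dir x = S.P z.1 z.2.1 z.2.2
  · obtain ⟨⟨η, s, θ⟩, hη, hs, hz⟩ := h
    simp only at hη hs hz
    have hr : 0 < ‖x‖ := norm_pos_iff.2 hx.1
    set z : E3 := !₂[‖x‖, s, θ] with hzd
    have z0 : z 0 = ‖x‖ := by simp [hzd]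
    have z1 : z 1 = s := by simp [hzd]
    have z2 : z 2 = θ := by simp [hzd]
    have hxe : radialMap (S.P η) z = x := by rw [radialMap, z0, z1, z2, ← hz, norm_smul_dir]
    have hP := SingularGerm.isConePolar hη
    rw [← hxe]
    refine contDiffAt_of_comp (hP.contDiffAt_radialMap (by rwa [z1]))
      (hP.det_jac_ne_zero S.s₀_le (by rwa [z0]) (by rwa [z1])) ?_
    have hev : ∀ᶠ y : E3 in 𝓝 z, 0 < y 0 ∧ y 1 ∈ Ioo 0 S.s₀ :=
      ((continuous_coord 0).continuousAt.eventually (lt_mem_nhds (show 0 < z 0 by rwa [z0]))).and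
        ((contDiff_coord 1 (n := 0)).continuous.continuousAt.eventually (isOpen_Ioo.mem_nhds (show z 1 ∈ Ioo 0 S.s₀ by rwa [z1])))
    refine ContDiffAt.congr_of_eventuallyEq ?_ (hev.mono fun y hy => D.gaugeField_radialMap a s₁ hη hy.1 hy.2)
    have hc : ∀ i, ContDiffAt ℝ ∞ (fun y : E3 => y i) z := fun i => (contDiff_coord i).contDiffAt
    refine ContDiffAt.smul ((((contDiff_radialCutoff a).contDiffAt.comp z (hc 0)).mul
      ((contDiff_discCutoff _ _).contDiffAt.comp z (hc 1))).mul (hc 0)) ?_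
    have h1 : ContDiffAt ℝ ∞ (fun z : ℝ × ℝ => D.velocity η z.1 z.2) (z 1, z 2) :=
      (D.contDiffOn_velocity hη).contDiffAt ((isOpen_Ioo.prod isOpen_univ).mem_nhds ⟨by rwa [z1], mem_univ _⟩)
    exact h1.comp (f := fun y : E3 => (y 1, y 2)) z ((hc 1).prodMk (hc 2))
  · have hout : ∀ᶠ y in 𝓝 x, ∀ η : S.endsAt p, y ∉ IsConePolar.sector (S.P η) (Ioc 0 ((S.s₀ + s₁) / 2)) := by
      refine eventually_all.2 fun η => (SingularGerm.isConePolar η.2).eventually_notMem_sector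
        (S.angle_pos _) (by linarith) hx.1 (hx.2 _ η.2) ?_
      rintro ⟨-, s, hs, θ, he⟩
      exact h ⟨(η, s, θ), η.2, ⟨hs.1, by linarith [hs.2]⟩, he⟩
    refine ContDiffAt.congr_of_eventuallyEq (contDiffAt_const (c := (0 : E3))) ?_
    filter_upwards [hout, isOpen_ne.mem_nhds hx.1] with y hy hy0
    by_cases h' : ∃ z : (E × Bool) × ℝ × ℝ, z.1 ∈ S.endsAt p ∧ z.2.1 ∈ Ioo 0 S.s₀ ∧ dir y = S.P z.1 z.2.1 z.2.2
    · obtain ⟨⟨η, s, θ⟩, hη, hs, hz⟩ := h'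
      simp only at hη hs hz
      rw [D.gaugeField_eq a s₁ hη hs hz]
      have : (S.s₀ + s₁) / 2 ≤ s := by
        by_contra! hlt
        exact hy ⟨η, hη⟩ ⟨hy0, s, ⟨hs.1, hlt.le⟩, θ, hz⟩
      rw [discCutoff_eq_zero hs₁ this]; simp
    · exact D.gaugeField_of_notMem a s₁ h'

/-- The tensor which represents the infinitesimal deformation. -/
noncomputable def representative (κ a b : ℝ) : NbhdTensor V E where
  onCone p := fun x => D.derivAtVertex κ p x
    + lieDerivative (D.gaugeField a (S.overlapAngle κ a b) p) (S.metricAtVertex κ p) x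
  onTube e := D.derivAtEdge κ e

/-- The representing tensor in polar coordinates. -/
lemma pullback_representative [Finite E] {κ a b : ℝ} (hab : S.IsTubular κ a b) {p : V} {η : E × Bool}
    (hη : η ∈ S.endsAt p) {x : E3} (hr : 0 < x 0) (hs : x 1 ∈ Ioo 0 (S.overlapAngle κ a b)) :
    pullback (radialMap (S.P η)) ((D.representative κ a b).onCone p) x
      = pullback (radialMap (S.P η)) (D.derivAtVertex κ p) x + lieDerivative (D.polarVelocity p η (radialCutoff a))
            (fun y => radialMetric κ (y 0) 1 0 (sin (y 1) ^ 2)) x := by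
  have hP := SingularGerm.isConePolar hη
  have hs₁ := hab.overlapAngle_mem
  have hs' : x 1 ∈ Ioo 0 S.s₀ := ⟨hs.1, hs.2.trans hs₁.2⟩
  have hop : IsOpen (Ioo 0 S.s₀ ×ˢ (univ : Set ℝ)) := isOpen_Ioo.prod isOpen_univ
  have hmem : ((x 1, x 2) : ℝ × ℝ) ∈ Ioo 0 S.s₀ ×ˢ (univ : Set ℝ) := ⟨hs', mem_univ _⟩
  have hev : ∀ᶠ y : E3 in 𝓝 x, 0 < y 0 ∧ y 1 ∈ Ioo 0 (S.overlapAngle κ a b) :=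
    ((continuous_coord 0).continuousAt.eventually (lt_mem_nhds hr)).and
      ((contDiff_coord 1 (n := 0)).continuous.continuousAt.eventually (isOpen_Ioo.mem_nhds hs))
  have hm := SingularGerm.radialMap_mem_puncturedCone hη hr hs'
  have hX : ContDiffAt ℝ ∞ (D.polarVelocity p η (radialCutoff a)) x :=
    contDiffAt_polarField (contDiff_radialCutoff a).contDiffAt
      ((D.contDiffOn_radialVelocity hη).contDiffAt (hop.mem_nhds hmem))
      ((D.contDiffOn_angularVelocity hη).contDiffAt (hop.mem_nhds hmem))
  have hZ : ContDiffAt ℝ ∞ (D.gaugeField a (S.overlapAngle κ a b) p) (radialMap (S.P η) x) :=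
    (D.contDiffOn_gaugeField a hs₁.2 p).contDiffAt ((isOpen_puncturedCone _ _).mem_nhds hm)
  have hrel : ∀ᶠ y in 𝓝 x, fderiv ℝ (radialMap (S.P η)) y (D.polarVelocity p η (radialCutoff a) y)
      = D.gaugeField a (S.overlapAngle κ a b) p (radialMap (S.P η) y) := by
    filter_upwards [hev] with y hy
    have hy' : y 1 ∈ Ioo 0 S.s₀ := ⟨hy.2.1, hy.2.2.trans hs₁.2⟩
    rw [polarVelocity, fderiv_radialMap_polarField ((hP.contDiffAt hy' _).differentiableAt (by simp)),
      ← D.velocity_eq hη hy', D.gaugeField_radialMap a _ hη hy.1 hy', discCutoff_eq_one hs₁.2 hy.2.2.le,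
      mul_one, mul_comm]
  have key := lieDerivative_pullback (k := S.metricAtVertex κ p) ((hP.contDiffAt_radialMap hs').of_le (by norm_cast))
    (fun i j => ((SingularGerm.contDiffOn_metricAtVertex κ p i j).contDiffAt
      ((isOpen_puncturedCone _ _).mem_nhds hm)).differentiableAt (by simp))
    (hX.differentiableAt (by simp)) (hZ.differentiableAt (by simp)) hrel
  have hg : pullback (radialMap (S.P η)) (S.metricAtVertex κ p)
      =ᶠ[𝓝 x] fun y => radialMetric κ (y 0) 1 0 (sin (y 1) ^ 2) := by
    filter_upwards [hev] with y hy
    exact hP.pullback_coneMetric κ IsConePolar.contDiffOn_id_dir hy.1 ⟨hy.2.1, hy.2.2.trans hs₁.2⟩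
  rw [lieDerivative_congr (EventuallyEq.refl _ _) hg] at key
  rw [key]
  ext i j
  simp only [representative, pullback_apply, Matrix.add_apply]
  simp only [mul_add, Finset.sum_add_distrib]

/-- Far from the vertex, the representing tensor is the variation of the cone angle. -/
lemma pullback_representative_of_lt [Finite E] {κ a b : ℝ} (hab : S.IsTubular κ a b) {p : V} {η : E × Bool}
    (hη : η ∈ S.endsAt p) {x : E3} (hr : a / 2 < x 0) (hs : x 1 ∈ Ioo 0 (S.overlapAngle κ a b)) (i j : Fin 3) :
    pullback (radialMap (S.P η)) ((D.representative κ a b).onCone p) x i j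
      = radialMetric κ (x 0) 0 0 (sin (x 1) ^ 2 * (2 * D.cdot η.1)) i j - radialMetric κ (x 0) 0 0 0 i j := by
  have ha := hab.a_pos
  have hr0 : 0 < x 0 := by linarith
  rw [D.pullback_representative hab hη hr0 hs, Matrix.add_apply,
    ← D.pullback_derivAtVertex_add κ hη hr0 ⟨hs.1, hs.2.trans hab.overlapAngle_mem.2⟩ i j]
  congr 1
  refine congrFun (congrFun (lieDerivative_congr ?_ (EventuallyEq.refl _ _)) i) j
  filter_upwards [(continuous_coord 0).continuousAt.eventually (lt_mem_nhds hr)] with y hy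
  simp only [polarVelocity, polarField, radialCutoff_eq_one ha (le_of_lt hy)]

end StandardDeformation

/-! ### The representing tensor -/

namespace StandardDeformation

variable {V E : Type*} {S : SingularGerm V E} (D : StandardDeformation S)

/-- The derivative of the twist. -/
noncomputable def tdot (e : E) : ℝ := deriv (D.t e) 0

/-- The derivative of the length. -/
noncomputable def ldot (e : E) : ℝ := deriv (D.l e) 0

lemma hasDerivAt_t (e : E) : HasDerivAt (D.t e) (D.tdot e) 0 :=
  (((D.smooth_t e).contDiffAt (isOpen_Ioo.mem_nhds D.zero_mem)).differentiableAt (by simp)).hasDerivAt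

lemma hasDerivAt_l (e : E) : HasDerivAt (D.l e) (D.ldot e) 0 :=
  (((D.smooth_l e).contDiffAt (isOpen_Ioo.mem_nhds D.zero_mem)).differentiableAt (by simp)).hasDerivAt

lemma derivAtEdge_eq (κ : ℝ) (e : E) (x : E3) : D.derivAtEdge κ e x = !![0, 0, 0;
         0, 2 * D.cdot e * sn κ (x 0) ^ 2, sn κ (x 0) ^ 2 * (D.tdot e * D.slope e (x 2));
         0, sn κ (x 0) ^ 2 * (D.tdot e * D.slope e (x 2)), cs κ (x 0) ^ 2 * (2 * D.ldot e * D.slope e (x 2))] := by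
  have hA : HasDerivAt (fun ε => (sn κ (x 0) * (1 + D.c e ε)) ^ 2) _ 0 :=
    (((D.hasDerivAt_c e).const_add 1).const_mul (sn κ (x 0))).pow 2
  have hB : HasDerivAt (fun ε => D.t e ε * D.slope e (x 2)) _ 0 := (D.hasDerivAt_t e).mul_const _
  have hC : HasDerivAt (fun ε => (cs κ (x 0) * (1 + D.l e ε * D.slope e (x 2))) ^ 2) _ 0 :=
    ((((D.hasDerivAt_l e).mul_const (D.slope e (x 2))).const_add 1).const_mul (cs κ (x 0))).pow 2
  have hAB : HasDerivAt (fun ε => (sn κ (x 0) * (1 + D.c e ε)) ^ 2 * (D.t e ε * D.slope e (x 2))) _ 0 :=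
    hA.mul hB
  have hABC : HasDerivAt (fun ε => (sn κ (x 0) * (1 + D.c e ε)) ^ 2 * (D.t e ε * D.slope e (x 2)) ^ 2
      + (cs κ (x 0) * (1 + D.l e ε * D.slope e (x 2))) ^ 2) _ 0 := (hA.mul (hB.pow 2)).add hC
  have hd : ∀ i j, D.derivAtEdge κ e x i j = deriv (fun ε => D.metricAtEdge κ ε e x i j) 0 := fun _ _ => rfl
  ext i j
  rw [hd]
  fin_cases i <;> fin_cases j <;> simp only [metricAtEdge, tubeMetric, of_apply, Matrix.cons_val',
    Matrix.cons_val_fin_one, cons_val_zero, cons_val_one, cons_val, Fin.zero_eta, Fin.mk_one,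
    Fin.reduceFinMk, deriv_const, hA.deriv, hAB.deriv, hABC.deriv, D.c_zero, D.t_zero, D.l_zero,
    Pi.pow_apply]
  all_goals ring

lemma deriv_f_eq_zero_of_lt {e : E} {y : ℝ} (hy : y < S.length e / 4) : deriv (D.f e) y = 0 := by
  have : D.f e =ᶠ[𝓝 y] fun _ => 0 := (eventually_lt_nhds hy).mono fun z hz => D.f_eq_zero e z hz.le
  rw [this.deriv_eq, deriv_const]

lemma deriv_f_eq_zero_of_gt {e : E} {y : ℝ} (hy : 3 * S.length e / 4 < y) : deriv (D.f e) y = 0 := by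
  have : D.f e =ᶠ[𝓝 y] fun _ => 1 := (eventually_gt_nhds hy).mono fun z hz => D.f_eq_one e z hz.le
  rw [this.deriv_eq, deriv_const]

lemma slope_of_mem {e : E} {y : ℝ} (hy : y ∈ Ioo 0 (S.length e)) : D.slope e y = deriv (D.f e) y := by
  have hl := S.length_pos e
  rw [slope, Int.fract_eq_self.2 ⟨by have := hy.1; positivity, (div_lt_one hl).2 hy.2⟩, mul_div_cancel₀ _ hl.ne']

lemma slope_add_length (e : E) (y : ℝ) : D.slope e (y + S.length e) = D.slope e y := by
  rw [slope, slope, add_div, div_self (S.length_pos e).ne', Int.fract_add_one]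

lemma contDiff_slope (e : E) : ContDiff ℝ ∞ (D.slope e) := by
  have hl := S.length_pos e
  have hf : ContDiff ℝ ∞ (deriv (D.f e)) := (contDiff_infty_iff_deriv.1 (D.smooth_f e)).2
  rw [contDiff_iff_contDiffAt]
  intro y
  set n : ℤ := ⌊y / S.length e⌋ with hn
  have hc : ContinuousAt (fun z : ℝ => z / S.length e) y := by fun_prop
  rcases (Int.floor_le (y / S.length e)).eq_or_lt with h | h
  · have h' : (n : ℝ) = y / S.length e := h
    -- Near the multiples of the length, the slope vanishes.
    refine ContDiffAt.congr_of_eventuallyEq (contDiffAt_const (c := (0 : ℝ))) ?_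
    have hev : ∀ᶠ z in 𝓝 y, z / S.length e ∈ Ioo ((n : ℝ) - 1 / 8) (n + 1 / 8) :=
      hc.eventually (isOpen_Ioo.mem_nhds (show y / S.length e ∈ _ from ⟨by linarith, by linarith⟩))
    filter_upwards [hev] with z hz
    rw [slope]
    rcases lt_or_ge (z / S.length e) n with h1 | h1
    · have : ⌊z / S.length e⌋ = n - 1 := by
        rw [Int.floor_eq_iff]; push_cast; constructor <;> linarith [hz.1]
      refine D.deriv_f_eq_zero_of_gt ?_
      rw [Int.fract, this]; push_cast
      nlinarith [hz.1]
    · have : ⌊z / S.length e⌋ = n := by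
        rw [Int.floor_eq_iff]; constructor <;> linarith [hz.2]
      refine D.deriv_f_eq_zero_of_lt ?_
      rw [Int.fract, this]
      nlinarith [hz.2]
  · have hev : ∀ᶠ z in 𝓝 y, z / S.length e ∈ Ioo (n : ℝ) (n + 1) :=
      hc.eventually (isOpen_Ioo.mem_nhds ⟨h, Int.lt_floor_add_one _⟩)
    refine ContDiffAt.congr_of_eventuallyEq (f := fun z => deriv (D.f e) (S.length e * (z / S.length e - n))) ?_ ?_
    · exact hf.contDiffAt.comp y (by fun_prop)
    · filter_upwards [hev] with z hz
      have : ⌊z / S.length e⌋ = n := Int.floor_eq_iff.2 ⟨hz.1.le, hz.2⟩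
      rw [slope, Int.fract, this]

lemma contDiff_derivAtEdge (κ : ℝ) (e : E) (i j : Fin 3) : ContDiff ℝ ∞ fun x => D.derivAtEdge κ e x i j := by
  have h0 : ContDiff ℝ ∞ fun x : E3 => sn κ (x 0) := (contDiff_sn κ).comp (contDiff_coord 0)
  have h1 : ContDiff ℝ ∞ fun x : E3 => cs κ (x 0) := (contDiff_cs κ).comp (contDiff_coord 0)
  have h2 : ContDiff ℝ ∞ fun x : E3 => D.slope e (x 2) := (D.contDiff_slope e).comp (contDiff_coord 2)
  simp only [D.derivAtEdge_eq]
  fin_cases i <;> fin_cases j <;> simp only [of_apply, Matrix.cons_val',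
    Matrix.cons_val_fin_one, cons_val_zero, cons_val_one, cons_val, Fin.zero_eta, Fin.mk_one,
    Fin.reduceFinMk] <;> fun_prop

end StandardDeformation

namespace SingularGerm

variable {V E : Type*} {S : SingularGerm V E} {κ a b : ℝ} {p : V} {η : E × Bool}

lemma IsTubular.endDist_mem (h : S.IsTubular κ a b) (hη : η ∈ S.endsAt p) {x : E3}
    (hx : x ∈ S.overlap κ a b η) : S.endDist η x ∈ Ioo (a / 2) a ∧ x 2 ∈ Ioo 0 (S.length η.1) ∧
      (x 2 < S.length η.1 / 4 ∨ 3 * S.length η.1 / 4 < x 2) := by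
  obtain ⟨⟨-, h2⟩, h3, -⟩ := hx
  obtain ⟨pq, hpq, -⟩ := hη
  have hne : S.ends η.1 ≠ none := by rw [hpq]; simp
  have h4 := h.a_le η.1 hne
  have ha := h.a_pos
  have h5 : x 2 ∈ Ioo (a / 2) (S.length η.1 - a / 2) := h2.resolve_left hne
  refine ⟨⟨?_, h3⟩, ⟨by linarith [h5.1], by linarith [h5.2]⟩, ?_⟩
  · unfold endDist; split_ifs <;> linarith [h5.1, h5.2]
  · unfold endDist at h3
    split_ifs at h3
    · right; linarith
    · left; linarith

/-- Spherical trigonometry in the triangle of the vertex, the point `x` and its foot point on the edge. -/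
lemma IsTubular.overlap_facts (h : S.IsTubular κ a b) (hη : η ∈ S.endsAt p) {x : E3} (hx : x ∈ S.overlap κ a b η) :
    S.vertexDist κ η x ∈ Ioo (a / 2) a ∧ S.vertexAngle κ η x ∈ Ioo 0 (S.overlapAngle κ a b) ∧
      sn κ (S.vertexDist κ η x) * sin (S.vertexAngle κ η x) = sn κ (x 0) ∧
      DifferentiableAt ℝ (S.vertexDist κ η) x ∧ DifferentiableAt ℝ (S.vertexAngle κ η) x := by
  have ha := h.a_pos
  obtain ⟨hd, -, -⟩ := h.endDist_mem hη hx
  obtain ⟨⟨hρ, -⟩, -, hra⟩ := hx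
  set d := S.endDist η x with hdd
  have hρr : InRange κ (x 0) := h.inRange_b.mono hρ.1.le hρ.2.le
  have hdr : InRange κ d := h.inRange_a.mono (by linarith [hd.1]) hd.2.le
  have s1 := sn_pos hρ.1 hρr
  have s2 := sn_pos (by linarith [hd.1]) hdr
  have c1 := cs_pos hρr
  have c2 := cs_pos hdr
  have e1 := cs_sq κ (x 0)
  have e2 := cs_sq κ d
  set u := sn κ (x 0) ^ 2 + cs κ (x 0) ^ 2 * sn κ d ^ 2 with hu
  have hu0 : 0 < u := by positivity
  have hκu : κ * u = 1 - cs κ (x 0) ^ 2 * cs κ d ^ 2 := by rw [hu, e2, e1]; ring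
  have hκ1 : κ * √u ^ 2 < 1 := by
    rw [sq_sqrt hu0.le, hκu]
    have : 0 < cs κ (x 0) ^ 2 * cs κ d ^ 2 := by positivity
    linarith
  have hr : S.vertexDist κ η x = arcsn κ √u := rfl
  have hsn : sn κ (S.vertexDist κ η x) = √u := by rw [hr, sn_arcsn hκ1.le]
  have hr0 : 0 ≤ S.vertexDist κ η x := by rw [hr]; exact arcsn_nonneg (sqrt_nonneg _)
  have husq : sn κ d < √u := by
    refine lt_sqrt_of_sq_lt ?_
    have : u = sn κ d ^ 2 + sn κ (x 0) ^ 2 * cs κ d ^ 2 := by rw [hu, e2, e1]; ring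
    rw [this]
    have : 0 < sn κ (x 0) ^ 2 * cs κ d ^ 2 := by positivity
    linarith
  have hhalf : sn κ (a / 2) < √u := (sn_le_sn (by linarith) hd.1.le hdr).trans_lt husq
  have hrlt : a / 2 < S.vertexDist κ η x := by
    by_contra! hle
    have := sn_le_sn hr0 hle (h.inRange_a.mono (by linarith) (by linarith))
    rw [hsn] at this
    linarith
  have hden : 0 < cs κ (x 0) * sn κ d := mul_pos c1 s2
  set z := sn κ (x 0) / (cs κ (x 0) * sn κ d) with hz
  have hz0 : 0 < z := div_pos s1 hden
  have hs : S.vertexAngle κ η x = arctan z := rfl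
  have hsq : √(1 + z ^ 2) = √u / (cs κ (x 0) * sn κ d) := by
    rw [sqrt_eq_iff_eq_sq (by positivity) (by positivity), hz, div_pow, div_pow, sq_sqrt hu0.le, hu]
    field_simp
    ring
  have hsin : sin (S.vertexAngle κ η x) = sn κ (x 0) / √u := by
    rw [hs, sin_arctan, hsq, hz]
    have := sqrt_pos.2 hu0
    field_simp
  have hsu := sqrt_pos.2 hu0
  refine ⟨⟨hrlt, hra⟩, ⟨by rw [hs]; exact arctan_pos.2 hz0, ?_⟩, ?_, ?_, ?_⟩
  · have hlt : sin (S.vertexAngle κ η x) < sin (S.overlapAngle κ a b) := by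
      rw [hsin, h.sin_overlapAngle]
      exact div_lt_div₀ (sn_lt_sn hρ.1.le hρ.2 h.inRange_b) hhalf.le (sn_pos h.b_pos h.inRange_b).le h.sn_half_pos
    refine (strictMonoOn_sin.lt_iff_lt ⟨?_, ?_⟩ ⟨?_, ?_⟩).1 hlt
    · rw [hs]; exact (neg_pi_div_two_lt_arctan _).le
    · rw [hs]; exact (arctan_lt_pi_div_two _).le
    · exact neg_pi_div_two_le_arcsin _
    · exact arcsin_le_pi_div_two _
  · rw [hsin, hsn]; field_simp
  all_goals
    have hdd' : DifferentiableAt ℝ (S.endDist η) x := by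
      have h2 : DifferentiableAt ℝ (fun y : E3 => y 2) x := (contDiff_coord 2 (n := 1)).differentiable (by simp) x
      unfold endDist
      split_ifs
      · exact h2.const_sub _
      · exact h2
    have h0 : DifferentiableAt ℝ (fun y : E3 => y 0) x := (contDiff_coord 0 (n := 1)).differentiable (by simp) x
    have d1 : DifferentiableAt ℝ (fun y : E3 => sn κ (y 0)) x :=
      ((contDiff_sn κ (n := 1)).differentiable (by simp) _).comp x h0
    have d2 : DifferentiableAt ℝ (fun y : E3 => cs κ (y 0)) x :=
      ((contDiff_cs κ (n := 1)).differentiable (by simp) _).comp x h0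
    have d3 : DifferentiableAt ℝ (fun y : E3 => sn κ (S.endDist η y)) x :=
      ((contDiff_sn κ (n := 1)).differentiable (by simp) _).comp x hdd'
  · exact (differentiableAt_arcsn hκ1).comp x (((d1.pow 2).add ((d2.pow 2).mul (d3.pow 2))).sqrt hu0.ne')
  · have : DifferentiableAt ℝ (fun y => sn κ (y 0) / (cs κ (y 0) * sn κ (S.endDist η y))) x := by
      simp only [div_eq_mul_inv]
      exact d1.fun_mul ((d2.fun_mul d3).fun_inv hden.ne')
    exact this.arctan

end SingularGerm

lemma norm_coneCoord {β s : ℝ} (h0 : 0 < s) (h1 : s < π) (θ : ℝ) : ‖coneCoord β s θ‖ = tan (s / 2) ^ (1 / β) := by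
  rw [coneCoord, Complex.norm_exp, rpow_def_of_pos (tan_half_pos h0 h1)]
  congr 1
  rw [Complex.div_ofReal_re]
  simp [div_eq_mul_inv]

lemma tendsto_tan_half : Tendsto (fun s : ℝ => tan (s / 2)) (𝓝[>] 0) (𝓝 0) := by
  have : ContinuousAt (fun s : ℝ => tan (s / 2)) 0 := by
    refine ContinuousAt.comp (g := tan) (continuousAt_tan.2 (by simp)) (by fun_prop)
  have h := this.tendsto
  simp only [zero_div, tan_zero] at h
  exact h.mono_left nhdsWithin_le_nhds

/-- A continuous function of the conformal coordinate is bounded near the cone point. -/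
lemma exists_norm_comp_coneCoord_le {β : ℝ} (hβ : 0 < β) {K : ℂ → ℂ} (hK : ContinuousAt K 0) :
    ∃ M, ∀ᶠ s in 𝓝[>] (0 : ℝ), ∀ θ, ‖K (coneCoord β s θ)‖ ≤ M := by
  obtain ⟨δ, hδ, h⟩ := Metric.continuousAt_iff.1 hK 1 one_pos
  refine ⟨‖K 0‖ + 1, ?_⟩
  have h1 : Tendsto (fun s : ℝ => tan (s / 2) ^ (1 / β)) (𝓝[>] 0) (𝓝 (0 ^ (1 / β))) :=
    tendsto_tan_half.rpow_const (Or.inr (by positivity))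
  rw [zero_rpow (by positivity)] at h1
  filter_upwards [h1.eventually (gt_mem_nhds hδ), self_mem_nhdsWithin,
    mem_nhdsWithin_of_mem_nhds (gt_mem_nhds pi_pos)] with s hs h0 h2 θ
  have h3 := h (x := coneCoord β s θ) (by rw [dist_zero_right, norm_coneCoord h0 h2]; exact hs)
  rw [dist_eq_norm] at h3
  linarith [norm_sub_norm_le (K (coneCoord β s θ)) (K 0)]

namespace StandardDeformation

variable {V E : Type*} {S : SingularGerm V E} (D : StandardDeformation S)

lemma angle_div_pos {S : SingularGerm V E} (e : E) : 0 < S.angle e / (2 * π) := div_pos (S.angle_pos e) (by positivity)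

/-- The velocity of the polar coordinates tends to zero at the cone points. -/
lemma eventually_velocity_lt [Finite E] {p : V} {η : E × Bool} (hη : η ∈ S.endsAt p) {ε : ℝ} (hε : 0 < ε) :
    ∀ᶠ s in 𝓝[>] (0 : ℝ), ∀ θ, D.radialVelocity p η s θ ^ 2 + sin s ^ 2 * D.angularVelocity p η s θ ^ 2 < ε := by
  obtain ⟨σ, ρ, H, h⟩ := D.exists_isHolomorphicVelocity hη
  obtain ⟨M, hM⟩ := exists_norm_comp_coneCoord_le (angle_div_pos (S := S) η.1)
    ((h.holomorphic.continuousOn.continuousAt (Metric.ball_mem_nhds 0 h.radius_pos)))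
  have ht := tendsto_tan_half
  have hlog : Tendsto (fun s : ℝ => tan (s / 2) * log (tan (s / 2))) (𝓝[>] 0) (𝓝 0) := by
    have := (continuous_mul_log.tendsto 0).comp ht
    rwa [zero_mul] at this
  have hlim : Tendsto (fun s : ℝ => (2 * (M * tan (s / 2)) + 2 * (|D.cdot η.1| * |tan (s / 2) * log (tan (s / 2))|)) ^ 2
        + (2 * (M * tan (s / 2))) ^ 2) (𝓝[>] 0) (𝓝 0) := by
    have h1 := ((ht.const_mul M).const_mul 2)
    have h2 := ((hlog.abs.const_mul |D.cdot η.1|).const_mul 2)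
    have h3 := ((h1.add h2).pow 2).add (h1.pow 2)
    simpa using h3
  filter_upwards [hM, hlim.eventually (gt_mem_nhds hε), self_mem_nhdsWithin,
    mem_nhdsWithin_of_mem_nhds (gt_mem_nhds h.mem.1)] with s h1 h2 h3 h4 θ
  have hs : s ∈ Ioo 0 σ := ⟨h3, h4⟩
  have hs2 : s ≤ π / 2 := h4.le.trans (h.mem.2.le.trans S.s₀_le)
  have hsπ : s < π := by linarith [pi_pos]
  have htan := tan_half_pos hs.1 hsπ
  have hsin0 : 0 ≤ sin s := sin_nonneg_of_nonneg_of_le_pi hs.1.le hsπ.le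
  have hsin : sin s ≤ 2 * tan (s / 2) := by
    have hc : 0 < cos (s / 2) := cos_pos_of_mem_Ioo ⟨by linarith [hs.1], by linarith⟩
    have e1 : sin s = 2 * tan (s / 2) * cos (s / 2) ^ 2 := by
      rw [tan_eq_sin_div_cos, show s = 2 * (s / 2) by ring, sin_two_mul]
      field_simp
    rw [e1]
    nlinarith [cos_sq_le_one (s / 2)]
  have hM0 : 0 ≤ M := (norm_nonneg _).trans (h1 θ)
  have hre := (Complex.abs_re_le_norm _).trans (h1 θ)
  have him := (Complex.abs_im_le_norm _).trans (h1 θ)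
  rw [h.radial s hs, h.angular s hs]
  set z := H (coneCoord (S.angle η.1 / (2 * π)) s θ)
  set τ := tan (s / 2)
  have b1 : |sin s * (z.re - D.cdot η.1 * log τ)| ≤ 2 * (M * τ) + 2 * (|D.cdot η.1| * |τ * log τ|) := by
    rw [abs_mul, abs_of_nonneg hsin0, abs_mul, abs_of_pos htan]
    have : |z.re - D.cdot η.1 * log τ| ≤ M + |D.cdot η.1| * |log τ| :=
      (abs_sub _ _).trans (by rw [abs_mul]; linarith)
    calc _ ≤ 2 * τ * (M + |D.cdot η.1| * |log τ|) := mul_le_mul hsin this (abs_nonneg _) (by positivity)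
      _ = _ := by ring
  have b2 : |sin s * z.im| ≤ 2 * (M * τ) := by
    rw [abs_mul, abs_of_nonneg hsin0]
    calc _ ≤ 2 * τ * M := mul_le_mul hsin him (abs_nonneg _) (by positivity)
      _ = _ := by ring
  rw [← mul_pow]
  have := sq_le_sq' (abs_le.1 b1).1 (abs_le.1 b1).2
  have := sq_le_sq' (abs_le.1 b2).1 (abs_le.1 b2).2
  linarith

/-- The gauge field tends to zero at the singular locus. -/
lemma tendsto_gaugeField [Finite E] {κ a b : ℝ} (hab : S.IsTubular κ a b) (p : V) {x₀ : E3} (hx₀ : ‖x₀‖ < a)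
    (hn : x₀ ∉ S.cone a p) :
    Tendsto (fun x => ∑ i, ∑ j, S.metricAtVertex κ p x i j * D.gaugeField a (S.overlapAngle κ a b) p x i
      * D.gaugeField a (S.overlapAngle κ a b) p x j) (𝓝[S.cone a p] x₀) (𝓝 0) := by
  have ha := hab.a_pos
  rcases eq_or_ne x₀ 0 with rfl | h0
  · refine Tendsto.congr' (f₁ := fun _ => 0) ?_ tendsto_const_nhds
    refine EventuallyEq.filter_mono ?_ nhdsWithin_le_nhds
    filter_upwards [Metric.ball_mem_nhds (0 : E3) (show 0 < a / 4 by linarith)] with x hx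
    rw [mem_ball_zero_iff] at hx
    simp [D.gaugeField_of_norm_le ha _ hx.le]
  obtain ⟨η, hη, hq⟩ : ∃ η ∈ S.endsAt p, dir x₀ = S.q η := by
    by_contra! h
    exact hn ⟨⟨h0, h⟩, hx₀⟩
  have hP := SingularGerm.isConePolar hη
  rw [Metric.tendsto_nhds]
  intro ε hε
  obtain ⟨C, hC, hCa⟩ : ∃ C > 0, ∀ x : E3, ‖x‖ < a → |sn κ ‖x‖| ≤ C := by
    obtain ⟨C, hC⟩ := isCompact_Icc.exists_bound_of_continuousOn (s := Icc 0 a)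
      ((contDiff_sn κ (n := 0)).continuous.continuousOn)
    exact ⟨max C 1, by positivity, fun x hx => (hC ‖x‖ ⟨norm_nonneg _, hx.le⟩).trans (le_max_left _ _)⟩
  obtain ⟨σ, hσ, hσ2⟩ := mem_nhdsGT_iff_exists_Ioo_subset.1 (D.eventually_velocity_lt hη (ε := ε / C ^ 2) (by positivity))
  have hs₁ := hab.overlapAngle_mem
  set s₁ := S.overlapAngle κ a b with hs₁d
  obtain ⟨δ, hδ, hsmall⟩ := hP.exists_small S.s₀_le (S.angle_pos _) hη (S.norm_q η)
    (σ := min σ s₁) ⟨lt_min hσ hs₁.1, (min_le_right _ _).trans_lt hs₁.2⟩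
  have hcont : ContinuousAt dir x₀ := (contDiffAt_dir h0 (n := 0)).continuousAt
  have hev : ∀ᶠ x in 𝓝 x₀, ‖dir x - S.q η‖ < δ := by
    have := hcont.eventually (Metric.ball_mem_nhds (dir x₀) hδ)
    filter_upwards [this] with x hx
    rwa [hq, dist_eq_norm] at hx
  filter_upwards [mem_nhdsWithin_of_mem_nhds hev, self_mem_nhdsWithin] with x hx hxc
  obtain ⟨s, hs, θ, hd⟩ := hsmall (dir x) (norm_dir hxc.1.1) (hxc.1.2 η hη) hx
  have hss₁ : s ∈ Ioo 0 s₁ := ⟨hs.1, hs.2.trans_le (min_le_right _ _)⟩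
  have hss : s ∈ Ioo 0 S.s₀ := ⟨hs.1, hss₁.2.trans hs₁.2⟩
  have hr : 0 < ‖x‖ := norm_pos_iff.2 hxc.1.1
  set z : E3 := !₂[‖x‖, s, θ] with hz
  have hzx : radialMap (S.P η) z = x := by
    rw [radialMap]
    simp only [hz, PiLp.toLp_apply, cons_val_zero, cons_val_one, cons_val]
    rw [hd, norm_smul_dir]
  have hg : ∑ i, ∑ j, S.metricAtVertex κ p x i j * D.gaugeField a s₁ p x i * D.gaugeField a s₁ p x j
      = sn κ ‖x‖ ^ 2 * radialCutoff a ‖x‖ ^ 2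
        * (D.radialVelocity p η s θ ^ 2 + sin s ^ 2 * D.angularVelocity p η s θ ^ 2) := by
    have e1 : D.gaugeField a s₁ p x = fderiv ℝ (radialMap (S.P η)) z (D.polarVelocity p η (radialCutoff a) z) := by
      have hz1 : z 1 ∈ Ioo 0 S.s₀ := hss
      rw [← hzx, D.gaugeField_radialMap a s₁ hη hr hz1, polarVelocity,
        fderiv_radialMap_polarField ((hP.contDiffAt hz1 _).differentiableAt (by simp)), ← D.velocity_eq hη hz1,
        show z 1 = s from rfl, discCutoff_eq_one hs₁.2 hss₁.2.le, mul_one, mul_comm]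
    have e2 := sum_pullback (radialMap (S.P η)) (S.metricAtVertex κ p) z (D.polarVelocity p η (radialCutoff a) z)
      (D.polarVelocity p η (radialCutoff a) z)
    rw [← e1, hzx, SingularGerm.metricAtVertex, hP.pullback_coneMetric κ IsConePolar.contDiffOn_id_dir hr hss] at e2
    have e3 : ∀ i j, S.metricAtVertex κ p x i j * D.gaugeField a s₁ p x i * D.gaugeField a s₁ p x j
      = D.gaugeField a s₁ p x i * D.gaugeField a s₁ p x j * coneMetric κ (S.φ p) id x i j := fun i j => by
        rw [SingularGerm.metricAtVertex]; ring
    simp only [e3, e2]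
    simp [Fin.sum_univ_three, polarVelocity, polarField, radialMetric, hz]
    ring
  rw [hg, dist_eq, sub_zero, abs_of_nonneg (by positivity)]
  have hv := hσ2 ⟨hs.1, hs.2.trans_le (min_le_left _ _)⟩ θ
  have h1 : sn κ ‖x‖ ^ 2 ≤ C ^ 2 := sq_le_sq' (abs_le.1 (hCa x hxc.2)).1 (abs_le.1 (hCa x hxc.2)).2
  have h2 : radialCutoff a ‖x‖ ^ 2 ≤ 1 :=
    pow_le_one₀ (smoothTransition.nonneg _) (smoothTransition.le_one _)
  calc _ ≤ C ^ 2 * 1 * (D.radialVelocity p η s θ ^ 2 + sin s ^ 2 * D.angularVelocity p η s θ ^ 2) := by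
        gcongr
    _ < C ^ 2 * 1 * (ε / C ^ 2) := by gcongr
    _ = ε := by field_simp

/-- On the overlaps, the cutoff functions are `1` and the slopes of the twist and of the length vanish: on both
sides, the tensor is the pure variation of the cone angle. -/
lemma representative_compatible [Finite E] {κ a b : ℝ} (hab : S.IsTubular κ a b) {p : V} {η : E × Bool}
    (hη : η ∈ S.endsAt p) {x : E3} (hx : x ∈ S.overlap κ a b η) :
    pullback (S.tubeToCone κ η) ((D.representative κ a b).onCone p) x = D.derivAtEdge κ η.1 x := by
  obtain ⟨hr, hs, hsn, dr, ds⟩ := hab.overlap_facts hη hx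
  obtain ⟨-, hy, hy'⟩ := hab.endDist_mem hη hx
  have hs' : S.vertexAngle κ η x ∈ Ioo 0 S.s₀ := ⟨hs.1, hs.2.trans hab.overlapAngle_mem.2⟩
  set Θ : E3 → E3 := fun y => !₂[S.vertexDist κ η y, S.vertexAngle κ η y, y 1] with hΘ
  have e0 : ∀ y, Θ y 0 = S.vertexDist κ η y := fun _ => rfl
  have e1 : ∀ y, Θ y 1 = S.vertexAngle κ η y := fun _ => rfl
  have e2 : ∀ y, Θ y 2 = y 1 := fun _ => rfl
  have dΘ : DifferentiableAt ℝ Θ x := by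
    rw [differentiableAt_euclidean]
    intro i
    fin_cases i
    · exact dr
    · exact ds
    · exact (contDiff_coord 1 (n := 1)).differentiable (by simp) x
  have hcomp : S.tubeToCone κ η = radialMap (S.P η) ∘ Θ := rfl
  have hP := SingularGerm.isConePolar hη
  have hsl : D.slope η.1 (x 2) = 0 := by
    rw [D.slope_of_mem hy]
    rcases hy' with h | h
    · exact D.deriv_f_eq_zero_of_lt h
    · exact D.deriv_f_eq_zero_of_gt h
  have hj : ∀ i, jac Θ x 2 i = if 1 = i then 1 else 0 := fun i => by
    rw [jac_eq_pd dΘ]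
    have : (fun y => Θ y 2) = fun y : E3 => y 1 := rfl
    rw [this, pd, (hasFDerivAt_coord x 1).fderiv]
    exact coordVec_apply i 1
  rw [hcomp, pullback_comp ((hP.contDiffAt_radialMap (x := Θ x) hs').differentiableAt (by simp)) dΘ,
    D.derivAtEdge_eq, hsl]
  ext i j
  rw [pullback_apply]
  simp only [D.pullback_representative_of_lt hab hη (x := Θ x) hr.1 hs, e0, e1]
  rw [← hsn]
  simp only [radialMetric, Fin.sum_univ_three, of_apply, Matrix.cons_val',
    Matrix.cons_val_fin_one, cons_val_zero, cons_val_one, cons_val, hj]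
  fin_cases i <;> fin_cases j <;> simp
  ring

lemma represents_representative [Finite E] {κ a b : ℝ} (hab : S.IsTubular κ a b) :
    D.Represents κ a b (D.representative κ a b) := by
  have hs₁ := hab.overlapAngle_mem
  have hsub : ∀ p, S.cone a p ⊆ puncturedCone (S.endsAt p) S.q := fun p x hx => hx.1
  refine ⟨⟨fun p i j => ?_, fun e i j => (D.contDiff_derivAtEdge κ e i j).contDiffOn, fun p x hx i j => ?_,
    fun e x _ i j => ?_, fun e x _ => ?_, fun e _ x _ => ?_, fun p η hη x hx => D.representative_compatible hab hη hx⟩,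
    fun e x _ => rfl, fun p => ⟨D.gaugeField a (S.overlapAngle κ a b) p,
      (D.contDiffOn_gaugeField a hs₁.2 p).mono (hsub p), fun x _ => rfl,
      fun x _ hx => D.gaugeField_of_norm_le hab.a_pos _ hx.le, fun η hη x hx => ?_,
      fun x₀ hx₀ hn => D.tendsto_gaugeField hab p hx₀ hn⟩⟩
  · exact ((D.contDiffOn_derivAtVertex κ p i j).add (contDiffOn_lieDerivative (isOpen_puncturedCone _ _)
      (D.contDiffOn_gaugeField a hs₁.2 p) (SingularGerm.contDiffOn_metricAtVertex κ p) i j)).mono (hsub p)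
  · refine congrArg₂ (· + ·) ?_ (lieDerivative_symm (fun y i j => coneMetric_symm κ (S.φ p) id y i j) i j)
    simp only [derivAtVertex, of_apply, metricAtVertex, coneMetric_symm κ _ _ x i j]
  · simp only [representative, D.derivAtEdge_eq]
    fin_cases i <;> fin_cases j <;> rfl
  · simp only [representative, D.derivAtEdge_eq]
    rfl
  · simp only [representative, D.derivAtEdge_eq]
    simp [D.slope_add_length]
  · obtain ⟨hr, hs, -⟩ := hab.overlap_facts hη hx
    have hs' : S.vertexAngle κ η x ∈ Ioo 0 S.s₀ := ⟨hs.1, hs.2.trans hs₁.2⟩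
    have h := D.gaugeField_radialMap a (S.overlapAngle κ a b) hη
      (x := !₂[S.vertexDist κ η x, S.vertexAngle κ η x, x 1]) (lt_trans (by linarith [hab.a_pos]) hr.1) hs'
    refine h.trans ?_
    have e : deriv (fun ε => D.tubeToCone κ ε η x) 0
      = S.vertexDist κ η x • D.velocity η (S.vertexAngle κ η x) (x 1) := by
      simp only [tubeToCone, velocity, polar]
      exact deriv_fun_const_smul_field _ _
    rw [e]
    simp only [cons_val_zero, cons_val_one, cons_val]
    rw [radialCutoff_eq_one hab.a_pos hr.1.le, discCutoff_eq_one hs₁.2 hs.2.le, one_mul, one_mul]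

end StandardDeformation

/-! ### Functions of the conformal coordinate -/

/-- The derivative of `K` along `sin s ∂_s`, for functions `K` of the conformal coordinate. -/
noncomputable def coneDeriv (β : ℝ) (K : ℂ → ℂ) (ζ : ℂ) : ℂ := ζ * deriv K ζ / β

lemma differentiableOn_coneDeriv {β ρ : ℝ} {K : ℂ → ℂ} (hK : DifferentiableOn ℂ K (Metric.ball 0 ρ)) :
    DifferentiableOn ℂ (coneDeriv β K) (Metric.ball 0 ρ) :=
  (differentiableOn_id.mul (hK.deriv Metric.isOpen_ball)).div_const _

lemma hasDerivAt_log_tan_half {s : ℝ} (hs : s ∈ Ioo 0 π) : HasDerivAt (fun s => log (tan (s / 2))) (sin s)⁻¹ s := by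
  have hc : 0 < cos (s / 2) := cos_pos_of_mem_Ioo ⟨by linarith [hs.1, pi_pos], by linarith [hs.2]⟩
  have hsn : 0 < sin (s / 2) := sin_pos_of_pos_of_lt_pi (by linarith [hs.1]) (by linarith [hs.2, hs.1])
  have h1 : HasDerivAt (fun s : ℝ => s / 2) (1 / 2) s := (hasDerivAt_id s).div_const 2
  have h2 : HasDerivAt (fun s : ℝ => tan (s / 2)) _ s :=
    HasDerivAt.comp (h₂ := tan) s (hasDerivAt_tan hc.ne') h1
  refine (h2.log (tan_half_pos hs.1 hs.2).ne').congr_deriv ?_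
  rw [tan_eq_sin_div_cos, show sin s = sin (2 * (s / 2)) by ring_nf, sin_two_mul]
  field_simp

lemma hasDerivAt_coneCoord_fst (β : ℝ) {s : ℝ} (hs : s ∈ Ioo 0 π) (θ : ℝ) :
    HasDerivAt (fun s => coneCoord β s θ) (coneCoord β s θ / β * ((sin s)⁻¹ : ℝ)) s := by
  refine ((((hasDerivAt_log_tan_half hs).ofReal_comp.add_const (θ * I)).div_const (β : ℂ)).cexp).congr_deriv ?_
  rw [coneCoord]
  ring

lemma hasDerivAt_coneCoord_snd (β s θ : ℝ) : HasDerivAt (fun θ => coneCoord β s θ) (coneCoord β s θ / β * I) θ := by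
  refine ((((((hasDerivAt_id θ).ofReal_comp.mul_const I)).const_add _).div_const (β : ℂ)).cexp).congr_deriv ?_
  rw [coneCoord]
  simp
  ring

lemma hasDerivAt_comp_coneCoord_fst {β ρ : ℝ} {K : ℂ → ℂ} (hK : DifferentiableOn ℂ K (Metric.ball 0 ρ)) {s : ℝ}
    (hs : s ∈ Ioo 0 π) {θ : ℝ} (hζ : coneCoord β s θ ∈ Metric.ball 0 ρ) :
    HasDerivAt (fun s => K (coneCoord β s θ)) (coneDeriv β K (coneCoord β s θ) * ((sin s)⁻¹ : ℝ)) s := by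
  have h1 := (hK.differentiableAt (Metric.isOpen_ball.mem_nhds hζ)).hasDerivAt
  refine (h1.comp s (hasDerivAt_coneCoord_fst β hs θ)).congr_deriv ?_
  rw [coneDeriv]; ring

lemma hasDerivAt_comp_coneCoord_snd {β ρ : ℝ} {K : ℂ → ℂ} (hK : DifferentiableOn ℂ K (Metric.ball 0 ρ)) {s : ℝ}
    {θ : ℝ} (hζ : coneCoord β s θ ∈ Metric.ball 0 ρ) :
    HasDerivAt (fun θ => K (coneCoord β s θ)) (coneDeriv β K (coneCoord β s θ) * I) θ := by
  have h1 := (hK.differentiableAt (Metric.isOpen_ball.mem_nhds hζ)).hasDerivAt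
  refine (h1.comp θ (hasDerivAt_coneCoord_snd β s θ)).congr_deriv ?_
  rw [coneDeriv]; ring

namespace StandardDeformation

variable {V E : Type*} {S : SingularGerm V E} {D : StandardDeformation S} {p : V} {η : E × Bool} {σ ρ : ℝ}
  {H : ℂ → ℂ}

lemma IsHolomorphicVelocity.mem_pi (h : D.IsHolomorphicVelocity p η σ ρ H) {s : ℝ} (hs : s ∈ Ioo 0 σ) :
    s ∈ Ioo 0 π := ⟨hs.1, by linarith [hs.2, h.mem.2, S.s₀_le, pi_pos]⟩

lemma IsHolomorphicVelocity.deriv_radial (h : D.IsHolomorphicVelocity p η σ ρ H) {s : ℝ} (hs : s ∈ Ioo 0 σ) (θ : ℝ) :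
    deriv (fun s => D.radialVelocity p η s θ) s
      = cos s * ((H (coneCoord (S.angle η.1 / (2 * π)) s θ)).re - D.cdot η.1 * log (tan (s / 2)))
        + (coneDeriv (S.angle η.1 / (2 * π)) H (coneCoord (S.angle η.1 / (2 * π)) s θ)).re - D.cdot η.1 := by
  have hsπ := h.mem_pi hs
  have hsin : sin s ≠ 0 := (sin_pos_of_pos_of_lt_pi hsπ.1 hsπ.2).ne'
  have e : (fun s => D.radialVelocity p η s θ) =ᶠ[𝓝 s] fun s => sin s *
      ((H (coneCoord (S.angle η.1 / (2 * π)) s θ)).re - D.cdot η.1 * log (tan (s / 2))) := by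
    filter_upwards [isOpen_Ioo.mem_nhds hs] with s' hs' using h.radial s' hs' θ
  rw [e.deriv_eq]
  have h1 := hasDerivAt_comp_coneCoord_fst h.holomorphic hsπ (h.coneCoord_mem s hs θ)
  have h2 : HasDerivAt (fun s => (H (coneCoord (S.angle η.1 / (2 * π)) s θ)).re) _ s :=
    Complex.reCLM.hasFDerivAt.comp_hasDerivAt s h1
  have h3 := (hasDerivAt_sin s).fun_mul (h2.fun_sub ((hasDerivAt_log_tan_half hsπ).const_mul (D.cdot η.1)))
  rw [h3.deriv]
  simp only [Complex.reCLM_apply, Complex.re_mul_ofReal]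
  field_simp
  ring

end StandardDeformation

/-- The functions of the polar coordinates `(s, θ)` which are near `s = 0` smooth functions of
`(s^μ, s, θ)`, plus such a function times `log s`. -/
def IsPolarSmooth (μ : ℝ) (u : ℝ → ℝ → ℝ) : Prop :=
  ∃ δ > 0, ∃ f : Fin 2 → ℝ × ℝ × ℝ → ℝ, (∀ ℓ, ContDiffOn ℝ ∞ (f ℓ) (Ioo (-δ) δ ×ˢ Ioo (-δ) δ ×ˢ univ)) ∧
    ∀ s ∈ Ioo 0 δ, ∀ θ, u s θ = f 0 (s ^ μ, s, θ) + log s * f 1 (s ^ μ, s, θ)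

namespace IsPolarSmooth

variable {μ : ℝ} {u v : ℝ → ℝ → ℝ}

lemma congr (hu : IsPolarSmooth μ u) {δ : ℝ} (hδ : 0 < δ) (h : ∀ s ∈ Ioo 0 δ, ∀ θ, v s θ = u s θ) :
    IsPolarSmooth μ v := by
  obtain ⟨δ', hδ', f, hf, hu⟩ := hu
  refine ⟨min δ δ', lt_min hδ hδ', f, fun ℓ => (hf ℓ).mono ?_, fun s hs θ => ?_⟩
  · have : Ioo (-(min δ δ')) (min δ δ') ⊆ Ioo (-δ') δ' :=
      Ioo_subset_Ioo (neg_le_neg (min_le_right _ _)) (min_le_right _ _)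
    exact prod_mono this (prod_mono this le_rfl)
  · rw [h s ⟨hs.1, hs.2.trans_le (min_le_left _ _)⟩, hu s ⟨hs.1, hs.2.trans_le (min_le_right _ _)⟩]

lemma add (hu : IsPolarSmooth μ u) (hv : IsPolarSmooth μ v) : IsPolarSmooth μ fun s θ => u s θ + v s θ := by
  obtain ⟨δ, hδ, f, hf, hu⟩ := hu
  obtain ⟨δ', hδ', f', hf', hv⟩ := hv
  have h1 : Ioo (-(min δ δ')) (min δ δ') ⊆ Ioo (-δ) δ :=
    Ioo_subset_Ioo (neg_le_neg (min_le_left _ _)) (min_le_left _ _)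
  have h2 : Ioo (-(min δ δ')) (min δ δ') ⊆ Ioo (-δ') δ' :=
    Ioo_subset_Ioo (neg_le_neg (min_le_right _ _)) (min_le_right _ _)
  refine ⟨min δ δ', lt_min hδ hδ', fun ℓ y => f ℓ y + f' ℓ y, fun ℓ =>
    ((hf ℓ).mono (prod_mono h1 (prod_mono h1 le_rfl))).add ((hf' ℓ).mono (prod_mono h2 (prod_mono h2 le_rfl))),
    fun s hs θ => ?_⟩
  beta_reduce
  rw [hu s ⟨hs.1, hs.2.trans_le (min_le_left _ _)⟩, hv s ⟨hs.1, hs.2.trans_le (min_le_right _ _)⟩]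
  ring

lemma smooth_mul (hu : IsPolarSmooth μ u) {g : ℝ → ℝ} (hg : ContDiff ℝ ∞ g) :
    IsPolarSmooth μ fun s θ => g s * u s θ := by
  obtain ⟨δ, hδ, f, hf, hu⟩ := hu
  refine ⟨δ, hδ, fun ℓ y => g y.2.1 * f ℓ y, fun ℓ => (hg.comp (by fun_prop)).contDiffOn.mul (hf ℓ), fun s hs θ => ?_⟩
  beta_reduce
  rw [hu s hs]; ring

lemma of_smooth {g : ℝ → ℝ} (hg : ContDiff ℝ ∞ g) : IsPolarSmooth μ fun s _ => g s :=
  ⟨1, one_pos, ![fun y => g y.2.1, fun _ => 0], fun ℓ => by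
    fin_cases ℓ
    · exact (hg.comp (by fun_prop)).contDiffOn
    · exact contDiffOn_const, fun s _ θ => by simp⟩

end IsPolarSmooth

lemma exists_tan_half_eq : ∃ δ ∈ Ioo (0 : ℝ) 1, ∃ m : ℝ → ℝ, ContDiffOn ℝ ∞ m (Ioo (-δ) δ) ∧
    (∀ s ∈ Ioo (-δ) δ, 0 < m s) ∧ ∀ s ∈ Ioo 0 δ, tan (s / 2) = s * m s := by
  have hΦ : ContDiffOn ℝ ∞ (fun z : ℝ × ℝ => tan (z.1 / 2)) (Ioo (-1) 1 ×ˢ univ) := by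
    intro z hz
    have hc : cos (z.1 / 2) ≠ 0 := (cos_pos_of_mem_Ioo
      ⟨by linarith [hz.1.1, pi_gt_three], by linarith [hz.1.2, pi_gt_three]⟩).ne'
    exact ((contDiffAt_tan.2 hc).comp z (f := fun z : ℝ × ℝ => z.1 / 2) (by fun_prop)).contDiffWithinAt
  obtain ⟨R, hR, he⟩ := exists_hadamard isOpen_univ hΦ
  have hRs : ContDiffOn ℝ ∞ (fun s => R (s, 0)) (Ioo (-1) 1) :=
    hR.comp (f := fun s : ℝ => (s, (0 : ℝ))) (by fun_prop) fun s hs => ⟨hs, mem_univ _⟩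
  have he' : ∀ s ∈ Ioo (-1 : ℝ) 1, tan (s / 2) = s * R (s, 0) := fun s hs => by
    have := he s hs 0 (mem_univ _)
    simpa using this
  have hc : ContinuousAt (fun s => R (s, 0)) 0 := hRs.continuousOn.continuousAt (Ioo_mem_nhds (by norm_num) (by norm_num))
  have h0 : 1 / 2 ≤ R (0, 0) := by
    refine ge_of_tendsto (hc.tendsto.mono_left (nhdsWithin_le_nhds (s := Ioi 0))) ?_
    filter_upwards [self_mem_nhdsWithin, mem_nhdsWithin_of_mem_nhds (Iio_mem_nhds one_pos)] with s h1 h2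
    rw [mem_Ioi] at h1
    rw [mem_Iio] at h2
    have h3 := lt_tan (x := s / 2) (by linarith) (by linarith [pi_gt_three])
    rw [he' s ⟨by linarith, h2⟩] at h3
    nlinarith
  obtain ⟨δ, hδ, hpos⟩ := Metric.eventually_nhds_iff.1 (hc.eventually (lt_mem_nhds (show (0 : ℝ) < R (0, 0) by linarith)))
  have h1 : min δ (1 / 2) ≤ 1 / 2 := min_le_right _ _
  refine ⟨min δ (1 / 2), ⟨lt_min hδ (by norm_num), by linarith⟩, fun s => R (s, 0),
    hRs.mono (Ioo_subset_Ioo (by linarith) (by linarith)), fun s hs => hpos ?_,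
    fun s hs => he' s ⟨by linarith [hs.1], by linarith [hs.2]⟩⟩
  rw [dist_eq, sub_zero, abs_lt]
  exact ⟨by linarith [hs.1, min_le_left δ (1 / 2)], hs.2.trans_le (min_le_left _ _)⟩

lemma isPolarSmooth_log_tan_half (μ : ℝ) : IsPolarSmooth μ fun s _ => log (tan (s / 2)) := by
  obtain ⟨δ, hδ, m, hm, hpos, he⟩ := exists_tan_half_eq
  refine ⟨δ, hδ.1, ![fun y => log (m y.2.1), fun _ => 1], fun ℓ => ?_, fun s hs θ => ?_⟩
  · fin_cases ℓ
    · exact (hm.comp (f := fun y : ℝ × ℝ × ℝ => y.2.1) (by fun_prop) fun y hy => hy.2.1).log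
        fun y hy => (hpos _ hy.2.1).ne'
    · exact contDiffOn_const
  · beta_reduce
    rw [he s hs, log_mul hs.1.ne' (hpos s ⟨by linarith [hs.1, hδ.1], hs.2⟩).ne']
    simp
    ring

/-- The conformal coordinate is `s^{1/β}` times a smooth function. -/
lemma isPolarSmooth_comp_coneCoord {β ρ : ℝ} (hρ : 0 < ρ) {K : ℂ → ℝ}
    (hK : ContDiffOn ℝ ∞ K (Metric.ball 0 ρ)) : IsPolarSmooth (1 / β) fun s θ => K (coneCoord β s θ) := by
  obtain ⟨δ, hδ, m, hm, hpos, he⟩ := exists_tan_half_eq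
  have h0 : (0 : ℝ) ∈ Ioo (-δ) δ := ⟨by linarith [hδ.1], hδ.1⟩
  have hm1 : ContDiffOn ℝ ∞ (fun s => m s ^ (1 / β)) (Ioo (-δ) δ) := hm.rpow_const_of_ne fun s hs => (hpos s hs).ne'
  -- the bound which keeps the conformal coordinate in the disc of radius `ρ`
  obtain ⟨δ', hδ', hb⟩ : ∃ δ' ∈ Ioo 0 δ, ∀ ξ ∈ Ioo (-δ') δ', ∀ s ∈ Ioo (-δ') δ', |ξ * m s ^ (1 / β)| < ρ := by
    have hc : ContinuousAt (fun z : ℝ × ℝ => |z.1 * m z.2 ^ (1 / β)|) (0, 0) := by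
      refine (continuousAt_fst.mul (ContinuousAt.comp (f := fun z : ℝ × ℝ => z.2) (g := fun s => m s ^ (1 / β))
        (x := (0, 0)) ?_ continuousAt_snd)).abs
      exact hm1.continuousOn.continuousAt (isOpen_Ioo.mem_nhds h0)
    obtain ⟨ε, hε, hb⟩ := Metric.eventually_nhds_iff.1 
      (hc.eventually (show ∀ᶠ y in 𝓝 _, y < ρ from gt_mem_nhds (by simpa using hρ)))
    have hd : (0 : ℝ) < min ε (δ / 2) := lt_min hε (by linarith [hδ.1])
    refine ⟨min ε (δ / 2), ⟨hd, by linarith [min_le_right ε (δ / 2), hδ.1]⟩, fun ξ hξ s hs =>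
      hb (y := (ξ, s)) ?_⟩
    rw [Prod.dist_eq]
    simp only [dist_eq, sub_zero]
    exact max_lt ((abs_lt.2 hξ).trans_le (min_le_left _ _)) ((abs_lt.2 hs).trans_le (min_le_left _ _))
  have hsub : Ioo (-δ') δ' ⊆ Ioo (-δ) δ := Ioo_subset_Ioo (by linarith [hδ'.2]) hδ'.2.le
  set Z : ℝ × ℝ × ℝ → ℂ := fun y => ((y.1 * m y.2.1 ^ (1 / β) : ℝ) : ℂ) * Complex.exp ((y.2.2 : ℂ) * I / β) with hZ
  have hZs : ContDiffOn ℝ ∞ Z (Ioo (-δ') δ' ×ˢ Ioo (-δ') δ' ×ˢ univ) := by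
    have h1 : ContDiffOn ℝ ∞ (fun y : ℝ × ℝ × ℝ => y.1 * m y.2.1 ^ (1 / β)) (Ioo (-δ') δ' ×ˢ Ioo (-δ') δ' ×ˢ univ) :=
      contDiffOn_fst.mul (hm1.comp (f := fun y : ℝ × ℝ × ℝ => y.2.1) (by fun_prop) fun y hy => hsub hy.2.1)
    refine (Complex.ofRealCLM.contDiff.comp_contDiffOn h1).mul (ContDiff.contDiffOn ?_)
    have h2 : ContDiff ℝ ∞ (fun y : ℝ × ℝ × ℝ => (y.2.2 : ℂ)) :=
      Complex.ofRealCLM.contDiff.comp (by fun_prop : ContDiff ℝ ∞ fun y : ℝ × ℝ × ℝ => y.2.2)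
    exact ((h2.mul contDiff_const).div_const _).cexp
  refine ⟨δ', hδ'.1, ![fun y => K (Z y), fun _ => 0], fun ℓ => ?_, fun s hs θ => ?_⟩
  · fin_cases ℓ
    · refine hK.comp hZs fun y hy => ?_
      rw [mem_ball_zero_iff, hZ, norm_mul, Complex.norm_real, Complex.norm_exp]
      have : (((y.2.2 : ℂ) * I / β)).re = 0 := by rw [Complex.div_ofReal_re]; simp
      rw [this, exp_zero, mul_one]
      exact hb _ hy.1 _ hy.2.1
    · exact contDiffOn_const
  · have hs' : s ∈ Ioo (-δ) δ := hsub ⟨by linarith [hs.1, hδ'.1], hs.2⟩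
    have hms := hpos s hs'
    simp only [cons_val_zero, cons_val_one, mul_zero, add_zero, hZ]
    congr 1
    rw [coneCoord, add_div, Complex.exp_add, ← mul_rpow hs.1.le hms.le, ← he s ⟨hs.1, hs.2.trans hδ'.2⟩,
      rpow_def_of_pos (tan_half_pos hs.1 (by linarith [hs.2, hδ'.2, hδ.2, pi_gt_three])), Complex.ofReal_exp]
    push_cast
    congr 2
    ring

lemma contDiffOn_re_of_differentiableOn {K : ℂ → ℂ} {U : Set ℂ} (hU : IsOpen U) (hK : DifferentiableOn ℂ K U) :
    ContDiffOn ℝ ∞ (fun z => (K z).re) U ∧ ContDiffOn ℝ ∞ (fun z => (K z).im) U := by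
  have h : ContDiffOn ℝ ∞ K U := (hK.contDiffOn hU (n := ∞)).restrict_scalars ℝ
  exact ⟨Complex.reCLM.contDiff.comp_contDiffOn h, Complex.imCLM.contDiff.comp_contDiffOn h⟩

/-! ### Polyhomogeneity of the representing tensor -/

namespace StandardDeformation

variable {V E : Type*} {S : SingularGerm V E} {D : StandardDeformation S} {p : V} {η : E × Bool} {σ ρ : ℝ}
  {H : ℂ → ℂ}

lemma IsHolomorphicVelocity.isPolarSmooth (h : D.IsHolomorphicVelocity p η σ ρ H) :
    IsPolarSmooth (1 / (S.angle η.1 / (2 * π))) (D.radialVelocity p η) ∧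
    IsPolarSmooth (1 / (S.angle η.1 / (2 * π))) (D.angularVelocity p η) ∧
    IsPolarSmooth (1 / (S.angle η.1 / (2 * π))) fun s θ => deriv (fun s => D.radialVelocity p η s θ) s := by
  obtain ⟨hre, him⟩ := contDiffOn_re_of_differentiableOn Metric.isOpen_ball h.holomorphic
  obtain ⟨hre', -⟩ := contDiffOn_re_of_differentiableOn Metric.isOpen_ball
    (differentiableOn_coneDeriv (β := S.angle η.1 / (2 * π)) h.holomorphic)
  have k1 := (isPolarSmooth_comp_coneCoord (β := S.angle η.1 / (2 * π)) h.radius_pos hre).add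
    ((isPolarSmooth_log_tan_half _).smooth_mul (g := fun _ => -D.cdot η.1) contDiff_const)
  refine ⟨(k1.smooth_mul (g := sin) contDiff_sin).congr h.mem.1 fun s hs θ => ?_,
    (isPolarSmooth_comp_coneCoord h.radius_pos him).congr h.mem.1 fun s hs θ => h.angular s hs θ,
    (((k1.smooth_mul (g := cos) contDiff_cos).add (isPolarSmooth_comp_coneCoord h.radius_pos hre')).add
      (IsPolarSmooth.of_smooth (g := fun _ => -D.cdot η.1) contDiff_const)).congr h.mem.1 fun s hs θ => ?_⟩
  · rw [h.radial s hs]; ring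
  · rw [h.deriv_radial hs]; ring

end StandardDeformation

lemma hasExpansion_of_smooth {X : Type*} [NormedAddCommGroup X] [NormedSpace ℝ X] {O : Set X} (hO : IsOpen O)
    {δ : ℝ} (hδ : 0 < δ) {f : ℝ × X → ℝ} (hf : ContDiffOn ℝ ∞ f (Ioo (-δ) δ ×ˢ O)) {u : ℝ × X → ℝ} {T₀ : ℝ}
    (hu : ∀ t < T₀, ∀ z ∈ O, u (t, z) = f (exp t, z)) : HasExpansion O u := by
  refine hasExpansion_of_smooth_log hO hδ one_pos (f := ![fun y => f y.2, fun _ => 0]) (T₀ := T₀) (fun ℓ => ?_)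
    fun t ht z hz => ?_
  · fin_cases ℓ
    · exact hf.comp (f := fun y : ℝ × ℝ × X => y.2) contDiffOn_snd fun y hy => hy.2
    · exact contDiffOn_const
  · rw [hu t ht z hz]; simp

lemma isExpBounded_of_smooth {X : Type*} [NormedAddCommGroup X] [NormedSpace ℝ X] {O : Set X} (hO : IsOpen O)
    {f : ℝ → ℝ} (hf : ContDiff ℝ ∞ f) : IsExpBounded O 0 fun y : ℝ × X => f (exp y.1) :=
  (isExpBounded_comp_exp hO one_pos one_pos (f := fun y : ℝ × ℝ × X => f y.2.1) (hf.comp (by fun_prop)).contDiffOn)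

lemma exists_smooth_sn_div (κ : ℝ) : ∃ ψ : ℝ → ℝ, ContDiffOn ℝ ∞ ψ (Ioo (-1) 1) ∧ ψ 0 = 1 ∧
    ∀ r ∈ Ioo 0 1, sn κ r / r = ψ r := by
  have hsn : ContDiffOn ℝ ∞ (fun z : ℝ × ℝ => sn κ z.1) (Ioo (-1) 1 ×ˢ univ) :=
    ((contDiff_sn κ).comp contDiff_fst).contDiffOn
  obtain ⟨R, hR, he⟩ := exists_hadamard isOpen_univ hsn
  have hs : ContDiffOn ℝ ∞ (fun r => R (r, 0)) (Ioo (-1) 1) :=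
    hR.comp (f := fun r : ℝ => (r, (0 : ℝ))) (by fun_prop) fun y hy => ⟨hy, mem_univ _⟩
  have hm : Ioo (-1 : ℝ) 1 ∈ 𝓝 (0 : ℝ) := isOpen_Ioo.mem_nhds ⟨by norm_num, by norm_num⟩
  have he' : ∀ r ∈ Ioo (-1 : ℝ) 1, sn κ r = r * R (r, 0) := fun r hr => by
    simpa [sn_zero] using he r hr 0 (mem_univ _)
  refine ⟨fun r => R (r, 0), hs, ?_, fun r hr => ?_⟩
  · have h1 : HasDerivAt (fun r => r * R (r, 0)) _ 0 := (hasDerivAt_id (0 : ℝ)).mul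
      ((hs.contDiffAt hm).differentiableAt (by simp)).hasDerivAt
    have h2 := (hasDerivAt_sn κ 0).congr_of_eventuallyEq (f₁ := fun r => r * R (r, 0)) (by
      filter_upwards [hm] with r hr using (he' r hr).symm)
    have := h1.unique h2
    simpa [cs_zero] using this
  · rw [he' r ⟨by linarith [hr.1], hr.2⟩, mul_div_cancel_left₀ _ hr.1.ne']

namespace IsPolarSmooth

variable {μ : ℝ} {u : ℝ → ℝ → ℝ}

lemma exp_eq {δ : ℝ} {t : ℝ} (ht : t < log δ) (hδ : 0 < δ) : exp t ∈ Ioo 0 δ ∧ exp t ^ μ = exp (μ * t) := by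
  refine ⟨⟨exp_pos t, (lt_log_iff_exp_lt hδ).1 ht⟩, ?_⟩
  rw [← exp_mul, mul_comm]

/-- The expansion at `s = 0`, with a parameter. -/
lemma hasExpansion (hμ : 0 < μ) (hu : IsPolarSmooth μ u) {v : ℝ → ℝ → ℝ} (hv : IsPolarSmooth μ v)
    {g₁ g₂ : ℝ → ℝ} (hg₁ : ContDiff ℝ ∞ g₁) (hg₂ : ContDiff ℝ ∞ g₂) {O : Set (ℝ × ℝ)} (hO : IsOpen O)
    {w : ℝ × ℝ × ℝ → ℝ} {δ : ℝ} (hδ : 0 < δ)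
    (h : ∀ s ∈ Ioo 0 δ, ∀ z ∈ O, w (log s, z) = g₁ z.1 * u s z.2 + g₂ z.1 * v s z.2) : HasExpansion O w := by
  obtain ⟨δ₁, hδ₁, f, hf, hu⟩ := hu
  obtain ⟨δ₂, hδ₂, f', hf', hv⟩ := hv
  set ε := min δ (min δ₁ δ₂) with hε
  have hε0 : 0 < ε := lt_min hδ (lt_min hδ₁ hδ₂)
  have e1 : ε ≤ δ₁ := (min_le_right _ _).trans (min_le_left _ _)
  have e2 : ε ≤ δ₂ := (min_le_right _ _).trans (min_le_right _ _)
  have h1 : Ioo (-ε) ε ⊆ Ioo (-δ₁) δ₁ := Ioo_subset_Ioo (neg_le_neg e1) e1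
  have h2 : Ioo (-ε) ε ⊆ Ioo (-δ₂) δ₂ := Ioo_subset_Ioo (neg_le_neg e2) e2
  refine hasExpansion_of_smooth_log hO hε0 hμ (T₀ := log ε)
    (f := fun ℓ y => g₁ y.2.2.1 * f ℓ (y.1, y.2.1, y.2.2.2) + g₂ y.2.2.1 * f' ℓ (y.1, y.2.1, y.2.2.2))
    (fun ℓ => ?_) fun t ht z hz => ?_
  · refine (((hg₁.comp (by fun_prop)).contDiffOn).mul ((hf ℓ).comp
      (f := fun y : ℝ × ℝ × ℝ × ℝ => (y.1, y.2.1, y.2.2.2)) (by fun_prop)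
      fun y hy => ⟨h1 hy.1, h1 hy.2.1, mem_univ _⟩)).add
      (((hg₂.comp (by fun_prop)).contDiffOn).mul ((hf' ℓ).comp
      (f := fun y : ℝ × ℝ × ℝ × ℝ => (y.1, y.2.1, y.2.2.2)) (by fun_prop)
      fun y hy => ⟨h2 hy.1, h2 hy.2.1, mem_univ _⟩))
  · obtain ⟨m, e⟩ := exp_eq (μ := μ) ht hε0
    have := h _ ⟨m.1, m.2.trans_le (min_le_left _ _)⟩ z hz
    rw [log_exp] at this
    rw [this, hu _ ⟨m.1, m.2.trans_le e1⟩, hv _ ⟨m.1, m.2.trans_le e2⟩, e, log_exp]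
    ring

lemma isExpBounded (hμ : 0 < μ) (hu : IsPolarSmooth μ u) : IsExpBounded univ (-1) fun y : ℝ × ℝ => u (exp y.1) y.2 := by
  obtain ⟨δ, hδ, f, hf, hu⟩ := hu
  have h0 := (isExpBounded_comp_exp isOpen_univ hδ hμ (hf 0)).mono (N' := -1) (by norm_num)
  have h1 := (isExpBounded_fst (isOpen_univ (X := ℝ)) (N := -1) (by norm_num)).mul isOpen_univ
    (isExpBounded_comp_exp isOpen_univ hδ hμ (hf 1))
  rw [add_zero] at h1
  refine (h0.add isOpen_univ h1).congr isOpen_univ (T₀ := log δ) fun t ht z _ => ?_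
  obtain ⟨m, e⟩ := exp_eq (μ := μ) ht hδ
  simp only [hu _ m, e, log_exp]

end IsPolarSmooth

namespace StandardDeformation

variable {V E : Type*} {S : SingularGerm V E} (D : StandardDeformation S)

lemma derivAtVertex_smul [Finite E] (κ : ℝ) (p : V) {ξ : E3} (hξ : ξ ∈ puncturedCone (S.endsAt p) S.q)
    (hn : ‖ξ‖ = 1) {r : ℝ} (hr : 0 < r) (i j : Fin 3) :
    D.derivAtVertex κ p (r • ξ) i j = (sn κ r / r) ^ 2 * D.derivAtVertex 0 p ξ i j := by
  have hd : DifferentiableAt ℝ (fun ε => D.metricAtVertex 0 ε p ξ i j) 0 := by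
    have h1 := (D.contDiffOn_metricAtVertex 0 p i j).contDiffAt
      ((isOpen_Ioo.prod (isOpen_puncturedCone _ _)).mem_nhds (show ((0 : ℝ), ξ) ∈ _ from ⟨D.zero_mem, hξ⟩))
    exact (h1.differentiableAt (by simp)).comp (f := fun ε : ℝ => (ε, ξ)) (0 : ℝ) (by fun_prop)
  have hm : ∀ ε, D.metricAtVertex κ ε p (r • ξ) i j
      = (sn κ r / r) ^ 2 * D.metricAtVertex 0 ε p ξ i j + (1 - (sn κ r / r) ^ 2) * (ξ i * ξ j) := by
    intro ε
    have e1 : ‖r • ξ‖ = r := by rw [norm_smul, hn, mul_one, norm_of_nonneg hr.le]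
    have e2 : sn 0 1 = 1 := by simp [sn]
    have e3 : ∀ v, fderiv ℝ (fun y => D.F p ε (dir y)) (r • ξ) v = r⁻¹ • fderiv ℝ (fun y => D.F p ε (dir y)) ξ v :=
      fun v => fderiv_smul_of_homogeneous (homogeneous_comp_dir (D.F p ε)) hr ξ v
    simp only [metricAtVertex, coneMetric, of_apply, e1, hn, e2, e3, dir_smul hr, inner_smul_left,
      inner_smul_right, conj_to_real, PiLp.smul_apply, smul_eq_mul]
    field_simp
    ring
  simp only [derivAtVertex, of_apply, hm]
  rw [deriv_add_const, deriv_const_mul _ hd]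

/-- Near the vertices, the gauge field vanishes. -/
lemma representative_of_norm_lt {κ a b : ℝ} (ha : 0 < a) {p : V} {x : E3} (hx : ‖x‖ < a / 4) :
    (D.representative κ a b).onCone p x = D.derivAtVertex κ p x := by
  have hev : D.gaugeField a (S.overlapAngle κ a b) p =ᶠ[𝓝 x] fun _ => 0 := by
    filter_upwards [continuous_norm.continuousAt.eventually (gt_mem_nhds hx)] with y hy
    exact D.gaugeField_of_norm_le ha _ (le_of_lt hy)
  simp only [representative]
  rw [lieDerivative_congr hev (EventuallyEq.refl _ _)]
  ext i j
  simp [lieDerivative, pd_const]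

/-- The components of the representing tensor in polar coordinates. -/
lemma exists_components [Finite E] {κ a b : ℝ} (hab : S.IsTubular κ a b) {p : V} {η : E × Bool}
    (hη : η ∈ S.endsAt p) (i j : Fin 3) :
    ∃ (g₁ g₂ : ℝ → ℝ) (u v : ℝ → ℝ → ℝ) (δ : ℝ), 0 < δ ∧ ContDiff ℝ ∞ g₁ ∧ ContDiff ℝ ∞ g₂ ∧
      IsPolarSmooth (1 / (S.angle η.1 / (2 * π))) u ∧ IsPolarSmooth (1 / (S.angle η.1 / (2 * π))) v ∧
      (∀ r < a / 4, g₂ r = 0) ∧ ∀ r > 0, ∀ s ∈ Ioo 0 δ, ∀ θ,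
        pullback (radialMap (S.P η)) ((D.representative κ a b).onCone p) !₂[r, s, θ] i j
          = g₁ r * u s θ + g₂ r * v s θ := by
  obtain ⟨σ, ρ, H, h⟩ := D.exists_isHolomorphicVelocity hη
  obtain ⟨hX, hY, hA⟩ := h.isPolarSmooth
  have hs₁ := hab.overlapAngle_mem
  have ha := hab.a_pos
  set χ := radialCutoff a with hχ
  have cχ : ContDiff ℝ ∞ χ := contDiff_radialCutoff a
  have cχ' : ContDiff ℝ ∞ (deriv χ) := (contDiff_infty_iff_deriv.1 cχ).2
  have csn : ContDiff ℝ ∞ (sn κ) := contDiff_sn κ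
  have z1 : ∀ r < a / 4, χ r = 0 := fun r hr => radialCutoff_eq_zero ha hr.le
  have z2 : ∀ r < a / 4, deriv χ r = 0 := fun r hr => by
    have : χ =ᶠ[𝓝 r] fun _ => 0 := (eventually_lt_nhds hr).mono fun t ht => z1 t ht
    rw [this.deriv_eq, deriv_const]
  have hpos : 0 < min σ (S.overlapAngle κ a b) := lt_min h.mem.1 hs₁.1
  have key : ∀ r : ℝ, 0 < r → ∀ s ∈ Ioo 0 (min σ (S.overlapAngle κ a b)), ∀ θ, _ := fun r hr s hs θ =>
    (D.pullback_representative hab hη (x := !₂[r, s, θ]) hr ⟨hs.1, hs.2.trans_le (min_le_right _ _)⟩).trans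
      (h.pullback_add κ χ !₂[r, s, θ] hr ⟨hs.1, hs.2.trans_le (min_le_left _ _)⟩ ((cχ.differentiable (by simp)) _))
  have c0 : ContDiff ℝ ∞ fun _ : ℝ => (0 : ℝ) := contDiff_const
  have gA : ContDiff ℝ ∞ fun r => sn κ r ^ 2 * (-2 * (1 - χ r)) :=
    (csn.pow 2).mul (contDiff_const.mul (contDiff_const.sub cχ))
  have gB : ContDiff ℝ ∞ fun r => sn κ r ^ 2 * deriv χ r := (csn.pow 2).mul cχ'
  have gC : ContDiff ℝ ∞ fun r => sn κ r ^ 2 * (2 * χ r * D.cdot η.1) :=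
    (csn.pow 2).mul ((contDiff_const.mul cχ).mul contDiff_const)
  have cs2 : ContDiff ℝ ∞ fun s => sin s ^ 2 := contDiff_sin.pow 2
  have u0 := IsPolarSmooth.of_smooth (μ := 1 / (S.angle η.1 / (2 * π))) c0
  have us := IsPolarSmooth.of_smooth (μ := 1 / (S.angle η.1 / (2 * π))) cs2
  have zB : ∀ r < a / 4, sn κ r ^ 2 * deriv χ r = 0 := fun r hr => by rw [z2 r hr, mul_zero]
  have zC : ∀ r < a / 4, sn κ r ^ 2 * (2 * χ r * D.cdot η.1) = 0 := fun r hr => by rw [z1 r hr]; ring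
  have z0 : ∀ r < a / 4, (fun _ : ℝ => (0 : ℝ)) r = 0 := fun _ _ => rfl
  simp only [Matrix.smul_of, Matrix.smul_cons, Matrix.smul_empty, smul_eq_mul] at key
  fin_cases i <;> fin_cases j
  · exact ⟨_, _, _, _, _, hpos, c0, c0, u0, u0, z0, fun r hr s hs θ => by rw [key r hr s hs θ]; simp⟩
  · exact ⟨_, _, _, _, _, hpos, c0, gB, u0, hX, zB, fun r hr s hs θ => by rw [key r hr s hs θ]; simp; ring⟩
  · exact ⟨_, _, _, _, _, hpos, c0, gB, u0, hY.smooth_mul cs2, zB, fun r hr s hs θ => by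
      rw [key r hr s hs θ]; simp; ring⟩
  · exact ⟨_, _, _, _, _, hpos, c0, gB, u0, hX, zB, fun r hr s hs θ => by rw [key r hr s hs θ]; simp; ring⟩
  · exact ⟨_, _, _, _, _, hpos, gA, c0, hA, u0, z0, fun r hr s hs θ => by rw [key r hr s hs θ]; simp; ring⟩
  · exact ⟨_, _, _, _, _, hpos, c0, c0, u0, u0, z0, fun r hr s hs θ => by rw [key r hr s hs θ]; simp⟩
  · exact ⟨_, _, _, _, _, hpos, c0, gB, u0, hY.smooth_mul cs2, zB, fun r hr s hs θ => by
      rw [key r hr s hs θ]; simp; ring⟩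
  · exact ⟨_, _, _, _, _, hpos, c0, c0, u0, u0, z0, fun r hr s hs θ => by rw [key r hr s hs θ]; simp⟩
  · exact ⟨_, _, _, _, _, hpos, gA, gC, hA.smooth_mul cs2, us, zC, fun r hr s hs θ => by
      rw [key r hr s hs θ]; simp; ring⟩

lemma contDiffOn_representative [Finite E] {κ a b : ℝ} (hab : S.IsTubular κ a b) (p : V) (i j : Fin 3) :
    ContDiffOn ℝ ∞ (fun x => (D.representative κ a b).onCone p x i j) (puncturedCone (S.endsAt p) S.q) :=
  (D.contDiffOn_derivAtVertex κ p i j).add (contDiffOn_lieDerivative (isOpen_puncturedCone _ _)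
      (D.contDiffOn_gaugeField a hab.overlapAngle_mem.2 p) (SingularGerm.contDiffOn_metricAtVertex κ p) i j)

lemma contDiffAt_pullback_representative [Finite E] {κ a b : ℝ} (hab : S.IsTubular κ a b) {p : V} {η : E × Bool}
    (hη : η ∈ S.endsAt p) {x : E3} (hr : 0 < x 0) (hs : x 1 ∈ Ioo 0 S.s₀) (i j : Fin 3) :
    ContDiffAt ℝ ∞ (fun x => pullback (radialMap (S.P η)) ((D.representative κ a b).onCone p) x i j) x :=
  contDiffAt_pullback (((SingularGerm.isConePolar hη).contDiffAt_radialMap hs).of_le (by simp))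
    (fun i j => (D.contDiffOn_representative hab p i j).contDiffAt ((isOpen_puncturedCone _ _).mem_nhds
      (SingularGerm.radialMap_mem_puncturedCone hη hr hs))) i j

lemma contDiff_triple : ContDiff ℝ ∞ fun z : ℝ × ℝ × ℝ => (!₂[z.1, z.2.1, z.2.2] : E3) := by
  rw [contDiff_euclidean]
  intro i
  fin_cases i <;> simp <;> fun_prop

/-- The expansions at the edges come from `IsPolarSmooth`; at the vertices, the gauge field vanishes and the tensor
is `sn_κ² r` times a tensor on the link. -/
lemma isPolyhomogeneous_representative [Finite E] {κ a b : ℝ} (hab : S.IsTubular κ a b) :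
    S.IsPolyhomogeneous a b (D.representative κ a b) := by
  have ha := hab.a_pos
  refine ⟨fun e i j => ?_, fun p i j => ?_, fun p η hη i j => ?_, fun p η hη i j => ?_⟩
  · have hO : IsOpen {z : ℝ × ℝ | z.2 ∈ S.tubeRange a e} := by
      refine IsOpen.preimage continuous_snd ?_
      by_cases h : S.ends e = none
      · simp [SingularGerm.tubeRange, h]
      · simp only [SingularGerm.tubeRange, h, false_or]
        exact isOpen_Ioo
    have hf : ContDiff ℝ ∞ fun w : ℝ × ℝ × ℝ => D.derivAtEdge κ e !₂[w.1, w.2.1, w.2.2] i j :=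
      (D.contDiff_derivAtEdge κ e i j).comp contDiff_triple
    exact (hasExpansion_of_smooth hO one_pos hf.contDiffOn (T₀ := 0) fun t _ z _ => rfl).isPhg hO hf.contDiffOn
  · have hO := isOpen_puncturedCone (S.endsAt p) S.q
    have hm : ∀ r : ℝ, 0 < r → ∀ w ∈ puncturedCone (S.endsAt p) S.q, r • dir w ∈ puncturedCone (S.endsAt p) S.q := by
      intro r hr w hw
      have h1 := norm_dir hw.1
      have h2 : dir w ≠ 0 := norm_ne_zero_iff.1 (by rw [h1]; norm_num)
      refine ⟨smul_ne_zero hr.ne' h2, fun η hη => ?_⟩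
      rw [dir_smul hr, dir_of_norm_eq_one h1]
      exact hw.2 η hη
    have hd : ContDiffOn ℝ ∞ dir (puncturedCone (S.endsAt p) S.q) := fun w hw =>
      (contDiffAt_dir hw.1).contDiffWithinAt
    refine HasExpansion.isPhg hO ?_ ?_
    · exact (D.contDiffOn_representative hab p i j).comp
        (contDiffOn_fst.smul (hd.comp contDiffOn_snd fun w hw => hw.2)) fun w hw => hm _ hw.1.1 _ hw.2
    · obtain ⟨ψ, hψ, -, he⟩ := exists_smooth_sn_div κ
      have hk : ContDiffOn ℝ ∞ (fun w => D.derivAtVertex 0 p (dir w) i j) (puncturedCone (S.endsAt p) S.q) :=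
        (D.contDiffOn_derivAtVertex 0 p i j).comp hd fun w hw => by
          have := hm 1 one_pos w hw
          rwa [one_smul] at this
      refine hasExpansion_of_smooth hO one_pos (T₀ := min 0 (log (a / 4)))
        (f := fun y => ψ y.1 ^ 2 * D.derivAtVertex 0 p (dir y.2) i j) ?_ fun t ht w hw => ?_
      · exact ((hψ.comp contDiffOn_fst fun y hy => hy.1).pow 2).mul (hk.comp contDiffOn_snd fun y hy => hy.2)
      · have hr := exp_pos t
        have h1 : exp t < 1 := exp_lt_one_iff.2 (ht.trans_le (min_le_left _ _))
        have h2 : exp t < a / 4 := (lt_log_iff_exp_lt (by linarith)).1 (ht.trans_le (min_le_right _ _))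
        have hn := norm_dir hw.1
        rw [D.representative_of_norm_lt ha (by rw [norm_smul, hn, mul_one, norm_of_nonneg hr.le]; exact h2),
          D.derivAtVertex_smul κ p (by have := hm 1 one_pos w hw; rwa [one_smul] at this) hn hr, he _ ⟨hr, h1⟩]
  · obtain ⟨g₁, g₂, u, v, δ, hδ, hg₁, hg₂, hu, hv, -, he⟩ := D.exists_components hab hη i j
    have hO : IsOpen {z : ℝ × ℝ | z.1 ∈ Ioo 0 a} := isOpen_Ioo.preimage continuous_fst
    refine HasExpansion.isPhg hO ?_ (IsPolarSmooth.hasExpansion (one_div_pos.2 (angle_div_pos η.1)) hu hv hg₁ hg₂ hO hδ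
      fun s hs z hz => ?_)
    · intro w hw
      refine ContDiffAt.contDiffWithinAt ?_
      refine ContDiffAt.comp (f := fun w : ℝ × ℝ × ℝ => (!₂[w.2.1, w.1, w.2.2] : E3)) w
        (D.contDiffAt_pullback_representative hab hη hw.2.1 hw.1 i j) ?_
      exact (contDiff_triple.comp (f := fun w : ℝ × ℝ × ℝ => (w.2.1, w.1, w.2.2)) (by fun_prop)).contDiffAt
    · simp only [exp_log hs.1]
      exact he z.1 hz.1 s hs z.2
  · obtain ⟨g₁, g₂, u, v, δ, hδ, hg₁, hg₂, hu, hv, hz, he⟩ := D.exists_components hab hη i j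
    have hμ : 0 < 1 / (S.angle η.1 / (2 * π)) := one_div_pos.2 (angle_div_pos η.1)
    have hB : HasExpansion univ fun y : ℝ × ℝ => u (exp y.1) y.2 := by
      obtain ⟨δ₁, hδ₁, f, hf, hu'⟩ := hu
      refine hasExpansion_of_smooth_log isOpen_univ hδ₁ hμ (T₀ := log δ₁) hf fun t ht z _ => ?_
      obtain ⟨m, e⟩ := IsPolarSmooth.exp_eq (μ := 1 / (S.angle η.1 / (2 * π))) ht hδ₁
      simp only [hu' _ m, e, log_exp]
    refine HasExpansion.isPhgCorner isOpen_univ ?_ (A := fun y => g₁ (exp y.1))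
      (B := fun y => u (exp y.1) y.2) (m := 1) (T₀ := min (log (a / 4)) (log δ))
      (hasExpansion_of_smooth isOpen_univ one_pos (f := fun y => g₁ y.1) (hg₁.comp contDiff_fst).contDiffOn
        (T₀ := 0) fun _ _ _ _ => rfl) hB ((isExpBounded_of_smooth isOpen_univ hg₁).mono (by norm_num))
      (hu.isExpBounded hμ) fun t ht t' ht' θ _ => ?_
    · intro w hw
      refine ContDiffAt.contDiffWithinAt ?_
      exact ContDiffAt.comp (f := fun w : ℝ × ℝ × ℝ => (!₂[w.1, w.2.1, w.2.2] : E3)) w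
        (D.contDiffAt_pullback_representative hab hη hw.1.1 hw.2.1 i j) contDiff_triple.contDiffAt
    · have h1 := (lt_log_iff_exp_lt (show 0 < a / 4 by linarith)).1 (ht.trans_le (min_le_left _ _))
      have h2 := (lt_log_iff_exp_lt hδ).1 (ht'.trans_le (min_le_right _ _))
      refine (he _ (exp_pos t) _ ⟨exp_pos t', h2⟩ θ).trans ?_
      rw [hz _ h1, zero_mul, add_zero]

end StandardDeformation

/-! ### Integrability -/

lemma norm_le_sum_abs (x : E3) : ‖x‖ ≤ ∑ i, |x i| := by
  conv_lhs => rw [← sum_smul_coordVec x]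
  refine (norm_sum_le _ _).trans (Finset.sum_le_sum fun i _ => ?_)
  rw [norm_smul, coordVec, PiLp.norm_single, norm_one, mul_one, norm_eq_abs]

lemma integrableOn_of_bounded_continuousOn {f : E3 → ℝ} {T : Set E3} (hT : MeasurableSet T) {M C : ℝ}
    (hM : ∀ x ∈ T, ∀ i, |x i| ≤ M) (hf : ContinuousOn f T) (hC : ∀ x ∈ T, |f x| ≤ C) : IntegrableOn f T := by
  have hb : Bornology.IsBounded T := isBounded_iff_forall_norm_le.2 ⟨3 * M, fun x hx => (norm_le_sum_abs x).trans (by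
    have := hM x hx
    rw [Fin.sum_univ_three]
    linarith [this 0, this 1, this 2])⟩
  exact IntegrableOn.of_bound hb.measure_lt_top (hf.aestronglyMeasurable hT) C
    ((ae_restrict_iff' hT).2 (Eventually.of_forall hC))

/-- A function of the first coordinate which is integrable on a box is integrable on an interval. -/
lemma integrableOn_fst_of_box {φ : ℝ → ℝ} {A B C : Set ℝ} (hB0 : volume B ≠ 0) (hC0 : volume C ≠ 0)
    (h : IntegrableOn (fun x : E3 => φ (x 0)) {x | x 0 ∈ A ∧ x 1 ∈ B ∧ x 2 ∈ C}) : IntegrableOn φ A := by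
  have e := (volume_preserving_piFinSuccAbove (fun _ : Fin 3 => ℝ) 0).comp
    (EuclideanSpace.volume_preserving_symm_measurableEquiv_toLp (Fin 3))
  have hemb : MeasurableEmbedding (MeasurableEquiv.piFinSuccAbove (fun _ : Fin 3 => ℝ) 0 ∘
      (MeasurableEquiv.toLp 2 (Fin 3 → ℝ)).symm) :=
    (MeasurableEquiv.measurableEmbedding _).comp (MeasurableEquiv.measurableEmbedding _)
  set T : Set (Fin 2 → ℝ) := Set.pi univ ![B, C] with hT
  have h1 : IntegrableOn (fun z : ℝ × (Fin 2 → ℝ) => φ z.1) (A ×ˢ T) := by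
    refine (e.integrableOn_comp_preimage hemb).1 ?_
    have : (MeasurableEquiv.piFinSuccAbove (fun _ : Fin 3 => ℝ) 0 ∘
        (MeasurableEquiv.toLp 2 (Fin 3 → ℝ)).symm) ⁻¹' A ×ˢ T = {x : E3 | x 0 ∈ A ∧ x 1 ∈ B ∧ x 2 ∈ C} := by
      ext x
      show (x 0 ∈ A ∧ _ ∈ Set.pi univ ![B, C]) ↔ (x 0 ∈ A ∧ x 1 ∈ B ∧ x 2 ∈ C)
      simp only [Set.mem_pi, Fin.forall_fin_two, mem_univ, true_implies]
      rfl
    rw [this]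
    exact h
  rw [IntegrableOn, Measure.volume_eq_prod, ← Measure.prod_restrict] at h1
  have hT0 : (volume.restrict T) ≠ 0 := by
    rw [Ne, Measure.restrict_eq_zero, hT, volume_pi_pi]
    simp [Fin.prod_univ_two, hB0, hC0]
  have := ae_neBot.2 hT0
  exact h1.prod_left_ae.exists.choose_spec

/-! ### The covariant derivative for diagonal metrics -/

lemma covDeriv_diagonal {g k : TensorField} {x : E3} {d : E3 → Fin 3 → ℝ}
    (hg : ∀ᶠ y in 𝓝 x, g y = diagonal (d y)) (hd : ∀ i, d x i ≠ 0) (l i j : Fin 3) :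
    covDeriv g k x l i j = pd l (fun y => k y i j) x
      - (pd l (fun y => d y i) x / d x i * k x i j + pd i (fun y => d y l) x / d x l * k x l j
          - if l = i then ∑ m, pd m (fun y => d y l) x / d x m * k x m j else 0) / 2
      - (pd l (fun y => d y j) x / d x j * k x i j + pd j (fun y => d y l) x / d x l * k x i l
          - if l = j then ∑ m, pd m (fun y => d y l) x / d x m * k x i m else 0) / 2 := by
  have hpd : ∀ c a b, pd c (fun y => g y a b) x = if a = b then pd c (fun y => d y a) x else 0 := by
    intro c a b
    have : (fun y => g y a b) =ᶠ[𝓝 x] fun y => if a = b then d y a else 0 := by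
      filter_upwards [hg] with y hy
      rw [hy, Matrix.diagonal_apply]
    rw [pd_congr this]
    split_ifs
    · rfl
    · exact pd_const 0 x c
  have hΓ : ∀ (a : Fin 3) (v : Fin 3 → ℝ), ∑ m, christoffel g x m l a * v m
      = (pd l (fun y => d y a) x / d x a * v a + pd a (fun y => d y l) x / d x l * v l
          - if l = a then ∑ m, pd m (fun y => d y l) x / d x m * v m else 0) / 2 := by
    intro a v
    simp only [christoffel_diagonal hg.self_of_nhds hd, christoffelLower, hpd]
    fin_cases l <;> fin_cases a <;> simp [Fin.sum_univ_three] <;> ring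
  rw [covDeriv, hΓ i fun m => k x m j, hΓ j fun m => k x i m]

lemma pd_polar_eq {w : ℝ → ℝ} {u : ℝ → ℝ → ℝ} {x : E3} {w' u₁ u₂ : ℝ} (hw : HasDerivAt w w' (x 0))
    (hu : DifferentiableAt ℝ (fun z : ℝ × ℝ => u z.1 z.2) (x 1, x 2))
    (h₁ : HasDerivAt (fun s => u s (x 2)) u₁ (x 1)) (h₂ : HasDerivAt (u (x 1)) u₂ (x 2)) (i : Fin 3) :
    pd i (fun y => w (y 0) * u (y 1) (y 2)) x = ![w' * u (x 1) (x 2), w (x 0) * u₁, w (x 0) * u₂] i := by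
  rw [pd_polar hw.differentiableAt hu, hw.deriv, h₁.deriv, h₂.deriv]

lemma pd_fst_thd {w v : ℝ → ℝ} {x : E3} {w' v' : ℝ} (hw : HasDerivAt w w' (x 0)) (hv : HasDerivAt v v' (x 2))
    (i : Fin 3) : pd i (fun y => w (y 0) * v (y 2)) x = ![w' * v (x 2), 0, w (x 0) * v'] i := by
  rw [pd_polar_eq (u := fun _ y => v y) hw (hv.differentiableAt.comp (f := fun z : ℝ × ℝ => z.2) (x 1, x 2)
    differentiableAt_snd) (hasDerivAt_const _ _) hv, mul_zero]

lemma pd_fst {w : ℝ → ℝ} {x : E3} {w' : ℝ} (hw : HasDerivAt w w' (x 0)) (i : Fin 3) :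
    pd i (fun y => w (y 0)) x = ![w', 0, 0] i := by
  have := pd_fst_thd (v := fun _ => 1) hw (hasDerivAt_const (x 2) 1) i
  simpa using this

/-! ### The tubes -/

lemma metricAtEdge_eq (κ : ℝ) (x : E3) : SingularGerm.metricAtEdge κ x
    = diagonal ![1, sn κ (x 0) ^ 2, cs κ (x 0) ^ 2] := by
  ext i j
  fin_cases i <;> fin_cases j <;> simp [SingularGerm.metricAtEdge, tubeMetric]

lemma volDensity_metricAtEdge {κ : ℝ} {x : E3} (hs : 0 ≤ sn κ (x 0)) (hc : 0 ≤ cs κ (x 0)) :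
    volDensity (SingularGerm.metricAtEdge κ) x = sn κ (x 0) * cs κ (x 0) := by
  rw [volDensity, metricAtEdge_eq, Matrix.det_diagonal]
  simp only [Fin.prod_univ_three, cons_val_zero, cons_val_one, cons_val, one_mul]
  rw [← mul_pow, sqrt_sq (by positivity)]

lemma covDeriv_metricAtEdge {κ : ℝ} {x : E3} (hs : sn κ (x 0) ≠ 0) (hc : cs κ (x 0) ≠ 0) (k : TensorField)
    (l i j : Fin 3) : covDeriv (SingularGerm.metricAtEdge κ) k x l i j = pd l (fun y => k y i j) x
      - ((![0, 2 * cs κ (x 0) / sn κ (x 0), -2 * κ * sn κ (x 0) / cs κ (x 0)] i * if l = 0 then k x i j else 0)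
        + (![0, 2 * cs κ (x 0) / sn κ (x 0), -2 * κ * sn κ (x 0) / cs κ (x 0)] l * if i = 0 then k x l j else 0)
        - if l = i then ![0, 2 * sn κ (x 0) * cs κ (x 0), -2 * κ * sn κ (x 0) * cs κ (x 0)] l * k x 0 j else 0) / 2
      - ((![0, 2 * cs κ (x 0) / sn κ (x 0), -2 * κ * sn κ (x 0) / cs κ (x 0)] j * if l = 0 then k x i j else 0)
        + (![0, 2 * cs κ (x 0) / sn κ (x 0), -2 * κ * sn κ (x 0) / cs κ (x 0)] l * if j = 0 then k x i l else 0)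
        - if l = j then ![0, 2 * sn κ (x 0) * cs κ (x 0), -2 * κ * sn κ (x 0) * cs κ (x 0)] l * k x i 0 else 0) / 2 := by
  have hd : ∀ c a, pd c (fun y : E3 => (![1, sn κ (y 0) ^ 2, cs κ (y 0) ^ 2] : Fin 3 → ℝ) a) x
      = if c = 0 then ![0, 2 * sn κ (x 0) * cs κ (x 0), -2 * κ * sn κ (x 0) * cs κ (x 0)] a else 0 := by
    intro c a
    have h1 := pd_fst (x := x) ((hasDerivAt_sn κ (x 0)).fun_pow 2) c
    have h2 := pd_fst (x := x) ((hasDerivAt_cs κ (x 0)).fun_pow 2) c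
    fin_cases a
    · simp [pd_const]
    · refine h1.trans ?_
      fin_cases c <;> simp
    · refine h2.trans ?_
      fin_cases c <;> simp
      ring
  rw [covDeriv_diagonal (d := fun y => ![1, sn κ (y 0) ^ 2, cs κ (y 0) ^ 2])
    (Eventually.of_forall fun y => metricAtEdge_eq κ y) (by intro i; fin_cases i <;> simp [hs, hc])]
  simp only [hd]
  fin_cases l <;> fin_cases i <;> fin_cases j <;> simp [Fin.sum_univ_three] <;> field_simp <;> simp

namespace StandardDeformation

variable {V E : Type*} {S : SingularGerm V E} (D : StandardDeformation S)

lemma isOpen_tube (a b : ℝ) (e : E) : IsOpen (S.tube a b e) := by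
  have h2 : IsOpen (S.tubeRange a e) := by
    by_cases h : S.ends e = none
    · simp [SingularGerm.tubeRange, h]
    · simp only [SingularGerm.tubeRange, h, false_or]
      exact isOpen_Ioo
  exact (isOpen_Ioo.preimage (continuous_coord 0)).inter (h2.preimage (contDiff_coord 2 (n := 0)).continuous)

/-- If the cone angle varies, then the covariant derivative of every representing tensor grows like the
inverse distance to the edge. -/
lemma cdot_eq_zero_of_covDerivL2On {κ a b : ℝ} (hab : S.IsTubular κ a b) {e : E} {k : TensorField}
    (hk : ∀ x ∈ S.tube a b e, k x = D.derivAtEdge κ e x)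
    (h : CovDerivL2On (SingularGerm.metricAtEdge κ) k (S.tubeDomain a b e)) : D.cdot e = 0 := by
  by_contra hc0
  have hb := hab.b_pos
  set φ : ℝ → ℝ := fun ρ => 4 * D.cdot e ^ 2 * cs κ ρ ^ 3 / sn κ ρ with hφ
  have hpos : ∀ ρ ∈ Ioo 0 b, 0 < sn κ ρ ∧ 0 < cs κ ρ := fun ρ hρ =>
    ⟨sn_pos hρ.1 (hab.inRange_b.mono hρ.1.le hρ.2.le), cs_pos (hab.inRange_b.mono hρ.1.le hρ.2.le)⟩
  have hset : S.tubeDomain a b e = {x | x 0 ∈ Ioo 0 b ∧ x 1 ∈ Ioo 0 (S.angle e) ∧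
      x 2 ∈ S.tubeRange a e ∩ Ioo 0 (S.length e)} := by
    ext x
    simp only [SingularGerm.tubeDomain, SingularGerm.tube, mem_ofPred_eq, mem_inter_iff]
    tauto
  have hlow : ∀ x ∈ S.tubeDomain a b e, φ (x 0) ≤ normSqCovDeriv (SingularGerm.metricAtEdge κ) k x
      * volDensity (SingularGerm.metricAtEdge κ) x := by
    intro x hx
    obtain ⟨hs, hc⟩ := hpos _ hx.1.1
    have hd : ∀ i, (![1, sn κ (x 0) ^ 2, cs κ (x 0) ^ 2] : Fin 3 → ℝ) i ≠ 0 := by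
      intro i; fin_cases i <;> simp [hs.ne', hc.ne']
    have hd' : ∀ i, 0 ≤ (![1, sn κ (x 0) ^ 2, cs κ (x 0) ^ 2] : Fin 3 → ℝ) i := by
      intro i; fin_cases i <;> simp <;> positivity
    rw [volDensity_metricAtEdge hs.le hc.le, normSqCovDeriv_diagonal (metricAtEdge_eq κ x) hd]
    have hev : ∀ i j, (fun y => k y i j) =ᶠ[𝓝 x] fun y => D.derivAtEdge κ e y i j := fun i j => by
      filter_upwards [(isOpen_tube a b e).mem_nhds hx.1] with y hy
      rw [hk y hy]
    have h1 : covDeriv (SingularGerm.metricAtEdge κ) k x 1 0 1 = -2 * D.cdot e * sn κ (x 0) * cs κ (x 0) := by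
      rw [covDeriv_metricAtEdge hs.ne' hc.ne', pd_congr (hev 0 1), hk x hx.1]
      simp only [D.derivAtEdge_eq]
      simp [pd_const]
      field_simp
    set F : Fin 3 → Fin 3 → Fin 3 → ℝ := fun l i j => covDeriv (SingularGerm.metricAtEdge κ) k x l i j ^ 2 /
      (![1, sn κ (x 0) ^ 2, cs κ (x 0) ^ 2] l * ![1, sn κ (x 0) ^ 2, cs κ (x 0) ^ 2] i
        * ![1, sn κ (x 0) ^ 2, cs κ (x 0) ^ 2] j) with hF
    have hF0 : ∀ l i j, 0 ≤ F l i j := fun l i j =>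
      div_nonneg (sq_nonneg _) (mul_nonneg (mul_nonneg (hd' l) (hd' i)) (hd' j))
    have h2 : F 1 0 1 ≤ ∑ l, ∑ i, ∑ j, F l i j :=
      (Finset.single_le_sum (fun j _ => hF0 1 0 j) (Finset.mem_univ 1)).trans
        ((Finset.single_le_sum (f := fun i => ∑ j, F 1 i j) (fun i _ => Finset.sum_nonneg fun j _ => hF0 1 i j)
          (Finset.mem_univ 0)).trans
        (Finset.single_le_sum (f := fun l => ∑ i, ∑ j, F l i j)
          (fun l _ => Finset.sum_nonneg fun i _ => Finset.sum_nonneg fun j _ => hF0 l i j) (Finset.mem_univ 1)))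
    refine le_trans (le_of_eq ?_) (mul_le_mul_of_nonneg_right h2 (by positivity))
    simp only [hF, h1, hφ]
    simp
    field_simp
    ring
  have hne : volume (S.tubeRange a e ∩ Ioo 0 (S.length e)) ≠ 0 := by
    have hl := S.length_pos e
    by_cases hn : S.ends e = none
    · simp [SingularGerm.tubeRange, hn, hl]
    · have h1 := hab.a_le e hn
      have h2 := hab.a_pos
      refine ne_of_gt (lt_of_lt_of_le ?_ (measure_mono (show Ioo (a / 2) (S.length e - a / 2) ⊆ _ from fun y hy =>
        ⟨Or.inr hy, by linarith [hy.1], by linarith [hy.2]⟩)))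
      rw [volume_Ioo, ENNReal.ofReal_pos]
      linarith
  have hcont : ContinuousOn φ (Ioo 0 b) := by
    refine ((continuous_const.mul ((contDiff_cs κ (n := 0)).continuous.pow 3)).continuousOn).div
      (contDiff_sn κ (n := 0)).continuous.continuousOn fun ρ hρ => (hpos ρ hρ).1.ne'
  have hmeas : MeasurableSet (S.tubeDomain a b e) := by
    refine ((isOpen_tube a b e).inter ?_).measurableSet
    exact (isOpen_Ioo.preimage (contDiff_coord 1 (n := 0)).continuous).inter
      (isOpen_Ioo.preimage (contDiff_coord 2 (n := 0)).continuous)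
  have hint : IntegrableOn φ (Ioo 0 b) := by
    refine integrableOn_fst_of_box (B := Ioo 0 (S.angle e)) (C := S.tubeRange a e ∩ Ioo 0 (S.length e))
      (by simp [S.angle_pos e]) hne ?_
    rw [← hset]
    refine Integrable.mono' h ?_ ((ae_restrict_iff' hmeas).2 (Eventually.of_forall fun x hx => ?_))
    · exact (hcont.comp (continuous_coord 0).continuousOn fun x hx => hx.1.1).aestronglyMeasurable hmeas
    · obtain ⟨hs, hc⟩ := hpos _ hx.1.1
      rw [norm_of_nonneg (by simp only [hφ]; positivity)]
      exact hlow x hx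
  refine not_intervalIntegrable_of_sub_inv_isBigO_punctured (f := φ) (c := 0) ?_ hb.ne left_mem_uIcc
    ((intervalIntegrable_iff_integrableOn_Ioo_of_le hb.le).2 hint)
  have h1 : Tendsto (fun ρ => ρ⁻¹ * sn κ ρ) (𝓝[≠] 0) (𝓝 1) := by
    have := (hasDerivAt_iff_tendsto_slope.1 (hasDerivAt_sn κ 0))
    rw [cs_zero] at this
    refine this.congr fun ρ => ?_
    rw [slope_def_field, sn_zero, sub_zero, sub_zero, div_eq_inv_mul]
  have h2 : Tendsto (fun ρ => ρ⁻¹ * sn κ ρ / (4 * D.cdot e ^ 2 * cs κ ρ ^ 3)) (𝓝[≠] 0) (𝓝 (1 / (4 * D.cdot e ^ 2))) := by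
    refine h1.div ?_ (by positivity)
    have : ContinuousAt (fun ρ => 4 * D.cdot e ^ 2 * cs κ ρ ^ 3) 0 :=
      (continuous_const.mul ((contDiff_cs κ (n := 0)).continuous.pow 3)).continuousAt
    have h := this.tendsto
    rw [cs_zero, one_pow, mul_one] at h
    exact h.mono_left nhdsWithin_le_nhds
  have h3 : ∀ᶠ ρ in 𝓝[≠] (0 : ℝ), cs κ ρ ≠ 0 := by
    refine nhdsWithin_le_nhds ((contDiff_cs κ (n := 0)).continuous.continuousAt.eventually_ne ?_)
    rw [cs_zero]; exact one_ne_zero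
  refine Asymptotics.IsBigO.congr' ((h2.isBigO_one ℝ).mul (Asymptotics.isBigO_refl φ _)) ?_
    (Eventually.of_forall fun ρ => one_mul _)
  filter_upwards [h1.eventually_ne one_ne_zero, h3] with ρ hs hc
  have hs' : sn κ ρ ≠ 0 := right_ne_zero_of_mul hs
  simp only [hφ, sub_zero]
  field_simp

end StandardDeformation

namespace StandardDeformation

variable {V E : Type*} {S : SingularGerm V E} (D : StandardDeformation S)

lemma measurableSet_tubeDomain (a b : ℝ) (e : E) : MeasurableSet (S.tubeDomain a b e) := by
  refine ((isOpen_tube a b e).inter ?_).measurableSet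
  exact (isOpen_Ioo.preimage (contDiff_coord 1 (n := 0)).continuous).inter
    (isOpen_Ioo.preimage (contDiff_coord 2 (n := 0)).continuous)

lemma sn_cs_pos {κ a b : ℝ} (hab : S.IsTubular κ a b) {ρ : ℝ} (hρ : ρ ∈ Ioo 0 b) : 0 < sn κ ρ ∧ 0 < cs κ ρ :=
  ⟨sn_pos hρ.1 (hab.inRange_b.mono hρ.1.le hρ.2.le), cs_pos (hab.inRange_b.mono hρ.1.le hρ.2.le)⟩

/-- An integrand on a tube which extends continuously to the closed tube is integrable. -/
lemma integrableOn_tubeDomain {κ a b : ℝ} (hab : S.IsTubular κ a b) (e : E) {f F : E3 → ℝ}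
    (hF : ContinuousOn F {x | cs κ (x 0) ≠ 0}) (h : ∀ x ∈ S.tubeDomain a b e, f x = F x) :
    IntegrableOn f (S.tubeDomain a b e) := by
  set K : Set E3 := {x | x 0 ∈ Icc 0 b ∧ x 1 ∈ Icc 0 (S.angle e) ∧ x 2 ∈ Icc 0 (S.length e)} with hK
  have hcl : IsClosed K := (isClosed_Icc.preimage (continuous_coord 0)).inter
    ((isClosed_Icc.preimage (contDiff_coord 1 (n := 0)).continuous).inter
    (isClosed_Icc.preimage (contDiff_coord 2 (n := 0)).continuous))
  have hbd : Bornology.IsBounded K := isBounded_iff_forall_norm_le.2 ⟨b + S.angle e + S.length e, fun x hx => by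
    refine (norm_le_sum_abs x).trans ?_
    rw [Fin.sum_univ_three, abs_of_nonneg hx.1.1, abs_of_nonneg hx.2.1.1, abs_of_nonneg hx.2.2.1]
    linarith [hx.1.2, hx.2.1.2, hx.2.2.2]⟩
  have hKc : IsCompact K := Metric.isCompact_of_isClosed_isBounded hcl hbd
  have h1 : IntegrableOn F K := by
    refine ContinuousOn.integrableOn_compact hKc (hF.mono fun x hx => ?_)
    exact (cs_pos (hab.inRange_b.mono hx.1.1 hx.1.2)).ne'
  refine (h1.mono_set (fun x hx => ?_)).congr_fun (fun x hx => (h x hx).symm) (measurableSet_tubeDomain a b e)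
  exact ⟨⟨hx.1.1.1.le, hx.1.1.2.le⟩, ⟨hx.2.1.1.le, hx.2.1.2.le⟩, hx.2.2.1.le, hx.2.2.2.le⟩

lemma l2On_derivAtEdge {κ a b : ℝ} (hab : S.IsTubular κ a b) (e : E) :
    L2On (SingularGerm.metricAtEdge κ) (D.derivAtEdge κ e) (S.tubeDomain a b e) := by
  refine integrableOn_tubeDomain hab e (F := fun x => sn κ (x 0) * cs κ (x 0) * ((2 * D.cdot e) ^ 2
    + 2 * (sn κ (x 0) * (D.tdot e * D.slope e (x 2)) / cs κ (x 0)) ^ 2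
    + (2 * D.ldot e * D.slope e (x 2)) ^ 2)) ?_ fun x hx => ?_
  · set T : Set E3 := {x | cs κ (x 0) ≠ 0}
    have h1 : ContinuousOn (fun x : E3 => sn κ (x 0)) T :=
      ((contDiff_sn κ (n := 0)).comp (contDiff_coord 0)).continuous.continuousOn
    have h2 : ContinuousOn (fun x : E3 => cs κ (x 0)) T :=
      ((contDiff_cs κ (n := 0)).comp (contDiff_coord 0)).continuous.continuousOn
    have h3 : ContinuousOn (fun x : E3 => D.slope e (x 2)) T :=
      ((D.contDiff_slope e).continuous.comp (contDiff_coord 2 (n := 0)).continuous).continuousOn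
    have h4 : ∀ x ∈ T, cs κ (x 0) ≠ 0 := fun x hx => hx
    exact (h1.mul h2).mul ((continuousOn_const.add (continuousOn_const.mul
      ((h1.mul (continuousOn_const.mul h3)).div h2 h4 |>.pow 2))).add ((continuousOn_const.mul h3).pow 2))
  · obtain ⟨hs, hc⟩ := sn_cs_pos hab hx.1.1
    rw [volDensity_metricAtEdge hs.le hc.le, normSqTensor_diagonal (metricAtEdge_eq κ x)
      (by intro i; fin_cases i <;> simp [hs.ne', hc.ne']), D.derivAtEdge_eq]
    simp [Fin.sum_univ_three]
    field_simp
    ring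

/-- For an infinitesimal deformation which fixes the cone angle of an edge, the covariant derivative is
bounded near the edge. -/
lemma covDerivL2On_derivAtEdge {κ a b : ℝ} (hab : S.IsTubular κ a b) {e : E} (h0 : D.cdot e = 0) :
    CovDerivL2On (SingularGerm.metricAtEdge κ) (D.derivAtEdge κ e) (S.tubeDomain a b e) := by
  have hsl := D.contDiff_slope e
  refine integrableOn_tubeDomain hab e (F := fun x => sn κ (x 0) * cs κ (x 0)
    * (2 * (D.tdot e * D.slope e (x 2) * (cs κ (x 0) + κ * sn κ (x 0) ^ 2 / cs κ (x 0)) / cs κ (x 0)) ^ 2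
      + 2 * (D.tdot e * D.slope e (x 2)) ^ 2
      + 2 * (κ * sn κ (x 0) ^ 2 * (D.tdot e * D.slope e (x 2)) / cs κ (x 0) / cs κ (x 0)) ^ 2
      + 2 * (κ * sn κ (x 0) * (2 * D.ldot e * D.slope e (x 2)) / cs κ (x 0)) ^ 2
      + 2 * (sn κ (x 0) * (D.tdot e * deriv (D.slope e) (x 2)) / cs κ (x 0) / cs κ (x 0)) ^ 2
      + (2 * D.ldot e * deriv (D.slope e) (x 2) / cs κ (x 0)) ^ 2)) ?_ fun x hx => ?_
  · set T : Set E3 := {x | cs κ (x 0) ≠ 0}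
    have h1 : ContinuousOn (fun x : E3 => sn κ (x 0)) T :=
      ((contDiff_sn κ (n := 0)).comp (contDiff_coord 0)).continuous.continuousOn
    have h2 : ContinuousOn (fun x : E3 => cs κ (x 0)) T :=
      ((contDiff_cs κ (n := 0)).comp (contDiff_coord 0)).continuous.continuousOn
    have h3 : ContinuousOn (fun x : E3 => D.slope e (x 2)) T :=
      ((D.contDiff_slope e).continuous.comp (contDiff_coord 2 (n := 0)).continuous).continuousOn
    have h4 : ContinuousOn (fun x : E3 => deriv (D.slope e) (x 2)) T :=
      (((D.contDiff_slope e).continuous_deriv (by simp)).comp (contDiff_coord 2 (n := 0)).continuous).continuousOn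
    have h5 : ∀ x ∈ T, cs κ (x 0) ≠ 0 := fun x hx => hx
    have hp := (continuousOn_const (c := D.tdot e)).mul h3
    have hq := (continuousOn_const (c := 2 * D.ldot e)).mul h3
    have hκ := (continuousOn_const (c := κ)).mul (h1.pow 2)
    have h2' : ∀ {u : E3 → ℝ}, ContinuousOn u T → ContinuousOn (fun x => 2 * u x ^ 2) T := fun hu =>
      continuousOn_const.mul (hu.pow 2)
    exact (h1.mul h2).mul ((((((h2' ((hp.mul (h2.add (hκ.div h2 h5))).div h2 h5)).add (h2' hp)).add
      (h2' (((hκ.mul hp).div h2 h5).div h2 h5))).add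
      (h2' (((continuousOn_const.mul h1).mul hq).div h2 h5))).add
      (h2' (((h1.mul (continuousOn_const.mul h4)).div h2 h5).div h2 h5))).add
      (((continuousOn_const.mul h4).div h2 h5).pow 2))
  · obtain ⟨hs, hc⟩ := sn_cs_pos hab hx.1.1
    rw [volDensity_metricAtEdge hs.le hc.le, normSqCovDeriv_diagonal (metricAtEdge_eq κ x)
      (by intro i; fin_cases i <;> simp [hs.ne', hc.ne'])]
    have hsd : HasDerivAt (D.slope e) (deriv (D.slope e) (x 2)) (x 2) :=
      (hsl.differentiable (by simp)).differentiableAt.hasDerivAt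
    have h1 : ∀ l, pd l (fun y => sn κ (y 0) ^ 2 * (D.tdot e * D.slope e (y 2))) x
        = ![2 * sn κ (x 0) * cs κ (x 0) * (D.tdot e * D.slope e (x 2)), 0,
          sn κ (x 0) ^ 2 * (D.tdot e * deriv (D.slope e) (x 2))] l := fun l => by
      have := pd_fst_thd (x := x) ((hasDerivAt_sn κ (x 0)).fun_pow 2) (hsd.const_mul (D.tdot e)) l
      simpa using this
    have h2 : ∀ l, pd l (fun y => cs κ (y 0) ^ 2 * (2 * D.ldot e * D.slope e (y 2))) x
        = ![-2 * κ * sn κ (x 0) * cs κ (x 0) * (2 * D.ldot e * D.slope e (x 2)), 0,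
          cs κ (x 0) ^ 2 * (2 * D.ldot e * deriv (D.slope e) (x 2))] l := fun l => by
      have := pd_fst_thd (x := x) ((hasDerivAt_cs κ (x 0)).fun_pow 2) (hsd.const_mul (2 * D.ldot e)) l
      rw [this]
      fin_cases l <;> norm_num
      ring_nf
      simp
    simp only [covDeriv_metricAtEdge hs.ne' hc.ne', D.derivAtEdge_eq, h0]
    simp [Fin.sum_univ_three, h1, h2, pd_const]
    field_simp
    ring

end StandardDeformation

/-! ### The cones -/

lemma integrableOn_ball_inv_sq (C a : ℝ) : IntegrableOn (fun x : E3 => C / ‖x‖ ^ 2) (Metric.ball 0 a) := by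
  refine (integrableOn_fun_norm_addHaar (volume : Measure E3) (f := fun r => C / r ^ 2) (r := a)).2 ?_
  have h : IntegrableOn (fun _ : ℝ => C) (Ioo 0 a) := integrableOn_const (hs := by simp)
  refine h.congr_fun (fun r hr => ?_) measurableSet_Ioo
  have := hr.1.ne'
  simp
  field_simp

namespace SingularGerm

variable {V E : Type*} (S : SingularGerm V E)

lemma measurable_dir : Measurable dir := by
  unfold dir
  fun_prop

/-- The polar coordinates are injective on a fundamental domain for the angle. -/
lemma integrableOn_sector {a : ℝ} {p : V} {η : E × Bool} (hη : η ∈ S.endsAt p) {f : E3 → ℝ}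
    (hf : ContinuousOn f (S.cone a p)) {σ C : ℝ} (hσ : σ < S.s₀)
    (h : ∀ x : E3, x 0 ∈ Ioo 0 a → x 1 ∈ Ioo 0 σ →
      |(jac (radialMap (S.P η)) x).det| * |f (radialMap (S.P η) x)| ≤ C) :
    IntegrableOn f (radialMap (S.P η) '' {x | x 0 ∈ Ioo 0 a ∧ x 1 ∈ Ioo 0 σ ∧ x 2 ∈ Ico 0 (S.angle η.1)}) := by
  set B : Set E3 := {x | x 0 ∈ Ioo 0 a ∧ x 1 ∈ Ioo 0 σ ∧ x 2 ∈ Ico 0 (S.angle η.1)} with hB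
  have hm : ∀ i : Fin 3, Measurable fun x : E3 => x i := fun i => (contDiff_coord i (n := 0)).continuous.measurable
  have hBm : MeasurableSet B :=
    ((hm 0) measurableSet_Ioo).inter (((hm 1) measurableSet_Ioo).inter ((hm 2) measurableSet_Ico))
  have hs : ∀ x ∈ B, x 1 ∈ Ioo 0 S.s₀ := fun x hx => ⟨hx.2.1.1, hx.2.1.2.trans hσ⟩
  have hP := isConePolar hη
  have hd : ∀ x ∈ B, ContDiffAt ℝ ∞ (radialMap (S.P η)) x := fun x hx => hP.contDiffAt_radialMap (hs x hx)
  have hinj : InjOn (radialMap (S.P η)) B := by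
    intro x hx y hy he
    have h0 : x 0 = y 0 := by
      rw [← norm_radialMap hη hx.1.1.le (hs x hx), he, norm_radialMap hη hy.1.1.le (hs y hy)]
    have he' : S.P η (x 1) (x 2) = S.P η (y 1) (y 2) := by
      simp only [radialMap, h0] at he
      exact smul_right_injective _ hy.1.1.ne' he
    obtain ⟨h1, n, hn⟩ := hP.injective _ (hs x hx) _ (hs y hy) _ _ he'
    have hα := S.angle_pos η.1
    have hn0 : n = 0 := by
      have h3 := hx.2.2
      have h4 := hy.2.2
      rw [hn] at h4
      have h5 : (n : ℝ) * S.angle η.1 < 1 * S.angle η.1 := by linarith [h4.2, h3.1]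
      have h6 : (-1) * S.angle η.1 < (n : ℝ) * S.angle η.1 := by linarith [h4.1, h3.2]
      have h7 : (n : ℝ) < 1 := lt_of_mul_lt_mul_right h5 hα.le
      have h8 : (-1 : ℝ) < n := lt_of_mul_lt_mul_right h6 hα.le
      have h9 : n < 1 := by exact_mod_cast h7
      have h10 : -1 < n := by exact_mod_cast h8
      omega
    ext i
    fin_cases i
    · exact h0
    · exact h1
    · simpa [hn0] using hn.symm
  rw [integrableOn_image_iff_integrableOn_abs_det_fderiv_smul volume hBm
    (fun x hx => ((hd x hx).differentiableAt (by simp)).hasFDerivAt.hasFDerivWithinAt) hinj]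
  refine integrableOn_of_bounded_continuousOn hBm (M := |a| + σ + S.angle η.1) (C := C) (fun x hx i => ?_) ?_
    fun x hx => ?_
  · have h1 := hx.1; have h2 := hx.2.1; have h3 := hx.2.2
    have := le_abs_self a; have := S.angle_pos η.1; have := h2.1.trans h2.2; have := abs_nonneg a
    fin_cases i
    · show |x 0| ≤ _
      exact abs_le.2 ⟨by linarith [h1.1], by linarith [h1.2]⟩
    · show |x 1| ≤ _
      exact abs_le.2 ⟨by linarith [h2.1], by linarith [h2.2]⟩
    · show |x 2| ≤ _
      exact abs_le.2 ⟨by linarith [h3.1], by linarith [h3.2]⟩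
  · have hdet : ContinuousOn (fun x => |(fderiv ℝ (radialMap (S.P η)) x).det|) B := fun x hx =>
      (ContinuousLinearMap.continuous_det.continuousAt.comp
        ((hd x hx).fderiv_right (m := 0) (by simp)).continuousAt).abs.continuousWithinAt
    exact hdet.smul (hf.comp (fun x hx => (hd x hx).continuousAt.continuousWithinAt) fun x hx =>
      ⟨radialMap_mem_puncturedCone hη hx.1.1 (hs x hx), by
        rw [norm_radialMap hη hx.1.1.le (hs x hx)]; exact hx.1.2⟩)
  · rw [det_fderiv_eq, smul_eq_mul, abs_mul, abs_abs]
    exact h x hx.1 hx.2.1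

/-- A function on a cone is integrable if its product with the Jacobian of polar coordinates is bounded near
the edges and if it is `O(r⁻²)` away from the edges. -/
lemma integrableOn_cone [Finite E] {a : ℝ} {p : V} {f : E3 → ℝ} (hf : ContinuousOn f (S.cone a p))
    (h1 : ∀ η ∈ S.endsAt p, ∃ σ ∈ Ioo 0 S.s₀, ∃ C, ∀ x : E3, x 0 ∈ Ioo 0 a → x 1 ∈ Ioo 0 σ →
      |(jac (radialMap (S.P η)) x).det| * |f (radialMap (S.P η) x)| ≤ C)
    (h2 : ∀ K : Set E3, IsCompact K → K ⊆ {ξ | ‖ξ‖ = 1} ∩ puncturedCone (S.endsAt p) S.q →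
      ∃ C, ∀ r ∈ Ioo 0 a, ∀ ξ ∈ K, |f (r • ξ)| ≤ C / r ^ 2) : IntegrableOn f (S.cone a p) := by
  choose! σ hσ C hC using h1
  have hsm : ∀ η ∈ S.endsAt p, ∃ δ > 0, ∀ ξ : E3, ‖ξ‖ = 1 → ξ ≠ S.q η → ‖ξ - S.q η‖ < δ →
      ∃ s ∈ Ioo 0 (σ η), ∃ θ, S.P η s θ = ξ := fun η hη =>
    (isConePolar hη).exists_small S.s₀_le (S.angle_pos _) hη (S.norm_q η) (hσ η hη)
  choose! δ hδ hδ' using hsm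
  set U : Set E3 := ⋃ η ∈ S.endsAt p, IsConePolar.sector (S.P η) (Ioo 0 (σ η)) ∪ Metric.ball (S.q η) (δ η) with hU
  have hUo : IsOpen U := isOpen_biUnion fun η hη => ((isConePolar hη).isOpen_sector S.s₀_le isOpen_Ioo
    (Ioo_subset_Ioo_right (hσ η hη).2.le)).union Metric.isOpen_ball
  set K : Set E3 := Metric.sphere 0 1 \ U with hK
  have hKc : IsCompact K := (isCompact_sphere 0 1).diff hUo
  have hK1 : ∀ ξ ∈ K, ‖ξ‖ = 1 := fun ξ hξ => by simpa using hξ.1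
  have hKs : K ⊆ {ξ | ‖ξ‖ = 1} ∩ puncturedCone (S.endsAt p) S.q := by
    intro ξ hξ
    have hn := hK1 ξ hξ
    refine ⟨hn, fun h0 => by simp [h0] at hn, fun η hη he => hξ.2 ?_⟩
    rw [dir_of_norm_eq_one hn] at he
    refine mem_biUnion hη (Or.inr ?_)
    rw [he]
    exact Metric.mem_ball_self (hδ η hη)
  obtain ⟨C', hC'⟩ := h2 K hKc hKs
  have hcov : S.cone a p ⊆ (⋃ η ∈ S.endsAt p, radialMap (S.P η) ''
      {x | x 0 ∈ Ioo 0 a ∧ x 1 ∈ Ioo 0 (σ η) ∧ x 2 ∈ Ico 0 (S.angle η.1)}) ∪ (S.cone a p ∩ dir ⁻¹' K) := by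
    intro x hx
    by_cases hxK : dir x ∈ K
    · exact Or.inr ⟨hx, hxK⟩
    · have hd := norm_dir hx.1.1
      have hxU : dir x ∈ U := by
        by_contra h
        exact hxK ⟨by simpa using hd, h⟩
      obtain ⟨η, hη, h⟩ := mem_iUnion₂.1 hxU
      refine Or.inl (mem_biUnion hη ?_)
      obtain ⟨s, hs, θ, hθ⟩ : ∃ s ∈ Ioo 0 (σ η), ∃ θ, S.P η s θ = dir x := by
        rcases h with ⟨-, s, hs, θ, h⟩ | h
        · exact ⟨s, hs, θ, by rw [← h, dir_of_norm_eq_one hd]⟩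
        · exact hδ' η hη _ hd (hx.1.2 η hη) (by simpa [dist_eq_norm] using h)
      obtain ⟨θ', hθ', h⟩ := (isConePolar hη).exists_mem_Ico (S.angle_pos _) (Ioo_subset_Ioo_right (hσ η hη).2.le hs) θ
      refine ⟨!₂[‖x‖, s, θ'], ⟨⟨by simpa using hx.1.1, by simpa using hx.2⟩, hs, hθ'⟩, ?_⟩
      simp [radialMap, h, hθ, norm_smul_dir]
  have hi : IntegrableOn f (S.cone a p ∩ dir ⁻¹' K) := by
    have hm : MeasurableSet (S.cone a p ∩ dir ⁻¹' K) :=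
      (isOpen_cone a p).measurableSet.inter (measurable_dir hKc.isClosed.measurableSet)
    refine Integrable.mono' ((integrableOn_ball_inv_sq C' a).mono_set fun x hx => by simpa using hx.1.2)
      ((hf.mono inter_subset_left).aestronglyMeasurable hm)
      ((ae_restrict_iff' hm).2 (Eventually.of_forall fun x hx => ?_))
    have := hC' ‖x‖ ⟨norm_pos_iff.2 hx.1.1.1, hx.1.2⟩ (dir x) hx.2
    rwa [norm_smul_dir] at this
  refine IntegrableOn.mono_set ?_ hcov
  refine IntegrableOn.union ?_ hi
  refine (integrableOn_finite_biUnion (toFinite _)).2 fun η hη => ?_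
  exact S.integrableOn_sector hη hf (hσ η hη).2 (hC η hη)

end SingularGerm

/-! ### Behaviour at the vertices, away from the edges -/

lemma pd_comp_smul (r : ℝ) (u : E3 → ℝ) (x : E3) (l : Fin 3) : pd l (fun y => u (r • y)) x = r * pd l u (r • x) := by
  simp [pd, fderiv_comp_smul]

lemma covDeriv_comp_smul (r : ℝ) (g k : TensorField) (x : E3) (l i j : Fin 3) :
    covDeriv (fun y => g (r • y)) (fun y => k (r • y)) x l i j = r * covDeriv g k (r • x) l i j := by
  have hpd : ∀ (u : TensorField) (l n i : Fin 3), pd l (fun y => u (r • y) n i) x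
      = r * pd l (fun y => u y n i) (r • x) := fun u l n i => pd_comp_smul r (fun y => u y n i) x l
  have hΓ : ∀ m l i, christoffel (fun y => g (r • y)) x m l i = r * christoffel g (r • x) m l i := by
    intro m l i
    simp only [christoffel, hpd, mul_sum]
    exact sum_congr rfl fun n _ => by ring
  simp only [covDeriv, hΓ, hpd, mul_sub, mul_sum, mul_assoc]

lemma normSqCovDeriv_comp_smul (r : ℝ) (g k : TensorField) (x : E3) :
    normSqCovDeriv (fun y => g (r • y)) (fun y => k (r • y)) x = r ^ 2 * normSqCovDeriv g k (r • x) := by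
  simp only [normSqCovDeriv, covDeriv_comp_smul, mul_sum]
  refine sum_congr rfl fun l _ => sum_congr rfl fun i _ => sum_congr rfl fun j _ =>
    sum_congr rfl fun l' _ => sum_congr rfl fun i' _ => sum_congr rfl fun j' _ => ?_
  ring

section Continuity

variable {Y : Type*} [NormedAddCommGroup Y] [NormedSpace ℝ Y] {g k : Y → TensorField} {z : Y × E3}

lemma continuousAt_pd_param {f : Y × E3 → ℝ} (hf : ContDiffAt ℝ 1 f z) (l : Fin 3) :
    ContinuousAt (fun w : Y × E3 => pd l (fun x => f (w.1, x)) w.2) z := by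
  have := ContDiffAt.fderiv (m := 0) (n := 1) (x₀ := z) (f := fun (w : Y × E3) x => f (w.1, x)) (g := fun w => w.2) (by
      show ContDiffAt ℝ 1 (fun v : (Y × E3) × E3 => f (v.1.1, v.2)) (z, z.2)
      exact ContDiffAt.comp (f := fun v : (Y × E3) × E3 => (v.1.1, v.2)) (z, z.2) hf (by fun_prop)) (by fun_prop) (by norm_num)
  exact this.continuousAt.clm_apply continuousAt_const

lemma continuousAt_inv_apply {X : Type*} [TopologicalSpace X] {A : X → Matrix (Fin 3) (Fin 3) ℝ} {x : X}
    (hA : ∀ i j, ContinuousAt (fun y => A y i j) x) (h0 : (A x).det ≠ 0) (i j : Fin 3) :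
    ContinuousAt (fun y => (A y)⁻¹ i j) x := by
  have hA' : ContinuousAt A x := continuousAt_pi.2 fun i => continuousAt_pi.2 fun j => hA i j
  simp only [Matrix.inv_def, Matrix.smul_apply, Ring.inverse_eq_inv', smul_eq_mul]
  have h1 : ContinuousAt (fun y => (A y).det) x := (continuous_id.matrix_det).continuousAt.comp hA'
  have h2 : ContinuousAt (fun y => (A y).adjugate i j) x :=
    ((continuous_id.matrix_adjugate).matrix_elem i j).continuousAt.comp hA'
  exact (h1.inv₀ h0).mul h2

variable (hg : ∀ i j, ContDiffAt ℝ 1 (fun w : Y × E3 => g w.1 w.2 i j) z)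
  (hk : ∀ i j, ContDiffAt ℝ 1 (fun w : Y × E3 => k w.1 w.2 i j) z) (h0 : (g z.1 z.2).det ≠ 0)
include hg

lemma continuousAt_volDensity_param : ContinuousAt (fun w : Y × E3 => volDensity (g w.1) w.2) z := by
  have hA' : ContinuousAt (fun w : Y × E3 => g w.1 w.2) z :=
    continuousAt_pi.2 fun i => continuousAt_pi.2 fun j => (hg i j).continuousAt
  have h1 : ContinuousAt (fun w : Y × E3 => (g w.1 w.2).det) z := (continuous_id.matrix_det).continuousAt.comp hA'
  exact h1.sqrt

include h0

lemma continuousAt_christoffel_param (m l i : Fin 3) :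
    ContinuousAt (fun w : Y × E3 => christoffel (g w.1) w.2 m l i) z := by
  unfold christoffel
  refine continuousAt_const.mul (tendsto_finsetSum _ fun n _ => ContinuousAt.mul
    (continuousAt_inv_apply (A := fun w : Y × E3 => g w.1 w.2) (fun i j => (hg i j).continuousAt) h0 m n) ?_)
  exact ((continuousAt_pd_param (hg n i) l).add (continuousAt_pd_param (hg n l) i)).sub
    (continuousAt_pd_param (hg l i) n)

include hk

lemma continuousAt_normSqTensor_param : ContinuousAt (fun w : Y × E3 => normSqTensor (g w.1) (k w.1) w.2) z := by
  unfold normSqTensor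
  have hi := fun i j => continuousAt_inv_apply (A := fun w : Y × E3 => g w.1 w.2) (fun i j => (hg i j).continuousAt)
    h0 i j
  refine tendsto_finsetSum _ fun i _ => tendsto_finsetSum _ fun j _ => tendsto_finsetSum _ fun i' _ =>
    tendsto_finsetSum _ fun j' _ => ?_
  exact (((hi i i').mul (hi j j')).mul (hk i j).continuousAt).mul (hk i' j').continuousAt

lemma continuousAt_normSqCovDeriv_param : ContinuousAt (fun w : Y × E3 => normSqCovDeriv (g w.1) (k w.1) w.2) z := by
  have hi := fun i j => continuousAt_inv_apply (A := fun w : Y × E3 => g w.1 w.2) (fun i j => (hg i j).continuousAt)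
    h0 i j
  have hc : ∀ l i j, ContinuousAt (fun w : Y × E3 => covDeriv (g w.1) (k w.1) w.2 l i j) z := fun l i j =>
    ((continuousAt_pd_param (hk i j) l).sub (tendsto_finsetSum _ fun m _ =>
      (continuousAt_christoffel_param hg h0 m l i).mul (hk m j).continuousAt)).sub (tendsto_finsetSum _ fun m _ =>
      (continuousAt_christoffel_param hg h0 m l j).mul (hk i m).continuousAt)
  unfold normSqCovDeriv
  refine tendsto_finsetSum _ fun l _ => tendsto_finsetSum _ fun i _ => tendsto_finsetSum _ fun j _ =>
    tendsto_finsetSum _ fun l' _ => tendsto_finsetSum _ fun i' _ => tendsto_finsetSum _ fun j' _ => ?_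
  exact ((((hi l l').mul (hi i i')).mul (hi j j')).mul (hc l i j)).mul (hc l' i' j')

end Continuity

/-- The tensor `k`, of which the coefficients in the coordinates `x = r ξ` are smooth functions of `r` and
`ξ` up to `r = 0`, near the unit sphere. The function `f` is a smooth continuation to negative `r`. -/
structure IsConical (O : Set E3) (k : TensorField) (δ : ℝ) (f : Fin 3 → Fin 3 → ℝ × E3 → ℝ) : Prop where
  pos : 0 < δ
  smooth : ∀ i j, ContDiffOn ℝ ∞ (fun x => k x i j) O
  smooth_ext : ∀ i j, ContDiffOn ℝ ∞ (f i j) (Ioo (-δ) δ ×ˢ (O ∩ {x | ‖x‖ < 2}))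
  eq : ∀ r ∈ Ioo 0 δ, ∀ x ∈ O, ‖x‖ < 2 → ∀ i j, k (r • x) i j = f i j (r, x)

namespace IsConical

variable {O : Set E3} {k g : TensorField} {δ δ' : ℝ} {f f' : Fin 3 → Fin 3 → ℝ × E3 → ℝ}

/-- The family of rescaled tensors, for all real scales. -/
noncomputable def rescaled (k : TensorField) (f : Fin 3 → Fin 3 → ℝ × E3 → ℝ) (r : ℝ) : TensorField := fun x =>
  if r ≤ 0 then Matrix.of fun i j => f i j (r, x) else k (r • x)

lemma rescaled_of_pos {r : ℝ} (hr : 0 < r) : rescaled k f r = fun x => k (r • x) := by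
  funext x
  simp [rescaled, hr.not_ge]

lemma contDiffAt_rescaled (h : IsConical O k δ f) (hO : IsOpen O) (hO' : ∀ r : ℝ, 0 < r → ∀ x ∈ O, r • x ∈ O) {r : ℝ}
    (hr : 0 ≤ r) {ξ : E3} (hξ : ξ ∈ O) (hn : ‖ξ‖ = 1) (i j : Fin 3) :
    ContDiffAt ℝ 1 (fun w : ℝ × E3 => rescaled k f w.1 w.2 i j) (r, ξ) := by
  have hon : IsOpen (O ∩ {x | ‖x‖ < 2}) := hO.inter (isOpen_lt continuous_norm continuous_const)
  rcases hr.eq_or_lt with rfl | hr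
  · have hm : (Ioo (-δ) δ ×ˢ (O ∩ {x | ‖x‖ < 2})) ∈ 𝓝 ((0 : ℝ), ξ) :=
      (isOpen_Ioo.prod hon).mem_nhds ⟨⟨by linarith [h.pos], h.pos⟩, hξ, show ‖ξ‖ < 2 by rw [hn]; norm_num⟩
    refine (((h.smooth_ext i j).contDiffAt hm).of_le (by exact_mod_cast le_top)).congr_of_eventuallyEq ?_
    filter_upwards [hm] with w hw
    by_cases h0 : w.1 ≤ 0
    · simp [rescaled, h0]
    · simp only [rescaled, h0, if_false]
      exact h.eq _ ⟨not_le.1 h0, hw.1.2⟩ _ hw.2.1 hw.2.2 i j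
  · have h1 : ContDiffAt ℝ ∞ (fun w : ℝ × E3 => k (w.1 • w.2) i j) (r, ξ) :=
      ContDiffAt.comp (f := fun w : ℝ × E3 => w.1 • w.2) (r, ξ)
        ((h.smooth i j).contDiffAt (hO.mem_nhds (hO' r hr ξ hξ))) (by fun_prop)
    refine (h1.of_le (by exact_mod_cast le_top)).congr_of_eventuallyEq ?_
    filter_upwards [continuous_fst.continuousAt.eventually (lt_mem_nhds hr)] with w hw
    rw [rescaled_of_pos hw]

/-- For conical tensors, `|k|²` is bounded and `|∇k|²` is `O(r⁻²)`, uniformly in compact sets of directions. -/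
lemma exists_bound (hg : IsConical O g δ f) (hk : IsConical O k δ' f') (hO : IsOpen O)
    (hO' : ∀ r : ℝ, 0 < r → ∀ x ∈ O, r • x ∈ O) {a : ℝ} (ha : 0 < a) {K : Set E3} (hK : IsCompact K)
    (hKO : K ⊆ {ξ | ‖ξ‖ = 1} ∩ O) (h0 : ∀ ξ ∈ K, (Matrix.of fun i j => f i j (0, ξ)).det ≠ 0)
    (h1 : ∀ r ∈ Ioc 0 a, ∀ ξ ∈ K, (g (r • ξ)).det ≠ 0) :
    ∃ C, ∀ r ∈ Ioo 0 a, ∀ ξ ∈ K, |normSqTensor g k (r • ξ) * volDensity g (r • ξ)| ≤ C / r ^ 2 ∧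
      |normSqCovDeriv g k (r • ξ) * volDensity g (r • ξ)| ≤ C / r ^ 2 := by
  have hdet : ∀ r ∈ Icc 0 a, ∀ ξ ∈ K, (rescaled g f r ξ).det ≠ 0 := by
    intro r hr ξ hξ
    rcases hr.1.eq_or_lt with rfl | h
    · simpa [rescaled] using h0 ξ hξ
    · rw [rescaled_of_pos h]; exact h1 r ⟨h, hr.2⟩ ξ hξ
  have hgs := fun r (hr : r ∈ Icc 0 a) ξ (hξ : ξ ∈ K) => hg.contDiffAt_rescaled hO hO' hr.1 (hKO hξ).2 (hKO hξ).1
  have hks := fun r (hr : r ∈ Icc 0 a) ξ (hξ : ξ ∈ K) => hk.contDiffAt_rescaled hO hO' hr.1 (hKO hξ).2 (hKO hξ).1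
  have hc := (isCompact_Icc (a := (0 : ℝ)) (b := a)).prod hK
  obtain ⟨C₁, hC₁⟩ := hc.exists_bound_of_continuousOn
    (f := fun w => normSqTensor (rescaled g f w.1) (rescaled k f' w.1) w.2 * volDensity (rescaled g f w.1) w.2)
    fun w hw => ((continuousAt_normSqTensor_param (hgs _ hw.1 _ hw.2) (hks _ hw.1 _ hw.2) (hdet _ hw.1 _ hw.2)).mul
      (continuousAt_volDensity_param (hgs _ hw.1 _ hw.2))).continuousWithinAt
  obtain ⟨C₂, hC₂⟩ := hc.exists_bound_of_continuousOn
    (f := fun w => normSqCovDeriv (rescaled g f w.1) (rescaled k f' w.1) w.2 * volDensity (rescaled g f w.1) w.2)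
    fun w hw => ((continuousAt_normSqCovDeriv_param (hgs _ hw.1 _ hw.2) (hks _ hw.1 _ hw.2) (hdet _ hw.1 _ hw.2)).mul
      (continuousAt_volDensity_param (hgs _ hw.1 _ hw.2))).continuousWithinAt
  refine ⟨|C₁| * a ^ 2 + |C₂|, fun r hr ξ hξ => ?_⟩
  have hm : (r, ξ) ∈ Icc 0 a ×ˢ K := ⟨⟨hr.1.le, hr.2.le⟩, hξ⟩
  have e₁ := hC₁ _ hm
  have e₂ := hC₂ _ hm
  simp only [rescaled_of_pos hr.1, norm_eq_abs, normSqCovDeriv_comp_smul] at e₁ e₂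
  have hr2 : 0 < r ^ 2 := pow_pos hr.1 2
  rw [le_div_iff₀ hr2, le_div_iff₀ hr2]
  constructor
  · calc _ ≤ C₁ * r ^ 2 := mul_le_mul_of_nonneg_right e₁ hr2.le
      _ ≤ |C₁| * a ^ 2 := mul_le_mul (le_abs_self _) (pow_le_pow_left₀ hr.1.le hr.2.le 2) hr2.le (abs_nonneg _)
      _ ≤ _ := le_add_of_nonneg_right (abs_nonneg _)
  · calc _ = |r ^ 2 * normSqCovDeriv g k (r • ξ) * volDensity g (r • ξ)| := by
          rw [mul_assoc (r ^ 2), abs_mul (r ^ 2), abs_of_pos hr2, mul_comm]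
      _ ≤ |C₂| := e₂.trans (le_abs_self _)
      _ ≤ _ := le_add_of_nonneg_left (by positivity)

end IsConical

/-- The eigenvalues of `A` are `1` and twice `c`. -/
lemma det_ne_zero_of_cone {n : E3} (hn : ‖n‖ = 1) {c : ℝ} (hc : c ≠ 0) {A : Matrix (Fin 3) (Fin 3) ℝ}
    (hA : ∀ i j, A i j = n i * n j + c * ((if i = j then 1 else 0) - n i * n j)) : A.det ≠ 0 := by
  have h1 : n 0 ^ 2 + n 1 ^ 2 + n 2 ^ 2 = 1 := by
    have := EuclideanSpace.real_norm_sq_eq n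
    rw [hn, Fin.sum_univ_three] at this
    linarith
  have : A.det = c ^ 2 := by
    rw [Matrix.det_fin_three]
    simp only [hA]
    simp
    linear_combination c ^ 2 * (1 - c) * h1
  rw [this]
  exact pow_ne_zero 2 hc

lemma det_coneMetric_ne_zero {κ : ℝ} {φ : E3 → ℝ} {x : E3} (hx : x ≠ 0) (hs : 0 < sn κ ‖x‖) :
    (coneMetric κ φ id x).det ≠ 0 := by
  have := norm_pos_iff.2 hx
  exact det_ne_zero_of_cone (norm_dir hx) (c := sn κ ‖x‖ ^ 2 * exp (2 * φ (dir x)) / ‖x‖ ^ 2) (by positivity)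
    fun i j => coneMetric_id κ φ hx i j

namespace StandardDeformation

variable {V E : Type*} {S : SingularGerm V E} (D : StandardDeformation S)

/-- Near the vertex, the metric and the representing tensor are conical; for larger radii, they are bounded by
compactness. -/
lemma exists_bound_away_edges [Finite E] {κ a b : ℝ} (hab : S.IsTubular κ a b) (p : V) {K : Set E3} (hK : IsCompact K)
    (hKO : K ⊆ {ξ | ‖ξ‖ = 1} ∩ puncturedCone (S.endsAt p) S.q) :
    ∃ C, ∀ r ∈ Ioo 0 a, ∀ ξ ∈ K,
      |normSqTensor (S.metricAtVertex κ p) ((D.representative κ a b).onCone p) (r • ξ)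
        * volDensity (S.metricAtVertex κ p) (r • ξ)| ≤ C / r ^ 2 ∧
      |normSqCovDeriv (S.metricAtVertex κ p) ((D.representative κ a b).onCone p) (r • ξ)
        * volDensity (S.metricAtVertex κ p) (r • ξ)| ≤ C / r ^ 2 := by
  have ha := hab.a_pos
  set O := puncturedCone (S.endsAt p) S.q with hO
  have hOo : IsOpen O := isOpen_puncturedCone _ _
  have hO' : ∀ r : ℝ, 0 < r → ∀ x ∈ O, r • x ∈ O := fun r hr x hx =>
    ⟨smul_ne_zero hr.ne' hx.1, fun η hη => by rw [dir_smul hr]; exact hx.2 η hη⟩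
  have hdO : ∀ x ∈ O, dir x ∈ O := fun x hx => hO' _ (inv_pos.2 (norm_pos_iff.2 hx.1)) x hx
  have hd : ContDiffOn ℝ ∞ dir O := fun w hw => (contDiffAt_dir hw.1).contDiffWithinAt
  have hdi : ∀ i : Fin 3, ContDiffOn ℝ ∞ (fun x => dir x i) O := fun i => (contDiff_coord i).comp_contDiffOn hd
  obtain ⟨ψ, hψ, hψ0, hψe⟩ := exists_smooth_sn_div κ
  have hφ : ContDiffOn ℝ ∞ (fun x => exp (2 * S.φ p (dir x))) O :=
    (contDiffOn_const.mul (S.link p).smooth_φ).exp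
  set O₂ := O ∩ {x | ‖x‖ < 2} with hO₂
  -- `sn r / r`, as a function of the scale and of the point
  have hψs : ∀ δ ≤ (1 / 2 : ℝ), ContDiffOn ℝ ∞ (fun z : ℝ × E3 => ψ (z.1 * ‖z.2‖) ^ 2) (Ioo (-δ) δ ×ˢ O₂) := by
    intro δ hδ
    refine (hψ.comp (f := fun z : ℝ × E3 => z.1 * ‖z.2‖) (contDiffOn_fst.mul fun z hz =>
      (contDiffAt_snd.norm ℝ hz.2.1.1).contDiffWithinAt) fun z hz => ?_).pow 2
    refine abs_lt.1 ?_
    rw [abs_mul, abs_norm]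
    have h1 : |z.1| < 1 / 2 := (abs_lt.2 hz.1).trans_le hδ
    have h2 : ‖z.2‖ < 2 := hz.2.2
    nlinarith [abs_nonneg z.1, norm_nonneg z.2]
  have hmem : ∀ {δ : ℝ}, δ ≤ 1 / 2 → ∀ r ∈ Ioo 0 δ, ∀ x ∈ O, ‖x‖ < 2 → r * ‖x‖ ∈ Ioo 0 1 := fun hδ r hr x hx h2 =>
    ⟨mul_pos hr.1 (norm_pos_iff.2 hx.1), by nlinarith [hr.1, hr.2, norm_nonneg x]⟩
  have hg : IsConical O (S.metricAtVertex κ p) (1 / 2) fun i j z => dir z.2 i * dir z.2 j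
      + ψ (z.1 * ‖z.2‖) ^ 2 * exp (2 * S.φ p (dir z.2)) * ((if i = j then 1 else 0) - dir z.2 i * dir z.2 j) := by
    refine ⟨by norm_num, SingularGerm.contDiffOn_metricAtVertex κ p, fun i j => ?_, fun r hr x hx h2 i j => ?_⟩
    · have hs : ∀ {u : E3 → ℝ}, ContDiffOn ℝ ∞ u O → ContDiffOn ℝ ∞ (fun z : ℝ × E3 => u z.2)
        (Ioo (-(1 / 2)) (1 / 2) ×ˢ O₂) := fun hu => hu.comp contDiffOn_snd fun z hz => hz.2.1
      have h3 := (hs (hdi i)).mul (hs (hdi j))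
      exact h3.add (((hψs _ le_rfl).mul (hs hφ)).mul (contDiffOn_const.sub h3))
    · rw [SingularGerm.metricAtVertex, coneMetric_id κ _ (hO' r hr.1 x hx).1, dir_smul hr.1, norm_smul,
        norm_of_nonneg hr.1.le, ← hψe _ (hmem le_rfl r hr x hx h2)]
      ring
  have hk : IsConical O ((D.representative κ a b).onCone p) (min (1 / 2) (a / 8)) fun i j z =>
      ψ (z.1 * ‖z.2‖) ^ 2 * D.derivAtVertex 0 p (dir z.2) i j := by
    refine ⟨by positivity, D.contDiffOn_representative hab p, fun i j => ?_, fun r hr x hx h2 i j => ?_⟩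
    · exact (hψs _ (min_le_left _ _)).mul (((D.contDiffOn_derivAtVertex 0 p i j).comp hd hdO).comp contDiffOn_snd
        fun z hz => hz.2.1)
    · have h3 : r < a / 8 := hr.2.trans_le (min_le_right _ _)
      have hx0 := norm_pos_iff.2 hx.1
      rw [D.representative_of_norm_lt ha (by rw [norm_smul, norm_of_nonneg hr.1.le]; nlinarith [hr.1]),
        ← hψe _ (hmem (min_le_left _ _) r hr x hx h2), ← D.derivAtVertex_smul κ p (hdO x hx) (norm_dir hx.1)
          (mul_pos hr.1 hx0), mul_smul, norm_smul_dir]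
  refine hg.exists_bound hk hOo hO' ha hK hKO (fun ξ hξ => ?_) fun r hr ξ hξ => ?_
  · exact det_ne_zero_of_cone (norm_dir (hKO hξ).2.1) (c := exp (2 * S.φ p (dir ξ))) (exp_pos _).ne'
      fun i j => by simp [hψ0]
  · have hr0 := hr.1
    have hs := sn_pos hr0 (hab.inRange_a.mono hr0.le hr.2)
    have hn : ‖r • ξ‖ = r := by rw [norm_smul, (hKO hξ).1, mul_one, norm_of_nonneg hr0.le]
    exact det_coneMetric_ne_zero (hO' r hr0 ξ (hKO hξ).2).1 (by rwa [hn])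

end StandardDeformation

/-! ### The covariant derivative near the edges, in the cones -/

lemma exists_bound_of_continuous {n : ℕ} {P : (Fin n → ℝ) → ℝ} (hP : Continuous P) (M : ℝ) :
    ∃ C, ∀ v : Fin n → ℝ, (∀ i, |v i| ≤ M) → |P v| ≤ C := by
  obtain ⟨C, hC⟩ := (isCompact_univ_pi fun _ : Fin n => isCompact_Icc (a := -M) (b := M)).exists_bound_of_continuousOn
    hP.continuousOn
  exact ⟨C, fun v hv => hC v fun i _ => abs_le.1 (hv i)⟩

/-- The components of the covariant derivative of the representing tensor of a deformation which preserves the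
cone angle, in the orthonormal frame of the polar coordinates `(r, s, θ)`, multiplied by `f = sn r`. Moreover
`c = cs r`, the cut-off function `w` has the derivatives `w₁`, `w₂`, and `u = -2 (1 - w)`, `S = sin s`, `C = cos s`; with the
holomorphic function `H` of the velocity, `x₀ + i y₀ = H`, `S (x₁ + i y₁) = coneDeriv H` and
`S (x₂ + i y₂) = coneDeriv (coneDeriv H)`. -/
noncomputable def edgeCovDeriv (f c u w₁ w₂ S C x₀ y₀ x₁ y₁ x₂ y₂ : ℝ) : Fin 3 → Matrix (Fin 3) (Fin 3) ℝ :=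
  let A := C * x₀ + S * x₁
  let B := u * A
  let Bs := u * (-S * x₀ + C * x₁ + x₂)
  let Bt := -u * (C * y₁ + y₂)
  let Q := f * (c * w₁ + f * w₂) * S
  let U := c * f * w₁ * S
  ![!![0, Q * x₀, Q * y₀; Q * x₀, 2 * f * w₁ * A, 0; Q * y₀, 0, 2 * f * w₁ * A],
    !![-2 * U * x₀, f * w₁ * A - c * B, f * w₁ * (C * y₀ + S * y₁);
      f * w₁ * A - c * B, Bs + 2 * U * x₀, U * y₀;
      f * w₁ * (C * y₀ + S * y₁), U * y₀, Bs],
    !![-2 * U * y₀, -f * w₁ * (S * y₁ + C * y₀), f * w₁ * (S * x₁ + C * x₀) - c * B;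
      -f * w₁ * (S * y₁ + C * y₀), Bt, U * x₀;
      f * w₁ * (S * x₁ + C * x₀) - c * B, U * x₀, Bt + 2 * U * y₀]]

lemma continuous_edgeCovDeriv (l i j : Fin 3) : Continuous fun v : Fin 13 → ℝ =>
    edgeCovDeriv (v 0) (v 1) (v 2) (v 3) (v 4) (v 5) (v 6) (v 7) (v 8) (v 9) (v 10) (v 11) (v 12) l i j := by
  fin_cases l <;> fin_cases i <;> fin_cases j <;> simp [edgeCovDeriv] <;> fun_prop

lemma radialMetric_polar (κ r s : ℝ) : radialMetric κ r 1 0 (sin s ^ 2)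
    = diagonal ![1, sn κ r ^ 2, sn κ r ^ 2 * sin s ^ 2] := by
  ext i j
  fin_cases i <;> fin_cases j <;> simp [radialMetric]

lemma volDensity_polar {g : TensorField} {x : E3} {κ : ℝ}
    (hg : g x = diagonal ![1, sn κ (x 0) ^ 2, sn κ (x 0) ^ 2 * sin (x 1) ^ 2])
    (hS : 0 ≤ sin (x 1)) : volDensity g x = sn κ (x 0) ^ 2 * sin (x 1) := by
  rw [volDensity, hg, Matrix.det_diagonal]
  simp only [Fin.prod_univ_three, cons_val_zero, cons_val_one, cons_val, one_mul]
  rw [show ∀ u v : ℝ, u ^ 2 * (u ^ 2 * v ^ 2) = (u ^ 2 * v) ^ 2 by intros; ring, sqrt_sq (by positivity)]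

section

variable {g k : TensorField} {x : E3} {κ : ℝ} {u wd : ℝ → ℝ} {X Y A : ℝ → ℝ → ℝ} {w₂ x₀ y₀ x₁ y₁ x₂ y₂ : ℝ}

/-- The covariant derivative of the representing tensor near an edge, in the polar coordinates. -/
lemma covDeriv_polar (hf : sn κ (x 0) ≠ 0) (hS : sin (x 1) ≠ 0)
    (hg : ∀ᶠ y in 𝓝 x, g y = diagonal ![1, sn κ (y 0) ^ 2, sn κ (y 0) ^ 2 * sin (y 1) ^ 2])
    (hk : ∀ᶠ y in 𝓝 x, k y = sn κ (y 0) ^ 2 • !![0, wd (y 0) * X (y 1) (y 2), sin (y 1) ^ 2 * (wd (y 0) * Y (y 1) (y 2));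
      wd (y 0) * X (y 1) (y 2), u (y 0) * A (y 1) (y 2), 0;
      sin (y 1) ^ 2 * (wd (y 0) * Y (y 1) (y 2)), 0, sin (y 1) ^ 2 * (u (y 0) * A (y 1) (y 2))])
    (hu : HasDerivAt u (2 * wd (x 0)) (x 0)) (hwd : HasDerivAt wd w₂ (x 0))
    (dX : DifferentiableAt ℝ (fun z : ℝ × ℝ => X z.1 z.2) (x 1, x 2))
    (dY : DifferentiableAt ℝ (fun z : ℝ × ℝ => Y z.1 z.2) (x 1, x 2))
    (dA : DifferentiableAt ℝ (fun z : ℝ × ℝ => A z.1 z.2) (x 1, x 2))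
    (eX : X (x 1) (x 2) = sin (x 1) * x₀) (eY : Y (x 1) (x 2) = y₀)
    (eA : A (x 1) (x 2) = cos (x 1) * x₀ + sin (x 1) * x₁)
    (Xs : HasDerivAt (fun s => X s (x 2)) (cos (x 1) * x₀ + sin (x 1) * x₁) (x 1))
    (Xt : HasDerivAt (X (x 1)) (-sin (x 1) ^ 2 * y₁) (x 2))
    (Ys : HasDerivAt (fun s => Y s (x 2)) y₁ (x 1)) (Yt : HasDerivAt (Y (x 1)) (sin (x 1) * x₁) (x 2))
    (As : HasDerivAt (fun s => A s (x 2)) (-sin (x 1) * x₀ + cos (x 1) * x₁ + x₂) (x 1))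
    (At : HasDerivAt (A (x 1)) (-sin (x 1) * (cos (x 1) * y₁ + y₂)) (x 2)) (l i j : Fin 3) :
    covDeriv g k x l i j = ![1, sn κ (x 0), sn κ (x 0) * sin (x 1)] l * ![1, sn κ (x 0), sn κ (x 0) * sin (x 1)] i
      * ![1, sn κ (x 0), sn κ (x 0) * sin (x 1)] j / sn κ (x 0)
      * edgeCovDeriv (sn κ (x 0)) (cs κ (x 0)) (u (x 0)) (wd (x 0)) w₂ (sin (x 1)) (cos (x 1))
        x₀ y₀ x₁ y₁ x₂ y₂ l i j := by
  have hsn := (hasDerivAt_sn κ (x 0)).fun_pow 2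
  have hsin := (hasDerivAt_sin (x 1)).fun_pow 2
  have dsin : DifferentiableAt ℝ (fun z : ℝ × ℝ => sin z.1 ^ 2) (x 1, x 2) := by fun_prop
  have d1 : ∀ c, pd c (fun y : E3 => sn κ (y 0) ^ 2) x = ![2 * sn κ (x 0) * cs κ (x 0), 0, 0] c := fun c => by
    rw [pd_fst hsn]; simp
  have d2 : ∀ c, pd c (fun y : E3 => sn κ (y 0) ^ 2 * sin (y 1) ^ 2) x
      = ![2 * sn κ (x 0) * cs κ (x 0) * sin (x 1) ^ 2, sn κ (x 0) ^ 2 * (2 * sin (x 1) * cos (x 1)), 0] c :=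
    fun c => by
      rw [pd_polar_eq (u := fun s _ => sin s ^ 2) hsn dsin hsin (hasDerivAt_const _ _)]; simp
  have hd : ∀ c a, pd c (fun y : E3 => (![1, sn κ (y 0) ^ 2, sn κ (y 0) ^ 2 * sin (y 1) ^ 2] : Fin 3 → ℝ) a) x
      = ![0, ![2 * sn κ (x 0) * cs κ (x 0), 0, 0] c, ![2 * sn κ (x 0) * cs κ (x 0) * sin (x 1) ^ 2,
        sn κ (x 0) ^ 2 * (2 * sin (x 1) * cos (x 1)), 0] c] a := by
    intro c a
    fin_cases a
    · exact pd_const _ _ _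
    · exact d1 c
    · exact d2 c
  have k1 : ∀ c, pd c (fun y : E3 => sn κ (y 0) ^ 2 * (wd (y 0) * X (y 1) (y 2))) x = _ := fun c => by
    have := pd_polar_eq (hsn.fun_mul hwd) dX Xs Xt c
    simp only [mul_assoc] at this ⊢
    exact this
  have k2 : ∀ c, pd c (fun y : E3 => sn κ (y 0) ^ 2 * (sin (y 1) ^ 2 * (wd (y 0) * Y (y 1) (y 2)))) x = _ := fun c => by
    have := pd_polar_eq (u := fun s θ => sin s ^ 2 * Y s θ) (hsn.fun_mul hwd) (dsin.fun_mul dY) (hsin.fun_mul Ys)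
      (Yt.const_mul _) c
    exact (congrArg (fun v => pd c v x) (funext fun y => by ring)).trans this
  have hw2 := hsn.fun_mul hu
  have k3 : ∀ c, pd c (fun y : E3 => sn κ (y 0) ^ 2 * (u (y 0) * A (y 1) (y 2))) x = _ := fun c => by
    have := pd_polar_eq hw2 dA As At c
    exact (congrArg (fun v => pd c v x) (funext fun y => by ring)).trans this
  have k4 : ∀ c, pd c (fun y : E3 => sn κ (y 0) ^ 2 * (sin (y 1) ^ 2 * (u (y 0) * A (y 1) (y 2)))) x = _ :=
    fun c => by
    have := pd_polar_eq (u := fun s θ => sin s ^ 2 * A s θ) hw2 (dsin.fun_mul dA) (hsin.fun_mul As) (At.const_mul _) c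
    exact (congrArg (fun v => pd c v x) (funext fun y => by ring)).trans this
  have hkx := hk.self_of_nhds
  have hpk : ∀ c i j, pd c (fun y => k y i j) x = pd c (fun y => (sn κ (y 0) ^ 2 •
      !![0, wd (y 0) * X (y 1) (y 2), sin (y 1) ^ 2 * (wd (y 0) * Y (y 1) (y 2));
      wd (y 0) * X (y 1) (y 2), u (y 0) * A (y 1) (y 2), 0;
      sin (y 1) ^ 2 * (wd (y 0) * Y (y 1) (y 2)), 0, sin (y 1) ^ 2 * (u (y 0) * A (y 1) (y 2))]
        : Matrix (Fin 3) (Fin 3) ℝ) i j) x := fun c i j => pd_congr (by filter_upwards [hk] with y hy; rw [hy]) c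
  rw [covDeriv_diagonal hg (by intro i; fin_cases i <;> simp [hf, hS])]
  simp only [hpk, hd, hkx, eX, eY, eA, Matrix.smul_of, Matrix.smul_cons, Matrix.smul_empty, smul_eq_mul, mul_zero]
  simp only [eX, eY, eA] at k1 k2 k3 k4
  fin_cases l <;> fin_cases i <;> fin_cases j <;>
    simp [Fin.sum_univ_three, pd_const, k1, k2, k3, k4, edgeCovDeriv] <;> field_simp <;> ring

end

/-! ### Estimates near the edges, in the cones -/

/-- The factor `sn r` by which `T` differs from the components of the covariant derivative in the orthonormal frame
cancels against the volume density `sn² r sin s`. -/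
lemma normSqCovDeriv_mul_volDensity {g k : TensorField} {x : E3} {κ : ℝ} {T : Fin 3 → Matrix (Fin 3) (Fin 3) ℝ}
    (hf : 0 < sn κ (x 0)) (hS : 0 < sin (x 1))
    (hg : g x = diagonal ![1, sn κ (x 0) ^ 2, sn κ (x 0) ^ 2 * sin (x 1) ^ 2])
    (h : ∀ l i j, covDeriv g k x l i j = ![1, sn κ (x 0), sn κ (x 0) * sin (x 1)] l
      * ![1, sn κ (x 0), sn κ (x 0) * sin (x 1)] i * ![1, sn κ (x 0), sn κ (x 0) * sin (x 1)] j
      / sn κ (x 0) * T l i j) :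
    normSqCovDeriv g k x * volDensity g x = (∑ l, ∑ i, ∑ j, T l i j ^ 2) * sin (x 1) := by
  have hw : ∀ i, (![1, sn κ (x 0) ^ 2, sn κ (x 0) ^ 2 * sin (x 1) ^ 2] : Fin 3 → ℝ) i
      = ![1, sn κ (x 0), sn κ (x 0) * sin (x 1)] i ^ 2 := by
    intro i; fin_cases i <;> simp [mul_pow]
  have hw0 : ∀ i, (![1, sn κ (x 0), sn κ (x 0) * sin (x 1)] : Fin 3 → ℝ) i ≠ 0 := by
    intro i; fin_cases i <;> simp [hf.ne', hS.ne']
  rw [volDensity_polar hg hS.le, normSqCovDeriv_diagonal hg (fun i => by rw [hw]; exact pow_ne_zero 2 (hw0 i))]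
  simp only [h, hw]
  generalize hW : (![1, sn κ (x 0), sn κ (x 0) * sin (x 1)] : Fin 3 → ℝ) = W at hw0 ⊢
  have e : ∀ l i j, (W l * W i * W j / sn κ (x 0) * T l i j) ^ 2 / (W l ^ 2 * W i ^ 2 * W j ^ 2)
      = T l i j ^ 2 * (1 / sn κ (x 0) ^ 2) := by
    intro l i j
    have h1 := hw0 l
    have h2 := hw0 i
    have h3 := hw0 j
    field_simp
  simp only [e, ← sum_mul]
  field_simp

lemma exists_bound_edgeCovDeriv (M : ℝ) : ∃ C, ∀ f c u w₁ w₂ S Cs x₀ y₀ x₁ y₁ x₂ y₂ : ℝ,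
    |f| ≤ M → |c| ≤ M → |u| ≤ M → |w₁| ≤ M → |w₂| ≤ M → |S| ≤ M → |Cs| ≤ M → |x₀| ≤ M → |y₀| ≤ M →
    |x₁| ≤ M → |y₁| ≤ M → |x₂| ≤ M → |y₂| ≤ M →
    |(∑ l, ∑ i, ∑ j, edgeCovDeriv f c u w₁ w₂ S Cs x₀ y₀ x₁ y₁ x₂ y₂ l i j ^ 2) * S| ≤ C := by
  have key : ∀ e : Fin 3 → Fin 3 → Fin 3 → (Fin 13 → ℝ) → ℝ, (∀ l i j, Continuous (e l i j)) →
      Continuous fun v => (∑ l, ∑ i, ∑ j, e l i j v ^ 2) * v 5 := by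
    intro e he
    fun_prop
  obtain ⟨C, hC⟩ := exists_bound_of_continuous (key _ continuous_edgeCovDeriv) M
  refine ⟨C, fun f c u w₁ w₂ S Cs x₀ y₀ x₁ y₁ x₂ y₂ h0 h1 h2 h3 h4 h5 h6 h7 h8 h9 h10 h11 h12 => ?_⟩
  refine hC ![f, c, u, w₁, w₂, S, Cs, x₀, y₀, x₁, y₁, x₂, y₂] fun i => ?_
  fin_cases i <;> assumption

lemma exists_bound_normSqTensor (cd M : ℝ) : ∃ C, ∀ f u w₁ X Y T R : ℝ,
    |f| ≤ M → |u| ≤ M → |w₁| ≤ M → |X| ≤ M → |Y| ≤ M → |T| ≤ M → |R| ≤ M →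
    |f ^ 2 * (2 * f ^ 2 * w₁ ^ 2 * (X ^ 2 + R ^ 4 * Y ^ 2) * R ^ 2 + (u * T) ^ 2
      + (u * T + (2 + u) * cd * R) ^ 2)| ≤ C := by
  obtain ⟨C, hC⟩ := exists_bound_of_continuous (n := 7) (P := fun v => v 0 ^ 2 * (2 * v 0 ^ 2 * v 2 ^ 2 *
    (v 3 ^ 2 + v 6 ^ 4 * v 4 ^ 2) * v 6 ^ 2 + (v 1 * v 5) ^ 2 + (v 1 * v 5 + (2 + v 1) * cd * v 6) ^ 2)) (by fun_prop) M
  refine ⟨C, fun f u w₁ X Y T R h0 h1 h2 h3 h4 h5 h6 => ?_⟩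
  refine hC ![f, u, w₁, X, Y, T, R] fun i => ?_
  fin_cases i <;> assumption

lemma normSqTensor_mul_volDensity {g k : TensorField} {x : E3} {κ u w₁ X Y A cd : ℝ}
    (hf : 0 < sn κ (x 0)) (hS : 0 < sin (x 1))
    (hg : g x = diagonal ![1, sn κ (x 0) ^ 2, sn κ (x 0) ^ 2 * sin (x 1) ^ 2])
    (hk : k x = sn κ (x 0) ^ 2 • !![0, w₁ * X, sin (x 1) ^ 2 * (w₁ * Y); w₁ * X, u * A, 0;
      sin (x 1) ^ 2 * (w₁ * Y), 0, sin (x 1) ^ 2 * (u * A + (2 + u) * cd)]) :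
    normSqTensor g k x * volDensity g x = sn κ (x 0) ^ 2 * (2 * sn κ (x 0) ^ 2 * w₁ ^ 2 *
      (X ^ 2 + √(sin (x 1)) ^ 4 * Y ^ 2) * √(sin (x 1)) ^ 2 + (u * (√(sin (x 1)) * A)) ^ 2
      + (u * (√(sin (x 1)) * A) + (2 + u) * cd * √(sin (x 1))) ^ 2) := by
  have h2 := sq_sqrt hS.le
  set R := √(sin (x 1))
  have hR : R ≠ 0 := (sqrt_pos.2 hS).ne'
  rw [volDensity_polar hg hS.le, normSqTensor_diagonal hg (by intro i; fin_cases i <;> simp [hf.ne', hS.ne']), hk]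
  simp only [← h2, Matrix.smul_of, Matrix.smul_cons, Matrix.smul_empty, smul_eq_mul]
  simp [Fin.sum_univ_three]
  field_simp
  ring

section

variable {β ρ s θ : ℝ} {K : ℂ → ℂ} (hK : DifferentiableOn ℂ K (Metric.ball 0 ρ)) (hs : s ∈ Ioo 0 π)
  (hζ : coneCoord β s θ ∈ Metric.ball 0 ρ)
include hK hζ

lemma differentiableAt_comp_coneCoord (hs : s ∈ Ioo 0 π) :
    DifferentiableAt ℝ (fun z : ℝ × ℝ => K (coneCoord β z.1 z.2)) (s, θ) := by
  have h1 : DifferentiableAt ℝ (fun z : ℝ × ℝ => log (tan (z.1 / 2))) (s, θ) :=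
    (hasDerivAt_log_tan_half hs).differentiableAt.comp (f := fun z : ℝ × ℝ => z.1) (s, θ) differentiableAt_fst
  have h2 : DifferentiableAt ℝ (fun z : ℝ × ℝ => ((log (tan (z.1 / 2)) : ℝ) : ℂ)) (s, θ) :=
    Complex.ofRealCLM.differentiableAt.comp (s, θ) h1
  have h3 : DifferentiableAt ℝ (fun z : ℝ × ℝ => (z.2 : ℂ)) (s, θ) :=
    Complex.ofRealCLM.differentiableAt.comp (s, θ) differentiableAt_snd
  have h4 : DifferentiableAt ℝ (fun z : ℝ × ℝ => coneCoord β z.1 z.2) (s, θ) := by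
    simp only [coneCoord, div_eq_mul_inv]
    exact ((h2.fun_add (h3.mul_const I)).mul_const (β : ℂ)⁻¹).cexp
  exact ((hK.differentiableAt (Metric.isOpen_ball.mem_nhds hζ)).restrictScalars ℝ).comp
    (f := fun z : ℝ × ℝ => coneCoord β z.1 z.2) (s, θ) h4

include hs

lemma hasDerivAt_re_fst : HasDerivAt (fun s => (K (coneCoord β s θ)).re)
    ((coneDeriv β K (coneCoord β s θ)).re / sin s) s :=
  (Complex.reCLM.hasFDerivAt.comp_hasDerivAt s (hasDerivAt_comp_coneCoord_fst hK hs hζ)).congr_deriv (by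
    rw [Complex.reCLM_apply, Complex.re_mul_ofReal, div_eq_mul_inv])

lemma hasDerivAt_im_fst : HasDerivAt (fun s => (K (coneCoord β s θ)).im)
    ((coneDeriv β K (coneCoord β s θ)).im / sin s) s :=
  (Complex.imCLM.hasFDerivAt.comp_hasDerivAt s (hasDerivAt_comp_coneCoord_fst hK hs hζ)).congr_deriv (by
    rw [Complex.imCLM_apply, Complex.im_mul_ofReal, div_eq_mul_inv])

omit hs

lemma hasDerivAt_re_snd : HasDerivAt (fun θ => (K (coneCoord β s θ)).re) (-(coneDeriv β K (coneCoord β s θ)).im) θ :=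
  (Complex.reCLM.hasFDerivAt.comp_hasDerivAt θ (hasDerivAt_comp_coneCoord_snd hK hζ)).congr_deriv (by simp)

lemma hasDerivAt_im_snd : HasDerivAt (fun θ => (K (coneCoord β s θ)).im) (coneDeriv β K (coneCoord β s θ)).re θ :=
  (Complex.imCLM.hasFDerivAt.comp_hasDerivAt θ (hasDerivAt_comp_coneCoord_snd hK hζ)).congr_deriv (by simp)

end

lemma tan_half_le_sin {s : ℝ} (h0 : 0 < s) (h1 : s < π / 2) : tan (s / 2) ≤ sin s ∧ sin s ≤ 2 * tan (s / 2) := by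
  have hc : 0 < cos (s / 2) := cos_pos_of_mem_Ioo ⟨by linarith, by linarith⟩
  have hs : 0 < sin (s / 2) := sin_pos_of_pos_of_lt_pi (by linarith) (by linarith)
  have h2 : sin s = 2 * sin (s / 2) * cos (s / 2) := by
    rw [← sin_two_mul]; ring_nf
  have h3 : cos s = 2 * cos (s / 2) ^ 2 - 1 := by
    rw [← cos_two_mul]; ring_nf
  have h4 : 0 < cos s := cos_pos_of_mem_Ioo ⟨by linarith, h1⟩
  rw [tan_eq_sin_div_cos, h2, div_le_iff₀ hc, ← mul_div_assoc, le_div_iff₀ hc]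
  constructor
  · nlinarith
  · have := cos_sq_le_one (s / 2)
    nlinarith

/-- The square of the logarithmic term is integrable on the cone. -/
lemma eventually_sqrt_sin_mul_log : ∀ᶠ s in 𝓝[>] (0 : ℝ), |√(sin s) * log (tan (s / 2))| ≤ 2 := by
  have ht : Tendsto (fun s : ℝ => tan (s / 2)) (𝓝[>] 0) (𝓝[>] 0) := by
    refine tendsto_nhdsWithin_of_tendsto_nhds_of_eventually_within _ tendsto_tan_half ?_
    filter_upwards [self_mem_nhdsWithin, mem_nhdsWithin_of_mem_nhds (gt_mem_nhds pi_pos)] with s h0 h1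
      using tan_half_pos h0 h1
  have h1 := (tendsto_log_mul_rpow_nhdsGT_zero (r := 1 / 2) (by norm_num)).comp ht
  have h2 := h1.abs
  rw [abs_zero] at h2
  filter_upwards [h2.eventually (gt_mem_nhds one_pos), self_mem_nhdsWithin,
    mem_nhdsWithin_of_mem_nhds (gt_mem_nhds (show (0 : ℝ) < π / 2 by positivity))] with s h3 h4 h5
  have h6 := tan_half_le_sin h4 h5
  have ht0 := tan_half_pos h4 (show s < π by linarith [pi_pos])
  simp only [Function.comp_apply, ← sqrt_eq_rpow, abs_mul, abs_of_nonneg (sqrt_nonneg _)] at h3 ⊢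
  have h7 : √(sin s) ≤ 2 * √(tan (s / 2)) := by
    rw [show (2 : ℝ) = √4 by rw [show (4 : ℝ) = 2 ^ 2 by norm_num]; simp, ← sqrt_mul (by norm_num)]
    exact sqrt_le_sqrt (by linarith)
  calc _ ≤ 2 * √(tan (s / 2)) * |log (tan (s / 2))| := mul_le_mul_of_nonneg_right h7 (abs_nonneg _)
    _ ≤ 2 := by nlinarith [h3]

/-- `ζ K'` is `O(s^{1/β})`, hence `O(sin s)`. -/
lemma norm_coneDeriv_coneCoord_le {β s θ M : ℝ} {K : ℂ → ℂ} (hβ : 0 < β) (hβ1 : β ≤ 1) (h0 : 0 < s) (h1 : s < π / 2)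
    (hM : ‖deriv K (coneCoord β s θ) / β‖ ≤ M) : ‖coneDeriv β K (coneCoord β s θ)‖ ≤ sin s * M := by
  have h2 := tan_half_le_sin h0 h1
  have h3 := tan_half_pos h0 (by linarith : s < π)
  rw [coneDeriv, mul_div_assoc, norm_mul, norm_coneCoord h0 (by linarith)]
  refine mul_le_mul ?_ hM (norm_nonneg _) (h3.le.trans h2.1)
  refine (rpow_le_rpow_of_exponent_ge h3 (h2.1.trans (sin_le_one s)) (z := 1) ?_).trans ?_
  · rw [le_div_iff₀ hβ]; linarith
  · rw [rpow_one]; exact h2.1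

namespace StandardDeformation

variable {V E : Type*} {S : SingularGerm V E} (D : StandardDeformation S)

lemma IsHolomorphicVelocity.exists_bound {D : StandardDeformation S} {p : V} {η : E × Bool} {σ ρ : ℝ} {H : ℂ → ℂ}
    (h : D.IsHolomorphicVelocity p η σ ρ H) : ∃ M, ∀ᶠ s in 𝓝[>] (0 : ℝ), ∀ θ,
      ‖H (coneCoord (S.angle η.1 / (2 * π)) s θ)‖ ≤ M ∧
      ‖coneDeriv (S.angle η.1 / (2 * π)) H (coneCoord (S.angle η.1 / (2 * π)) s θ)‖ ≤ sin s * M ∧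
      ‖coneDeriv (S.angle η.1 / (2 * π)) (coneDeriv (S.angle η.1 / (2 * π)) H) (coneCoord (S.angle η.1 / (2 * π)) s θ)‖
        ≤ sin s * M := by
  have hβ := angle_div_pos (S := S) η.1
  have hβ1 : S.angle η.1 / (2 * π) ≤ 1 := by
    rw [div_le_one (by positivity)]; exact (S.angle_lt η.1).le
  set β := S.angle η.1 / (2 * π)
  have hc : ∀ {K : ℂ → ℂ}, DifferentiableOn ℂ K (Metric.ball 0 ρ) → ContinuousAt K 0 := fun hK =>
    hK.continuousOn.continuousAt (Metric.ball_mem_nhds 0 h.radius_pos)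
  have h1 := differentiableOn_coneDeriv (β := β) h.holomorphic
  obtain ⟨M₀, e₀⟩ := exists_norm_comp_coneCoord_le hβ (hc h.holomorphic)
  obtain ⟨M₁, e₁⟩ := exists_norm_comp_coneCoord_le hβ (hc ((h.holomorphic.deriv Metric.isOpen_ball).div_const (β : ℂ)))
  obtain ⟨M₂, e₂⟩ := exists_norm_comp_coneCoord_le hβ (hc ((h1.deriv Metric.isOpen_ball).div_const (β : ℂ)))
  refine ⟨max M₀ (max M₁ M₂), ?_⟩
  filter_upwards [e₀, e₁, e₂, self_mem_nhdsWithin,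
    mem_nhdsWithin_of_mem_nhds (gt_mem_nhds (show (0 : ℝ) < π / 2 by positivity))] with s f₀ f₁ f₂ hs hs' θ
  exact ⟨(f₀ θ).trans (le_max_left _ _),
    norm_coneDeriv_coneCoord_le hβ hβ1 hs hs' ((f₁ θ).trans ((le_max_left _ _).trans (le_max_right _ _))),
    norm_coneDeriv_coneCoord_le hβ hβ1 hs hs' ((f₂ θ).trans ((le_max_right _ _).trans (le_max_right _ _)))⟩

/-- The pointwise estimates near an edge, in polar coordinates: the representing tensor is square integrable,
and so is its covariant derivative if the cone angle is fixed. -/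
lemma exists_bound_polar {κ a : ℝ} (hr : InRange κ a) {p : V} {η : E × Bool} (hη : η ∈ S.endsAt p)
    {σ ρ : ℝ} {H : ℂ → ℂ} (h : D.IsHolomorphicVelocity p η σ ρ H) :
    ∃ σ' ∈ Ioc 0 σ, ∃ C, ∀ (g k : TensorField) (x : E3), x 0 ∈ Ioo 0 a → x 1 ∈ Ioo 0 σ' →
      (∀ᶠ y in 𝓝 x, g y = radialMetric κ (y 0) 1 0 (sin (y 1) ^ 2)) →
      (∀ᶠ y in 𝓝 x, k y = pullback (radialMap (S.P η)) (D.derivAtVertex κ p) y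
        + lieDerivative (D.polarVelocity p η (radialCutoff a)) (fun y => radialMetric κ (y 0) 1 0 (sin (y 1) ^ 2)) y) →
      |normSqTensor g k x * volDensity g x| ≤ C ∧ (D.cdot η.1 = 0 → |normSqCovDeriv g k x * volDensity g x| ≤ C) := by
  set β := S.angle η.1 / (2 * π) with hβ
  set χ := radialCutoff a with hχ
  have cχ : ContDiff ℝ ∞ χ := contDiff_radialCutoff a
  have cχ' : ContDiff ℝ ∞ (deriv χ) := (contDiff_infty_iff_deriv.1 cχ).2
  have cχ'' : ContDiff ℝ ∞ (deriv (deriv χ)) := (contDiff_infty_iff_deriv.1 cχ').2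
  set u : ℝ → ℝ := fun r => -2 * (1 - χ r) with hu
  have cu : Continuous u := continuous_const.mul (continuous_const.sub cχ.continuous)
  have bd : ∀ {q : ℝ → ℝ}, Continuous q → ∃ M, ∀ r ∈ Ioo 0 a, |q r| ≤ M := fun hq => by
    obtain ⟨M, hM⟩ := (isCompact_Icc (a := (0 : ℝ)) (b := a)).exists_bound_of_continuousOn hq.continuousOn
    exact ⟨M, fun r hr => hM r ⟨hr.1.le, hr.2.le⟩⟩
  obtain ⟨M₁, h1⟩ := bd (contDiff_sn κ (n := 0)).continuous
  obtain ⟨M₂, h2⟩ := bd (contDiff_cs κ (n := 0)).continuous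
  obtain ⟨M₃, h3⟩ := bd cu
  obtain ⟨M₄, h4⟩ := bd cχ'.continuous
  obtain ⟨M₅, h5⟩ := bd cχ''.continuous
  obtain ⟨M₀, hH⟩ := h.exists_bound
  rw [← hβ] at hH
  set cd := D.cdot η.1 with hcd
  set M := |M₀| + |M₀| + 2 * |cd| + |cd| + |M₁| + |M₂| + |M₃| + |M₄| + |M₅| + 1 with hM
  obtain ⟨C₁, hC₁⟩ := exists_bound_normSqTensor cd M
  obtain ⟨C₂, hC₂⟩ := exists_bound_edgeCovDeriv M
  have hev := hH.and (eventually_sqrt_sin_mul_log.and (mem_nhdsWithin_of_mem_nhds (gt_mem_nhds h.mem.1)))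
  obtain ⟨σ', hσ', hsub⟩ := mem_nhdsGT_iff_exists_Ioo_subset.1 hev
  refine ⟨min σ' σ, ⟨lt_min hσ' h.mem.1, min_le_right _ _⟩, max C₁ C₂, fun g k x hx hs hg hk => ?_⟩
  have hsσ : x 1 ∈ Ioo 0 σ := ⟨hs.1, hs.2.trans_le (min_le_right _ _)⟩
  obtain ⟨b1, b2, -⟩ := hsub ⟨hs.1, hs.2.trans_le (min_le_left _ _)⟩
  obtain ⟨b3, b4, b5⟩ := b1 (x 2)
  have hsπ := h.mem_pi hsσ
  have hS : 0 < sin (x 1) := sin_pos_of_pos_of_lt_pi hsπ.1 hsπ.2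
  have hf : 0 < sn κ (x 0) := sn_pos hx.1 (hr.mono hx.1.le hx.2.le)
  have hζ := fun s (hs : s ∈ Ioo 0 σ) θ => h.coneCoord_mem s hs θ
  rw [← hβ] at hζ
  have hk' : ∀ᶠ y in 𝓝 x, k y = sn κ (y 0) ^ 2 • !![0, deriv χ (y 0) * D.radialVelocity p η (y 1) (y 2),
          sin (y 1) ^ 2 * (deriv χ (y 0) * D.angularVelocity p η (y 1) (y 2));
        deriv χ (y 0) * D.radialVelocity p η (y 1) (y 2),
          u (y 0) * deriv (fun s => D.radialVelocity p η s (y 2)) (y 1), 0;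
        sin (y 1) ^ 2 * (deriv χ (y 0) * D.angularVelocity p η (y 1) (y 2)), 0,
          sin (y 1) ^ 2 * (u (y 0) * deriv (fun s => D.radialVelocity p η s (y 2)) (y 1) + (2 + u (y 0)) * cd)] := by
    filter_upwards [hk, (continuous_coord 0).continuousAt.eventually (lt_mem_nhds hx.1),
      (contDiff_coord 1 (n := 0)).continuous.continuousAt.eventually (isOpen_Ioo.mem_nhds hsσ)] with y hy h0 h1
    rw [hy, h.pullback_add κ χ y h0 h1 (cχ.differentiable (by simp) _),
      show 2 + u (y 0) = 2 * χ (y 0) by simp only [hu]; ring]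
  have hg' : ∀ᶠ y in 𝓝 x, g y = diagonal ![1, sn κ (y 0) ^ 2, sn κ (y 0) ^ 2 * sin (y 1) ^ 2] := by
    filter_upwards [hg] with y hy
    rw [hy, radialMetric_polar]
  have hX := h.radial _ hsσ (x 2)
  have hY := h.angular _ hsσ (x 2)
  have hA := h.deriv_radial hsσ (x 2)
  rw [← hβ, ← hcd] at hX hA
  rw [← hβ] at hY
  set z₀ := H (coneCoord β (x 1) (x 2)) with hz₀
  set z₁ := coneDeriv β H (coneCoord β (x 1) (x 2)) with hz₁
  set z₂ := coneDeriv β (coneDeriv β H) (coneCoord β (x 1) (x 2)) with hz₂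
  set L := log (tan (x 1 / 2)) with hL
  have hS1 := sin_le_one (x 1)
  have aS : |sin (x 1)| ≤ 1 := abs_sin_le_one _
  have aC : |cos (x 1)| ≤ 1 := abs_cos_le_one _
  have hR1 : √(sin (x 1)) ≤ 1 := sqrt_le_one.2 hS1
  have hR0 := sqrt_nonneg (sin (x 1))
  have n0 : 0 ≤ |M₀| := abs_nonneg _
  have n1 : 0 ≤ |M₁| := abs_nonneg _
  have n2 : 0 ≤ |M₂| := abs_nonneg _
  have n3 : 0 ≤ |M₃| := abs_nonneg _
  have n4 : 0 ≤ |M₄| := abs_nonneg _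
  have n5 : 0 ≤ |M₅| := abs_nonneg _
  have nc : 0 ≤ |cd| := abs_nonneg _
  have lM := le_abs_self M₀
  have c1 : |sn κ (x 0)| ≤ M := by linarith [h1 _ hx, le_abs_self M₁]
  have c2 : |cs κ (x 0)| ≤ M := by linarith [h2 _ hx, le_abs_self M₂]
  have c3 : |u (x 0)| ≤ M := by linarith [h3 _ hx, le_abs_self M₃]
  have c4 : |deriv χ (x 0)| ≤ M := by linarith [h4 _ hx, le_abs_self M₄]
  have c5 : |deriv (deriv χ) (x 0)| ≤ M := by linarith [h5 _ hx, le_abs_self M₅]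
  have r0 : |z₀.re| ≤ |M₀| := (Complex.abs_re_le_norm _).trans (b3.trans lM)
  have i0 : |z₀.im| ≤ |M₀| := (Complex.abs_im_le_norm _).trans (b3.trans lM)
  have q : ∀ {z : ℂ}, ‖z‖ ≤ sin (x 1) * M₀ → |z.re / sin (x 1)| ≤ |M₀| ∧ |z.im / sin (x 1)| ≤ |M₀| := by
    intro z hz
    rw [abs_div, abs_div, abs_of_pos hS, div_le_iff₀ hS, div_le_iff₀ hS]
    have : sin (x 1) * M₀ ≤ |M₀| * sin (x 1) := by rw [mul_comm]; exact mul_le_mul_of_nonneg_right lM hS.le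
    exact ⟨(Complex.abs_re_le_norm _).trans (hz.trans this), (Complex.abs_im_le_norm _).trans (hz.trans this)⟩
  constructor
  · refine le_trans ?_ (le_max_left _ _)
    rw [normSqTensor_mul_volDensity hf hS hg'.self_of_nhds hk'.self_of_nhds]
    have r1 : |z₁.re| ≤ |M₀| := (Complex.abs_re_le_norm _).trans (b4.trans
      ((mul_le_mul_of_nonneg_left lM hS.le).trans (mul_le_of_le_one_left n0 hS1)))
    -- the square root of `sin s` absorbs the logarithm
    have bl : |√(sin (x 1)) * (cd * L)| ≤ 2 * |cd| := by
      rw [show √(sin (x 1)) * (cd * L) = cd * (√(sin (x 1)) * L) by ring, abs_mul, mul_comm 2]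
      exact mul_le_mul_of_nonneg_left b2 nc
    have aR : ∀ {y m : ℝ}, |y| ≤ m → |√(sin (x 1)) * y| ≤ m := fun hy => by
      rw [abs_mul, abs_of_nonneg hR0]
      exact (mul_le_of_le_one_left (abs_nonneg _) hR1).trans hy
    have aCm : ∀ {y m : ℝ}, |y| ≤ m → |cos (x 1) * y| ≤ m := fun hy => by
      rw [abs_mul]
      exact (mul_le_of_le_one_left (abs_nonneg _) aC).trans hy
    have bR : |√(sin (x 1)) * (z₀.re - cd * L)| ≤ |M₀| + 2 * |cd| := by
      rw [mul_sub]
      exact (abs_sub _ _).trans (add_le_add (aR r0) bl)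
    refine hC₁ _ _ _ _ _ _ _ c1 c3 c4 ?_ ?_ ?_ ?_
    · rw [hX, show sin (x 1) * (z₀.re - cd * L) = √(sin (x 1)) * (√(sin (x 1)) * (z₀.re - cd * L)) by
          rw [← mul_assoc, mul_self_sqrt hS.le]]
      have := aR bR
      linarith
    · rw [hY]; linarith
    · rw [hA, show √(sin (x 1)) * (cos (x 1) * (z₀.re - cd * L) + z₁.re - cd)
        = cos (x 1) * (√(sin (x 1)) * (z₀.re - cd * L)) + √(sin (x 1)) * z₁.re - √(sin (x 1)) * cd by ring]
      have e1 := aCm bR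
      have e2 := aR r1
      have e3 := aR (le_refl |cd|)
      have e4 := abs_sub (cos (x 1) * (√(sin (x 1)) * (z₀.re - cd * L)) + √(sin (x 1)) * z₁.re) (√(sin (x 1)) * cd)
      have e5 := abs_add_le (cos (x 1) * (√(sin (x 1)) * (z₀.re - cd * L))) (√(sin (x 1)) * z₁.re)
      linarith
    · rw [abs_of_nonneg hR0]; linarith
  · intro h0
    refine le_trans ?_ (le_max_right _ _)
    have hop : IsOpen (Ioo 0 S.s₀ ×ˢ (univ : Set ℝ)) := isOpen_Ioo.prod isOpen_univ
    have hmem : ((x 1, x 2) : ℝ × ℝ) ∈ Ioo 0 S.s₀ ×ˢ (univ : Set ℝ) := ⟨⟨hsσ.1, hsσ.2.trans h.mem.2⟩, mem_univ _⟩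
    have dX := ((D.contDiffOn_radialVelocity hη).contDiffAt (hop.mem_nhds hmem)).differentiableAt (by simp)
    have dY := ((D.contDiffOn_angularVelocity hη).contDiffAt (hop.mem_nhds hmem)).differentiableAt (by simp)
    have hol := h.holomorphic
    have hol1 := differentiableOn_coneDeriv (β := β) hol
    have hz := hζ _ hsσ (x 2)
    have hA' : ∀ s ∈ Ioo 0 σ, ∀ θ, deriv (fun s => D.radialVelocity p η s θ) s
        = cos s * (H (coneCoord β s θ)).re + (coneDeriv β H (coneCoord β s θ)).re := fun s hs θ => by
      rw [h.deriv_radial hs, ← hcd, h0]; ring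
    have hX' : ∀ s ∈ Ioo 0 σ, ∀ θ, D.radialVelocity p η s θ = sin s * (H (coneCoord β s θ)).re := fun s hs θ => by
      rw [h.radial s hs, ← hcd, h0]; ring
    have nb := isOpen_Ioo.mem_nhds hsσ
    have nb2 : Ioo 0 σ ×ˢ (univ : Set ℝ) ∈ 𝓝 (x 1, x 2) := (isOpen_Ioo.prod isOpen_univ).mem_nhds ⟨hsσ, mem_univ _⟩
    have dA : DifferentiableAt ℝ (fun z : ℝ × ℝ => deriv (fun s => D.radialVelocity p η s z.2) z.1) (x 1, x 2) := by
      have e1 := Complex.reCLM.differentiableAt.comp (x 1, x 2) (differentiableAt_comp_coneCoord hol hz hsπ)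
      have e2 := Complex.reCLM.differentiableAt.comp (x 1, x 2) (differentiableAt_comp_coneCoord hol1 hz hsπ)
      have e3 : DifferentiableAt ℝ (fun z : ℝ × ℝ => cos z.1) (x 1, x 2) := by fun_prop
      refine ((e3.mul e1).add e2).congr_of_eventuallyEq ?_
      filter_upwards [nb2] with z hz using hA' z.1 hz.1 z.2
    rw [normSqCovDeriv_mul_volDensity hf hS hg'.self_of_nhds (covDeriv_polar (u := u) (wd := deriv χ)
      (X := D.radialVelocity p η) (Y := D.angularVelocity p η)
      (A := fun s θ => deriv (fun s => D.radialVelocity p η s θ) s) (w₂ := deriv (deriv χ) (x 0))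
      (x₀ := z₀.re) (y₀ := z₀.im) (x₁ := z₁.re / sin (x 1)) (y₁ := z₁.im / sin (x 1))
      (x₂ := z₂.re / sin (x 1)) (y₂ := z₂.im / sin (x 1)) hf.ne' hS.ne' hg' ?_ ?_
      ((cχ'.differentiable (by simp)) _).hasDerivAt dX dY dA (hX' _ hsσ _) hY ?_ ?_ ?_ ?_ ?_ ?_ ?_)]
    · exact hC₂ _ _ _ _ _ _ _ _ _ _ _ _ _ c1 c2 c3 c4 c5 (by linarith) (by linarith) (by linarith) (by linarith)
        (by linarith [(q b4).1]) (by linarith [(q b4).2]) (by linarith [(q b5).1]) (by linarith [(q b5).2])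
    · filter_upwards [hk'] with y hy
      rw [hy, h0]
      simp
    · refine (((cχ.differentiable (by simp)) (x 0)).hasDerivAt.const_sub 1 |>.const_mul (-2)).congr_deriv (by ring)
    · beta_reduce
      rw [hA' _ hsσ, mul_div_cancel₀ _ hS.ne']
    · have := (hasDerivAt_sin (x 1)).fun_mul (hasDerivAt_re_fst hol hsπ hz)
      refine this.congr_of_eventuallyEq ?_
      filter_upwards [nb] with s hs using hX' s hs _
    · have := (hasDerivAt_re_snd hol hz).const_mul (sin (x 1))
      refine (this.congr_of_eventuallyEq (Eventually.of_forall fun θ => hX' _ hsσ θ)).congr_deriv ?_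
      field_simp
      rw [hz₁]
    · refine (hasDerivAt_im_fst hol hsπ hz).congr_of_eventuallyEq ?_
      filter_upwards [nb] with s hs using h.angular s hs _
    · refine ((hasDerivAt_im_snd hol hz).congr_of_eventuallyEq
        (Eventually.of_forall fun θ => h.angular _ hsσ θ)).congr_deriv ?_
      field_simp
      rw [hz₁]
    · have := ((hasDerivAt_cos (x 1)).fun_mul (hasDerivAt_re_fst hol hsπ hz)).fun_add (hasDerivAt_re_fst hol1 hsπ hz)
      refine this.congr_of_eventuallyEq ?_
      filter_upwards [nb] with s hs using hA' s hs _
    · have := ((hasDerivAt_re_snd hol hz).const_mul (cos (x 1))).fun_add (hasDerivAt_re_snd hol1 hz)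
      refine (this.congr_of_eventuallyEq (Eventually.of_forall fun θ => hA' _ hsσ θ)).congr_deriv ?_
      field_simp
      ring

end StandardDeformation

/-! ### Square integrability on the cones -/

namespace StandardDeformation

variable {V E : Type*} {S : SingularGerm V E} (D : StandardDeformation S)

section

variable [Finite E] {κ a b : ℝ} (hab : S.IsTubular κ a b) (p : V)
include hab

lemma continuousOn_integrands :
    ContinuousOn (fun x => normSqTensor (S.metricAtVertex κ p) ((D.representative κ a b).onCone p) x
      * volDensity (S.metricAtVertex κ p) x) (S.cone a p) ∧
    ContinuousOn (fun x => normSqCovDeriv (S.metricAtVertex κ p) ((D.representative κ a b).onCone p) x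
      * volDensity (S.metricAtVertex κ p) x) (S.cone a p) := by
  have hs : ∀ {k : TensorField}, (∀ i j, ContDiffOn ℝ ∞ (fun x => k x i j) (puncturedCone (S.endsAt p) S.q)) →
      ∀ x ∈ S.cone a p, ∀ i j, ContDiffAt ℝ 1 (fun w : ℝ × E3 => k w.2 i j) (0, x) := fun hk x hx i j =>
    ((((hk i j).contDiffAt ((isOpen_puncturedCone _ _).mem_nhds hx.1)).of_le (by exact_mod_cast le_top))).comp
      (f := fun w : ℝ × E3 => w.2) (0, x) contDiffAt_snd
  have hg := hs (SingularGerm.contDiffOn_metricAtVertex (S := S) κ p)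
  have hk := hs (D.contDiffOn_representative hab p)
  have hd : ∀ x ∈ S.cone a p, (S.metricAtVertex κ p x).det ≠ 0 := fun x hx => det_coneMetric_ne_zero hx.1.1
    (sn_pos (norm_pos_iff.2 hx.1.1) (hab.inRange_a.mono (norm_nonneg x) (le_of_lt hx.2)))
  have hi : ∀ {u : E3 → ℝ} {x : E3}, ContinuousAt (fun w : ℝ × E3 => u w.2) (0, x) → ContinuousWithinAt u (S.cone a p) x :=
    fun {u x} h => (h.comp (f := fun y : E3 => ((0 : ℝ), y)) (by fun_prop)).continuousWithinAt
  constructor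
  · intro x hx
    have h1 := continuousAt_normSqTensor_param (g := fun _ : ℝ => S.metricAtVertex κ p)
      (k := fun _ => (D.representative κ a b).onCone p) (hg x hx) (hk x hx) (hd x hx)
    exact hi (h1.mul (continuousAt_volDensity_param (g := fun _ : ℝ => S.metricAtVertex κ p) (hg x hx)))
  · intro x hx
    have h1 := continuousAt_normSqCovDeriv_param (g := fun _ : ℝ => S.metricAtVertex κ p)
      (k := fun _ => (D.representative κ a b).onCone p) (hg x hx) (hk x hx) (hd x hx)
    exact hi (h1.mul (continuousAt_volDensity_param (g := fun _ : ℝ => S.metricAtVertex κ p) (hg x hx)))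

/-- The estimates near an edge, for the change of variables to polar coordinates. -/
lemma exists_bound_near_edge {η : E × Bool} (hη : η ∈ S.endsAt p) :
    ∃ σ ∈ Ioo 0 S.s₀, ∃ C, ∀ x : E3, x 0 ∈ Ioo 0 a → x 1 ∈ Ioo 0 σ →
      |(jac (radialMap (S.P η)) x).det| * |normSqTensor (S.metricAtVertex κ p) ((D.representative κ a b).onCone p)
        (radialMap (S.P η) x) * volDensity (S.metricAtVertex κ p) (radialMap (S.P η) x)| ≤ C ∧
      (D.cdot η.1 = 0 → |(jac (radialMap (S.P η)) x).det| * |normSqCovDeriv (S.metricAtVertex κ p)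
        ((D.representative κ a b).onCone p) (radialMap (S.P η) x)
          * volDensity (S.metricAtVertex κ p) (radialMap (S.P η) x)| ≤ C) := by
  obtain ⟨σ, ρ, H, h⟩ := D.exists_isHolomorphicVelocity hη
  obtain ⟨σ', hσ', C, hC⟩ := D.exists_bound_polar hab.inRange_a hη h
  have hs₁ := hab.overlapAngle_mem
  have hP := SingularGerm.isConePolar hη
  refine ⟨min σ' (S.overlapAngle κ a b), ⟨lt_min hσ'.1 hs₁.1, (min_le_right _ _).trans_lt hs₁.2⟩, C, fun x hx hs => ?_⟩
  have hso : x 1 ∈ Ioo 0 (S.overlapAngle κ a b) := ⟨hs.1, hs.2.trans_le (min_le_right _ _)⟩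
  have hs' : x 1 ∈ Ioo 0 S.s₀ := ⟨hs.1, hso.2.trans hs₁.2⟩
  have hev : ∀ᶠ y : E3 in 𝓝 x, 0 < y 0 ∧ y 1 ∈ Ioo 0 (S.overlapAngle κ a b) :=
    ((continuous_coord 0).continuousAt.eventually (lt_mem_nhds hx.1)).and
      ((contDiff_coord 1 (n := 0)).continuous.continuousAt.eventually (isOpen_Ioo.mem_nhds hso))
  have key := hC (pullback (radialMap (S.P η)) (S.metricAtVertex κ p))
    (pullback (radialMap (S.P η)) ((D.representative κ a b).onCone p)) x hx ⟨hs.1, hs.2.trans_le (min_le_left _ _)⟩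
    (by
      filter_upwards [hev] with y hy
      exact hP.pullback_coneMetric κ IsConePolar.contDiffOn_id_dir hy.1 ⟨hy.2.1, hy.2.2.trans hs₁.2⟩)
    (by
      filter_upwards [hev] with y hy
      exact D.pullback_representative hab hη hy.1 hy.2)
  have hJ := hP.det_jac_ne_zero S.s₀_le hx.1 hs'
  have hm := SingularGerm.radialMap_mem_puncturedCone hη hx.1 hs'
  have hnb := (isOpen_puncturedCone (S.endsAt p) S.q).mem_nhds hm
  have hdet : (S.metricAtVertex κ p (radialMap (S.P η) x)).det ≠ 0 := by
    refine det_coneMetric_ne_zero hm.1 ?_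
    rw [SingularGerm.norm_radialMap hη hx.1.le hs']
    exact sn_pos hx.1 (hab.inRange_a.mono hx.1.le hx.2.le)
  have e : ∀ u v w : ℝ, |u| * |v * w| = |v * (|u| * w)| := fun u v w => by
    rw [abs_mul, abs_mul, abs_mul, abs_abs]; ring
  rw [normSqTensor_pullback hJ, normSqCovDeriv_pullback ((hP.contDiffAt_radialMap hs').of_le (by norm_cast))
    (fun i j => ((SingularGerm.contDiffOn_metricAtVertex κ p i j).contDiffAt hnb).differentiableAt (by simp))
    (fun i j => ((D.contDiffOn_representative hab p i j).contDiffAt hnb).differentiableAt (by simp))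
    (fun i j => ?_) hJ hdet, volDensity_pullback] at key
  · rw [e, e]
    exact key
  · simp only [SingularGerm.metricAtVertex, coneMetric_id κ _ hm.1, mul_comm, eq_comm]

lemma l2On_representative : L2On (S.metricAtVertex κ p) ((D.representative κ a b).onCone p) (S.cone a p) := by
  refine S.integrableOn_cone (D.continuousOn_integrands hab p).1 (fun η hη => ?_) fun K hK hKO => ?_
  · obtain ⟨σ, hσ, C, hC⟩ := D.exists_bound_near_edge hab p hη
    exact ⟨σ, hσ, C, fun x h0 h1 => (hC x h0 h1).1⟩
  · obtain ⟨C, hC⟩ := D.exists_bound_away_edges hab p hK hKO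
    exact ⟨C, fun r hr ξ hξ => (hC r hr ξ hξ).1⟩

lemma covDerivL2On_representative (h0 : ∀ e, D.cdot e = 0) :
    CovDerivL2On (S.metricAtVertex κ p) ((D.representative κ a b).onCone p) (S.cone a p) := by
  refine S.integrableOn_cone (D.continuousOn_integrands hab p).2 (fun η hη => ?_) fun K hK hKO => ?_
  · obtain ⟨σ, hσ, C, hC⟩ := D.exists_bound_near_edge hab p hη
    exact ⟨σ, hσ, C, fun x hx h1 => (hC x hx h1).2 (h0 _)⟩
  · obtain ⟨C, hC⟩ := D.exists_bound_away_edges hab p hK hKO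
    exact ⟨C, fun r hr ξ hξ => (hC r hr ξ hξ).2⟩

end

lemma preservesAngles_of_isCovDerivL2 {κ a b : ℝ} (hab : S.IsTubular κ a b) {k : NbhdTensor V E}
    (hk : D.Represents κ a b k) (h : S.IsCovDerivL2 κ a b k) : D.PreservesAngles :=
  D.preservesAngles_iff.2 fun e => D.cdot_eq_zero_of_covDerivL2On hab (hk.tube_eq e) (h.2 e)

end StandardDeformation

theorem mainTheorem5 {V E : Type*} [Finite V] [Finite E] (κ : ℝ) (S : SingularGerm V E)
    (D : StandardDeformation S) (a b : ℝ) (hab : S.IsTubular κ a b) :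
    (∃ k : NbhdTensor V E, D.Represents κ a b k ∧ S.IsPolyhomogeneous a b k ∧ S.IsL2 κ a b k ∧
      (S.IsCovDerivL2 κ a b k ↔ D.PreservesAngles)) ∧
    ∀ k : NbhdTensor V E, D.Represents κ a b k → S.IsCovDerivL2 κ a b k → D.PreservesAngles := by
  refine ⟨⟨D.representative κ a b, D.represents_representative hab, D.isPolyhomogeneous_representative hab,
    ⟨fun p => D.l2On_representative hab p, fun e => D.l2On_derivAtEdge hab e⟩,
    D.preservesAngles_of_isCovDerivL2 hab (D.represents_representative hab), fun h => ?_⟩,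
    fun k hk => D.preservesAngles_of_isCovDerivL2 hab hk⟩
  have h0 := D.preservesAngles_iff.1 h
  exact ⟨fun p => D.covDerivL2On_representative hab p h0, fun e => D.covDerivL2On_derivAtEdge hab (h0 e)⟩
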